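/- Let $K\subset\mathbb{C}$ be an imaginary quadratic field with ring of integers $\mathcal{O}_K$ and discriminant $-\Delta_K$. For a nonzero ideal $\mathfrak{m}$ of $\mathcal{O}_K$ and an integer $l\ge 1$, a Hecke character of $K$ modulo $\mathfrak{m}$ with $\infty$-type $l$ is a homomorphism $\psi$ from the group of fractional ideals of $K$ prime to $\mathfrak{m}$ to $\mathbb{C}^*$ such that $\psi(\alpha\mathcal{O}_K)=\alpha^l$ for all $\alpha\in K^*$ with $\alpha\equiv 1 \bmod \mathfrak{m}$ (multiplicative congruence); $\psi$ is extended by $0$ to the ideals not prime to $\mathfrak{m}$. Its conductor is the ideal $\mathfrak{f}$ such that $\psi$ is defined modulo $\mathfrak{f}$ (that is, it agrees with a Hecke character modulo $\mathfrak{f}$ of the same $\infty$-type wherever both are defined as nonzero values) and $\mathfrak{f}\mid\mathfrak{n}$ for every $\mathfrak{n}$ modulo which $\psi$ is defined. We say that $\psi$ has rational coefficients if all the coefficients $a_n=\sum_{\mathcal{N}(\mathfrak{a})=n}\psi(\mathfrak{a})$, $n\ge 1$ (sum over integral ideals of norm $n$), of the attached eigenform $f_\psi=\sum_{\mathfrak{a}}\psi(\mathfrak{a})q^{\mathcal{N}(\mathfrak{a})}$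 are rational. Let $\psi$ be a Hecke character of $K$ with rational coefficients and $\infty$-type $l\geq 1$, and let $\mathfrak{p}$ be a nonzero prime of $\mathcal{O}_K$, with complex conjugate $\bar{\mathfrak{p}}$. Denote by $e_{\mathfrak{p}}$ the exponent of $\mathfrak{p}$ in the conductor of $\psi$. Then $e_{\mathfrak{p}}=e_{\bar{\mathfrak{p}}}$, and $e_{\mathfrak{p}}$ takes one of the following values. (1) $\Delta_K\neq 3,4$. If $\mathfrak{p}\nmid 2$: $e_{\mathfrak{p}}=1$ if $\mathfrak{p}$ is ramified and $l$ is odd; $e_{\mathfrak{p}}=0$ if $\mathfrak{p}$ is ramified and $l$ is even; $e_{\mathfrak{p}}\in\{0,1\}$ if $\mathfrak{p}$ is unramified. If $\mathfrak{p}\mid 2$: for $4\,\|\,\Delta_K$, $l$ is even and $e_{\mathfrak{p}}\in\{0,4\}$ (there is no such $\psi$ with $l$ odd); for $8\mid\Delta_K$, $e_{\mathfrak{p}}=5$ if $l$ is odd and $e_{\mathfrak{p}}\in\{0,2\}$ if $l$ is even; for $\mathfrak{p}$ unramified, $e_{\mathfrak{p}}\in\{0,2,3\}$. (2) $\Delta_K=4$.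 If $\mathfrak{p}\nmid 2$: $e_{\mathfrak{p}}\in\{0,1\}$. If $\mathfrak{p}\mid 2$: $e_{\mathfrak{p}}\in\{3,4,6\}$ if $l$ is odd, and $e_{\mathfrak{p}}\in\{0,2,4,6\}$ if $l$ is even. (3) $\Delta_K=3$. If $\mathfrak{p}\nmid 2$: $e_{\mathfrak{p}}\in\{1,2,4\}$ if $\mathfrak{p}$ is ramified and $l$ is odd; $e_{\mathfrak{p}}\in\{0,2,4\}$ if $\mathfrak{p}$ is ramified and $l$ is even; $e_{\mathfrak{p}}\in\{0,1\}$ if $\mathfrak{p}$ is unramified. If $\mathfrak{p}\mid 2$: $e_{\mathfrak{p}}\in\{0,1,2,3\}$. Conversely, all these values are possible: if $K$ has a Hecke character with rational coefficients and $\infty$-type $l$, then for every prime $\mathfrak{p}$, each value listed for $(K,\mathfrak{p},l)$ is the exponent at $\mathfrak{p}$ of the conductor of some Hecke character of $K$ with rational coefficients and $\infty$-type $l$, defined modulo its conductor. -/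

import Mathlib

open NumberField IsDedekindDomain
open scoped nonZeroDivisors

noncomputable section

/-- The group of fractional ideals of `K` which are prime to the ideal `𝔪`: no prime dividing `𝔪`
occurs in their factorisation. -/
def idealsPrimeTo {K : Type*} [Field K] [NumberField K] (𝔪 : Ideal (𝓞 K)) :
    Subgroup (FractionalIdeal (𝓞 K)⁰ K)ˣ where
  carrier := {I | ∀ v : HeightOneSpectrum (𝓞 K), v.asIdeal ∣ 𝔪 →
    FractionalIdeal.count K v (I : FractionalIdeal (𝓞 K)⁰ K) = 0}
  one_mem' := fun v _ => by
    rw [Units.val_one, FractionalIdeal.count_one]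
  mul_mem' := by
    intro I J hI hJ v hv
    rw [Units.val_mul, FractionalIdeal.count_mul K v I.ne_zero J.ne_zero, hI v hv, hJ v hv,
      add_zero]
  inv_mem' := by
    intro I hI v hv
    rw [Units.val_inv_eq_inv_val, FractionalIdeal.count_inv, hI v hv, neg_zero]

/-- Multiplicative congruence `α ≡ 1 mod 𝔪` for `α ∈ K`: one can write `α = a / b` with algebraic
integers `a ≡ b mod 𝔪` and `b` (hence also `a`) prime to `𝔪`. -/
def CongrOneMod {K : Type*} [Field K] [NumberField K] (𝔪 : Ideal (𝓞 K)) (α : K) : Prop :=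
  ∃ a b : 𝓞 K, b ≠ 0 ∧ IsCoprime (Ideal.span {b}) 𝔪 ∧ a - b ∈ 𝔪 ∧ α * (b : K) = (a : K)

/-- A Hecke character of `K ⊂ ℂ` (embedded by `φ`) modulo the nonzero ideal `𝔪` with `∞`-type `l`:
a homomorphism `ψ` from the group of fractional ideals prime to `𝔪` to `ℂˣ` with
`ψ(α 𝓞_K) = α ^ l` for all `α ∈ Kˣ` with `α ≡ 1 mod 𝔪`.
(For such `α` the ideal `α 𝓞_K` is automatically prime to `𝔪`; the binder `hα` only serves to
form the argument of `ψ`.) -/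
structure HeckeCharacter {K : Type*} [Field K] [NumberField K] (φ : K →+* ℂ)
    (𝔪 : Ideal (𝓞 K)) (l : ℕ) where
  modulus_ne_bot : 𝔪 ≠ ⊥
  toHom : idealsPrimeTo 𝔪 →* ℂˣ
  map_principal : ∀ (α : Kˣ) (hα : toPrincipalIdeal (𝓞 K) K α ∈ idealsPrimeTo 𝔪),
    CongrOneMod 𝔪 (α : K) → (toHom ⟨toPrincipalIdeal (𝓞 K) K α, hα⟩ : ℂ) = φ α ^ l

namespace HeckeCharacter

variable {K : Type*} [Field K] [NumberField K] {φ : K →+* ℂ} {𝔪 : Ideal (𝓞 K)} {l : ℕ}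

open Classical in
/-- The value `ψ(𝔞)` at an integral ideal `𝔞`, where `ψ` is extended by `0` to the ideals which are
not prime to the modulus. -/
def eval (ψ : HeckeCharacter φ 𝔪 l) (𝔞 : Ideal (𝓞 K)) : ℂ :=
  if h : ∃ h₀ : 𝔞 ∈ (Ideal (𝓞 K))⁰, FractionalIdeal.mk0 K ⟨𝔞, h₀⟩ ∈ idealsPrimeTo 𝔪 then
    ((ψ.toHom ⟨FractionalIdeal.mk0 K ⟨𝔞, h.1⟩, h.2⟩ : ℂˣ) : ℂ)
  else 0

/-- The `n`-th Fourier coefficient `a_n = ∑_{N(𝔞) = n} ψ(𝔞)` of the eigenform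
`f_ψ = ∑_𝔞 ψ(𝔞) q ^ N(𝔞)` attached to `ψ`; the sum is over the integral ideals of norm `n`. -/
def coeff (ψ : HeckeCharacter φ 𝔪 l) (n : ℕ) : ℂ :=
  ∑ 𝔞 ∈ (Ideal.finite_setOfPred_absNorm_eq (S := 𝓞 K) n).toFinset, ψ.eval 𝔞

/-- `ψ` has rational coefficients if all the Fourier coefficients of `f_ψ` are rational. -/
def HasRationalCoefficients (ψ : HeckeCharacter φ 𝔪 l) : Prop :=
  ∀ n : ℕ, 1 ≤ n → ∃ q : ℚ, ψ.coeff n = (q : ℂ)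

/-- `ψ` (given modulo `𝔪`) is defined modulo `𝔫`: there is a Hecke character modulo `𝔫`, of the same
`∞`-type, which agrees with `ψ` on all the fractional ideals prime to both `𝔪` and `𝔫`. -/
def IsDefinedModulo (ψ : HeckeCharacter φ 𝔪 l) (𝔫 : Ideal (𝓞 K)) : Prop :=
  ∃ ψ' : HeckeCharacter φ 𝔫 l, ∀ (I : (FractionalIdeal (𝓞 K)⁰ K)ˣ)
    (h : I ∈ idealsPrimeTo 𝔪) (h' : I ∈ idealsPrimeTo 𝔫), ψ.toHom ⟨I, h⟩ = ψ'.toHom ⟨I, h'⟩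

/-- `𝔣` is the conductor of `ψ`: `ψ` is defined modulo `𝔣`, and `𝔣` divides every ideal modulo which
`ψ` is defined. -/
def IsConductor (ψ : HeckeCharacter φ 𝔪 l) (𝔣 : Ideal (𝓞 K)) : Prop :=
  ψ.IsDefinedModulo 𝔣 ∧ ∀ 𝔫 : Ideal (𝓞 K), ψ.IsDefinedModulo 𝔫 → 𝔣 ∣ 𝔫

end HeckeCharacter

/-- The exponent of the prime `𝔭` in the nonzero ideal `𝔣`. -/
def exponentAt {K : Type*} [Field K] [NumberField K] (𝔭 : HeightOneSpectrum (𝓞 K))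
    (𝔣 : Ideal (𝓞 K)) : ℕ :=
  multiplicity 𝔭.asIdeal 𝔣

/-- The complex conjugate `𝔭̄` of a prime `𝔭` of an imaginary quadratic field. -/
def conjPrime {K : Type*} [Field K] [NumberField K] [Algebra.IsQuadraticExtension ℚ K]
    [IsTotallyComplex K] (𝔭 : HeightOneSpectrum (𝓞 K)) : HeightOneSpectrum (𝓞 K) :=
  haveI : IsCMField K := IsCMField.ofCMExtension ℚ K
  HeightOneSpectrum.equivOfRingEquiv
    (IsCMField.ringOfIntegersComplexConj K).toRingEquiv 𝔭

open Classical in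
/-- One row of the table of exponents. The arguments `c₁, …, c₈` are the cells of the row; this
selects the cell in the column of `𝔭` and `l`. With `Δ_K = -discr K = |discr K|`, the columns are

* `𝔭` prime to `2`: ramified and `l` odd, ramified and `l` even, unramified;
* `𝔭` above `2`: `4 ∥ Δ_K` and `l` odd, `4 ∥ Δ_K` and `l` even, `8 ∣ Δ_K` and `l` odd,
  `8 ∣ Δ_K` and `l` even, unramified (i.e. `4 ∤ Δ_K`). -/
def tableRow {K : Type*} [Field K] [NumberField K] (𝔭 : HeightOneSpectrum (𝓞 K)) (l : ℕ)
    (c₁ c₂ c₃ c₄ c₅ c₆ c₇ c₈ : Set ℕ) : Set ℕ :=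
  if (2 : 𝓞 K) ∉ 𝔭.asIdeal then
    if ¬ Algebra.IsUnramifiedAt ℤ 𝔭.asIdeal then
      if Odd l then c₁ else c₂
    else c₃
  else if (8 : ℤ) ∣ discr K then
    if Odd l then c₆ else c₇
  else if (4 : ℤ) ∣ discr K then
    if Odd l then c₄ else c₅
  else c₈

open Classical in
/-- The table of the possible exponents at `𝔭` of the conductor of a Hecke character with rational
coefficients and `∞`-type `l`. An empty cell means that there is no such character, or that
the column does not occur for the field. -/
def possibleExponents {K : Type*} [Field K] [NumberField K] (𝔭 : HeightOneSpectrum (𝓞 K))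
    (l : ℕ) : Set ℕ :=
  if discr K = -4 then
    tableRow 𝔭 l ∅ ∅ {0, 1} {3, 4, 6} {0, 2, 4, 6} ∅ ∅ ∅
  else if discr K = -3 then
    tableRow 𝔭 l {1, 2, 4} {0, 2, 4} {0, 1} ∅ ∅ ∅ ∅ {0, 1, 2, 3}
  else
    tableRow 𝔭 l {1} {0} {0, 1} ∅ {0, 4} {5} {0, 2} {0, 2, 3}

end

/-! Extend `ψ` to a homomorphism `Ψ` on all fractional ideals and put `η(a) = Ψ((a)) / a ^ l`. On
the integers prime to the modulus, `η` is a character of finite order, and `ψ` is defined modulo `𝔫`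
exactly when `η` factors through congruence modulo `𝔫` (`HeckeCharacter.isDefinedModulo_iff`,
resting on `exists_descent`). The conductor is thus the smallest modulus of `η`.

Rationality of the coefficients at `N(v)` and `N(v) ^ 2` makes `ψ(v)` a root of a rational quadratic
polynomial. Since some power of `v` is principal, a power of `ψ(v)` is a nonreal element of `K` when
`v ≠ v̄`. Hence `ψ` has values in `K` and commutes with complex conjugation
(`HeckeCharacter.isGood_of_hasRationalCoefficients`); the converse is
`IsGood.hasRationalCoefficients`. Consequently `η` takes values in the roots of unity of `K`, it
commutes with conjugation, and the conductor is stable under conjugation. This gives the equality of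
the two exponents.

For a rational prime `p`, the Chinese remainder theorem isolates a local component `L` of `η`
(`locHom`). If `𝔮` is the product of the distinct primes above `p`, the exponent is at most `j` if
and only if `L` is trivial on the elements prime to `p` that are `1` modulo `𝔮 ^ j`
(`IsLocalSetup.exponentAt_le_iff`). Two facts bound the exponent. The values of `L` have order
dividing `2`, or `4` or `6` for discriminant `-4` or `-3`; and `L` is trivial on norms. For most odd
`p` the order is prime to `p`, so `L` is trivial on `1 + 𝔮`; in the other cases, elements close to
`1` are squares, cubes or fourth powers up to smaller terms, which `L` kills. The remaining
exponents are excluded by evaluating `L` at explicit elements.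

The global inputs for these evaluations are as follows. A split prime `q` has `η(q) = 1`, because
`Ψ((q))` is an absolute value squared. With Dirichlet's theorem this gives `η = 1` on rational
integers prime to the modulus when `l` is even (`IsGood.etaHom_intCast_of_even`), and the value of
`L` at certain integers when `l` is odd. A character of odd weight cannot be unramified at a
ramified prime, since `ψ(v)` would be rational with square of absolute value `p ^ l`
(`IsLocalSetup.not_locTriv_zero`). At a ramified prime above `2`, outside discriminants `-3` and
`-4`, a global element whose square is twice an element close to a local unit yields one more value
of `L` for even `l`, and forces `K = ℚ(√-2)` for odd `l`.

Conversely, when the only units are `±1`, all listed exponents come from the given character by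
twisting with `χ ∘ N`, where `χ` is the quadratic character modulo `p` or one of `χ₄`, `χ₈`: this
multiplies `L(x)` by `χ(N x)`. For discriminants `-4` and `-3` the ring of integers is principal,
and the characters are written down as `ψ((x)) = χ(x) x ^ l`, where `χ` is a unit-valued character
modulo an integer with `χ(u) u ^ l = 1` on units (`IsUnitChar.exists_isGood`). -/

open scoped ComplexConjugate

set_option linter.unusedSectionVars false

/-! ### Integral generator, norm, trace and discriminant of an imaginary quadratic field. -/

section QuadraticArithmetic

variable {K : Type*} [Field K] [NumberField K] [Algebra.IsQuadraticExtension ℚ K]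
    [IsTotallyComplex K]

variable (K) in
/-- Complex conjugation on the ring of integers of an imaginary quadratic field. -/
noncomputable def conjInt : 𝓞 K ≃+* 𝓞 K :=
  haveI : IsCMField K := IsCMField.ofCMExtension ℚ K
  (IsCMField.ringOfIntegersComplexConj K).toRingEquiv

theorem embedding_conjInt (φ : K →+* ℂ) (x : 𝓞 K) : φ (conjInt K x : 𝓞 K) = conj (φ x) := by
  have : IsCMField K := IsCMField.ofCMExtension ℚ K
  exact IsCMField.complexEmbedding_complexConj K φ (x : K)

theorem conjInt_conjInt (x : 𝓞 K) : conjInt K (conjInt K x) = x := by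
  have : IsCMField K := IsCMField.ofCMExtension ℚ K
  apply RingOfIntegers.ext
  exact IsCMField.complexConj_apply_apply K (x : K)

theorem exists_conjInt_ne : ∃ x : 𝓞 K, conjInt K x ≠ x := by
  have : IsCMField K := IsCMField.ofCMExtension ℚ K
  by_contra! h
  apply IsCMField.complexConj_ne_one K
  ext x
  obtain ⟨a, b, hb, rfl⟩ := IsFractionRing.div_surjective (A := 𝓞 K) x
  have ha : IsCMField.complexConj K (algebraMap (𝓞 K) K a) = algebraMap (𝓞 K) K a :=
    congrArg (algebraMap (𝓞 K) K) (h a)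
  have hb' : IsCMField.complexConj K (algebraMap (𝓞 K) K b) = algebraMap (𝓞 K) K b :=
    congrArg (algebraMap (𝓞 K) K) (h b)
  simp [map_div₀, ha, hb']

theorem mem_conjPrime (𝔭 : HeightOneSpectrum (𝓞 K)) (x : 𝓞 K) :
    x ∈ (conjPrime 𝔭).asIdeal ↔ conjInt K x ∈ 𝔭.asIdeal := by
  have : x ∈ (conjPrime 𝔭).asIdeal ↔ (conjInt K).symm x ∈ 𝔭.asIdeal := Iff.rfl
  rw [this]
  have : (conjInt K).symm x = conjInt K x := by
    rw [RingEquiv.symm_apply_eq, conjInt_conjInt]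
  rw [this]

theorem conjPrime_asIdeal (𝔭 : HeightOneSpectrum (𝓞 K)) :
    (conjPrime 𝔭).asIdeal = 𝔭.asIdeal.map (conjInt K) := by
  ext x
  rw [mem_conjPrime, Ideal.mem_map_of_equiv]
  constructor
  · intro h
    exact ⟨_, h, conjInt_conjInt x⟩
  · rintro ⟨y, hy, rfl⟩
    rwa [conjInt_conjInt]

theorem conjPrime_conjPrime (𝔭 : HeightOneSpectrum (𝓞 K)) : conjPrime (conjPrime 𝔭) = 𝔭 := by
  ext x
  rw [mem_conjPrime, mem_conjPrime, conjInt_conjInt]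

/-- `θ` generates the ring of integers of the imaginary quadratic field `K` and is a root of
`X ^ 2 - t X + n`. -/
structure IsQuadGen (θ : 𝓞 K) (t n : ℤ) : Prop where
  exists_eq : ∀ x : 𝓞 K, ∃ a b : ℤ, x = a + b * θ
  eq_zero : ∀ a b : ℤ, (a + b * θ : 𝓞 K) = 0 → a = 0 ∧ b = 0
  sq : θ ^ 2 = t * θ - n
  conj_eq : conjInt K θ = t - θ

theorem finrank_int_ringOfIntegers : Module.finrank ℤ (𝓞 K) = 2 := by
  rw [RingOfIntegers.rank, Algebra.IsQuadraticExtension.finrank_eq_two]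

theorem int_unit_of_mul_eq_one {d : ℤ} {x : 𝓞 K} (h : (d : 𝓞 K) * x = 1) : IsUnit d := by
  have h1 := congrArg (Algebra.norm ℤ) h
  rw [map_mul, map_one, show (d : 𝓞 K) = algebraMap ℤ (𝓞 K) d by simp, Algebra.norm_algebraMap,
    finrank_int_ringOfIntegers] at h1
  exact IsUnit.of_mul_eq_one (d * Algebra.norm ℤ x) (by rw [← h1]; ring)

/-- The coordinates `u`, `v` of `1` in any integral basis are coprime, because their gcd is an
integer invertible in `𝓞 K`. A Bézout relation `r u + s v = 1` completes `(u, v)` to a unimodular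
matrix with second row `(-s, r)`. -/
theorem exists_basis_one : ∃ θ : 𝓞 K, (∀ x : 𝓞 K, ∃ a b : ℤ, x = a + b * θ) ∧
    ∀ a b : ℤ, (a + b * θ : 𝓞 K) = 0 → a = 0 ∧ b = 0 := by
  let b : Module.Basis (Fin 2) ℤ (𝓞 K) :=
    Module.finBasisOfFinrankEq ℤ (𝓞 K) finrank_int_ringOfIntegers
  set u := b.repr 1 0 with hu
  set v := b.repr 1 1 with hv
  have h1 : (1 : 𝓞 K) = u * b 0 + v * b 1 := by
    have := b.sum_repr 1
    rw [Fin.sum_univ_two] at this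
    rw [← this, zsmul_eq_mul, zsmul_eq_mul]
  have hcop : IsCoprime u v := by
    rw [Int.isCoprime_iff_gcd_eq_one]
    obtain ⟨u', hu'⟩ := Int.gcd_dvd_left u v
    obtain ⟨v', hv'⟩ := Int.gcd_dvd_right u v
    have : IsUnit ((Int.gcd u v : ℕ) : ℤ) := by
      refine int_unit_of_mul_eq_one (K := K) (x := u' * b 0 + v' * b 1) ?_
      have cu := congrArg (Int.cast (R := 𝓞 K)) hu'
      have cv := congrArg (Int.cast (R := 𝓞 K)) hv'
      rw [Int.cast_mul] at cu cv
      linear_combination (-b 0) * cu - b 1 * cv - h1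
    simpa [Int.isUnit_iff_natAbs_eq] using this
  obtain ⟨r, s, hrs⟩ := hcop
  refine ⟨- s * b 0 + r * b 1, fun x => ?_, fun p q hpq => ?_⟩
  · have hx := b.sum_repr x
    rw [Fin.sum_univ_two, zsmul_eq_mul, zsmul_eq_mul] at hx
    refine ⟨b.repr x 0 * r + b.repr x 1 * s, - b.repr x 0 * v + b.repr x 1 * u, ?_⟩
    have hrs' : (r * u + s * v : 𝓞 K) = 1 := by exact_mod_cast congrArg (Int.cast (R := 𝓞 K)) hrs
    conv_lhs => rw [← hx]
    push_cast
    linear_combination (-(b.repr x 0 * r + b.repr x 1 * s : 𝓞 K)) * h1 +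
      (-(b.repr x 0 : 𝓞 K) * b 0 - (b.repr x 1 : 𝓞 K) * b 1) * hrs'
  · have h2 : ((p * u - q * s) : ℤ) • b 0 + ((p * v + q * r) : ℤ) • b 1 = 0 := by
      rw [zsmul_eq_mul, zsmul_eq_mul, ← hpq]
      push_cast
      linear_combination (-p : 𝓞 K) * h1
    have h3 := Fintype.linearIndependent_iff.1 b.linearIndependent
      ![p * u - q * s, p * v + q * r] (by simpa [Fin.sum_univ_two] using h2)
    have e0 : p * u - q * s = 0 := by simpa using h3 0
    have e1 : p * v + q * r = 0 := by simpa using h3 1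
    constructor
    · linear_combination r * e0 + s * e1 - p * hrs
    · linear_combination u * e1 - v * e0 - q * hrs

/-- Subtracting an integer from the second basis vector reduces its trace to `0` or `1`. The
conjugate of `θ` is the other root of the same quadratic polynomial, because conjugation moves some
integer and hence moves `θ`. -/
theorem exists_isQuadGen : ∃ (θ : 𝓞 K) (t n : ℤ), IsQuadGen θ t n ∧ (t = 0 ∨ t = 1) := by
  obtain ⟨θ₀, h1, h2⟩ := exists_basis_one (K := K)
  obtain ⟨n₀, t₀, hsq⟩ := h1 (θ₀ ^ 2)
  obtain ⟨m, t, ht, ht'⟩ : ∃ m t : ℤ, t₀ = t + 2 * m ∧ (t = 0 ∨ t = 1) :=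
    ⟨t₀ / 2, t₀ % 2, by omega, by omega⟩
  refine ⟨θ₀ - m, t, m ^ 2 - t₀ * m - n₀, ⟨fun x => ?_, fun a b hab => ?_, ?_, ?_⟩, ht'⟩
  · obtain ⟨a, b, rfl⟩ := h1 x
    exact ⟨a + b * m, b, by push_cast; ring⟩
  · have := h2 (a - b * m) b (by rw [← hab]; push_cast; ring)
    constructor
    · rw [this.2] at this; simpa using this.1
    · exact this.2
  · have : t = t₀ - 2 * m := by omega
    rw [this]
    push_cast
    linear_combination hsq
  · have hne : conjInt K θ₀ ≠ θ₀ := by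
      intro h
      obtain ⟨x, hx⟩ := exists_conjInt_ne (K := K)
      obtain ⟨a, b, rfl⟩ := h1 x
      exact hx (by simp [h])
    have hc : (conjInt K θ₀) ^ 2 = n₀ + t₀ * conjInt K θ₀ := by
      rw [← map_pow, hsq]; simp
    have : (conjInt K θ₀ - θ₀) * (conjInt K θ₀ - (t₀ - θ₀)) = 0 := by
      linear_combination hc - hsq
    rcases mul_eq_zero.1 this with h | h
    · exact absurd (sub_eq_zero.1 h) hne
    · have : t = t₀ - 2 * m := by omega
      rw [map_sub, map_intCast, this]
      push_cast
      linear_combination h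

namespace IsQuadGen

variable {θ : 𝓞 K} {t n : ℤ}

theorem ext_iff (hθ : IsQuadGen θ t n) {a b c d : ℤ} : (a + b * θ : 𝓞 K) = c + d * θ ↔ a = c ∧ b = d := by
  constructor
  · intro h
    have := hθ.eq_zero (a - c) (b - d) (by push_cast; linear_combination h)
    omega
  · rintro ⟨rfl, rfl⟩; rfl

theorem conj_apply (hθ : IsQuadGen θ t n) (a b : ℤ) : conjInt K (a + b * θ) = a + b * (t - θ) := by
  simp [hθ.conj_eq]

theorem mul_conj (hθ : IsQuadGen θ t n) (a b : ℤ) : (a + b * θ) * conjInt K (a + b * θ) =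
    ((a ^ 2 + t * a * b + n * b ^ 2 : ℤ) : 𝓞 K) := by
  rw [hθ.conj_apply]
  push_cast
  linear_combination (-(b : 𝓞 K) ^ 2) * hθ.sq

theorem exists_basis (hθ : IsQuadGen θ t n) : ∃ b : Module.Basis (Fin 2) ℤ (𝓞 K), b 0 = 1 ∧ b 1 = θ := by
  have hli : LinearIndependent ℤ ![(1 : 𝓞 K), θ] := by
    rw [LinearIndependent.pair_iff]
    intro a b h
    exact hθ.eq_zero a b (by simpa using h)
  have hsp : ⊤ ≤ Submodule.span ℤ (Set.range ![(1 : 𝓞 K), θ]) := by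
    intro x _
    obtain ⟨a, b, rfl⟩ := hθ.exists_eq x
    have h0 : (1 : 𝓞 K) ∈ Submodule.span ℤ (Set.range ![(1 : 𝓞 K), θ]) :=
      Submodule.subset_span ⟨0, rfl⟩
    have h1 : θ ∈ Submodule.span ℤ (Set.range ![(1 : 𝓞 K), θ]) :=
      Submodule.subset_span ⟨1, rfl⟩
    have := Submodule.add_mem _ (Submodule.smul_mem _ a h0) (Submodule.smul_mem _ b h1)
    simpa using this
  exact ⟨Module.Basis.mk hli hsp, by simp, by simp⟩

theorem repr_eq (hθ : IsQuadGen θ t n) {b : Module.Basis (Fin 2) ℤ (𝓞 K)} (h0 : b 0 = 1) (h1 : b 1 = θ) (x y : ℤ) :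
    b.repr (x + y * θ) 0 = x ∧ b.repr (x + y * θ) 1 = y := by
  have h := b.sum_repr (x + y * θ)
  rw [Fin.sum_univ_two, h0, h1, zsmul_eq_mul, zsmul_eq_mul, mul_one] at h
  exact hθ.ext_iff.1 h

theorem leftMulMatrix_eq (hθ : IsQuadGen θ t n) {b : Module.Basis (Fin 2) ℤ (𝓞 K)} (h0 : b 0 = 1) (h1 : b 1 = θ)
    (x y : ℤ) : Algebra.leftMulMatrix b (x + y * θ) = !![x, - n * y; y, x + t * y] := by
  have e0 : (x + y * θ) * b 0 = x + y * θ := by rw [h0, mul_one]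
  have e1 : (x + y * θ) * b 1 = ((- n * y : ℤ) : 𝓞 K) + ((x + t * y : ℤ) : 𝓞 K) * θ := by
    rw [h1]
    push_cast
    linear_combination (y : 𝓞 K) * hθ.sq
  ext i j
  rw [Algebra.leftMulMatrix_eq_repr_mul]
  fin_cases j
  · simp only [Fin.zero_eta, e0]
    fin_cases i
    · simpa using (hθ.repr_eq h0 h1 x y).1
    · simpa using (hθ.repr_eq h0 h1 x y).2
  · simp only [Fin.mk_one, e1]
    fin_cases i
    · exact (hθ.repr_eq h0 h1 _ _).1.trans (by simp)
    · exact (hθ.repr_eq h0 h1 _ _).2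

theorem norm_eq (hθ : IsQuadGen θ t n) (x y : ℤ) : Algebra.norm ℤ (x + y * θ : 𝓞 K) = x ^ 2 + t * x * y + n * y ^ 2 := by
  obtain ⟨b, h0, h1⟩ := hθ.exists_basis
  rw [Algebra.norm_eq_matrix_det b, hθ.leftMulMatrix_eq h0 h1, Matrix.det_fin_two_of]
  ring

theorem trace_eq (hθ : IsQuadGen θ t n) (x y : ℤ) : Algebra.trace ℤ (𝓞 K) (x + y * θ : 𝓞 K) = 2 * x + t * y := by
  obtain ⟨b, h0, h1⟩ := hθ.exists_basis
  rw [Algebra.trace_eq_matrix_trace b, hθ.leftMulMatrix_eq h0 h1, Matrix.trace_fin_two_of]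
  ring

theorem discr_eq (hθ : IsQuadGen θ t n) : discr K = t ^ 2 - 4 * n := by
  obtain ⟨b, h0, h1⟩ := hθ.exists_basis
  rw [← NumberField.discr_eq_discr K b, Algebra.discr_def, Matrix.det_fin_two]
  simp only [Algebra.traceMatrix_apply, Algebra.traceForm_apply, h0, h1, one_mul, mul_one]
  have e1 : Algebra.trace ℤ (𝓞 K) 1 = 2 := by
    have := hθ.trace_eq 1 0
    simpa using this
  have e2 : Algebra.trace ℤ (𝓞 K) θ = t := by
    have := hθ.trace_eq 0 1
    simpa using this
  have e3 : Algebra.trace ℤ (𝓞 K) (θ * θ) = t ^ 2 - 2 * n := by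
    have := hθ.trace_eq (- n) t
    rw [← pow_two, hθ.sq]
    rw [show (t * θ - n : 𝓞 K) = ((-n : ℤ) : 𝓞 K) + t * θ by push_cast; ring, this]
    ring
  rw [e1, e2, e3]
  ring

end IsQuadGen

theorem mul_conjInt_eq_norm (x : 𝓞 K) : x * conjInt K x = (Algebra.norm ℤ x : ℤ) := by
  obtain ⟨θ, t, n, hθ, -⟩ := exists_isQuadGen (K := K)
  obtain ⟨a, b, rfl⟩ := hθ.exists_eq x
  rw [hθ.mul_conj, hθ.norm_eq]

theorem norm_nonneg_int (x : 𝓞 K) : 0 ≤ Algebra.norm ℤ x := by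
  have φ : K →+* ℂ := Classical.choice (inferInstance : Nonempty (K →+* ℂ))
  have h := congrArg (fun y : 𝓞 K => φ y) (mul_conjInt_eq_norm x)
  simp only [map_mul, embedding_conjInt] at h
  rw [Complex.mul_conj] at h
  have h2 : φ ((Algebra.norm ℤ x : ℤ) : 𝓞 K) = ((Algebra.norm ℤ x : ℝ) : ℂ) := by simp
  rw [h2] at h
  have h3 : Complex.normSq (φ x) = (Algebra.norm ℤ x : ℝ) := by exact_mod_cast h
  have := Complex.normSq_nonneg (φ x)
  rw [h3] at this
  exact_mod_cast this

theorem absNorm_span_eq (x : 𝓞 K) :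
    ((Ideal.absNorm (Ideal.span {x}) : ℕ) : ℤ) = Algebra.norm ℤ x := by
  rw [Ideal.absNorm_span_singleton, Int.natAbs_of_nonneg (norm_nonneg_int x)]

theorem discr_neg : discr K < 0 := by
  obtain ⟨θ, t, n, hθ, ht⟩ := exists_isQuadGen (K := K)
  -- The element `2 θ - t` is a square root of the discriminant, so its norm is `-discr K`.
  have h1 := norm_nonneg_int (((-t : ℤ) : 𝓞 K) + ((2 : ℤ) : 𝓞 K) * θ)
  rw [hθ.norm_eq] at h1
  have h2 := NumberField.discr_ne_zero K
  rw [hθ.discr_eq] at h2 ⊢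
  have : t ^ 2 - 4 * n ≤ 0 := by linarith [h1, (by ring : (-t)^2 + t * (-t) * 2 + n * 2 ^ 2 = -(t ^ 2 - 4 * n))]
  omega

end QuadraticArithmetic

/-! ### Homomorphisms on fractional ideals and the finite part `η`. -/

section TotalHom

variable {K : Type*} [Field K] [NumberField K]

/-- An integral ideal which is not zero, as an invertible fractional ideal. -/
noncomputable def idealUnit (𝔞 : Ideal (𝓞 K)) (h : 𝔞 ≠ 0) : (FractionalIdeal (𝓞 K)⁰ K)ˣ :=
  FractionalIdeal.mk0 K ⟨𝔞, mem_nonZeroDivisors_of_ne_zero h⟩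

theorem coe_idealUnit (𝔞 : Ideal (𝓞 K)) (h : 𝔞 ≠ 0) :
    (idealUnit 𝔞 h : FractionalIdeal (𝓞 K)⁰ K) = 𝔞 := rfl

theorem idealUnit_mul {𝔞 𝔟 : Ideal (𝓞 K)} (ha : 𝔞 ≠ 0) (hb : 𝔟 ≠ 0) :
    idealUnit (𝔞 * 𝔟) (mul_ne_zero ha hb) = idealUnit 𝔞 ha * idealUnit 𝔟 hb := by
  apply Units.ext
  rw [Units.val_mul, coe_idealUnit, coe_idealUnit, coe_idealUnit, FractionalIdeal.coeIdeal_mul]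

theorem idealUnit_top : idealUnit (⊤ : Ideal (𝓞 K)) top_ne_bot = 1 := by
  apply Units.ext
  rw [coe_idealUnit, FractionalIdeal.coeIdeal_top, Units.val_one]

theorem idealUnit_span {a : 𝓞 K} (h : Ideal.span {a} ≠ 0) (α : Kˣ)
    (hα : (α : K) = a) : idealUnit (Ideal.span {a}) h = toPrincipalIdeal (𝓞 K) K α := by
  apply Units.ext
  rw [coe_idealUnit, coe_toPrincipalIdeal, FractionalIdeal.coeIdeal_span_singleton, hα]

/-- A prime ideal as an invertible fractional ideal. -/
noncomputable def primeUnit (v : HeightOneSpectrum (𝓞 K)) : (FractionalIdeal (𝓞 K)⁰ K)ˣ :=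
  idealUnit v.asIdeal v.ne_bot

theorem count_primeUnit_self (v : HeightOneSpectrum (𝓞 K)) :
    FractionalIdeal.count K v (primeUnit v : FractionalIdeal (𝓞 K)⁰ K) = 1 :=
  FractionalIdeal.count_self K v

theorem count_primeUnit_of_ne {v w : HeightOneSpectrum (𝓞 K)} (h : w ≠ v) :
    FractionalIdeal.count K v (primeUnit w : FractionalIdeal (𝓞 K)⁰ K) = 0 :=
  FractionalIdeal.count_maximal_coprime K v h

theorem count_finite (I : (FractionalIdeal (𝓞 K)⁰ K)ˣ) :
    {v : HeightOneSpectrum (𝓞 K) |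
      FractionalIdeal.count K v (I : FractionalIdeal (𝓞 K)⁰ K) ≠ 0}.Finite :=
  FractionalIdeal.finite_factors (I : FractionalIdeal (𝓞 K)⁰ K)

theorem finprod_primeUnit (I : (FractionalIdeal (𝓞 K)⁰ K)ˣ) :
    ∏ᶠ v : HeightOneSpectrum (𝓞 K),
      primeUnit v ^ FractionalIdeal.count K v (I : FractionalIdeal (𝓞 K)⁰ K) = I := by
  apply Units.ext
  rw [← Units.coeHom_apply, MonoidHom.map_finprod_of_injective _ Units.val_injective]
  simp only [map_zpow, Units.coeHom_apply]
  exact FractionalIdeal.finprod_heightOneSpectrum_factorization' K I.ne_zero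

/-- The group of fractional ideals prime to `𝔪` is generated by the primes not dividing `𝔪`. -/
theorem idealsPrimeTo_le {𝔪 : Ideal (𝓞 K)} {S : Subgroup (FractionalIdeal (𝓞 K)⁰ K)ˣ}
    (h : ∀ v : HeightOneSpectrum (𝓞 K), ¬ v.asIdeal ∣ 𝔪 → primeUnit v ∈ S) :
    idealsPrimeTo 𝔪 ≤ S := by
  intro I hI
  rw [← finprod_primeUnit I]
  refine finprod_induction (· ∈ S) S.one_mem (fun x y hx hy => S.mul_mem hx hy) fun v => ?_
  by_cases hv : v.asIdeal ∣ 𝔪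
  · rw [hI v hv, zpow_zero]; exact S.one_mem
  · exact S.zpow_mem (h v hv) _

theorem primeUnit_mem_iff {𝔪 : Ideal (𝓞 K)} {v : HeightOneSpectrum (𝓞 K)} :
    primeUnit v ∈ idealsPrimeTo 𝔪 ↔ ¬ v.asIdeal ∣ 𝔪 := by
  constructor
  · intro h hv
    have := h v hv
    rw [count_primeUnit_self] at this
    exact one_ne_zero this
  · intro h w hw
    refine count_primeUnit_of_ne ?_
    rintro rfl
    exact h hw

theorem idealsPrimeTo_mono {𝔪 𝔫 : Ideal (𝓞 K)} (h : 𝔪 ∣ 𝔫) :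
    idealsPrimeTo 𝔫 ≤ idealsPrimeTo 𝔪 :=
  fun _ hI v hv => hI v (hv.trans h)

theorem count_idealUnit_eq_zero_iff {𝔞 : Ideal (𝓞 K)} (h : 𝔞 ≠ 0) (v : HeightOneSpectrum (𝓞 K)) :
    FractionalIdeal.count K v (idealUnit 𝔞 h : FractionalIdeal (𝓞 K)⁰ K) = 0 ↔
      ¬ v.asIdeal ∣ 𝔞 := by
  classical
  rw [coe_idealUnit, FractionalIdeal.count_coe K v h, ← Associates.count_ne_zero_iff_dvd h v.irreducible]
  simp

theorem isCoprime_iff_forall_prime {𝔞 𝔪 : Ideal (𝓞 K)} (hm : 𝔪 ≠ 0) :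
    IsCoprime 𝔞 𝔪 ↔ ∀ v : HeightOneSpectrum (𝓞 K), v.asIdeal ∣ 𝔪 → ¬ v.asIdeal ∣ 𝔞 := by
  rw [Ideal.isCoprime_iff_sup_eq]
  constructor
  · intro h v hv ha
    have : 𝔞 ⊔ 𝔪 ≤ v.asIdeal := sup_le (Ideal.le_of_dvd ha) (Ideal.le_of_dvd hv)
    rw [h] at this
    exact v.isPrime.ne_top (top_le_iff.1 this)
  · intro h
    by_contra hne
    obtain ⟨P, hP, hle⟩ := Ideal.exists_le_maximal _ hne
    have hPm : 𝔪 ≤ P := le_sup_right.trans hle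
    have hP0 : P ≠ ⊥ := by rintro rfl; exact hm (le_bot_iff.1 hPm)
    exact h ⟨P, hP.isPrime, hP0⟩ (Ideal.dvd_iff_le.2 hPm)
      (Ideal.dvd_iff_le.2 (le_sup_left.trans hle))

theorem idealUnit_mem_iff {𝔞 𝔪 : Ideal (𝓞 K)} (h : 𝔞 ≠ 0) (hm : 𝔪 ≠ 0) :
    idealUnit 𝔞 h ∈ idealsPrimeTo 𝔪 ↔ IsCoprime 𝔞 𝔪 := by
  rw [isCoprime_iff_forall_prime hm]
  exact forall₂_congr fun v _ => count_idealUnit_eq_zero_iff h v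

/-- A fractional ideal prime to `𝔪` is a quotient of integral ideals prime to `𝔪`. -/
theorem exists_idealUnit_of_mem {𝔪 : Ideal (𝓞 K)} (hm : 𝔪 ≠ 0)
    {I : (FractionalIdeal (𝓞 K)⁰ K)ˣ} (hI : I ∈ idealsPrimeTo 𝔪) :
    ∃ (𝔞 𝔟 : Ideal (𝓞 K)) (ha : 𝔞 ≠ 0) (hb : 𝔟 ≠ 0), IsCoprime 𝔞 𝔪 ∧ IsCoprime 𝔟 𝔪 ∧
      I * idealUnit 𝔟 hb = idealUnit 𝔞 ha := by
  let S : Subgroup (FractionalIdeal (𝓞 K)⁰ K)ˣ :=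
    { carrier := {I | ∃ (𝔞 𝔟 : Ideal (𝓞 K)) (ha : 𝔞 ≠ 0) (hb : 𝔟 ≠ 0), IsCoprime 𝔞 𝔪 ∧
        IsCoprime 𝔟 𝔪 ∧ I * idealUnit 𝔟 hb = idealUnit 𝔞 ha}
      one_mem' := ⟨⊤, ⊤, top_ne_bot, top_ne_bot, by simp [Ideal.isCoprime_iff_sup_eq],
        by simp [Ideal.isCoprime_iff_sup_eq], by simp⟩
      mul_mem' := by
        rintro I J ⟨a, b, ha, hb, ca, cb, h⟩ ⟨a', b', ha', hb', ca', cb', h'⟩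
        refine ⟨a * a', b * b', mul_ne_zero ha ha', mul_ne_zero hb hb', ca.mul_left ca',
          cb.mul_left cb', ?_⟩
        rw [idealUnit_mul hb hb', idealUnit_mul ha ha', ← h, ← h', mul_mul_mul_comm]
      inv_mem' := by
        rintro I ⟨a, b, ha, hb, ca, cb, h⟩
        refine ⟨b, a, hb, ha, cb, ca, ?_⟩
        rw [← h, inv_mul_cancel_left] }
  refine idealsPrimeTo_le (S := S) (fun v hv => ?_) hI
  refine ⟨v.asIdeal, ⊤, v.ne_bot, top_ne_bot, ?_, by simp [Ideal.isCoprime_iff_sup_eq], ?_⟩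
  · rw [← idealUnit_mem_iff v.ne_bot hm]
    exact primeUnit_mem_iff.2 hv
  · rw [idealUnit_top, mul_one]; rfl

/-- The homomorphism on fractional ideals with prescribed values at the primes. -/
noncomputable def extHom (g : HeightOneSpectrum (𝓞 K) → ℂˣ) :
    (FractionalIdeal (𝓞 K)⁰ K)ˣ →* ℂˣ where
  toFun I := ∏ᶠ v, g v ^ FractionalIdeal.count K v (I : FractionalIdeal (𝓞 K)⁰ K)
  map_one' := by
    simp [FractionalIdeal.count_one]
  map_mul' I J := by
    rw [← finprod_mul_distrib]
    · refine finprod_congr fun v => ?_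
      rw [Units.val_mul, FractionalIdeal.count_mul K v I.ne_zero J.ne_zero, zpow_add]
    · refine (count_finite I).subset fun v hv hv' => hv ?_
      simp only [hv', zpow_zero]
    · refine (count_finite J).subset fun v hv hv' => hv ?_
      simp only [hv', zpow_zero]

theorem extHom_primeUnit (g : HeightOneSpectrum (𝓞 K) → ℂˣ) (v : HeightOneSpectrum (𝓞 K)) :
    extHom g (primeUnit v) = g v := by
  have h : extHom g (primeUnit v) = ∏ᶠ w, g w ^
    FractionalIdeal.count K w (primeUnit v : FractionalIdeal (𝓞 K)⁰ K) := rfl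
  rw [h, finprod_eq_single _ v, count_primeUnit_self, zpow_one]
  intro w hw
  rw [count_primeUnit_of_ne hw.symm, zpow_zero]

/-- The value of `Ψ` at an integral ideal, `0` at the zero ideal. -/
noncomputable def idealVal (Ψ : (FractionalIdeal (𝓞 K)⁰ K)ˣ →* ℂˣ) : Ideal (𝓞 K) →*₀ ℂ := by
  classical
  exact
  { toFun := fun 𝔞 => if h : 𝔞 ≠ 0 then (Ψ (idealUnit 𝔞 h) : ℂ) else 0
    map_zero' := by simp
    map_one' := by
      rw [dif_pos one_ne_zero]
      have := idealUnit_top (K := K)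
      simp only [Ideal.one_eq_top, this]
      simp
    map_mul' := by
      intro 𝔞 𝔟
      by_cases ha : 𝔞 = 0
      · simp [ha]
      by_cases hb : 𝔟 = 0
      · simp [hb]
      simp only [ne_eq, ha, not_false_eq_true, hb, dite_true, mul_eq_zero, or_self]
      rw [idealUnit_mul ha hb, map_mul, Units.val_mul] }

theorem idealVal_of_ne (Ψ : (FractionalIdeal (𝓞 K)⁰ K)ˣ →* ℂˣ) {𝔞 : Ideal (𝓞 K)} (h : 𝔞 ≠ 0) :
    idealVal Ψ 𝔞 = Ψ (idealUnit 𝔞 h) := dif_pos h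

theorem idealVal_ne_zero (Ψ : (FractionalIdeal (𝓞 K)⁰ K)ˣ →* ℂˣ) {𝔞 : Ideal (𝓞 K)} (h : 𝔞 ≠ 0) :
    idealVal Ψ 𝔞 ≠ 0 := by
  rw [idealVal_of_ne Ψ h]; exact Units.ne_zero _

theorem span_ne_zero {a : 𝓞 K} (ha : a ≠ 0) : Ideal.span {a} ≠ 0 := by
  simpa [Ideal.span_singleton_eq_bot] using ha

/-- `η(a) = Ψ((a)) / a ^ l` for an algebraic integer `a`. -/
noncomputable def etaHom (φ : K →+* ℂ) (l : ℕ) (Ψ : (FractionalIdeal (𝓞 K)⁰ K)ˣ →* ℂˣ) :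
    𝓞 K →*₀ ℂ where
  toFun a := idealVal Ψ (Ideal.span {a}) / φ a ^ l
  map_zero' := by
    rw [Ideal.span_singleton_eq_bot.2 rfl, ← Ideal.zero_eq_bot, map_zero, zero_div]
  map_one' := by
    rw [Ideal.span_singleton_one, ← Ideal.one_eq_top, map_one]
    simp
  map_mul' a b := by
    rw [← Ideal.span_singleton_mul_span_singleton, map_mul]
    push_cast
    rw [map_mul, mul_pow, mul_div_mul_comm]

theorem etaHom_apply (φ : K →+* ℂ) (l : ℕ) (Ψ : (FractionalIdeal (𝓞 K)⁰ K)ˣ →* ℂˣ) (a : 𝓞 K) :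
    etaHom φ l Ψ a = idealVal Ψ (Ideal.span {a}) / φ a ^ l := rfl

theorem embedding_ne_zero (φ : K →+* ℂ) {a : 𝓞 K} (ha : a ≠ 0) : φ a ≠ 0 := by
  rw [map_ne_zero_iff _ φ.injective]
  exact_mod_cast ha

theorem etaHom_ne_zero (φ : K →+* ℂ) (l : ℕ) (Ψ : (FractionalIdeal (𝓞 K)⁰ K)ˣ →* ℂˣ) {a : 𝓞 K}
    (ha : a ≠ 0) : etaHom φ l Ψ a ≠ 0 :=
  div_ne_zero (idealVal_ne_zero Ψ (span_ne_zero ha)) (pow_ne_zero _ (embedding_ne_zero φ ha))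

theorem idealVal_span (φ : K →+* ℂ) (l : ℕ) (Ψ : (FractionalIdeal (𝓞 K)⁰ K)ˣ →* ℂˣ) {a : 𝓞 K}
    (ha : a ≠ 0) : idealVal Ψ (Ideal.span {a}) = etaHom φ l Ψ a * φ a ^ l := by
  rw [etaHom_apply, div_mul_cancel₀ _ (pow_ne_zero _ (embedding_ne_zero φ ha))]

/-- `a` is nonzero and prime to the ideal `𝔪`. -/
def PrimeToIdeal (𝔪 : Ideal (𝓞 K)) (a : 𝓞 K) : Prop :=
  a ≠ 0 ∧ IsCoprime (Ideal.span {a}) 𝔪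

theorem PrimeToIdeal.mul {𝔪 : Ideal (𝓞 K)} {a b : 𝓞 K} (ha : PrimeToIdeal 𝔪 a)
    (hb : PrimeToIdeal 𝔪 b) : PrimeToIdeal 𝔪 (a * b) := by
  refine ⟨mul_ne_zero ha.1 hb.1, ?_⟩
  rw [← Ideal.span_singleton_mul_span_singleton]
  exact ha.2.mul_left hb.2

theorem PrimeToIdeal.mono {𝔪 𝔫 : Ideal (𝓞 K)} (h : 𝔫 ∣ 𝔪) {a : 𝓞 K} (ha : PrimeToIdeal 𝔪 a) :
    PrimeToIdeal 𝔫 a :=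
  ⟨ha.1, ha.2.of_isCoprime_of_dvd_right h⟩

theorem isCoprime_span_iff {𝔪 : Ideal (𝓞 K)} {a : 𝓞 K} :
    IsCoprime (Ideal.span {a}) 𝔪 ↔ ∃ b, a * b - 1 ∈ 𝔪 := by
  rw [Ideal.isCoprime_iff_exists]
  constructor
  · rintro ⟨i, hi, j, hj, h⟩
    obtain ⟨b, rfl⟩ := Ideal.mem_span_singleton'.1 hi
    refine ⟨b, ?_⟩
    have : a * b - 1 = - j := by rw [← h]; ring
    rw [this]; exact 𝔪.neg_mem hj
  · rintro ⟨b, hb⟩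
    exact ⟨a * b, Ideal.mem_span_singleton'.2 ⟨b, mul_comm _ _⟩, 1 - a * b,
      by rw [← neg_sub]; exact 𝔪.neg_mem hb, by ring⟩

theorem isCoprime_span_congr {𝔪 : Ideal (𝓞 K)} {a b : 𝓞 K} (h : a - b ∈ 𝔪)
    (ha : IsCoprime (Ideal.span {a}) 𝔪) : IsCoprime (Ideal.span {b}) 𝔪 := by
  obtain ⟨c, hc⟩ := isCoprime_span_iff.1 ha
  refine isCoprime_span_iff.2 ⟨c, ?_⟩
  have : b * c - 1 = (a * c - 1) - (a - b) * c := by ring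
  rw [this]
  exact 𝔪.sub_mem hc (𝔪.mul_mem_right _ h)

theorem exists_inverse_mod {𝔪 : Ideal (𝓞 K)} (hm : 𝔪 ≠ 0) {a : 𝓞 K} (ha : PrimeToIdeal 𝔪 a) :
    ∃ b, PrimeToIdeal 𝔪 b ∧ a * b - 1 ∈ 𝔪 := by
  obtain ⟨b, hb⟩ := isCoprime_span_iff.1 ha.2
  obtain ⟨m, hm1, hm0⟩ := Submodule.exists_mem_ne_zero_of_ne_bot hm
  -- An inverse can be `0` only modulo the unit ideal, and then `1` serves as well.
  by_cases h0 : b = 0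
  · subst h0
    have h1 : (1 : 𝓞 K) ∈ 𝔪 := by
      have := 𝔪.neg_mem hb; simpa using this
    have ht : 𝔪 = ⊤ := (Ideal.eq_top_iff_one _).2 h1
    refine ⟨1, ⟨one_ne_zero, ?_⟩, by rw [ht]; trivial⟩
    rw [Ideal.span_singleton_one, ht]
    simp [Ideal.isCoprime_iff_sup_eq]
  · exact ⟨b, ⟨h0, isCoprime_span_iff.2 ⟨a, by rwa [mul_comm]⟩⟩, hb⟩

/-- `η` depends only on the class modulo `𝔫`, on the integers prime to `𝔐`. -/
def FactorsMod (φ : K →+* ℂ) (l : ℕ) (Ψ : (FractionalIdeal (𝓞 K)⁰ K)ˣ →* ℂˣ)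
    (𝔐 𝔫 : Ideal (𝓞 K)) : Prop :=
  ∀ a b : 𝓞 K, PrimeToIdeal 𝔐 a → PrimeToIdeal 𝔐 b → a - b ∈ 𝔫 →
    etaHom φ l Ψ a = etaHom φ l Ψ b

/-- Multiplication by an inverse of `b` modulo `𝔐` turns a congruence between `a` and `b` into a
congruence with `1`. -/
theorem factorsMod_iff {φ : K →+* ℂ} {l : ℕ} {Ψ : (FractionalIdeal (𝓞 K)⁰ K)ˣ →* ℂˣ}
    {𝔐 𝔫 : Ideal (𝓞 K)} (hM : 𝔐 ≠ 0) (h : 𝔫 ∣ 𝔐) : FactorsMod φ l Ψ 𝔐 𝔫 ↔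
      ∀ a : 𝓞 K, PrimeToIdeal 𝔐 a → a - 1 ∈ 𝔫 → etaHom φ l Ψ a = 1 := by
  have p1 : PrimeToIdeal 𝔐 1 := ⟨one_ne_zero, by
    rw [Ideal.span_singleton_one]; simp [Ideal.isCoprime_iff_sup_eq]⟩
  constructor
  · intro H a ha h1
    rw [H a 1 ha p1 h1, map_one]
  · intro H a b ha hb hab
    obtain ⟨c, hc, hbc⟩ := exists_inverse_mod hM hb
    have h1 := H (b * c) (hb.mul hc) (Ideal.le_of_dvd h hbc)
    have h2 := H (a * c) (ha.mul hc) (by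
      have : a * c - 1 = (a - b) * c + (b * c - 1) := by ring
      rw [this]
      exact 𝔫.add_mem (𝔫.mul_mem_right _ hab) (Ideal.le_of_dvd h hbc))
    rw [map_mul] at h1 h2
    exact mul_right_cancel₀ (etaHom_ne_zero φ l Ψ hc.1) (h2.trans h1.symm)

end TotalHom

/-! ### Multiplicative congruences and descent of a character to a smaller modulus. -/

section Descent

variable {K : Type*} [Field K] [NumberField K]

theorem CongrOneMod.one (𝔪 : Ideal (𝓞 K)) : CongrOneMod 𝔪 (1 : K) :=
  ⟨1, 1, one_ne_zero, by rw [Ideal.span_singleton_one]; simp [Ideal.isCoprime_iff_sup_eq],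
    by simp, by simp⟩

theorem CongrOneMod.mul {𝔪 : Ideal (𝓞 K)} {α β : K} (ha : CongrOneMod 𝔪 α)
    (hb : CongrOneMod 𝔪 β) : CongrOneMod 𝔪 (α * β) := by
  obtain ⟨a, b, hb0, hc, hs, h⟩ := ha
  obtain ⟨a', b', hb0', hc', hs', h'⟩ := hb
  refine ⟨a * a', b * b', mul_ne_zero hb0 hb0', ?_, ?_, ?_⟩
  · rw [← Ideal.span_singleton_mul_span_singleton]
    exact hc.mul_left hc'
  · have : a * a' - b * b' = (a - b) * a' + b * (a' - b') := by ring
    rw [this]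
    exact 𝔪.add_mem (𝔪.mul_mem_right _ hs) (𝔪.mul_mem_left _ hs')
  · simp only [RingOfIntegers.coe_eq_algebraMap, map_mul] at h h' ⊢
    rw [← h, ← h']; ring

theorem CongrOneMod.inv {𝔪 : Ideal (𝓞 K)} {α : Kˣ} (ha : CongrOneMod 𝔪 (α : K)) :
    CongrOneMod 𝔪 ((α⁻¹ : Kˣ) : K) := by
  obtain ⟨a, b, hb0, hc, hs, h⟩ := ha
  have ha0 : a ≠ 0 := by
    rintro rfl
    rw [RingOfIntegers.coe_eq_algebraMap, RingOfIntegers.coe_eq_algebraMap, map_zero] at h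
    rcases mul_eq_zero.1 h with h | h
    · exact α.ne_zero h
    · exact hb0 (by simpa using h)
  refine ⟨b, a, ha0, isCoprime_span_congr (b := a) ?_ hc, ?_, ?_⟩
  · rw [← neg_sub]; exact 𝔪.neg_mem hs
  · rw [← neg_sub]; exact 𝔪.neg_mem hs
  · rw [← h, Units.inv_mul_cancel_left]

theorem CongrOneMod.mono {𝔪 𝔫 : Ideal (𝓞 K)} (hd : 𝔫 ∣ 𝔪) {α : K} (h : CongrOneMod 𝔪 α) :
    CongrOneMod 𝔫 α := by
  obtain ⟨a, b, hb0, hc, hs, h⟩ := h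
  exact ⟨a, b, hb0, hc.of_isCoprime_of_dvd_right hd, Ideal.le_of_dvd hd hs, h⟩

theorem congrOneMod_div {𝔪 : Ideal (𝓞 K)} {a b : 𝓞 K} (hb : PrimeToIdeal 𝔪 b) (h : a - b ∈ 𝔪)
    {α : K} (hα : α * b = a) : CongrOneMod 𝔪 α :=
  ⟨a, b, hb.1, hb.2, h, hα⟩

/-- An element of `K` prime to `𝔐` is a quotient of integers prime to `𝔐`. -/
theorem exists_div_of_mem {𝔐 : Ideal (𝓞 K)} (hM : 𝔐 ≠ 0) {α : Kˣ}
    (hα : toPrincipalIdeal (𝓞 K) K α ∈ idealsPrimeTo 𝔐) :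
    ∃ a b : 𝓞 K, PrimeToIdeal 𝔐 a ∧ PrimeToIdeal 𝔐 b ∧ (α : K) * b = a := by
  obtain ⟨𝔞, 𝔟, ha, hb, ca, cb, h⟩ := exists_idealUnit_of_mem hM hα
  -- Except for the trivial modulus, `b` is an element of `𝔟` congruent to `1` modulo `𝔐`.
  -- Multiplying by it clears the denominator of `α` without leaving the ideals prime to `𝔐`.
  obtain ⟨b, hb', hb1, hbc⟩ : ∃ b ∈ 𝔟, b ≠ 0 ∧ IsCoprime (Ideal.span {b}) 𝔐 := by
    obtain ⟨i, hi, j, hj, hij⟩ := Ideal.isCoprime_iff_exists.1 cb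
    by_cases hi0 : i = 0
    · obtain ⟨x, hx, hx0⟩ := Submodule.exists_mem_ne_zero_of_ne_bot hb
      have : 𝔐 = ⊤ := by
        rw [Ideal.eq_top_iff_one, ← hij, hi0, zero_add]; exact hj
      exact ⟨x, hx, hx0, by rw [this]; simp [Ideal.isCoprime_iff_sup_eq]⟩
    · refine ⟨i, hi, hi0, isCoprime_span_congr (a := 1) ?_ ?_⟩
      · rw [← hij]; simpa using hj
      · rw [Ideal.span_singleton_one]; simp [Ideal.isCoprime_iff_sup_eq]
  obtain ⟨𝔠, hc⟩ := Ideal.dvd_iff_le.2 ((Ideal.span_singleton_le_iff_mem _).2 hb')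
  have hc0 : 𝔠 ≠ 0 := by
    rintro rfl
    rw [mul_zero] at hc
    exact span_ne_zero hb1 hc
  have hβ : (b : K) ≠ 0 := by exact_mod_cast hb1
  have key : toPrincipalIdeal (𝓞 K) K (α * Units.mk0 (b : K) hβ) =
      idealUnit (𝔞 * 𝔠) (mul_ne_zero ha hc0) := by
    rw [map_mul, ← idealUnit_span (span_ne_zero hb1) (Units.mk0 (b : K) hβ) rfl,
      idealUnit_mul ha hc0, ← h, mul_assoc, ← idealUnit_mul hb hc0]
    simp only [hc]
  have key2 : FractionalIdeal.spanSingleton (𝓞 K)⁰ ((α : K) * b) =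
      ((𝔞 * 𝔠 : Ideal (𝓞 K)) : FractionalIdeal (𝓞 K)⁰ K) := by
    have := congrArg Units.val key
    rw [coe_toPrincipalIdeal, coe_idealUnit] at this
    simpa using this
  have hmem : (α : K) * b ∈ ((𝔞 * 𝔠 : Ideal (𝓞 K)) : FractionalIdeal (𝓞 K)⁰ K) := by
    rw [← key2]; exact FractionalIdeal.mem_spanSingleton_self _ _
  obtain ⟨a, -, hae⟩ := (FractionalIdeal.mem_coeIdeal _).1 hmem
  have ha0 : a ≠ 0 := by
    rintro rfl
    rw [map_zero] at hae
    exact mul_ne_zero α.ne_zero hβ hae.symm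
  have hsp : Ideal.span {a} = 𝔞 * 𝔠 := by
    rw [← FractionalIdeal.coeIdeal_inj (K := K), ← key2, ← hae,
      FractionalIdeal.coeIdeal_span_singleton]
  refine ⟨a, b, ⟨ha0, ?_⟩, ⟨hb1, hbc⟩, hae.symm⟩
  rw [hsp]
  rw [hc] at hbc
  exact ca.mul_left hbc.of_mul_left_right

/-- `Ψ` restricts to a Hecke character modulo `𝔪` with `∞`-type `l`. -/
def IsHecke (φ : K →+* ℂ) (l : ℕ) (Ψ : (FractionalIdeal (𝓞 K)⁰ K)ˣ →* ℂˣ)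
    (𝔪 : Ideal (𝓞 K)) : Prop :=
  FactorsMod φ l Ψ 𝔪 𝔪

/-- For `α = a / b` the value of `Ψ` at `(α)` is `α ^ l η(a) / η(b)`. -/
theorem apply_toPrincipalIdeal {φ : K →+* ℂ} {l : ℕ} {Ψ : (FractionalIdeal (𝓞 K)⁰ K)ˣ →* ℂˣ}
    {α : Kˣ} {a b : 𝓞 K} (ha : a ≠ 0) (hb : b ≠ 0) (h : (α : K) * b = a)
    (hη : etaHom φ l Ψ a = etaHom φ l Ψ b) :
    (Ψ (toPrincipalIdeal (𝓞 K) K α) : ℂ) = φ α ^ l := by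
  have hβ : (b : K) ≠ 0 := by exact_mod_cast hb
  have h1 : toPrincipalIdeal (𝓞 K) K α * idealUnit (Ideal.span {b}) (span_ne_zero hb) =
      idealUnit (Ideal.span {a}) (span_ne_zero ha) := by
    rw [idealUnit_span (span_ne_zero hb) (Units.mk0 (b : K) hβ) rfl, ← map_mul,
      idealUnit_span (span_ne_zero ha) (α * Units.mk0 (b : K) hβ) (by simpa using h)]
  have h2 := congrArg (fun x => ((Ψ x : ℂˣ) : ℂ)) h1
  simp only [map_mul, Units.val_mul] at h2
  rw [← idealVal_of_ne, ← idealVal_of_ne, idealVal_span φ l Ψ ha, idealVal_span φ l Ψ hb, hη,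
    ← h, map_mul, mul_pow] at h2
  have h3 := etaHom_ne_zero φ l Ψ hb
  have h4 := pow_ne_zero l (embedding_ne_zero φ hb)
  apply mul_right_cancel₀ (mul_ne_zero h3 h4)
  rw [h2]; ring

theorem IsHecke.apply_principal {φ : K →+* ℂ} {l : ℕ}
    {Ψ : (FractionalIdeal (𝓞 K)⁰ K)ˣ →* ℂˣ} {𝔪 : Ideal (𝓞 K)} (h : IsHecke φ l Ψ 𝔪) {α : Kˣ}
    (hα : CongrOneMod 𝔪 (α : K)) : (Ψ (toPrincipalIdeal (𝓞 K) K α) : ℂ) = φ α ^ l := by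
  obtain ⟨a, b, hb0, hc, hs, he⟩ := hα
  have ha0 : a ≠ 0 := by
    rintro rfl
    rw [RingOfIntegers.coe_eq_algebraMap, RingOfIntegers.coe_eq_algebraMap, map_zero] at he
    rcases mul_eq_zero.1 he with h | h
    · exact α.ne_zero h
    · exact hb0 (by simpa using h)
  refine apply_toPrincipalIdeal ha0 hb0 he (h a b ⟨ha0, isCoprime_span_congr (a := b) ?_ hc⟩
    ⟨hb0, hc⟩ hs)
  rw [← neg_sub]; exact 𝔪.neg_mem hs

theorem IsHecke.mono {φ : K →+* ℂ} {l : ℕ} {Ψ : (FractionalIdeal (𝓞 K)⁰ K)ˣ →* ℂˣ}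
    {𝔪 𝔫 : Ideal (𝓞 K)} (h : IsHecke φ l Ψ 𝔪) (hd : 𝔪 ∣ 𝔫) : IsHecke φ l Ψ 𝔫 :=
  fun a b ha hb hab => h a b (ha.mono hd) (hb.mono hd) (Ideal.le_of_dvd hd hab)

/-- The Hecke character modulo `𝔪` obtained by restricting `Ψ`. -/
noncomputable def IsHecke.toHeckeCharacter {φ : K →+* ℂ} {l : ℕ}
    {Ψ : (FractionalIdeal (𝓞 K)⁰ K)ˣ →* ℂˣ} {𝔪 : Ideal (𝓞 K)} (h : IsHecke φ l Ψ 𝔪)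
    (hm : 𝔪 ≠ ⊥) : HeckeCharacter φ 𝔪 l where
  modulus_ne_bot := hm
  toHom := Ψ.comp (idealsPrimeTo 𝔪).subtype
  map_principal _ _ hα := h.apply_principal hα

open Classical in
/-- The extension of a Hecke character to all fractional ideals by the value `1` at the primes
dividing the modulus. -/
noncomputable def HeckeCharacter.total {φ : K →+* ℂ} {l : ℕ} {𝔪 : Ideal (𝓞 K)}
    (ψ : HeckeCharacter φ 𝔪 l) : (FractionalIdeal (𝓞 K)⁰ K)ˣ →* ℂˣ :=
  extHom fun v => if h : primeUnit v ∈ idealsPrimeTo 𝔪 then ψ.toHom ⟨primeUnit v, h⟩ else 1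

theorem HeckeCharacter.total_apply {φ : K →+* ℂ} {l : ℕ} {𝔪 : Ideal (𝓞 K)}
    (ψ : HeckeCharacter φ 𝔪 l) {I : (FractionalIdeal (𝓞 K)⁰ K)ˣ} (hI : I ∈ idealsPrimeTo 𝔪) :
    ψ.total I = ψ.toHom ⟨I, hI⟩ := by
  let S := (MonoidHom.eqLocus (ψ.total.comp (idealsPrimeTo 𝔪).subtype) ψ.toHom).map
    (idealsPrimeTo 𝔪).subtype
  have hS : idealsPrimeTo 𝔪 ≤ S := by
    refine idealsPrimeTo_le fun v hv => ?_
    have hv' := primeUnit_mem_iff.2 hv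
    refine ⟨⟨primeUnit v, hv'⟩, ?_, rfl⟩
    change ψ.total (primeUnit v) = _
    rw [HeckeCharacter.total, extHom_primeUnit, dif_pos hv']
  obtain ⟨J, hJ, hJI⟩ := hS hI
  subst hJI
  exact hJ

theorem HeckeCharacter.isHecke_total {φ : K →+* ℂ} {l : ℕ} {𝔪 : Ideal (𝓞 K)}
    (ψ : HeckeCharacter φ 𝔪 l) : IsHecke φ l ψ.total 𝔪 := by
  intro a b ha hb hab
  have hm := ψ.modulus_ne_bot
  have ha' : (a : K) ≠ 0 := by exact_mod_cast ha.1
  have hb' : (b : K) ≠ 0 := by exact_mod_cast hb.1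
  let α : Kˣ := Units.mk0 (a : K) ha' * (Units.mk0 (b : K) hb')⁻¹
  have hα : (α : K) * b = a := by simp [α, hb']
  have hu : toPrincipalIdeal (𝓞 K) K α * idealUnit (Ideal.span {b}) (span_ne_zero hb.1) =
      idealUnit (Ideal.span {a}) (span_ne_zero ha.1) := by
    rw [idealUnit_span (span_ne_zero hb.1) (Units.mk0 (b : K) hb') rfl, ← map_mul,
      idealUnit_span (span_ne_zero ha.1) (α * Units.mk0 (b : K) hb') (by simpa using hα)]
  have hmem : toPrincipalIdeal (𝓞 K) K α ∈ idealsPrimeTo 𝔪 := by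
    rw [eq_mul_inv_of_mul_eq hu]
    exact mul_mem ((idealUnit_mem_iff _ hm).2 ha.2) (inv_mem ((idealUnit_mem_iff _ hm).2 hb.2))
  have h1 := ψ.map_principal α hmem (congrOneMod_div hb hab hα)
  rw [← ψ.total_apply hmem] at h1
  have h2 := congrArg (fun x => ((ψ.total x : ℂˣ) : ℂ)) hu
  simp only [map_mul, Units.val_mul] at h2
  rw [h1, ← idealVal_of_ne, ← idealVal_of_ne] at h2
  rw [etaHom_apply, etaHom_apply, ← h2, ← hα, map_mul, mul_pow]
  exact mul_div_mul_left _ _ (pow_ne_zero _ ((map_ne_zero φ).2 α.ne_zero))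

/-- A prime `v` not dividing `𝔫` has a multiple prime to `𝔐` outside `v` which is generated by an
element congruent to `1` modulo `𝔫`. -/
theorem exists_span_eq_mul {𝔐 𝔫 : Ideal (𝓞 K)} (hM : 𝔐 ≠ 0) (hd : 𝔫 ∣ 𝔐)
    {v : HeightOneSpectrum (𝓞 K)} (hv : ¬ v.asIdeal ∣ 𝔫) : ∃ (x : 𝓞 K) (𝔠 : Ideal (𝓞 K)),
      x ≠ 0 ∧ 𝔠 ≠ 0 ∧ Ideal.span {x} = v.asIdeal * 𝔠 ∧ IsCoprime 𝔠 𝔐 ∧ x - 1 ∈ 𝔫 := by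
  have hfin : FiniteMultiplicity v.asIdeal 𝔐 :=
    FiniteMultiplicity.of_prime_left v.prime hM
  obtain ⟨𝔯, hM', hvr⟩ := hfin.exists_eq_pow_mul_and_not_dvd
  have hr0 : 𝔯 ≠ 0 := by rintro rfl; exact hvr (dvd_zero _)
  have hcop : ∀ 𝔞 : Ideal (𝓞 K), ¬ v.asIdeal ∣ 𝔞 → ∀ k, IsCoprime 𝔞 (v.asIdeal ^ k) := by
    intro 𝔞 ha k
    refine IsCoprime.pow_right ?_
    rw [isCoprime_iff_forall_prime v.ne_bot]
    intro w hw
    rwa [← v.isMaximal.eq_of_le w.isPrime.ne_top (Ideal.le_of_dvd hw)]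
  have hnr : 𝔫 ∣ 𝔯 := (hcop 𝔫 hv _).dvd_of_dvd_mul_left (hM' ▸ hd)
  obtain ⟨i, hi, j, hj, hij⟩ := Ideal.isCoprime_iff_exists.1 (hcop 𝔯 hvr 2)
  obtain ⟨π, hπ, hπ2⟩ : ∃ π ∈ v.asIdeal, π ∉ v.asIdeal ^ 2 := by
    have := Ideal.exists_mem_pow_notMem_pow_succ v.asIdeal v.ne_bot v.isPrime.ne_top 1
    simpa using this
  -- Since `i + j = 1`, the element `x` is `1` modulo the part `𝔯` of `𝔐` prime to `v`, and a
  -- uniformizer modulo `v ^ 2`. Hence `(x) = v 𝔠` with `𝔠` prime both to `v` and to `𝔯`.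
  set x := i * π + j with hx
  have hx1 : x - 1 ∈ 𝔯 := by
    have : x - 1 = i * (π - 1) := by rw [hx]; linear_combination hij
    rw [this]; exact 𝔯.mul_mem_right _ hi
  have hx2 : x - π ∈ v.asIdeal ^ 2 := by
    have : x - π = j * (1 - π) := by
      rw [hx]; linear_combination π * hij
    rw [this]; exact Ideal.mul_mem_right _ _ hj
  have hxv : x ∈ v.asIdeal := by
    have := v.asIdeal.add_mem (Ideal.pow_le_self two_ne_zero hx2) hπ
    simpa using this
  have hxv2 : x ∉ v.asIdeal ^ 2 := fun h => hπ2 (by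
    have := Ideal.sub_mem _ h hx2
    simpa using this)
  have hx0 : x ≠ 0 := by rintro h; exact hxv2 (h ▸ Ideal.zero_mem _)
  obtain ⟨𝔠, hc⟩ := Ideal.dvd_iff_le.2 ((Ideal.span_singleton_le_iff_mem _).2 hxv)
  have hc0 : 𝔠 ≠ 0 := by
    rintro rfl
    rw [mul_zero] at hc
    exact span_ne_zero hx0 hc
  have hxr : IsCoprime (Ideal.span {x}) 𝔯 := isCoprime_span_congr (a := 1)
    (by rw [← neg_sub]; exact 𝔯.neg_mem hx1)
    (by rw [Ideal.span_singleton_one]; simp [Ideal.isCoprime_iff_sup_eq])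
  have hcv : ¬ v.asIdeal ∣ 𝔠 := by
    rintro ⟨𝔡, rfl⟩
    apply hxv2
    rw [← Ideal.span_singleton_le_iff_mem, hc, ← mul_assoc, ← pow_two]
    exact Ideal.mul_le_left
  have hcM : IsCoprime 𝔠 𝔐 := by
    rw [hM']
    refine IsCoprime.mul_right (hcop _ hcv _) ?_
    rw [hc] at hxr
    exact hxr.of_mul_left_right
  exact ⟨x, 𝔠, hx0, hc0, hc, hcM, Ideal.le_of_dvd hnr hx1⟩

/-- A prime not dividing `𝔫` can be moved away from `𝔐` by an element congruent to `1`
modulo `𝔫`. -/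
theorem exists_congrOneMod_mul_primeUnit {𝔐 𝔫 : Ideal (𝓞 K)} (hM : 𝔐 ≠ 0) (hd : 𝔫 ∣ 𝔐)
    {v : HeightOneSpectrum (𝓞 K)} (hv : ¬ v.asIdeal ∣ 𝔫) : ∃ α : Kˣ, CongrOneMod 𝔫 (α : K) ∧
      toPrincipalIdeal (𝓞 K) K α * primeUnit v ∈ idealsPrimeTo 𝔐 := by
  obtain ⟨x, 𝔠, hx0, hc0, hc, hcM, hx1⟩ := exists_span_eq_mul hM hd hv
  have hx' : (x : K) ≠ 0 := by exact_mod_cast hx0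
  refine ⟨(Units.mk0 (x : K) hx')⁻¹, CongrOneMod.inv ?_, ?_⟩
  · refine congrOneMod_div (b := 1) (a := x) ⟨one_ne_zero, ?_⟩ hx1 (by simp)
    rw [Ideal.span_singleton_one]; simp [Ideal.isCoprime_iff_sup_eq]
  · have : toPrincipalIdeal (𝓞 K) K (Units.mk0 (x : K) hx')⁻¹ * primeUnit v =
        (idealUnit 𝔠 hc0)⁻¹ := by
      rw [map_inv, ← idealUnit_span (span_ne_zero hx0) (Units.mk0 (x : K) hx') rfl,
        eq_inv_iff_mul_eq_one, mul_assoc, primeUnit, ← idealUnit_mul v.ne_bot hc0,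
        inv_mul_eq_one]
      simp only [hc]
    rw [this]
    exact inv_mem ((idealUnit_mem_iff hc0 hM).2 hcM)

theorem exists_congrOneMod_mul_mem {𝔐 𝔫 : Ideal (𝓞 K)} (hM : 𝔐 ≠ 0) (hd : 𝔫 ∣ 𝔐)
    {I : (FractionalIdeal (𝓞 K)⁰ K)ˣ} (hI : I ∈ idealsPrimeTo 𝔫) :
    ∃ α : Kˣ, CongrOneMod 𝔫 (α : K) ∧ toPrincipalIdeal (𝓞 K) K α * I ∈ idealsPrimeTo 𝔐 := by
  let S : Subgroup (FractionalIdeal (𝓞 K)⁰ K)ˣ :=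
    { carrier := {I | ∃ α : Kˣ, CongrOneMod 𝔫 (α : K) ∧
        toPrincipalIdeal (𝓞 K) K α * I ∈ idealsPrimeTo 𝔐}
      one_mem' := ⟨1, by simpa using CongrOneMod.one 𝔫, by simp⟩
      mul_mem' := by
        rintro I J ⟨α, h, h'⟩ ⟨β, k, k'⟩
        refine ⟨α * β, by simpa using h.mul k, ?_⟩
        rw [map_mul, mul_mul_mul_comm]
        exact mul_mem h' k'
      inv_mem' := by
        rintro I ⟨α, h, h'⟩
        refine ⟨α⁻¹, h.inv, ?_⟩
        rw [map_inv, ← mul_inv]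
        exact inv_mem h' }
  exact idealsPrimeTo_le (S := S) (fun v hv => exists_congrOneMod_mul_primeUnit hM hd hv) hI

/-- Two fractions represent `α`: one with terms prime to `𝔐`, one with terms congruent modulo `𝔫`.
Cross-multiplying and cancelling the second denominator modulo `𝔫` makes the terms of the first
congruent modulo `𝔫`, and these are the elements to which the hypothesis on `η` applies. -/
theorem FactorsMod.apply_principal {φ : K →+* ℂ} {l : ℕ}
    {Ψ : (FractionalIdeal (𝓞 K)⁰ K)ˣ →* ℂˣ} {𝔐 𝔫 : Ideal (𝓞 K)} (hM : 𝔐 ≠ 0)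
    (h : FactorsMod φ l Ψ 𝔐 𝔫) {α : Kˣ} (hα : CongrOneMod 𝔫 (α : K))
    (hα' : toPrincipalIdeal (𝓞 K) K α ∈ idealsPrimeTo 𝔐) :
    (Ψ (toPrincipalIdeal (𝓞 K) K α) : ℂ) = φ α ^ l := by
  obtain ⟨a, b, ha, hb, he⟩ := exists_div_of_mem hM hα'
  obtain ⟨a₀, b₀, hb₀, hc₀, hs₀, he₀⟩ := hα
  refine apply_toPrincipalIdeal ha.1 hb.1 he (h a b ha hb ?_)
  obtain ⟨c, hc⟩ := isCoprime_span_iff.1 hc₀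
  have h1 : a * b₀ = a₀ * b := by
    apply RingOfIntegers.ext
    simp only [RingOfIntegers.coe_eq_algebraMap, map_mul] at he he₀ ⊢
    rw [← he, ← he₀]; ring
  have : a - b = (a₀ - b₀) * b * c - (a - b) * (b₀ * c - 1) := by
    linear_combination c * h1
  rw [this]
  exact 𝔫.sub_mem (𝔫.mul_mem_right _ (𝔫.mul_mem_right _ hs₀)) (𝔫.mul_mem_left _ hc)

/-- A character whose `η` factors modulo `𝔫` descends to a Hecke character modulo `𝔫`. -/
theorem exists_descent {φ : K →+* ℂ} {l : ℕ} {Ψ : (FractionalIdeal (𝓞 K)⁰ K)ˣ →* ℂˣ}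
    {𝔐 𝔫 : Ideal (𝓞 K)} (hM : 𝔐 ≠ 0) (hd : 𝔫 ∣ 𝔐) (h : FactorsMod φ l Ψ 𝔐 𝔫) :
    ∃ Ψ' : (FractionalIdeal (𝓞 K)⁰ K)ˣ →* ℂˣ, IsHecke φ l Ψ' 𝔫 ∧
      ∀ I ∈ idealsPrimeTo 𝔐, Ψ' I = Ψ I := by
  classical
  choose α hα1 hα2 using fun v : HeightOneSpectrum (𝓞 K) =>
    exists_congrOneMod_mul_primeUnit (v := v) hM hd
  let φu : Kˣ →* ℂˣ := Units.map (φ : K →* ℂ)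
  -- At `v ∤ 𝔫` the value is forced: for some `α ≡ 1` modulo `𝔫` the ideal `(α) v` is prime to `𝔐`,
  -- and `Ψ'(v)` has to be `Ψ((α) v) / α ^ l`. The subgroup `S` below spreads this formula from
  -- primes to all ideals prime to `𝔫`.
  let Ψ' := extHom fun v => if hv : v.asIdeal ∣ 𝔫 then 1 else
    Ψ (toPrincipalIdeal (𝓞 K) K (α v hv) * primeUnit v) * (φu (α v hv) ^ l)⁻¹
  let S : Subgroup (FractionalIdeal (𝓞 K)⁰ K)ˣ :=
    { carrier := {I | ∃ α : Kˣ, CongrOneMod 𝔫 (α : K) ∧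
        toPrincipalIdeal (𝓞 K) K α * I ∈ idealsPrimeTo 𝔐 ∧
        Ψ' I * φu α ^ l = Ψ (toPrincipalIdeal (𝓞 K) K α * I)}
      one_mem' := ⟨1, by simpa using CongrOneMod.one 𝔫, by simp, by simp⟩
      mul_mem' := by
        rintro I J ⟨α, h, h', h''⟩ ⟨β, k, k', k''⟩
        refine ⟨α * β, by simpa using h.mul k, ?_, ?_⟩
        · rw [map_mul, mul_mul_mul_comm]
          exact mul_mem h' k'
        · rw [map_mul (toPrincipalIdeal _ _), mul_mul_mul_comm, map_mul Ψ, ← h'', ← k'',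
            map_mul, map_mul, mul_pow, mul_mul_mul_comm]
      inv_mem' := by
        rintro I ⟨α, h, h', h''⟩
        refine ⟨α⁻¹, h.inv, ?_, ?_⟩
        · rw [map_inv, ← mul_inv]
          exact inv_mem h'
        · rw [map_inv (toPrincipalIdeal _ _), ← mul_inv, map_inv Ψ, ← h'', map_inv, map_inv, inv_pow,
            mul_inv] }
  have hS : idealsPrimeTo 𝔫 ≤ S := by
    refine idealsPrimeTo_le fun v hv => ⟨α v hv, hα1 v hv, hα2 v hv, ?_⟩
    rw [extHom_primeUnit, dif_neg hv, inv_mul_cancel_right]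
  refine ⟨Ψ', ?_, ?_⟩
  · intro a b ha hb hab
    have ha' : (a : K) ≠ 0 := by exact_mod_cast ha.1
    have hb' : (b : K) ≠ 0 := by exact_mod_cast hb.1
    have hn : 𝔫 ≠ 0 := by rintro rfl; exact hM (zero_dvd_iff.1 hd)
    let β : Kˣ := Units.mk0 (a : K) ha' * (Units.mk0 (b : K) hb')⁻¹
    have hβ : (β : K) * b = a := by simp [β, hb']
    have hu : toPrincipalIdeal (𝓞 K) K β * idealUnit (Ideal.span {b}) (span_ne_zero hb.1) =
        idealUnit (Ideal.span {a}) (span_ne_zero ha.1) := by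
      rw [idealUnit_span (span_ne_zero hb.1) (Units.mk0 (b : K) hb') rfl, ← map_mul,
        idealUnit_span (span_ne_zero ha.1) (β * Units.mk0 (b : K) hb') (by simpa using hβ)]
    have hmem : toPrincipalIdeal (𝓞 K) K β ∈ idealsPrimeTo 𝔫 := by
      rw [eq_mul_inv_of_mul_eq hu]
      exact mul_mem ((idealUnit_mem_iff _ hn).2 ha.2) (inv_mem ((idealUnit_mem_iff _ hn).2 hb.2))
    obtain ⟨γ, hγ1, hγ2, hγ3⟩ := hS hmem
    rw [← map_mul] at hγ2 hγ3
    have h1 := h.apply_principal hM (α := γ * β)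
      (by simpa using hγ1.mul (congrOneMod_div hb hab hβ)) hγ2
    have h2 : (Ψ' (toPrincipalIdeal (𝓞 K) K β) : ℂ) = φ β ^ l := by
      have h3 := congrArg Units.val hγ3
      rw [h1] at h3
      simp only [Units.val_mul, Units.val_pow_eq_pow_val, map_mul, mul_pow, φu, Units.coe_map,
        MonoidHom.coe_coe] at h3
      have h4 : φ γ ^ l ≠ 0 := pow_ne_zero _ ((map_ne_zero φ).2 γ.ne_zero)
      apply mul_right_cancel₀ h4
      rw [h3]; ring
    have h5 := congrArg (fun x => ((Ψ' x : ℂˣ) : ℂ)) hu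
    simp only [map_mul, Units.val_mul] at h5
    rw [h2, ← idealVal_of_ne, ← idealVal_of_ne] at h5
    rw [etaHom_apply, etaHom_apply, ← h5, ← hβ, map_mul, mul_pow]
    exact mul_div_mul_left _ _ (pow_ne_zero _ ((map_ne_zero φ).2 β.ne_zero))
  · intro I hI
    obtain ⟨γ, hγ1, hγ2, hγ3⟩ := hS (idealsPrimeTo_mono hd hI)
    have hγ : toPrincipalIdeal (𝓞 K) K γ ∈ idealsPrimeTo 𝔐 := by
      have := mul_mem hγ2 (inv_mem hI)
      simpa using this
    have h1 := h.apply_principal hM hγ1 hγ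
    have h2 : Ψ (toPrincipalIdeal (𝓞 K) K γ) = φu γ ^ l := by
      apply Units.ext
      rw [h1]; simp [φu]
    rw [map_mul, h2, mul_comm] at hγ3
    exact mul_left_cancel hγ3

end Descent

/-! ### The conductor as the smallest modulus of `η`. -/

section Conductor

variable {K : Type*} [Field K] [NumberField K] {φ : K →+* ℂ} {l : ℕ}

theorem idealVal_congr {Ψ Ψ' : (FractionalIdeal (𝓞 K)⁰ K)ˣ →* ℂˣ} {𝔐 : Ideal (𝓞 K)} (hM : 𝔐 ≠ 0)
    (h : ∀ I ∈ idealsPrimeTo 𝔐, Ψ I = Ψ' I) {𝔞 : Ideal (𝓞 K)} (ha : 𝔞 ≠ 0)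
    (hc : IsCoprime 𝔞 𝔐) : idealVal Ψ 𝔞 = idealVal Ψ' 𝔞 := by
  rw [idealVal_of_ne Ψ ha, idealVal_of_ne Ψ' ha, h _ ((idealUnit_mem_iff ha hM).2 hc)]

theorem etaHom_congr {Ψ Ψ' : (FractionalIdeal (𝓞 K)⁰ K)ˣ →* ℂˣ} {𝔐 : Ideal (𝓞 K)} (hM : 𝔐 ≠ 0)
    (h : ∀ I ∈ idealsPrimeTo 𝔐, Ψ I = Ψ' I) {a : 𝓞 K} (ha : PrimeToIdeal 𝔐 a) :
    etaHom φ l Ψ a = etaHom φ l Ψ' a := by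
  rw [etaHom_apply, etaHom_apply, idealVal_congr hM h (span_ne_zero ha.1) ha.2]

theorem FactorsMod.congr {Ψ Ψ' : (FractionalIdeal (𝓞 K)⁰ K)ˣ →* ℂˣ} {𝔐 𝔫 : Ideal (𝓞 K)}
    (hM : 𝔐 ≠ 0) (h : ∀ I ∈ idealsPrimeTo 𝔐, Ψ I = Ψ' I) (H : FactorsMod φ l Ψ 𝔐 𝔫) :
    FactorsMod φ l Ψ' 𝔐 𝔫 := by
  intro a b ha hb hab
  rw [← etaHom_congr hM h ha, ← etaHom_congr hM h hb]
  exact H a b ha hb hab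

theorem FactorsMod.mono {Ψ : (FractionalIdeal (𝓞 K)⁰ K)ˣ →* ℂˣ} {𝔐 𝔐' 𝔫 𝔫' : Ideal (𝓞 K)}
    (h : FactorsMod φ l Ψ 𝔐 𝔫) (hM : 𝔐 ∣ 𝔐') (hn : 𝔫 ∣ 𝔫') : FactorsMod φ l Ψ 𝔐' 𝔫' :=
  fun a b ha hb hab => h a b (ha.mono hM) (hb.mono hM) (Ideal.le_of_dvd hn hab)

/-- `ψ` is defined modulo `𝔫` if and only if `η` factors modulo `𝔫`. -/
theorem HeckeCharacter.isDefinedModulo_iff {𝔪 𝔐 𝔫 : Ideal (𝓞 K)} (ψ : HeckeCharacter φ 𝔪 l)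
    (hM : 𝔐 ≠ 0) (hm : 𝔪 ∣ 𝔐) (hn : 𝔫 ∣ 𝔐) :
    ψ.IsDefinedModulo 𝔫 ↔ FactorsMod φ l ψ.total 𝔐 𝔫 := by
  constructor
  · rintro ⟨ψ', h⟩
    have hag : ∀ I ∈ idealsPrimeTo 𝔐, ψ'.total I = ψ.total I := by
      intro I hI
      rw [ψ.total_apply (idealsPrimeTo_mono hm hI), ψ'.total_apply (idealsPrimeTo_mono hn hI), h]
    exact FactorsMod.congr hM hag (FactorsMod.mono ψ'.isHecke_total hn (dvd_refl 𝔫))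
  · intro h
    obtain ⟨Ψ', hΨ', hag⟩ := exists_descent hM hn h
    have hn0 : 𝔫 ≠ 0 := by rintro rfl; exact hM (zero_dvd_iff.1 hn)
    refine ⟨hΨ'.toHeckeCharacter hn0, fun I hI hI' => ?_⟩
    change ψ.toHom ⟨I, hI⟩ = Ψ' I
    rw [← ψ.total_apply hI]
    have hinf : 𝔪 ⊓ 𝔫 ∣ 𝔐 := Ideal.dvd_iff_le.2 (le_inf (Ideal.le_of_dvd hm) (Ideal.le_of_dvd hn))
    have hImn : I ∈ idealsPrimeTo (𝔪 ⊓ 𝔫) := by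
      intro v hv
      rcases (v.isPrime.inf_le).1 (Ideal.le_of_dvd hv) with h | h
      · exact hI v (Ideal.dvd_iff_le.2 h)
      · exact hI' v (Ideal.dvd_iff_le.2 h)
    -- The ideal `I` need not be prime to `𝔐`. An `α ≡ 1` modulo both `𝔪` and `𝔫` moves it there,
    -- and both characters take the value `α ^ l` at `(α)`.
    obtain ⟨α, hα, hαI⟩ := exists_congrOneMod_mul_mem hM hinf hImn
    have h1 := ψ.isHecke_total.apply_principal (hα.mono (Ideal.dvd_iff_le.2 inf_le_left))
    have h2 := hΨ'.apply_principal (hα.mono (Ideal.dvd_iff_le.2 inf_le_right))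
    have h3 := hag _ hαI
    rw [map_mul, map_mul, Units.ext (h2.trans h1.symm)] at h3
    exact (mul_left_cancel h3).symm

/-- This is surjectivity of the unit groups from level `𝔐` to level `𝔫`. It follows from moving the
ideal `(c)` away from `𝔐` by an element congruent to `1` modulo `𝔫`, and then inverting the
denominator modulo `𝔐`. -/
theorem exists_lift_primeTo {𝔐 𝔫 : Ideal (𝓞 K)} (hM : 𝔐 ≠ 0) (hd : 𝔫 ∣ 𝔐) {c : 𝓞 K}
    (hc : PrimeToIdeal 𝔫 c) : ∃ c', PrimeToIdeal 𝔐 c' ∧ c' - c ∈ 𝔫 := by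
  have hn : 𝔫 ≠ 0 := by rintro rfl; exact hM (zero_dvd_iff.1 hd)
  have hc' : (c : K) ≠ 0 := by exact_mod_cast hc.1
  obtain ⟨α, hα, hαI⟩ := exists_congrOneMod_mul_mem hM hd
    ((idealUnit_mem_iff (span_ne_zero hc.1) hn).2 hc.2)
  rw [idealUnit_span (span_ne_zero hc.1) (Units.mk0 (c : K) hc') rfl, ← map_mul] at hαI
  obtain ⟨a, b, ha, hb, he⟩ := exists_div_of_mem hM hαI
  obtain ⟨b', hb', hbb⟩ := exists_inverse_mod hM hb
  obtain ⟨a₁, b₁, -, hb₁, hs, he₁⟩ := hα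
  obtain ⟨d, hd'⟩ := isCoprime_span_iff.1 hb₁
  refine ⟨a * b', ha.mul hb', ?_⟩
  have h1 : a₁ * c * b = a * b₁ := by
    apply RingOfIntegers.ext
    simp only [RingOfIntegers.coe_eq_algebraMap, map_mul, Units.val_mul, Units.val_mk0] at he he₁ ⊢
    rw [← he, ← he₁]; ring
  have : a * b' - c = - (a * b' - c) * (b₁ * d - 1) + (a₁ - b₁) * c * b * b' * d +
      (b * b' - 1) * b₁ * c * d := by
    linear_combination (-b' * d) * h1
  rw [this]
  refine 𝔫.add_mem (𝔫.add_mem (𝔫.mul_mem_left _ hd') ?_) ?_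
  · exact 𝔫.mul_mem_right _ (𝔫.mul_mem_right _ (𝔫.mul_mem_right _ (𝔫.mul_mem_right _ hs)))
  · exact 𝔫.mul_mem_right _ (𝔫.mul_mem_right _ (𝔫.mul_mem_right _ (Ideal.le_of_dvd hd hbb)))

/-- If `a - b = x + y` with `x ∈ 𝔫₁` and `y ∈ 𝔫₂`, then `a - x = b + y` is congruent to `a` modulo
`𝔫₁` and to `b` modulo `𝔫₂`. A lift of it prime to `𝔐` has the same value of `η` as both. This is
why a smallest modulus exists. -/
theorem FactorsMod.sup {Ψ : (FractionalIdeal (𝓞 K)⁰ K)ˣ →* ℂˣ} {𝔐 𝔫₁ 𝔫₂ : Ideal (𝓞 K)}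
    (hM : 𝔐 ≠ 0) (hd₁ : 𝔫₁ ∣ 𝔐) (hd₂ : 𝔫₂ ∣ 𝔐) (h₁ : FactorsMod φ l Ψ 𝔐 𝔫₁)
    (h₂ : FactorsMod φ l Ψ 𝔐 𝔫₂) : FactorsMod φ l Ψ 𝔐 (𝔫₁ ⊔ 𝔫₂) := by
  intro a b ha hb hab
  obtain ⟨x, hx, y, hy, hxy⟩ := Submodule.mem_sup.1 hab
  have hinf : 𝔫₁ ⊓ 𝔫₂ ∣ 𝔐 :=
    Ideal.dvd_iff_le.2 (le_inf (Ideal.le_of_dvd hd₁) (Ideal.le_of_dvd hd₂))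
  have hinf0 : 𝔫₁ ⊓ 𝔫₂ ≠ 0 := by intro h; rw [h] at hinf; exact hM (zero_dvd_iff.1 hinf)
  have c1 : a - (a - x) ∈ 𝔫₁ := by simpa using hx
  have c2 : b - (a - x) ∈ 𝔫₂ := by
    have : b - (a - x) = - y := by linear_combination hxy
    rw [this]; exact 𝔫₂.neg_mem hy
  obtain ⟨c, hc, hcc⟩ : ∃ c, PrimeToIdeal 𝔐 c ∧ c - (a - x) ∈ 𝔫₁ ⊓ 𝔫₂ := by
    -- Zero is prime only to the unit ideal, so here both moduli are trivial and any element works.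
    by_cases h0 : a - x = 0
    · rw [h0] at c1 c2 ⊢
      have e1 := isCoprime_span_congr c1 (ha.2.of_isCoprime_of_dvd_right hd₁)
      have e2 := isCoprime_span_congr c2 (hb.2.of_isCoprime_of_dvd_right hd₂)
      have f : ∀ 𝔫 : Ideal (𝓞 K), IsCoprime (Ideal.span {0}) 𝔫 → 𝔫 = ⊤ := by
        intro 𝔫 h
        obtain ⟨b, hb⟩ := isCoprime_span_iff.1 h
        rw [zero_mul, zero_sub] at hb
        exact (Ideal.eq_top_iff_one _).2 (by simpa using 𝔫.neg_mem hb)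
      exact ⟨a, ha, by rw [f _ e1, f _ e2]; trivial⟩
    · refine exists_lift_primeTo hM hinf ⟨h0, ?_⟩
      rw [isCoprime_iff_forall_prime hinf0]
      intro v hv
      rcases (v.isPrime.inf_le).1 (Ideal.le_of_dvd hv) with h | h
      · have := isCoprime_span_congr c1 (ha.2.of_isCoprime_of_dvd_right hd₁)
        rw [isCoprime_iff_forall_prime (by rintro rfl; exact hM (zero_dvd_iff.1 hd₁))] at this
        exact this v (Ideal.dvd_iff_le.2 h)
      · have := isCoprime_span_congr c2 (hb.2.of_isCoprime_of_dvd_right hd₂)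
        rw [isCoprime_iff_forall_prime (by rintro rfl; exact hM (zero_dvd_iff.1 hd₂))] at this
        exact this v (Ideal.dvd_iff_le.2 h)
  rw [h₁ a c ha hc ?_, h₂ b c hb hc ?_]
  · have : b - c = (b - (a - x)) - (c - (a - x)) := by ring
    rw [this]; exact 𝔫₂.sub_mem c2 hcc.2
  · have : a - c = (a - (a - x)) - (c - (a - x)) := by ring
    rw [this]; exact 𝔫₁.sub_mem c1 hcc.1

/-- `𝔣` is the smallest modulus, among the divisors of `𝔐`, through which `η` factors. -/
def IsCond (φ : K →+* ℂ) (l : ℕ) (Ψ : (FractionalIdeal (𝓞 K)⁰ K)ˣ →* ℂˣ)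
    (𝔐 𝔣 : Ideal (𝓞 K)) : Prop :=
  𝔣 ∣ 𝔐 ∧ ∀ 𝔫, 𝔫 ∣ 𝔐 → (𝔣 ∣ 𝔫 ↔ FactorsMod φ l Ψ 𝔐 𝔫)

/-- The moduli through which `η` factors are closed under sums, so an ideal maximal among them
contains all the others. -/
theorem exists_isCond {Ψ : (FractionalIdeal (𝓞 K)⁰ K)ˣ →* ℂˣ} {𝔐 : Ideal (𝓞 K)} (hM : 𝔐 ≠ 0)
    (h : IsHecke φ l Ψ 𝔐) : ∃ 𝔣, IsCond φ l Ψ 𝔐 𝔣 := by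
  obtain ⟨𝔣, ⟨hf1, hf2⟩, hmax⟩ := set_has_maximal_iff_noetherian.2
    (inferInstance : IsNoetherian (𝓞 K) (𝓞 K))
    {𝔫 : Ideal (𝓞 K) | 𝔫 ∣ 𝔐 ∧ FactorsMod φ l Ψ 𝔐 𝔫} ⟨𝔐, dvd_refl _, h⟩
  refine ⟨𝔣, hf1, fun 𝔫 hn => ⟨fun hd => hf2.mono (dvd_refl _) hd, fun H => ?_⟩⟩
  have hs : 𝔣 ⊔ 𝔫 ∣ 𝔐 := Dvd.dvd.trans (Ideal.dvd_iff_le.2 le_sup_left) hf1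
  have := hmax (𝔣 ⊔ 𝔫) ⟨hs, hf2.sup hM hf1 hn H⟩
  have hle : 𝔣 ≤ 𝔣 ⊔ 𝔫 := le_sup_left
  have heq : 𝔣 = 𝔣 ⊔ 𝔫 := by
    by_contra hne
    exact this (lt_of_le_of_ne hle hne)
  rw [Ideal.dvd_iff_le, heq]
  exact le_sup_right

theorem HeckeCharacter.IsConductor.isCond {𝔪 𝔐 𝔣 : Ideal (𝓞 K)} {ψ : HeckeCharacter φ 𝔪 l}
    (h : ψ.IsConductor 𝔣) (hM : 𝔐 ≠ 0) (hm : 𝔪 ∣ 𝔐) : IsCond φ l ψ.total 𝔐 𝔣 := by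
  have hfm : 𝔣 ∣ 𝔪 := h.2 𝔪 ⟨ψ, fun _ _ _ => rfl⟩
  have hfM := hfm.trans hm
  refine ⟨hfM, fun 𝔫 hn => ⟨fun hd => ?_, fun H => ?_⟩⟩
  · exact ((ψ.isDefinedModulo_iff hM hm hfM).1 h.1).mono (dvd_refl _) hd
  · exact h.2 𝔫 ((ψ.isDefinedModulo_iff hM hm hn).2 H)

/-- `IsCond` compares only divisors of `𝔐`, whereas a conductor must divide every modulus `𝔫`.
Working modulo `𝔐 𝔫`, the character is also defined modulo `𝔣 ⊔ 𝔫`, which divides `𝔐`; minimality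
then gives `𝔣 ∣ 𝔣 ⊔ 𝔫`, which divides `𝔫`. -/
theorem IsCond.isConductor {Ψ Ψ' : (FractionalIdeal (𝓞 K)⁰ K)ˣ →* ℂˣ} {𝔐 𝔣 : Ideal (𝓞 K)}
    (hM : 𝔐 ≠ 0) (h : IsCond φ l Ψ 𝔐 𝔣) (hΨ' : IsHecke φ l Ψ' 𝔣) (hf0 : 𝔣 ≠ ⊥)
    (hag : ∀ I ∈ idealsPrimeTo 𝔐, Ψ' I = Ψ I) : (hΨ'.toHeckeCharacter hf0).IsConductor 𝔣 := by
  set ψ := hΨ'.toHeckeCharacter hf0 with hψ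
  refine ⟨⟨ψ, fun _ _ _ => rfl⟩, fun 𝔫 hn => ?_⟩
  have hn0 : 𝔫 ≠ 0 := hn.choose.modulus_ne_bot
  have hMn : 𝔐 * 𝔫 ≠ 0 := mul_ne_zero hM hn0
  have hfMn : 𝔣 ∣ 𝔐 * 𝔫 := h.1.trans (dvd_mul_right _ _)
  have hnMn : 𝔫 ∣ 𝔐 * 𝔫 := dvd_mul_left _ _
  have h1 := (ψ.isDefinedModulo_iff hMn hfMn hnMn).1 hn
  have h2 := (ψ.isDefinedModulo_iff hMn hfMn hfMn).1 ⟨ψ, fun _ _ _ => rfl⟩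
  have hsf : 𝔣 ⊔ 𝔫 ∣ 𝔣 := Ideal.dvd_iff_le.2 le_sup_left
  have h3 := (ψ.isDefinedModulo_iff hMn hfMn (hsf.trans hfMn)).2 (h2.sup hMn hfMn hnMn h1)
  have h4 := (ψ.isDefinedModulo_iff hM h.1 (hsf.trans h.1)).1 h3
  have hag' : ∀ I ∈ idealsPrimeTo 𝔐, ψ.total I = Ψ I := by
    intro I hI
    rw [ψ.total_apply (idealsPrimeTo_mono h.1 hI), ← hag I hI]
    rfl
  have h5 := (h.2 _ (hsf.trans h.1)).2 (h4.congr hM hag')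
  exact h5.trans (Ideal.dvd_iff_le.2 le_sup_right)

end Conductor

/-! ### Characters with values in `K` compatible with conjugation have rational coefficients. -/

section Rationality

variable {K : Type*} [Field K] [NumberField K] [Algebra.IsQuadraticExtension ℚ K]
    [IsTotallyComplex K]

/-- The complex conjugate of an ideal. -/
noncomputable def conjIdeal (𝔞 : Ideal (𝓞 K)) : Ideal (𝓞 K) := 𝔞.map (conjInt K)

theorem mem_conjIdeal {𝔞 : Ideal (𝓞 K)} {x : 𝓞 K} : x ∈ conjIdeal 𝔞 ↔ conjInt K x ∈ 𝔞 := by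
  rw [conjIdeal, Ideal.mem_map_of_equiv]
  constructor
  · rintro ⟨y, hy, rfl⟩
    rwa [conjInt_conjInt]
  · intro h
    exact ⟨_, h, conjInt_conjInt x⟩

theorem conjIdeal_conjIdeal (𝔞 : Ideal (𝓞 K)) : conjIdeal (conjIdeal 𝔞) = 𝔞 := by
  ext x; rw [mem_conjIdeal, mem_conjIdeal, conjInt_conjInt]

theorem conjIdeal_mul (𝔞 𝔟 : Ideal (𝓞 K)) : conjIdeal (𝔞 * 𝔟) = conjIdeal 𝔞 * conjIdeal 𝔟 :=
  Ideal.map_mul _ _ _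

theorem conjIdeal_pow (𝔞 : Ideal (𝓞 K)) (n : ℕ) : conjIdeal (𝔞 ^ n) = conjIdeal 𝔞 ^ n :=
  Ideal.map_pow _ _ _

theorem conjIdeal_span (a : 𝓞 K) : conjIdeal (Ideal.span {a}) = Ideal.span {conjInt K a} := by
  rw [conjIdeal, Ideal.map_span, Set.image_singleton]

theorem conjIdeal_top : conjIdeal (⊤ : Ideal (𝓞 K)) = ⊤ := by
  ext x; rw [mem_conjIdeal]; simp

theorem conjIdeal_ne_zero {𝔞 : Ideal (𝓞 K)} (h : 𝔞 ≠ 0) : conjIdeal 𝔞 ≠ 0 := by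
  intro h0
  apply h
  rw [← conjIdeal_conjIdeal 𝔞, h0]
  ext x; rw [mem_conjIdeal]; simp

theorem conjIdeal_dvd {𝔞 𝔟 : Ideal (𝓞 K)} (h : 𝔞 ∣ 𝔟) : conjIdeal 𝔞 ∣ conjIdeal 𝔟 := by
  obtain ⟨𝔠, rfl⟩ := h
  rw [conjIdeal_mul]; exact dvd_mul_right _ _

theorem absNorm_conjIdeal (𝔞 : Ideal (𝓞 K)) : Ideal.absNorm (conjIdeal 𝔞) = Ideal.absNorm 𝔞 := by
  rw [Ideal.absNorm_apply, Ideal.absNorm_apply]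
  exact (Nat.card_congr (Ideal.quotientEquiv 𝔞 (conjIdeal 𝔞) (conjInt K) rfl).toEquiv).symm

theorem asIdeal_conjPrime (v : HeightOneSpectrum (𝓞 K)) :
    (conjPrime v).asIdeal = conjIdeal v.asIdeal := conjPrime_asIdeal v

/-- `Ψ` is a Hecke character modulo `𝔐` of `∞`-type `l` with values in `K` at the ideals prime
to `𝔐`, compatible with complex conjugation. -/
structure IsGood (φ : K →+* ℂ) (l : ℕ) (Ψ : (FractionalIdeal (𝓞 K)⁰ K)ˣ →* ℂˣ)
    (𝔐 : Ideal (𝓞 K)) : Prop where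
  ne_zero : 𝔐 ≠ 0
  isHecke : IsHecke φ l Ψ 𝔐
  mem_range : ∀ v : HeightOneSpectrum (𝓞 K), ¬ v.asIdeal ∣ 𝔐 →
    ∃ x : K, (Ψ (primeUnit v) : ℂ) = φ x
  conj_not_dvd : ∀ v : HeightOneSpectrum (𝓞 K), ¬ v.asIdeal ∣ 𝔐 → ¬ (conjPrime v).asIdeal ∣ 𝔐
  map_conj : ∀ v : HeightOneSpectrum (𝓞 K), ¬ v.asIdeal ∣ 𝔐 →
    (Ψ (primeUnit (conjPrime v)) : ℂ) = conj (Ψ (primeUnit v) : ℂ)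

/-- Induction on the integral ideals prime to `𝔐`. -/
theorem ideal_induction_primeTo {𝔐 : Ideal (𝓞 K)} (hM : 𝔐 ≠ 0) {P : Ideal (𝓞 K) → Prop}
    (h1 : P ⊤) (hmul : ∀ (v : HeightOneSpectrum (𝓞 K)) (𝔞 : Ideal (𝓞 K)), ¬ v.asIdeal ∣ 𝔐 →
      𝔞 ≠ 0 → IsCoprime 𝔞 𝔐 → P 𝔞 → P (v.asIdeal * 𝔞)) {𝔞 : Ideal (𝓞 K)} (ha : 𝔞 ≠ 0)
    (hc : IsCoprime 𝔞 𝔐) : P 𝔞 := by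
  revert ha hc
  refine UniqueFactorizationMonoid.induction_on_prime 𝔞 (fun h => absurd rfl h) ?_ ?_
  · intro x hx _ _
    rw [Ideal.isUnit_iff.1 hx]; exact h1
  · intro a p ha hp ih _ hc
    have hv := hc.of_mul_left_left
    let v : HeightOneSpectrum (𝓞 K) := ⟨p, Ideal.isPrime_of_prime hp, hp.ne_zero⟩
    refine hmul v a ?_ ha hc.of_mul_left_right (ih ha hc.of_mul_left_right)
    intro hd
    exact (isCoprime_iff_forall_prime hM).1 hv v hd (dvd_refl p)

theorem idealVal_top (Ψ : (FractionalIdeal (𝓞 K)⁰ K)ˣ →* ℂˣ) : idealVal Ψ ⊤ = 1 := by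
  rw [← Ideal.one_eq_top, map_one]

theorem idealVal_prime (Ψ : (FractionalIdeal (𝓞 K)⁰ K)ˣ →* ℂˣ) (v : HeightOneSpectrum (𝓞 K)) :
    idealVal Ψ v.asIdeal = Ψ (primeUnit v) := idealVal_of_ne Ψ v.ne_bot

variable {φ : K →+* ℂ} {l : ℕ} {Ψ : (FractionalIdeal (𝓞 K)⁰ K)ˣ →* ℂˣ} {𝔐 : Ideal (𝓞 K)}

namespace IsGood

theorem idealVal_mem_range (h : IsGood φ l Ψ 𝔐) {𝔞 : Ideal (𝓞 K)} (ha : 𝔞 ≠ 0)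
    (hc : IsCoprime 𝔞 𝔐) : ∃ x : K, idealVal Ψ 𝔞 = φ x := by
  refine ideal_induction_primeTo h.ne_zero (P := fun 𝔞 => ∃ x : K, idealVal Ψ 𝔞 = φ x)
    ⟨1, by rw [idealVal_top, map_one]⟩ ?_ ha hc
  rintro v 𝔟 hv - - ⟨x, hx⟩
  obtain ⟨y, hy⟩ := h.mem_range v hv
  exact ⟨y * x, by rw [map_mul, idealVal_prime, hy, hx, map_mul]⟩

theorem isCoprime_conjIdeal (h : IsGood φ l Ψ 𝔐) {𝔞 : Ideal (𝓞 K)}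
    (hc : IsCoprime 𝔞 𝔐) : IsCoprime (conjIdeal 𝔞) 𝔐 := by
  rw [isCoprime_iff_forall_prime h.ne_zero] at hc ⊢
  intro v hv hva
  have h1 : (conjPrime v).asIdeal ∣ 𝔞 := by
    rw [asIdeal_conjPrime, ← conjIdeal_conjIdeal 𝔞]
    exact conjIdeal_dvd hva
  have h2 : ¬ (conjPrime v).asIdeal ∣ 𝔐 := fun h3 => hc _ h3 h1
  have := h.conj_not_dvd _ h2
  rw [conjPrime_conjPrime] at this
  exact this hv

theorem idealVal_conjIdeal (h : IsGood φ l Ψ 𝔐) {𝔞 : Ideal (𝓞 K)} (ha : 𝔞 ≠ 0)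
    (hc : IsCoprime 𝔞 𝔐) : idealVal Ψ (conjIdeal 𝔞) = conj (idealVal Ψ 𝔞) := by
  refine ideal_induction_primeTo h.ne_zero
    (P := fun 𝔞 => idealVal Ψ (conjIdeal 𝔞) = conj (idealVal Ψ 𝔞))
    (by rw [conjIdeal_top, idealVal_top, map_one]) ?_ ha hc
  intro v 𝔟 hv _ _ hx
  rw [conjIdeal_mul, map_mul, map_mul, hx, map_mul, ← asIdeal_conjPrime, idealVal_prime,
    idealVal_prime, h.map_conj v hv]

theorem primeTo_conj (h : IsGood φ l Ψ 𝔐) {a : 𝓞 K} (ha : PrimeToIdeal 𝔐 a) :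
    PrimeToIdeal 𝔐 (conjInt K a) :=
  ⟨(map_ne_zero_iff _ (conjInt K).injective).2 ha.1, by
    rw [← conjIdeal_span]; exact h.isCoprime_conjIdeal ha.2⟩

theorem etaHom_conj (h : IsGood φ l Ψ 𝔐) {a : 𝓞 K} (ha : PrimeToIdeal 𝔐 a) :
    etaHom φ l Ψ (conjInt K a) = conj (etaHom φ l Ψ a) := by
  rw [etaHom_apply, etaHom_apply, ← conjIdeal_span,
    h.idealVal_conjIdeal (span_ne_zero ha.1) ha.2, embedding_conjInt, map_div₀, map_pow]

end IsGood

theorem exists_pow_sub_one_mem {𝔐 : Ideal (𝓞 K)} (hM : 𝔐 ≠ 0) {a : 𝓞 K}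
    (ha : PrimeToIdeal 𝔐 a) : ∃ k, 0 < k ∧ a ^ k - 1 ∈ 𝔐 := by
  have hfin : Finite (𝓞 K ⧸ 𝔐) := Ring.HasFiniteQuotients.finiteQuotient hM
  obtain ⟨b, -, hb⟩ := exists_inverse_mod hM ha
  have hu : Ideal.Quotient.mk 𝔐 a * Ideal.Quotient.mk 𝔐 b = 1 := by
    rw [← map_mul, ← map_one (Ideal.Quotient.mk 𝔐), Ideal.Quotient.eq]; exact hb
  let u : (𝓞 K ⧸ 𝔐)ˣ := Units.mkOfMulEqOne _ _ hu
  refine ⟨orderOf u, orderOf_pos u, ?_⟩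
  rw [← Ideal.Quotient.eq, map_pow, map_one]
  have := congrArg Units.val (pow_orderOf_eq_one u)
  rwa [Units.val_pow_eq_pow_val, Units.val_one] at this

theorem PrimeToIdeal.pow {a : 𝓞 K} (ha : PrimeToIdeal 𝔐 a) (k : ℕ) :
    PrimeToIdeal 𝔐 (a ^ k) := by
  refine ⟨pow_ne_zero _ ha.1, ?_⟩
  rw [← Ideal.span_singleton_pow]
  exact ha.2.pow_left

theorem primeToIdeal_one : PrimeToIdeal 𝔐 (1 : 𝓞 K) := by
  refine ⟨one_ne_zero, ?_⟩
  rw [Ideal.span_singleton_one]; simp [Ideal.isCoprime_iff_sup_eq]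

theorem IsHecke.etaHom_pow_eq_one (hM : 𝔐 ≠ 0) (h : IsHecke φ l Ψ 𝔐) {a : 𝓞 K}
    (ha : PrimeToIdeal 𝔐 a) : ∃ k, 0 < k ∧ etaHom φ l Ψ a ^ k = 1 := by
  obtain ⟨k, hk, hk'⟩ := exists_pow_sub_one_mem hM ha
  refine ⟨k, hk, ?_⟩
  rw [← map_pow, h (a ^ k) 1 (ha.pow k) primeToIdeal_one hk', map_one]

/-- An element of `K` fixed by complex conjugation in `ℂ` is rational. -/
theorem exists_rat_of_conj_eq (φ : K →+* ℂ) {x : K} (hx : conj (φ x) = φ x) :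
    ∃ q : ℚ, φ x = q := by
  obtain ⟨a, b, hb, rfl⟩ := IsFractionRing.div_surjective (A := 𝓞 K) x
  have hb0 : b ≠ 0 := nonZeroDivisors.ne_zero hb
  obtain ⟨θ, t, n, hθ, -⟩ := exists_isQuadGen (K := K)
  -- Write the element as `a b̄ / N(b)`: the numerator is an integer of `K` fixed by conjugation, so
  -- its coordinate along `θ` vanishes.
  have key : ∃ m : ℤ, a * conjInt K b = m := by
    obtain ⟨p, q, hpq⟩ := hθ.exists_eq (a * conjInt K b)
    have hc : conjInt K (a * conjInt K b) = a * conjInt K b := by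
      have hinj : Function.Injective (fun y : 𝓞 K => φ y) := fun y z hyz =>
        RingOfIntegers.ext (φ.injective hyz)
      apply hinj
      simp only [map_mul, embedding_conjInt, conjInt_conjInt]
      have e1 : φ (algebraMap (𝓞 K) K b) ≠ 0 := embedding_ne_zero φ hb0
      have e2 : conj (φ (algebraMap (𝓞 K) K b)) ≠ 0 := by simpa using e1
      rw [map_div₀, map_div₀, div_eq_div_iff e2 e1] at hx
      rw [hx]
    rw [hpq, hθ.conj_apply] at hc
    have h2 : ((q * t : ℤ) : 𝓞 K) + ((- 2 * q : ℤ) : 𝓞 K) * θ = 0 := by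
      push_cast; linear_combination hc
    have h3 : q = 0 := by have := (hθ.eq_zero _ _ h2).2; omega
    exact ⟨p, by rw [hpq, h3]; simp⟩
  obtain ⟨m, hm⟩ := key
  refine ⟨m / Algebra.norm ℤ b, ?_⟩
  have h1 := mul_conjInt_eq_norm b
  have hbK : (algebraMap (𝓞 K) K b) ≠ 0 := by
    rw [map_ne_zero_iff _ (RingOfIntegers.coe_injective)]; exact hb0
  have hcb : (algebraMap (𝓞 K) K (conjInt K b)) ≠ 0 := by
    rw [map_ne_zero_iff _ (RingOfIntegers.coe_injective),
      map_ne_zero_iff _ (conjInt K).injective]; exact hb0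
  have h2 : algebraMap (𝓞 K) K a / algebraMap (𝓞 K) K b = (m : K) / (Algebra.norm ℤ b : ℤ) := by
    have e1 := congrArg (algebraMap (𝓞 K) K) hm
    have e2 := congrArg (algebraMap (𝓞 K) K) h1
    rw [map_mul, map_intCast] at e1 e2
    rw [← e1, ← e2, mul_div_mul_right _ _ hcb]
  rw [h2, map_div₀, map_intCast, map_intCast]
  push_cast
  rfl

theorem IsHecke.eval_eq (h : IsHecke φ l Ψ 𝔐) (hM : 𝔐 ≠ 0) (𝔞 : Ideal (𝓞 K))
    [Decidable (𝔞 ≠ 0 ∧ IsCoprime 𝔞 𝔐)] :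
    (h.toHeckeCharacter hM).eval 𝔞 = if 𝔞 ≠ 0 ∧ IsCoprime 𝔞 𝔐 then idealVal Ψ 𝔞 else 0 := by
  by_cases h' : 𝔞 ≠ 0 ∧ IsCoprime 𝔞 𝔐
  · rw [if_pos h', HeckeCharacter.eval, dif_pos
      ⟨mem_nonZeroDivisors_of_ne_zero h'.1, (idealUnit_mem_iff h'.1 hM).2 h'.2⟩,
      idealVal_of_ne Ψ h'.1]
    rfl
  · rw [if_neg h', HeckeCharacter.eval, dif_neg]
    rintro ⟨h0, h1⟩
    have h0' := nonZeroDivisors.ne_zero h0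
    exact h' ⟨h0', (idealUnit_mem_iff h0' hM).1 h1⟩

/-- Conjugation permutes the ideals of norm `n`, so the coefficient is a real element of `K`, hence
rational. -/
theorem IsGood.hasRationalCoefficients (h : IsGood φ l Ψ 𝔐) :
    (h.isHecke.toHeckeCharacter h.ne_zero).HasRationalCoefficients := by
  classical
  intro n hn
  set ψ := h.isHecke.toHeckeCharacter h.ne_zero with hψ
  have hr : ∀ 𝔞, ∃ x : K, ψ.eval 𝔞 = φ x := by
    intro 𝔞
    rw [h.isHecke.eval_eq h.ne_zero]
    split_ifs with h'
    · exact h.idealVal_mem_range h'.1 h'.2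
    · exact ⟨0, (map_zero φ).symm⟩
  have hcj : ∀ 𝔞, ψ.eval (conjIdeal 𝔞) = conj (ψ.eval 𝔞) := by
    intro 𝔞
    rw [h.isHecke.eval_eq h.ne_zero, h.isHecke.eval_eq h.ne_zero]
    by_cases h' : 𝔞 ≠ 0 ∧ IsCoprime 𝔞 𝔐
    · rw [if_pos h', if_pos ⟨conjIdeal_ne_zero h'.1, h.isCoprime_conjIdeal h'.2⟩,
        h.idealVal_conjIdeal h'.1 h'.2]
    · rw [if_neg h', if_neg, map_zero]
      rintro ⟨h0, h1⟩
      apply h'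
      rw [← conjIdeal_conjIdeal 𝔞]
      exact ⟨conjIdeal_ne_zero h0, h.isCoprime_conjIdeal h1⟩
  choose x hx using hr
  set s := (Ideal.finite_setOfPred_absNorm_eq (S := 𝓞 K) n).toFinset with hs
  have hsum : ψ.coeff n = φ (∑ 𝔞 ∈ s, x 𝔞) := by
    rw [map_sum]
    exact Finset.sum_congr rfl fun 𝔞 _ => hx 𝔞
  rw [hsum]
  apply exists_rat_of_conj_eq φ
  rw [← hsum]
  change conj (∑ 𝔞 ∈ s, ψ.eval 𝔞) = ∑ 𝔞 ∈ s, ψ.eval 𝔞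
  rw [map_sum]
  refine Finset.sum_bij' (fun 𝔞 _ => conjIdeal 𝔞) (fun 𝔞 _ => conjIdeal 𝔞) ?_ ?_ ?_ ?_ ?_
  · intro 𝔞 ha
    simpa [hs, absNorm_conjIdeal] using ha
  · intro 𝔞 ha
    simpa [hs, absNorm_conjIdeal] using ha
  · intro 𝔞 _; exact conjIdeal_conjIdeal 𝔞
  · intro 𝔞 _; exact conjIdeal_conjIdeal 𝔞
  · intro 𝔞 _; exact (hcj 𝔞).symm

theorem IsGood.mono {𝔐' : Ideal (𝓞 K)} (h : IsGood φ l Ψ 𝔐) (hd : 𝔐 ∣ 𝔐') (h0 : 𝔐' ≠ 0)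
    (hc : conjIdeal 𝔐' = 𝔐') : IsGood φ l Ψ 𝔐' where
  ne_zero := h0
  isHecke := h.isHecke.mono hd
  mem_range v hv := h.mem_range v fun h' => hv (h'.trans hd)
  conj_not_dvd v hv h' := hv (by
    have := conjIdeal_dvd h'
    rwa [asIdeal_conjPrime, conjIdeal_conjIdeal, hc] at this)
  map_conj v hv := h.map_conj v fun h' => hv (h'.trans hd)

/-- The new values are at primes `v` dividing `𝔐` but not `𝔫`. Writing `(x) = v 𝔠` with `x ≡ 1`
modulo `𝔫` and `𝔠` prime to `𝔐`, the value is `x ^ l / Ψ(𝔠)`. It lies in `K`, and conjugating `x`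
and `𝔠` gives the value at the conjugate prime. -/
theorem IsGood.descent {Ψ' : (FractionalIdeal (𝓞 K)⁰ K)ˣ →* ℂˣ} {𝔫 : Ideal (𝓞 K)}
    (h : IsGood φ l Ψ 𝔐) (hd : 𝔫 ∣ 𝔐) (hc : conjIdeal 𝔫 = 𝔫) (hΨ' : IsHecke φ l Ψ' 𝔫)
    (hag : ∀ I ∈ idealsPrimeTo 𝔐, Ψ' I = Ψ I) : IsGood φ l Ψ' 𝔫 := by
  have hn0 : 𝔫 ≠ 0 := by rintro rfl; exact h.ne_zero (zero_dvd_iff.1 hd)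
  have hstab : ∀ v : HeightOneSpectrum (𝓞 K), ¬ v.asIdeal ∣ 𝔫 → ¬ (conjPrime v).asIdeal ∣ 𝔫 := by
    intro v hv h'
    apply hv
    have := conjIdeal_dvd h'
    rwa [asIdeal_conjPrime, conjIdeal_conjIdeal, hc] at this
  have key : ∀ v : HeightOneSpectrum (𝓞 K), ¬ v.asIdeal ∣ 𝔫 → ∃ (x : 𝓞 K) (𝔠 : Ideal (𝓞 K)),
      x ≠ 0 ∧ 𝔠 ≠ 0 ∧ IsCoprime 𝔠 𝔐 ∧
      (Ψ' (primeUnit v) : ℂ) = φ x ^ l / idealVal Ψ 𝔠 ∧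
      (Ψ' (primeUnit (conjPrime v)) : ℂ) = φ (conjInt K x) ^ l / idealVal Ψ (conjIdeal 𝔠) := by
    intro v hv
    obtain ⟨x, 𝔠, hx0, hc0, hxc, hcM, hx1⟩ := exists_span_eq_mul h.ne_zero hd hv
    have p1 : ∀ y : 𝓞 K, y ≠ 0 → y - 1 ∈ 𝔫 → idealVal Ψ' (Ideal.span {y}) = φ y ^ l := by
      intro y hy hy1
      rw [idealVal_span φ l Ψ' hy, hΨ' y 1 ⟨hy, isCoprime_span_congr (a := 1)
        (by rw [← neg_sub]; exact 𝔫.neg_mem hy1) primeToIdeal_one.2⟩ primeToIdeal_one hy1, map_one, one_mul]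
    refine ⟨x, 𝔠, hx0, hc0, hcM, ?_, ?_⟩
    · rw [eq_div_iff (idealVal_ne_zero Ψ hc0), ← p1 x hx0 hx1, hxc, map_mul, idealVal_prime,
        idealVal_congr h.ne_zero hag hc0 hcM]
    · rw [eq_div_iff (idealVal_ne_zero Ψ (conjIdeal_ne_zero hc0)), ← p1 (conjInt K x), ← conjIdeal_span, hxc,
        conjIdeal_mul, map_mul, ← asIdeal_conjPrime, idealVal_prime,
        idealVal_congr h.ne_zero hag (conjIdeal_ne_zero hc0) (h.isCoprime_conjIdeal hcM)]
      · rwa [map_ne_zero_iff _ (conjInt K).injective]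
      · rw [← hc, mem_conjIdeal, map_sub, conjInt_conjInt, map_one]; exact hx1
  refine ⟨hn0, hΨ', fun v hv => ?_, hstab, fun v hv => ?_⟩
  · obtain ⟨x, 𝔠, hx0, hc0, hcM, h1, -⟩ := key v hv
    obtain ⟨y, hy⟩ := h.idealVal_mem_range hc0 hcM
    exact ⟨x ^ l / y, by rw [h1, hy, map_div₀, map_pow]⟩
  · obtain ⟨x, 𝔠, hx0, hc0, hcM, h1, h2⟩ := key v hv
    rw [h1, h2, h.idealVal_conjIdeal hc0 hcM, embedding_conjInt, map_div₀, map_pow]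

/-- The conductor of a good character is stable under complex conjugation. -/
theorem IsGood.conjIdeal_cond {𝔣 : Ideal (𝓞 K)} (h : IsGood φ l Ψ 𝔐) (hMc : conjIdeal 𝔐 = 𝔐)
    (hf : IsCond φ l Ψ 𝔐 𝔣) : conjIdeal 𝔣 = 𝔣 := by
  have hd : conjIdeal 𝔣 ∣ 𝔐 := by rw [← hMc]; exact conjIdeal_dvd hf.1
  have h1 : FactorsMod φ l Ψ 𝔐 (conjIdeal 𝔣) := by
    intro a b ha hb hab
    have := (hf.2 𝔣 hf.1).1 (dvd_refl _) _ _ (h.primeTo_conj ha) (h.primeTo_conj hb)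
      (by rw [← map_sub]; exact mem_conjIdeal.1 hab)
    rw [h.etaHom_conj ha, h.etaHom_conj hb] at this
    exact (starRingEnd ℂ).injective this
  have h2 := (hf.2 _ hd).2 h1
  have h3 := conjIdeal_dvd h2
  rw [conjIdeal_conjIdeal] at h3
  exact dvd_antisymm h3 h2

end Rationality

/-! ### Rational coefficients force values in `K` compatible with conjugation. -/

section RationalToGood

variable {K : Type*} [Field K] [NumberField K] [Algebra.IsQuadraticExtension ℚ K]
    [IsTotallyComplex K]

theorem exists_prime_mem (v : HeightOneSpectrum (𝓞 K)) :
    ∃ p : ℕ, p.Prime ∧ (p : 𝓞 K) ∈ v.asIdeal := by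
  have key : ∀ n : ℕ, n ≠ 0 → (n : 𝓞 K) ∈ v.asIdeal → ∃ p : ℕ, p.Prime ∧ (p : 𝓞 K) ∈ v.asIdeal := by
    intro n
    refine induction_on_primes (motive := fun n => n ≠ 0 → (n : 𝓞 K) ∈ v.asIdeal →
      ∃ p : ℕ, p.Prime ∧ (p : 𝓞 K) ∈ v.asIdeal) (fun h => absurd rfl h) ?_ ?_ n
    · intro _ h
      rw [Nat.cast_one] at h
      exact absurd ((Ideal.eq_top_iff_one _).2 h) v.isPrime.ne_top
    · intro p a hp ih h0 h
      rw [Nat.cast_mul] at h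
      rcases v.isPrime.mem_or_mem h with h | h
      · exact ⟨p, hp, h⟩
      · exact ih (by rintro rfl; simp at h0) h
  refine key _ ?_ (Ideal.absNorm_mem v.asIdeal)
  rw [Ne, Ideal.absNorm_eq_zero_iff]
  exact v.ne_bot

theorem int_dvd_of_mem {v : HeightOneSpectrum (𝓞 K)} {p : ℕ} (hp : p.Prime)
    (hv : (p : 𝓞 K) ∈ v.asIdeal) {m : ℤ} (hm : (m : 𝓞 K) ∈ v.asIdeal) : (p : ℤ) ∣ m := by
  by_contra h
  have hc : IsCoprime (p : ℤ) m := (Nat.prime_iff_prime_int.1 hp).coprime_iff_not_dvd.2 h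
  obtain ⟨a, b, hab⟩ := hc
  apply v.isPrime.ne_top
  rw [Ideal.eq_top_iff_one]
  have : (1 : 𝓞 K) = a * p + b * m := by exact_mod_cast (congrArg (Int.cast (R := 𝓞 K)) hab).symm
  rw [this]
  exact Ideal.add_mem _ (Ideal.mul_mem_left _ _ hv) (Ideal.mul_mem_left _ _ hm)

theorem mem_iff_dvd {v : HeightOneSpectrum (𝓞 K)} {p : ℕ} (hp : p.Prime)
    (hv : (p : 𝓞 K) ∈ v.asIdeal) {m : ℤ} : (m : 𝓞 K) ∈ v.asIdeal ↔ (p : ℤ) ∣ m := by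
  refine ⟨int_dvd_of_mem hp hv, ?_⟩
  rintro ⟨k, rfl⟩
  push_cast
  exact Ideal.mul_mem_right _ _ hv

/-- The primes above a rational prime form one orbit under complex conjugation. -/
theorem eq_or_eq_conjPrime {v w : HeightOneSpectrum (𝓞 K)} {p : ℕ} (hp : p.Prime)
    (hv : (p : 𝓞 K) ∈ v.asIdeal) (hw : (p : 𝓞 K) ∈ w.asIdeal) : w = v ∨ w = conjPrime v := by
  -- The norm `x x̄` is a rational integer in `v`, so `p` divides it and it lies in `w`.
  have key : ∀ x ∈ v.asIdeal, x ∈ w.asIdeal ∨ conjInt K x ∈ w.asIdeal := by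
    intro x hx
    apply w.isPrime.mem_or_mem
    rw [mul_conjInt_eq_norm, mem_iff_dvd hp hw]
    apply int_dvd_of_mem hp hv
    rw [← mul_conjInt_eq_norm]
    exact Ideal.mul_mem_right _ _ hx
  have hle : v.asIdeal ≤ w.asIdeal ∨ v.asIdeal ≤ (conjPrime w).asIdeal := by
    by_contra! h
    obtain ⟨x, hx, hxw⟩ := Set.not_subset.1 h.1
    obtain ⟨y, hy, hyw⟩ := Set.not_subset.1 h.2
    have h1 : x ∈ (conjPrime w).asIdeal :=
      (mem_conjPrime w x).2 ((key x hx).resolve_left hxw)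
    have h2 : y ∈ w.asIdeal := (key y hy).resolve_right fun h => hyw ((mem_conjPrime w y).2 h)
    rcases key (x + y) (Ideal.add_mem _ hx hy) with h3 | h3
    · exact hxw (by simpa using Ideal.sub_mem _ h3 h2)
    · exact hyw (by
        have := Ideal.sub_mem _ ((mem_conjPrime w (x + y)).2 h3) h1
        simpa using this)
  rcases hle with h | h
  · left
    exact HeightOneSpectrum.ext (v.isMaximal.eq_of_le w.isPrime.ne_top h).symm
  · right
    rw [HeightOneSpectrum.ext (v.isMaximal.eq_of_le (conjPrime w).isPrime.ne_top h),
      conjPrime_conjPrime]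

theorem absNorm_prime_eq {v : HeightOneSpectrum (𝓞 K)} {p : ℕ} (hp : p.Prime)
    (hv : (p : 𝓞 K) ∈ v.asIdeal) :
    Ideal.absNorm v.asIdeal = p ∨ Ideal.absNorm v.asIdeal = p ^ 2 := by
  have h1 : Ideal.absNorm v.asIdeal ∣ p ^ 2 := by
    have h := Ideal.absNorm_dvd_absNorm_of_le ((Ideal.span_singleton_le_iff_mem _).2 hv)
    rwa [Ideal.absNorm_span_natCast, finrank_int_ringOfIntegers] at h
  obtain ⟨k, hk, hk'⟩ := (Nat.dvd_prime_pow hp).1 h1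
  have h0 : k ≠ 0 := by
    rintro rfl
    rw [pow_zero, Ideal.absNorm_eq_one_iff] at hk'
    exact v.isPrime.ne_top hk'
  interval_cases k
  · exact absurd rfl h0
  · left; simpa using hk'
  · right; exact hk'

theorem absNorm_conjPrime (v : HeightOneSpectrum (𝓞 K)) :
    Ideal.absNorm (conjPrime v).asIdeal = Ideal.absNorm v.asIdeal := by
  rw [asIdeal_conjPrime, absNorm_conjIdeal]

/-- Every prime divisor of such an ideal lies above the rational prime below `v`, so it is `v` or
its conjugate. These have equal norms, and removing one factor lowers `m` by one. -/
theorem eq_pow_mul_pow_of_absNorm_eq (v : HeightOneSpectrum (𝓞 K)) (m : ℕ) {𝔞 : Ideal (𝓞 K)}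
    (h : Ideal.absNorm 𝔞 = Ideal.absNorm v.asIdeal ^ m) :
    ∃ i j, i + j = m ∧ 𝔞 = v.asIdeal ^ i * (conjPrime v).asIdeal ^ j := by
  obtain ⟨p, hp, hpv⟩ := exists_prime_mem v
  have hq : Ideal.absNorm v.asIdeal ≠ 0 := by
    rw [Ne, Ideal.absNorm_eq_zero_iff]; exact v.ne_bot
  have hq1 : Ideal.absNorm v.asIdeal ≠ 1 := by
    rw [Ne, Ideal.absNorm_eq_one_iff]; exact v.isPrime.ne_top
  induction m generalizing 𝔞 with
  | zero =>
    rw [pow_zero, Ideal.absNorm_eq_one_iff] at h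
    exact ⟨0, 0, rfl, by rw [h]; simp⟩
  | succ m ih =>
    have hne : 𝔞 ≠ ⊤ := by
      rw [Ne, ← Ideal.absNorm_eq_one_iff, h]
      exact fun h' => hq1 (by simpa using h')
    obtain ⟨P, hP, hle⟩ := Ideal.exists_le_maximal _ hne
    have hmem : ((Ideal.absNorm v.asIdeal : ℕ) : 𝓞 K) ∈ P := by
      have := hle (Ideal.absNorm_mem 𝔞)
      rw [h, Nat.cast_pow] at this
      exact hP.isPrime.mem_of_pow_mem _ this
    have hpP : (p : 𝓞 K) ∈ P := by
      rcases absNorm_prime_eq hp hpv with h' | h'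
      · rwa [h'] at hmem
      · rw [h', Nat.cast_pow] at hmem
        exact hP.isPrime.mem_of_pow_mem _ hmem
    have hP0 : P ≠ ⊥ := by
      rintro rfl
      rw [Ideal.mem_bot] at hpP
      exact hp.ne_zero (by exact_mod_cast hpP)
    let w : HeightOneSpectrum (𝓞 K) := ⟨P, hP.isPrime, hP0⟩
    obtain ⟨𝔟, hb⟩ := Ideal.dvd_iff_le.2 hle
    have hw : w = v ∨ w = conjPrime v := eq_or_eq_conjPrime hp hpv hpP
    have hNw : Ideal.absNorm w.asIdeal = Ideal.absNorm v.asIdeal := by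
      rcases hw with h | h
      · rw [h]
      · rw [h, absNorm_conjPrime]
    have hNb : Ideal.absNorm 𝔟 = Ideal.absNorm v.asIdeal ^ m := by
      have h2 : Ideal.absNorm v.asIdeal * Ideal.absNorm 𝔟 = Ideal.absNorm v.asIdeal ^ (m + 1) := by
        rw [← h, hb, map_mul, ← hNw]
      rw [pow_succ', mul_right_inj' hq] at h2
      exact h2
    obtain ⟨i, j, hij, he⟩ := ih hNb
    rcases hw with h | h
    · refine ⟨i + 1, j, by omega, ?_⟩
      rw [hb, he, ← h, pow_succ']
      simp only [w]; ring
    · refine ⟨i, j + 1, by omega, ?_⟩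
      rw [hb, he, ← h]
      simp only [w]; ring

theorem conjPrime_pow_ne {v : HeightOneSpectrum (𝓞 K)} (hv : conjPrime v ≠ v) {n : ℕ}
    (hn : n ≠ 0) : conjIdeal (v.asIdeal ^ n) ≠ v.asIdeal ^ n := by
  intro h
  rw [conjIdeal_pow, ← asIdeal_conjPrime] at h
  have h1 : (conjPrime v).asIdeal ∣ v.asIdeal ^ n := by
    rw [← h]; exact dvd_pow_self _ hn
  have h2 := (conjPrime v).prime.dvd_of_dvd_pow h1
  exact hv (HeightOneSpectrum.ext
    (v.isMaximal.eq_of_le (conjPrime v).isPrime.ne_top (Ideal.le_of_dvd h2)).symm)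

/-- Finiteness of the class group makes a power of `𝔞` principal; finiteness of the units modulo `𝔪`
makes a further power of the generator congruent to `1`. -/
theorem exists_pow_eq_span {𝔪 𝔞 : Ideal (𝓞 K)} (hm : 𝔪 ≠ 0) (ha : 𝔞 ≠ 0) (hc : IsCoprime 𝔞 𝔪) :
    ∃ (n : ℕ) (b : 𝓞 K), 0 < n ∧ 𝔞 ^ n = Ideal.span {b} ∧ PrimeToIdeal 𝔪 b ∧ b - 1 ∈ 𝔪 := by
  have hfin : Finite (ClassGroup (𝓞 K)) := inferInstance
  set c := ClassGroup.mk0 ⟨𝔞, mem_nonZeroDivisors_of_ne_zero ha⟩ with hcdef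
  have h1 : ClassGroup.mk0 ⟨𝔞 ^ orderOf c, mem_nonZeroDivisors_of_ne_zero (pow_ne_zero _ ha)⟩ = 1 := by
    rw [← pow_orderOf_eq_one c, hcdef, ← map_pow]
    rfl
  rw [ClassGroup.mk0_eq_one_iff] at h1
  obtain ⟨b₀, hb₀⟩ := h1.principal
  rw [Ideal.submodule_span_eq] at hb₀
  have hb0 : b₀ ≠ 0 := by
    rintro rfl
    rw [Ideal.span_singleton_eq_bot.2 rfl] at hb₀
    exact pow_ne_zero _ ha hb₀
  have hb0p : PrimeToIdeal 𝔪 b₀ := ⟨hb0, by rw [← hb₀]; exact hc.pow_left⟩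
  obtain ⟨k, hk, hk'⟩ := exists_pow_sub_one_mem hm hb0p
  exact ⟨orderOf c * k, b₀ ^ k, Nat.mul_pos (orderOf_pos c) hk,
    by rw [pow_mul, hb₀, Ideal.span_singleton_pow], hb0p.pow k, hk'⟩

variable {φ : K →+* ℂ} {l : ℕ}

theorem HeckeCharacter.eval_eq {𝔪 : Ideal (𝓞 K)} (ψ : HeckeCharacter φ 𝔪 l) (𝔞 : Ideal (𝓞 K))
    [Decidable (𝔞 ≠ 0 ∧ IsCoprime 𝔞 𝔪)] :
    ψ.eval 𝔞 = if 𝔞 ≠ 0 ∧ IsCoprime 𝔞 𝔪 then idealVal ψ.total 𝔞 else 0 := by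
  have hM := ψ.modulus_ne_bot
  by_cases h' : 𝔞 ≠ 0 ∧ IsCoprime 𝔞 𝔪
  · rw [if_pos h', HeckeCharacter.eval, dif_pos
      ⟨mem_nonZeroDivisors_of_ne_zero h'.1, (idealUnit_mem_iff h'.1 hM).2 h'.2⟩,
      idealVal_of_ne ψ.total h'.1, ψ.total_apply ((idealUnit_mem_iff h'.1 hM).2 h'.2)]
    rfl
  · rw [if_neg h', HeckeCharacter.eval, dif_neg]
    rintro ⟨h0, h1⟩
    have h0' := nonZeroDivisors.ne_zero h0
    exact h' ⟨h0', (idealUnit_mem_iff h0' hM).1 h1⟩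

theorem HeckeCharacter.eval_mul {𝔪 : Ideal (𝓞 K)} (ψ : HeckeCharacter φ 𝔪 l)
    (𝔞 𝔟 : Ideal (𝓞 K)) : ψ.eval (𝔞 * 𝔟) = ψ.eval 𝔞 * ψ.eval 𝔟 := by
  classical
  rw [ψ.eval_eq, ψ.eval_eq, ψ.eval_eq]
  by_cases ha : 𝔞 ≠ 0 ∧ IsCoprime 𝔞 𝔪
  · by_cases hb : 𝔟 ≠ 0 ∧ IsCoprime 𝔟 𝔪
    · rw [if_pos ha, if_pos hb, if_pos ⟨mul_ne_zero ha.1 hb.1, ha.2.mul_left hb.2⟩, map_mul]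
    · rw [if_neg hb, mul_zero, if_neg]
      exact fun h => hb ⟨right_ne_zero_of_mul h.1, h.2.of_mul_left_right⟩
  · rw [if_neg ha, zero_mul, if_neg]
    exact fun h => ha ⟨left_ne_zero_of_mul h.1, h.2.of_mul_left_left⟩

theorem isCoprime_prime_iff {𝔪 : Ideal (𝓞 K)} (hm : 𝔪 ≠ 0) (v : HeightOneSpectrum (𝓞 K)) :
    IsCoprime v.asIdeal 𝔪 ↔ ¬ v.asIdeal ∣ 𝔪 := by
  rw [← idealUnit_mem_iff v.ne_bot hm]
  exact primeUnit_mem_iff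

theorem HeckeCharacter.eval_prime_of_not_dvd {𝔪 : Ideal (𝓞 K)} (ψ : HeckeCharacter φ 𝔪 l)
    {v : HeightOneSpectrum (𝓞 K)} (hv : ¬ v.asIdeal ∣ 𝔪) :
    ψ.eval v.asIdeal = ψ.total (primeUnit v) := by
  classical
  rw [ψ.eval_eq, if_pos ⟨v.ne_bot, (isCoprime_prime_iff ψ.modulus_ne_bot v).2 hv⟩, idealVal_prime]

theorem HeckeCharacter.eval_prime_of_dvd {𝔪 : Ideal (𝓞 K)} (ψ : HeckeCharacter φ 𝔪 l)
    {v : HeightOneSpectrum (𝓞 K)} (hv : v.asIdeal ∣ 𝔪) : ψ.eval v.asIdeal = 0 := by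
  classical
  rw [ψ.eval_eq, if_neg]
  exact fun h => (isCoprime_prime_iff ψ.modulus_ne_bot v).1 h.2 hv

theorem HeckeCharacter.coeff_eq_sum {𝔪 : Ideal (𝓞 K)} (ψ : HeckeCharacter φ 𝔪 l) {n : ℕ}
    {s : Finset (Ideal (𝓞 K))} (hs : ∀ 𝔞, 𝔞 ∈ s ↔ Ideal.absNorm 𝔞 = n) :
    ψ.coeff n = ∑ 𝔞 ∈ s, ψ.eval 𝔞 := by
  rw [HeckeCharacter.coeff]
  congr 1
  ext 𝔞
  rw [hs]
  simp

/-- Some power of the value of `ψ` at a prime which is not conjugation invariant is a nonreal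
element of `K`. -/
theorem HeckeCharacter.exists_pow_eq {𝔪 : Ideal (𝓞 K)} (hl : l ≠ 0) (ψ : HeckeCharacter φ 𝔪 l)
    {v : HeightOneSpectrum (𝓞 K)} (hv : ¬ v.asIdeal ∣ 𝔪) (hvc : conjPrime v ≠ v) :
    ∃ (n : ℕ) (β : 𝓞 K), (ψ.total (primeUnit v) : ℂ) ^ n = φ β ∧ conj (φ β) ≠ φ β := by
  have hm := ψ.modulus_ne_bot
  obtain ⟨n, b, hn, hb, hbp, hb1⟩ :=
    exists_pow_eq_span hm v.ne_bot ((isCoprime_prime_iff hm v).2 hv)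
  refine ⟨n, b ^ l, ?_, ?_⟩
  · rw [← idealVal_prime, ← map_pow, hb, idealVal_span φ l _ hbp.1,
      ψ.isHecke_total b 1 hbp primeToIdeal_one hb1, map_one, one_mul]
    simp
  · rw [← embedding_conjInt]
    intro h
    have h1 : conjInt K (b ^ l) = b ^ l := RingOfIntegers.ext (φ.injective h)
    -- With `v ^ n = (b)`, a real `b ^ l` would make `v ^ (n * l)` stable under conjugation.
    apply conjPrime_pow_ne hvc (n := n * l) (Nat.mul_ne_zero hn.ne' hl)
    rw [pow_mul, hb, Ideal.span_singleton_pow, conjIdeal_span, h1]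

/-- A root of a rational quadratic polynomial with a nonreal power in `K` lies in `K`. -/
theorem mem_range_of_pow {φ : K →+* ℂ} {x y : ℂ} {r s : ℚ} (h1 : x + y = r)
    (h2 : x ^ 2 + x * y + y ^ 2 = s) {n : ℕ} {β : K} (hn : x ^ n = φ β) (hβ : conj (φ β) ≠ φ β) :
    y = conj x ∧ ∃ z : K, x = φ z := by
  have hxr : conj x ≠ x := by
    intro h
    apply hβ
    rw [← hn, map_pow, h]
  -- The sum `r` and the product `r ^ 2 - s` of `x` and `y` are rational.
  have hq : x ^ 2 = r * x + (s - r ^ 2 : ℚ) := by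
    push_cast
    rw [← h1, ← h2]; ring
  have hqc : (conj x) ^ 2 = r * conj x + (s - r ^ 2 : ℚ) := by
    have := congrArg conj hq
    simpa using this
  have hy : y = conj x := by
    have : (conj x - x) * (conj x - y) = 0 := by
      have e : y = r - x := by rw [← h1]; ring
      rw [e]; linear_combination hqc - hq
    rcases mul_eq_zero.1 this with h | h
    · exact absurd (sub_eq_zero.1 h) hxr
    · exact (sub_eq_zero.1 h).symm
  refine ⟨hy, ?_⟩
  -- Every power of `x` is `A x + B` with rational `A`, `B`. For the power lying in `K` the
  -- coefficient `A` is nonzero, as that power is not real, so the equation can be solved for `x` in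
  -- `K`.
  have hpow : ∀ m : ℕ, ∃ A B : ℚ, x ^ m = A * x + B := by
    intro m
    induction m with
    | zero => exact ⟨0, 1, by simp⟩
    | succ m ih =>
      obtain ⟨A, B, h⟩ := ih
      refine ⟨A * r + B, A * (s - r ^ 2), ?_⟩
      rw [pow_succ, h]
      push_cast at hq ⊢
      linear_combination (A : ℂ) * hq
  obtain ⟨A, B, hAB⟩ := hpow n
  have hA : (A : ℂ) ≠ 0 := by
    intro h
    apply hβ
    rw [← hn, hAB, h]
    simp
  refine ⟨(β - B) / A, ?_⟩
  rw [map_div₀, map_sub, ← hn, hAB, map_ratCast, map_ratCast, eq_div_iff hA]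
  ring

/-- A Hecke character with rational coefficients has its values in `K` and is compatible with
complex conjugation. -/
theorem HeckeCharacter.isGood_of_hasRationalCoefficients {𝔪 : Ideal (𝓞 K)} (hl : l ≠ 0)
    {ψ : HeckeCharacter φ 𝔪 l} (hψ : ψ.HasRationalCoefficients) : IsGood φ l ψ.total 𝔪 := by
  have hm := ψ.modulus_ne_bot
  have key : ∀ v : HeightOneSpectrum (𝓞 K), ¬ v.asIdeal ∣ 𝔪 →
      (∃ x : K, (ψ.total (primeUnit v) : ℂ) = φ x) ∧ ¬ (conjPrime v).asIdeal ∣ 𝔪 ∧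
      (ψ.total (primeUnit (conjPrime v)) : ℂ) = conj (ψ.total (primeUnit v) : ℂ) := by
    intro v hv
    have hq : Ideal.absNorm v.asIdeal ≠ 0 := by
      rw [Ne, Ideal.absNorm_eq_zero_iff]; exact v.ne_bot
    by_cases hvc : conjPrime v = v
    -- When `v` is its own conjugate it is the only ideal of its norm, so `ψ(v)` is itself a
    -- coefficient.
    · obtain ⟨q, hq'⟩ := hψ (Ideal.absNorm v.asIdeal) (Nat.one_le_iff_ne_zero.2 hq)
      rw [ψ.coeff_eq_sum (s := {v.asIdeal}), Finset.sum_singleton,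
        ψ.eval_prime_of_not_dvd hv] at hq'
      · refine ⟨⟨q, by rw [hq', map_ratCast]⟩, by rwa [hvc], ?_⟩
        rw [hvc, hq']; simp
      · intro 𝔞
        rw [Finset.mem_singleton]
        constructor
        · rintro rfl; rfl
        · intro h
          obtain ⟨i, j, hij, he⟩ := eq_pow_mul_pow_of_absNorm_eq v 1 (by rw [h, pow_one])
          rw [he, hvc, ← pow_add, hij, pow_one]
    · have hne : v.asIdeal ≠ (conjPrime v).asIdeal := fun h => hvc (HeightOneSpectrum.ext h.symm)
      have hv0 : v.asIdeal ≠ 0 := v.ne_bot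
      have hw0 : (conjPrime v).asIdeal ≠ 0 := (conjPrime v).ne_bot
      obtain ⟨r, hr⟩ := hψ (Ideal.absNorm v.asIdeal) (Nat.one_le_iff_ne_zero.2 hq)
      -- The coefficients at `N(v)` and `N(v) ^ 2` are `x + y` and `x ^ 2 + x y + y ^ 2`, where `x`
      -- and `y` are the values of `ψ` at `v` and at its conjugate.
      obtain ⟨s, hs⟩ := hψ (Ideal.absNorm v.asIdeal ^ 2)
        (Nat.one_le_iff_ne_zero.2 (pow_ne_zero _ hq))
      have hne2 : v.asIdeal ^ 2 ≠ v.asIdeal * (conjPrime v).asIdeal := by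
        rw [pow_two]; exact fun h => hne (mul_left_cancel₀ hv0 h)
      have hne3 : v.asIdeal * (conjPrime v).asIdeal ≠ (conjPrime v).asIdeal ^ 2 := by
        rw [pow_two]; exact fun h => hne (mul_right_cancel₀ hw0 h)
      have hne4 : v.asIdeal ^ 2 ≠ (conjPrime v).asIdeal ^ 2 := by
        intro h
        have := conjPrime_pow_ne hvc (n := 2) two_ne_zero
        rw [conjIdeal_pow, ← asIdeal_conjPrime] at this
        exact this h.symm
      classical
      rw [ψ.coeff_eq_sum (s := {v.asIdeal, (conjPrime v).asIdeal}), Finset.sum_pair hne,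
        ψ.eval_prime_of_not_dvd hv] at hr
      · rw [ψ.coeff_eq_sum (s := {v.asIdeal ^ 2, v.asIdeal * (conjPrime v).asIdeal,
          (conjPrime v).asIdeal ^ 2}), Finset.sum_insert, Finset.sum_pair hne3, pow_two, pow_two,
          ψ.eval_mul, ψ.eval_mul, ψ.eval_mul, ψ.eval_prime_of_not_dvd hv] at hs
        · obtain ⟨n, β, hn, hβ⟩ := ψ.exists_pow_eq hl hv hvc
          obtain ⟨h1, h2⟩ := mem_range_of_pow hr (by rw [← hs]; ring) hn hβ
          -- If the conjugate prime divided `𝔪`, its value would be `0`, yet it is the complex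
          -- conjugate of a nonzero number.
          have hvd : ¬ (conjPrime v).asIdeal ∣ 𝔪 := by
            intro hd
            rw [ψ.eval_prime_of_dvd hd] at h1
            exact Units.ne_zero (ψ.total (primeUnit v)) (by simpa using h1.symm)
          rw [ψ.eval_prime_of_not_dvd hvd] at h1
          exact ⟨h2, hvd, h1⟩
        · simp only [Finset.mem_insert, Finset.mem_singleton, not_or]
          exact ⟨hne2, hne4⟩
        · intro 𝔞
          simp only [Finset.mem_insert, Finset.mem_singleton]
          constructor
          · rintro (rfl | rfl | rfl)
            · rw [map_pow]
            · rw [map_mul, absNorm_conjPrime, pow_two]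
            · rw [map_pow, absNorm_conjPrime]
          · intro h
            obtain ⟨i, j, hij, he⟩ := eq_pow_mul_pow_of_absNorm_eq v 2 h
            have : (i = 2 ∧ j = 0) ∨ (i = 1 ∧ j = 1) ∨ (i = 0 ∧ j = 2) := by omega
            rcases this with ⟨rfl, rfl⟩ | ⟨rfl, rfl⟩ | ⟨rfl, rfl⟩
            · left; simpa using he
            · right; left; simpa using he
            · right; right; simpa using he
      · intro 𝔞
        simp only [Finset.mem_insert, Finset.mem_singleton]
        constructor
        · rintro (rfl | rfl)
          · rfl
          · rw [absNorm_conjPrime]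
        · intro h
          obtain ⟨i, j, hij, he⟩ := eq_pow_mul_pow_of_absNorm_eq v 1 (by rw [h, pow_one])
          have : (i = 1 ∧ j = 0) ∨ (i = 0 ∧ j = 1) := by omega
          rcases this with ⟨rfl, rfl⟩ | ⟨rfl, rfl⟩
          · left; simpa using he
          · right; simpa using he
  exact ⟨hm, ψ.isHecke_total, fun v hv => (key v hv).1, fun v hv => (key v hv).2.1,
    fun v hv => (key v hv).2.2⟩

end RationalToGood

/-! ### Exponents of conjugation-stable ideals. -/

section ExponentOfConductor

variable {K : Type*} [Field K] [NumberField K]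

theorem isCoprime_prime_pow_iff (v : HeightOneSpectrum (𝓞 K)) {I : Ideal (𝓞 K)}
    (h : ¬ v.asIdeal ∣ I) (n : ℕ) : IsCoprime (v.asIdeal ^ n) I := by
  apply IsCoprime.pow_left
  rw [Ideal.isCoprime_iff_sup_eq]
  by_contra hne
  apply h
  rw [Ideal.dvd_iff_le]
  have := v.isMaximal.eq_of_le hne le_sup_left
  rw [this]
  exact le_sup_right

theorem ideal_dvd_of_forall_prime_pow {I J : Ideal (𝓞 K)} (hI : I ≠ 0) (hJ : J ≠ 0)
    (h : ∀ (v : HeightOneSpectrum (𝓞 K)) (n : ℕ), v.asIdeal ^ n ∣ I → v.asIdeal ^ n ∣ J) :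
    I ∣ J := by
  induction I using UniqueFactorizationMonoid.induction_on_prime generalizing J with
  | h₁ => exact absurd rfl hI
  | h₂ x hx => exact hx.dvd
  | h₃ a P ha hP ih =>
    have hP' : P.IsPrime := Ideal.isPrime_of_prime hP
    let w : HeightOneSpectrum (𝓞 K) := ⟨P, hP', hP.ne_zero⟩
    obtain ⟨J', rfl⟩ : P ∣ J := by simpa using h w 1 (by simp [w])
    apply mul_dvd_mul_left
    refine ih ha (right_ne_zero_of_mul hJ) (fun v n hn => ?_)
    by_cases hv : v = w
    · have h1 := h w (n + 1) (by rw [pow_succ', ← hv]; rw [hv] at hn ⊢; exact mul_dvd_mul_left _ hn)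
      rw [pow_succ', mul_dvd_mul_iff_left hP.ne_zero] at h1
      rwa [hv]
    · have h1 := h v n (hn.mul_left _)
      refine (isCoprime_prime_pow_iff v (fun hd => hv ?_) n).dvd_of_dvd_mul_left h1
      exact HeightOneSpectrum.ext
        (w.isMaximal.eq_of_le v.isPrime.ne_top (Ideal.le_of_dvd hd)).symm

theorem exponentAt_le_iff {v : HeightOneSpectrum (𝓞 K)} {𝔣 : Ideal (𝓞 K)} (hf : 𝔣 ≠ 0) {j : ℕ} :
    exponentAt v 𝔣 ≤ j ↔ ∀ n, v.asIdeal ^ n ∣ 𝔣 → n ≤ j := by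
  have hfin := FiniteMultiplicity.of_prime_left v.prime hf
  constructor
  · intro h n hn
    exact (hfin.le_multiplicity_of_pow_dvd hn).trans h
  · intro h
    exact h _ (pow_multiplicity_dvd _ _)

/-- `𝔮` is the product of the distinct primes above the rational prime `p`, and `𝔮 ^ c = (p)`. -/
structure IsLocalIdeal (p : ℕ) (𝔮 : Ideal (𝓞 K)) (c : ℕ) : Prop where
  prime : p.Prime
  pow_eq : 𝔮 ^ c = Ideal.span {(p : 𝓞 K)}
  dvd : ∀ v : HeightOneSpectrum (𝓞 K), (p : 𝓞 K) ∈ v.asIdeal → v.asIdeal ∣ 𝔮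
  not_sq : ∀ v : HeightOneSpectrum (𝓞 K), ¬ v.asIdeal ^ 2 ∣ 𝔮
  pos : 0 < c

namespace IsLocalIdeal

variable {p c : ℕ} {𝔮 : Ideal (𝓞 K)}

theorem ne_zero (h : IsLocalIdeal p 𝔮 c) : 𝔮 ≠ 0 := by
  rintro rfl
  have := h.pow_eq
  rw [zero_pow h.pos.ne'] at this
  exact span_ne_zero (Nat.cast_ne_zero.2 h.prime.ne_zero) this.symm

theorem natCast_mem (h : IsLocalIdeal p 𝔮 c) : (p : 𝓞 K) ∈ 𝔮 := by
  have : (p : 𝓞 K) ∈ 𝔮 ^ c := by rw [h.pow_eq]; exact Ideal.mem_span_singleton_self _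
  exact Ideal.pow_le_self h.pos.ne' this

theorem mem_of_dvd (h : IsLocalIdeal p 𝔮 c) {v : HeightOneSpectrum (𝓞 K)} (hv : v.asIdeal ∣ 𝔮) :
    (p : 𝓞 K) ∈ v.asIdeal :=
  Ideal.le_of_dvd hv h.natCast_mem

theorem pow_dvd_iff (h : IsLocalIdeal p 𝔮 c) {v : HeightOneSpectrum (𝓞 K)}
    (hv : (p : 𝓞 K) ∈ v.asIdeal) {I : Ideal (𝓞 K)} (hI : ¬ v.asIdeal ∣ I) {n j : ℕ} :
    v.asIdeal ^ n ∣ 𝔮 ^ j * I ↔ n ≤ j := by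
  constructor
  · intro hd
    have hd := (isCoprime_prime_pow_iff v hI n).dvd_of_dvd_mul_right hd
    have h1 : emultiplicity v.asIdeal 𝔮 = 1 := by
      have := (emultiplicity_eq_coe (a := v.asIdeal) (b := 𝔮) (n := 1)).2
        ⟨by simpa using h.dvd v hv, h.not_sq v⟩
      simpa using this
    have h2 := le_emultiplicity_of_pow_dvd hd
    rw [emultiplicity_pow v.prime, h1, mul_one] at h2
    exact_mod_cast h2
  · intro hd
    exact ((pow_dvd_pow _ hd).trans (pow_dvd_pow_of_dvd (h.dvd v hv) j)).mul_right I

end IsLocalIdeal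

variable [Algebra.IsQuadraticExtension ℚ K] [IsTotallyComplex K]

theorem exponentAt_conjPrime {𝔣 : Ideal (𝓞 K)} (hf : 𝔣 ≠ 0) (hc : conjIdeal 𝔣 = 𝔣)
    (v : HeightOneSpectrum (𝓞 K)) : exponentAt (conjPrime v) 𝔣 = exponentAt v 𝔣 := by
  have key : ∀ v : HeightOneSpectrum (𝓞 K), exponentAt (conjPrime v) 𝔣 ≤ exponentAt v 𝔣 := by
    intro v
    rw [exponentAt_le_iff hf]
    intro n hn
    have := conjIdeal_dvd hn
    rw [hc, conjIdeal_pow, ← asIdeal_conjPrime, conjPrime_conjPrime] at this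
    exact (exponentAt_le_iff hf).1 le_rfl n this
  apply le_antisymm (key v)
  have := key (conjPrime v)
  rwa [conjPrime_conjPrime] at this

/-- The primes above `p` form one orbit under conjugation, so a conjugation-stable ideal has the
same exponent at all of them. A bound at `v` is therefore a bound on the power of `𝔮`. -/
theorem IsLocalIdeal.exponentAt_le_iff {p c k j : ℕ} {𝔮 : Ideal (𝓞 K)} (h : IsLocalIdeal p 𝔮 c)
    {v : HeightOneSpectrum (𝓞 K)} (hv : (p : 𝓞 K) ∈ v.asIdeal) {𝔣 I : Ideal (𝓞 K)} (hI0 : I ≠ 0)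
    (hI : ∀ w : HeightOneSpectrum (𝓞 K), (p : 𝓞 K) ∈ w.asIdeal → ¬ w.asIdeal ∣ I)
    (hd : 𝔣 ∣ 𝔮 ^ k * I) (hc : conjIdeal 𝔣 = 𝔣) :
    exponentAt v 𝔣 ≤ j ↔ 𝔣 ∣ 𝔮 ^ j * I := by
  have hf : 𝔣 ≠ 0 := ne_zero_of_dvd_ne_zero (mul_ne_zero (pow_ne_zero _ h.ne_zero) hI0) hd
  rw [_root_.exponentAt_le_iff hf]
  constructor
  · intro hn
    refine ideal_dvd_of_forall_prime_pow hf (mul_ne_zero (pow_ne_zero _ h.ne_zero) hI0)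
      fun w n hw => ?_
    by_cases hpw : (p : 𝓞 K) ∈ w.asIdeal
    · rw [h.pow_dvd_iff hpw (hI w hpw)]
      rcases eq_or_eq_conjPrime h.prime hv hpw with rfl | rfl
      · exact hn n hw
      · apply hn
        have := conjIdeal_dvd hw
        rwa [hc, conjIdeal_pow, ← asIdeal_conjPrime, conjPrime_conjPrime] at this
    · have h1 : ¬ w.asIdeal ∣ 𝔮 ^ k :=
        fun h' => hpw (h.mem_of_dvd (w.prime.dvd_of_dvd_pow h'))
      exact ((isCoprime_prime_pow_iff w h1 n).dvd_of_dvd_mul_left (hw.trans hd)).mul_left _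
  · intro hd n hn
    exact (h.pow_dvd_iff hv (hI v hv)).1 (hn.trans hd)

end ExponentOfConductor

/-! ### Ramification in terms of the discriminant. -/

section Ramification

variable {K : Type*} [Field K] [NumberField K] [Algebra.IsQuadraticExtension ℚ K]
    [IsTotallyComplex K] {p : ℕ} {v : HeightOneSpectrum (𝓞 K)}

theorem natCast_ne_zero_of_prime (hp : p.Prime) : (p : 𝓞 K) ≠ 0 :=
  Nat.cast_ne_zero.2 hp.ne_zero

theorem eq_of_dvd_of_absNorm_eq {I J : Ideal (𝓞 K)} (hJ : J ≠ 0) (h : I ∣ J)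
    (hN : Ideal.absNorm I = Ideal.absNorm J) : I = J := by
  obtain ⟨c, rfl⟩ := h
  rw [map_mul] at hN
  have hI : Ideal.absNorm I ≠ 0 := by
    rw [Ne, Ideal.absNorm_eq_zero_iff]; exact left_ne_zero_of_mul hJ
  have : Ideal.absNorm c = 1 := by
    apply mul_left_cancel₀ hI; rw [← hN, mul_one]
  rw [Ideal.absNorm_eq_one_iff.1 this]
  exact (Ideal.mul_top I).symm

theorem absNorm_span_prime : Ideal.absNorm (Ideal.span {(p : 𝓞 K)}) = p ^ 2 := by
  rw [Ideal.absNorm_span_natCast, finrank_int_ringOfIntegers]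

theorem IsQuadGen.dvd_iff {θ : 𝓞 K} {t n : ℤ} (h : IsQuadGen θ t n) {m a b : ℤ} :
    (m : 𝓞 K) ∣ a + b * θ ↔ m ∣ a ∧ m ∣ b := by
  constructor
  · rintro ⟨x, hx⟩
    obtain ⟨c, d, rfl⟩ := h.exists_eq x
    have : (a + b * θ : 𝓞 K) = (m * c : ℤ) + (m * d : ℤ) * θ := by
      rw [hx]; push_cast; ring
    obtain ⟨h1, h2⟩ := h.ext_iff.1 this
    exact ⟨⟨c, h1⟩, ⟨d, h2⟩⟩
  · rintro ⟨⟨c, rfl⟩, ⟨d, rfl⟩⟩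
    exact ⟨c + d * θ, by push_cast; ring⟩

theorem intCast_dvd_intCast {m a : ℤ} : (m : 𝓞 K) ∣ a ↔ m ∣ a := by
  obtain ⟨θ, t, n, h, -⟩ := exists_isQuadGen (K := K)
  have := h.dvd_iff (m := m) (a := a) (b := 0)
  simpa using this

theorem exists_int_sub_mem (hp : p.Prime) (hN : Ideal.absNorm v.asIdeal = p) (x : 𝓞 K) :
    ∃ m : ℕ, x - m ∈ v.asIdeal := by
  have hc : Nat.card (𝓞 K ⧸ v.asIdeal) = p := by
    rw [← hN, Ideal.absNorm_apply, Submodule.cardQuot_apply]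
  have : Fact p.Prime := ⟨hp⟩
  have hfin : Finite (𝓞 K ⧸ v.asIdeal) := Nat.finite_of_card_ne_zero (by rw [hc]; exact hp.ne_zero)
  have := Fintype.ofFinite (𝓞 K ⧸ v.asIdeal)
  have hchar : CharP (𝓞 K ⧸ v.asIdeal) p := by
    refine charP_of_card_eq_prime ?_
    rw [← Nat.card_eq_fintype_card, hc]
  let f := ZMod.castHom (dvd_refl p) (𝓞 K ⧸ v.asIdeal)
  have hb : Function.Bijective f := by
    refine (Fintype.bijective_iff_injective_and_card f).2 ⟨f.injective, ?_⟩
    rw [ZMod.card, ← hc, Nat.card_eq_fintype_card]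
  obtain ⟨y, hy⟩ := hb.2 (Ideal.Quotient.mk _ x)
  refine ⟨y.val, ?_⟩
  rw [← Ideal.Quotient.eq, ← hy, map_natCast]
  conv_lhs => rw [← ZMod.natCast_zmod_val y, map_natCast]

/-- At a prime dividing the discriminant, `θ` is congruent to a rational integer. -/
theorem IsQuadGen.exists_root_of_dvd_discr {θ : 𝓞 K} {t n : ℤ} (h : IsQuadGen θ t n)
    (ht : t = 0 ∨ t = 1) (hp : p.Prime) (hd : (p : ℤ) ∣ discr K) :
    ∃ a : ℤ, (p : ℤ) ∣ 2 * a - t ∧ (p : ℤ) ∣ a ^ 2 - t * a + n := by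
  rw [h.discr_eq] at hd
  rcases hp.eq_two_or_odd' with rfl | hodd
  · have h0 : t = 0 := by rcases ht with rfl | rfl <;> omega
    subst h0
    -- For `p = 2` and `t = 0` the root `a = n` works because `n (n + 1)` is even.
    refine ⟨n, ⟨n, by push_cast; ring⟩, ?_⟩
    have := (Int.even_mul_succ_self n).two_dvd
    push_cast
    have e : n ^ 2 - 0 * n + n = n * (n + 1) := by ring
    rw [e]; exact_mod_cast this
  · obtain ⟨k, hk⟩ := hodd
    have hp2 : IsCoprime (p : ℤ) 4 := by
      have : IsCoprime (p : ℤ) 2 := ⟨1, -k, by rw [hk]; push_cast; ring⟩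
      exact (IsCoprime.mul_right this this : IsCoprime (p : ℤ) (2 * 2))
    -- With `p = 2 k + 1`, the integer `k + 1` is the inverse of `2` modulo `p`, so this is `t / 2`.
    refine ⟨t * (k + 1), ⟨t, by rw [hk]; push_cast; ring⟩, ?_⟩
    apply hp2.dvd_of_dvd_mul_left
    have e : 4 * ((t * (k + 1)) ^ 2 - t * (t * (k + 1)) + n) =
      p * (p * t ^ 2) - (t ^ 2 - 4 * n) := by rw [hk]; push_cast; ring
    rw [e]
    exact (dvd_mul_right _ _).sub hd

/-- Modulo `p` the polynomial of `θ` has a double root `a`, so `p` divides `(θ - a) ^ 2` and `θ - a`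
lies in `v`. Then `v` is generated by `p` and `θ - a`, which gives `v ^ 2 ⊆ (p)`. Also `v ≠ (p)`, as
`p` does not divide `θ - a`; comparing norms gives equality. -/
theorem ramified_aux (hp : p.Prime) (hd : (p : ℤ) ∣ discr K) (hv : (p : 𝓞 K) ∈ v.asIdeal) :
    v.asIdeal ^ 2 = Ideal.span {(p : 𝓞 K)} ∧ Ideal.absNorm v.asIdeal = p := by
  obtain ⟨θ, t, n, h, ht⟩ := exists_isQuadGen (K := K)
  obtain ⟨a, ha1, ha2⟩ := h.exists_root_of_dvd_discr ht hp hd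
  have hsq : (θ - a) ^ 2 = ((t - 2 * a : ℤ) : 𝓞 K) * (θ - a) - ((a ^ 2 - t * a + n : ℤ) : 𝓞 K) := by
    push_cast; linear_combination h.sq
  have hdiv : (p : 𝓞 K) ∣ (θ - a) ^ 2 := by
    rw [hsq]
    have e1 : ((p : ℤ) : 𝓞 K) ∣ ((t - 2 * a : ℤ) : 𝓞 K) := by
      rw [intCast_dvd_intCast]; rw [← dvd_neg]; simpa using ha1
    have e2 : ((p : ℤ) : 𝓞 K) ∣ ((a ^ 2 - t * a + n : ℤ) : 𝓞 K) := intCast_dvd_intCast.2 ha2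
    exact (by simpa using (e1.mul_right (θ - a)).sub e2)
  have hx : θ - a ∈ v.asIdeal := by
    apply v.isPrime.mem_of_pow_mem 2
    exact Ideal.mem_of_dvd _ hdiv hv
  have hle : v.asIdeal ^ 2 ≤ Ideal.span {(p : 𝓞 K)} := by
    rw [pow_two, Ideal.mul_le]
    have key : ∀ y ∈ v.asIdeal, ∃ y₁ y₂ : 𝓞 K, y = p * y₁ + (θ - a) * y₂ := by
      intro y hy
      obtain ⟨b, c, rfl⟩ := h.exists_eq y
      have h1 : ((b + c * a : ℤ) : 𝓞 K) ∈ v.asIdeal := by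
        have := Ideal.sub_mem _ hy (Ideal.mul_mem_left _ (c : 𝓞 K) hx)
        convert this using 1; push_cast; ring
      obtain ⟨k, hk⟩ := int_dvd_of_mem hp hv h1
      have hk' := congrArg (Int.cast (R := 𝓞 K)) hk
      push_cast at hk'
      exact ⟨k, c, by linear_combination hk'⟩
    intro y hy z hz
    obtain ⟨y₁, y₂, rfl⟩ := key y hy
    obtain ⟨z₁, z₂, rfl⟩ := key z hz
    rw [Ideal.mem_span_singleton]
    have : (p * y₁ + (θ - a) * y₂) * (p * z₁ + (θ - a) * z₂) =
      p * (p * y₁ * z₁ + (θ - a) * (y₁ * z₂ + y₂ * z₁)) + (θ - a) ^ 2 * (y₂ * z₂) := by ring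
    rw [this]
    exact (dvd_mul_right _ _).add (hdiv.mul_right _)
  have hN : Ideal.absNorm v.asIdeal = p := by
    rcases absNorm_prime_eq hp hv with h' | h'
    · exact h'
    · exfalso
      have e : v.asIdeal = Ideal.span {(p : 𝓞 K)} := by
        exact eq_of_dvd_of_absNorm_eq (span_ne_zero (natCast_ne_zero_of_prime hp))
          (Ideal.dvd_span_singleton.2 hv) (by rw [h', absNorm_span_prime])
      rw [e, Ideal.mem_span_singleton] at hx
      have := (h.dvd_iff (m := p) (a := -a) (b := 1)).1 (by
        convert hx using 1
        · simp
        · push_cast; ring)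
      have h2 := Int.isUnit_iff.1 (isUnit_of_dvd_one this.2)
      have := hp.two_le
      omega
  exact ⟨(eq_of_dvd_of_absNorm_eq (pow_ne_zero _ v.ne_bot) (Ideal.dvd_iff_le.2 hle)
    (by rw [map_pow, hN, absNorm_span_prime])).symm, hN⟩

theorem isLocalIdeal_of_dvd_discr (hp : p.Prime) (hd : (p : ℤ) ∣ discr K)
    (hv : (p : 𝓞 K) ∈ v.asIdeal) : IsLocalIdeal p v.asIdeal 2 where
  prime := hp
  pow_eq := (ramified_aux hp hd hv).1
  pos := two_pos
  dvd w hw := by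
    have h : w.asIdeal ∣ v.asIdeal ^ 2 := by
      rw [(ramified_aux hp hd hv).1]; exact Ideal.dvd_span_singleton.2 hw
    exact w.prime.dvd_of_dvd_pow h
  not_sq w hw := by
    have h1 : w = v := HeightOneSpectrum.ext (v.isMaximal.eq_of_le w.isPrime.ne_top
      (Ideal.le_of_dvd ((dvd_pow_self _ two_ne_zero).trans hw))).symm
    rw [h1] at hw
    have := (pow_dvd_pow_iff (a := v.asIdeal) (n := 2) (m := 1) v.ne_bot v.prime.not_isUnit).1
      (by simpa using hw)
    omega

theorem absNorm_of_dvd_discr (hp : p.Prime) (hd : (p : ℤ) ∣ discr K)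
    (hv : (p : 𝓞 K) ∈ v.asIdeal) : Ideal.absNorm v.asIdeal = p := (ramified_aux hp hd hv).2

theorem natCast_mem_conjPrime (hv : (p : 𝓞 K) ∈ v.asIdeal) :
    (p : 𝓞 K) ∈ (conjPrime v).asIdeal := by
  rw [mem_conjPrime, map_natCast]; exact hv

theorem conjPrime_of_dvd_discr (hp : p.Prime) (hd : (p : ℤ) ∣ discr K)
    (hv : (p : 𝓞 K) ∈ v.asIdeal) : conjPrime v = v :=
  HeightOneSpectrum.ext (v.isMaximal.eq_of_le (conjPrime v).isPrime.ne_top (Ideal.le_of_dvd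
    ((isLocalIdeal_of_dvd_discr hp hd hv).dvd _ (natCast_mem_conjPrime hv)))).symm

/-- If `v ^ 2` divided `(p)`, then `v` would have norm `p` and be self-conjugate. For `θ ≡ a` modulo
`v`, both `θ - a` and its conjugate lie in `v`, so `p` divides their sum and their product. The
discriminant is the square of the sum minus four times the product. -/
theorem not_sq_dvd_of_not_dvd_discr (hp : p.Prime) (hd : ¬ (p : ℤ) ∣ discr K) :
    ¬ v.asIdeal ^ 2 ∣ Ideal.span {(p : 𝓞 K)} := by
  intro hsq
  apply hd
  have hv : (p : 𝓞 K) ∈ v.asIdeal :=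
    Ideal.dvd_span_singleton.1 ((dvd_pow_self _ two_ne_zero).trans hsq)
  have hp0 := span_ne_zero (natCast_ne_zero_of_prime (K := K) hp)
  have hN : Ideal.absNorm v.asIdeal = p := by
    rcases absNorm_prime_eq hp hv with h' | h'
    · exact h'
    · exfalso
      obtain ⟨c, hc⟩ := hsq
      have h1 := congrArg Ideal.absNorm hc
      rw [absNorm_span_prime, map_mul, map_pow, h'] at h1
      have h2 : (p ^ 2) ^ 2 ∣ p ^ 2 := ⟨_, h1⟩
      rw [← pow_mul] at h2
      have := (Nat.pow_dvd_pow_iff_le_right hp.one_lt).1 h2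
      omega
  have hsq' : v.asIdeal ^ 2 = Ideal.span {(p : 𝓞 K)} :=
    eq_of_dvd_of_absNorm_eq hp0 hsq (by rw [map_pow, hN, absNorm_span_prime])
  have hconj : conjPrime v = v := by
    have h1 : (conjPrime v).asIdeal ∣ v.asIdeal ^ 2 := by
      rw [hsq']; exact Ideal.dvd_span_singleton.2 (natCast_mem_conjPrime hv)
    exact HeightOneSpectrum.ext (v.isMaximal.eq_of_le (conjPrime v).isPrime.ne_top
      (Ideal.le_of_dvd ((conjPrime v).prime.dvd_of_dvd_pow h1))).symm
  obtain ⟨θ, t, n, h, ht⟩ := exists_isQuadGen (K := K)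
  obtain ⟨a, ha⟩ := exists_int_sub_mem hp hN θ
  have hc : conjInt K (θ - a) ∈ v.asIdeal := by
    rw [← mem_conjPrime, hconj]; exact ha
  have hc' : conjInt K (θ - a) = t - θ - a := by rw [map_sub, h.conj_eq, map_natCast]
  rw [hc'] at hc
  have h1 : (p : ℤ) ∣ t - 2 * a := by
    rw [← mem_iff_dvd hp hv]
    have := Ideal.add_mem _ ha hc
    convert this using 1; push_cast; ring
  have h2 : (p : ℤ) ∣ a ^ 2 - t * a + n := by
    have hm := Ideal.mul_mem_mul ha hc
    rw [← pow_two, hsq', Ideal.mem_span_singleton] at hm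
    have e : (θ - a) * (t - θ - a) = ((a ^ 2 - t * a + n : ℤ) : 𝓞 K) := by
      push_cast; linear_combination -h.sq
    rw [e] at hm
    exact intCast_dvd_intCast.1 (by simpa using hm)
  have e : discr K = (t - 2 * a) ^ 2 - 4 * (a ^ 2 - t * a + n) := by rw [h.discr_eq]; ring
  rw [e]
  exact (dvd_pow h1 two_ne_zero).sub (h2.mul_left 4)

theorem isLocalIdeal_of_not_dvd_discr (hp : p.Prime) (hd : ¬ (p : ℤ) ∣ discr K) :
    IsLocalIdeal p (Ideal.span {(p : 𝓞 K)}) 1 where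
  prime := hp
  pow_eq := pow_one _
  pos := one_pos
  dvd _ hv := Ideal.dvd_span_singleton.2 hv
  not_sq _ := not_sq_dvd_of_not_dvd_discr hp hd

/-- The discriminant criterion speaks of all primes above `p`. If `p` divides the discriminant there
is only one, so being unramified at `v` already contradicts it. -/
theorem isUnramifiedAt_iff (hp : p.Prime) (hv : (p : 𝓞 K) ∈ v.asIdeal) :
    Algebra.IsUnramifiedAt ℤ v.asIdeal ↔ ¬ (p : ℤ) ∣ discr K := by
  have hiff := NumberField.not_dvd_discr_iff_forall_mem K (𝓞 K) (Nat.prime_iff_prime_int.1 hp)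
  constructor
  · intro h hd
    refine hiff.2 (fun P hP hpP => ?_) hd
    have hP0 : P ≠ ⊥ := by
      rintro rfl
      rw [Ideal.mem_bot] at hpP
      exact natCast_ne_zero_of_prime (K := K) hp (by simpa using hpP)
    have : (⟨P, hP, hP0⟩ : HeightOneSpectrum (𝓞 K)) = v := by
      rcases eq_or_eq_conjPrime (w := ⟨P, hP, hP0⟩) hp hv (by simpa using hpP) with h' | h'
      · exact h'
      · rw [h', conjPrime_of_dvd_discr hp hd hv]
    rw [← this] at h
    exact h
  · intro h
    exact hiff.1 h _ v.isPrime (by simpa using hv)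

end Ramification

/-! ### The local component at `p` and its relation to the conductor exponent. -/

section LocalCharacter

variable {K : Type*} [Field K] [NumberField K] [Algebra.IsQuadraticExtension ℚ K]
    [IsTotallyComplex K] {φ : K →+* ℂ} {l : ℕ} {Ψ : (FractionalIdeal (𝓞 K)⁰ K)ˣ →* ℂˣ}

/-- For `e ≡ 1` modulo a power of `p` and `e ≡ 0` modulo `r`, this is congruent to `x` modulo the
power of `p` and to `1` modulo `r`. -/
def crtLift (e : ℤ) (x : 𝓞 K) : 𝓞 K := x * e + (1 - e)

/-- The component at `p` of the finite part of `Ψ`. -/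
noncomputable def locHom (φ : K →+* ℂ) (l : ℕ) (Ψ : (FractionalIdeal (𝓞 K)⁰ K)ˣ →* ℂˣ) (e : ℤ)
    (x : 𝓞 K) : ℂ := etaHom φ l Ψ (crtLift e x)

/-- The component at `p` is trivial on the elements congruent to `1` modulo `𝔮 ^ j`. -/
def LocTriv (φ : K →+* ℂ) (l : ℕ) (Ψ : (FractionalIdeal (𝓞 K)⁰ K)ˣ →* ℂˣ) (p : ℕ) (e : ℤ)
    (𝔮 : Ideal (𝓞 K)) (j : ℕ) : Prop :=
  ∀ x : 𝓞 K, IsCoprime x (p : 𝓞 K) → x - 1 ∈ 𝔮 ^ j → locHom φ l Ψ e x = 1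

/-- `Ψ` is a character modulo `p ^ s * r` and `e` is an idempotent modulo `p ^ s * r`. -/
structure IsLocalSetup (φ : K →+* ℂ) (l : ℕ) (Ψ : (FractionalIdeal (𝓞 K)⁰ K)ˣ →* ℂˣ)
    (p s r : ℕ) (e : ℤ) : Prop where
  prime : p.Prime
  pos : 0 < s
  good : IsGood φ l Ψ (Ideal.span {((p ^ s * r : ℕ) : 𝓞 K)})
  not_dvd : ¬ p ∣ r
  sub_one : ((p ^ s : ℕ) : ℤ) ∣ e - 1
  dvd : (r : ℤ) ∣ e

theorem conjIdeal_span_natCast (M : ℕ) :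
    conjIdeal (Ideal.span {(M : 𝓞 K)}) = Ideal.span {(M : 𝓞 K)} := by
  rw [conjIdeal_span, map_natCast]

theorem not_isUnit_prime {p : ℕ} (hp : p.Prime) : ¬ IsUnit (p : 𝓞 K) := by
  intro h
  obtain ⟨y, hy⟩ := h.exists_right_inv
  have := int_unit_of_mul_eq_one (K := K) (d := (p : ℤ)) (by simpa using hy)
  rcases Int.isUnit_iff.1 this with h | h <;> have := hp.two_le <;> omega

theorem ne_zero_of_isCoprime {p : ℕ} (hp : p.Prime) {x : 𝓞 K} (hx : IsCoprime x (p : 𝓞 K)) :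
    x ≠ 0 := by
  rintro rfl
  exact not_isUnit_prime (K := K) hp (isCoprime_zero_left.1 hx)

/-- The norm of `𝔐` gives an integer modulus `p ^ a * r` with `p ∤ r`. Raising the power of `p` to
at least `b` ensures that every exponent up to `b` can be tested. The idempotent comes from a Bézout
relation between `p ^ s` and `r`. -/
theorem exists_isLocalSetup {𝔐 : Ideal (𝓞 K)} (h : IsGood φ l Ψ 𝔐) {p : ℕ} (hp : p.Prime)
    (b : ℕ) : ∃ (s r : ℕ) (e : ℤ), b ≤ s ∧ 𝔐 ∣ Ideal.span {((p ^ s * r : ℕ) : 𝓞 K)} ∧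
      IsLocalSetup φ l Ψ p s r e := by
  have hN : Ideal.absNorm 𝔐 ≠ 0 := by rw [Ne, Ideal.absNorm_eq_zero_iff]; exact h.ne_zero
  obtain ⟨a, r, hr, hNr⟩ := Nat.exists_eq_pow_mul_and_not_dvd hN p hp.ne_one
  have hr0 : r ≠ 0 := by rintro rfl; exact hr (dvd_zero p)
  have hd : 𝔐 ∣ Ideal.span {((p ^ (a + b + 1) * r : ℕ) : 𝓞 K)} := by
    rw [Ideal.dvd_span_singleton]
    refine Ideal.mem_of_dvd _ ?_ (Ideal.absNorm_mem 𝔐)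
    rw [hNr]
    exact Nat.cast_dvd_cast (mul_dvd_mul_right (pow_dvd_pow p (by omega)) r)
  have hcop : IsCoprime ((p ^ (a + b + 1) : ℕ) : ℤ) (r : ℤ) :=
    Nat.isCoprime_iff_coprime.2 ((hp.coprime_iff_not_dvd.2 hr).pow_left _)
  obtain ⟨u, w, huw⟩ := hcop
  refine ⟨a + b + 1, r, w * r, by omega, hd, hp, by omega, ?_, hr, ⟨-u, ?_⟩, Dvd.intro_left _ rfl⟩
  · exact h.mono hd (span_ne_zero (Nat.cast_ne_zero.2
      (Nat.mul_ne_zero (pow_ne_zero _ hp.ne_zero) hr0))) (conjIdeal_span_natCast _)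
  · linear_combination huw

theorem crtLift_intCast (e m : ℤ) : crtLift e (m : 𝓞 K) = ((m * e + (1 - e) : ℤ) : 𝓞 K) := by
  rw [crtLift]; push_cast; rfl

theorem conjInt_crtLift (e : ℤ) (x : 𝓞 K) :
    conjInt K (crtLift e x) = crtLift e (conjInt K x) := by
  simp only [crtLift, map_add, map_mul, map_sub, map_one, map_intCast]

theorem isCoprime_conjInt {p : ℕ} {x : 𝓞 K} (hx : IsCoprime x (p : 𝓞 K)) :
    IsCoprime (conjInt K x) (p : 𝓞 K) := by
  have := hx.map (conjInt K).toRingHom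
  simpa using this

namespace IsLocalSetup

variable {p s r : ℕ} {e : ℤ}

theorem ne_zero (h : IsLocalSetup φ l Ψ p s r e) : r ≠ 0 := by
  rintro rfl; exact h.not_dvd (dvd_zero p)

theorem modulus_dvd (h : IsLocalSetup φ l Ψ p s r e) :
    ((p ^ s * r : ℕ) : 𝓞 K) ∣ ((e * (1 - e) : ℤ) : 𝓞 K) := by
  have h1 : ((p ^ s * r : ℕ) : ℤ) ∣ e * (1 - e) := by
    rw [Nat.cast_mul, mul_comm e]
    refine mul_dvd_mul ?_ h.dvd
    rw [← dvd_neg]; simpa using h.sub_one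
  simpa using intCast_dvd_intCast (K := K).2 h1

theorem sub_one_dvd (h : IsLocalSetup φ l Ψ p s r e) :
    ((p ^ s : ℕ) : 𝓞 K) ∣ (e : 𝓞 K) - 1 := by
  simpa using intCast_dvd_intCast (K := K).2 h.sub_one

theorem dvd_e (h : IsLocalSetup φ l Ψ p s r e) : (r : 𝓞 K) ∣ (e : 𝓞 K) := by
  simpa using intCast_dvd_intCast (K := K).2 h.dvd

theorem isCoprime_crtLift (h : IsLocalSetup φ l Ψ p s r e) {x : 𝓞 K}
    (hx : IsCoprime x (p : 𝓞 K)) : IsCoprime (crtLift e x) ((p ^ s * r : ℕ) : 𝓞 K) := by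
  obtain ⟨k, hk⟩ := h.sub_one_dvd
  obtain ⟨k', hk'⟩ := h.dvd_e
  rw [Nat.cast_mul]
  apply IsCoprime.mul_right
  · have : crtLift e x = x + ((p ^ s : ℕ) : 𝓞 K) * (k * (x - 1)) := by
      rw [crtLift]; linear_combination (x - 1) * hk
    rw [this, IsCoprime.add_mul_left_left_iff, Nat.cast_pow]
    exact hx.pow_right
  · have : crtLift e x = 1 + (r : 𝓞 K) * (k' * (x - 1)) := by
      rw [crtLift]; linear_combination (x - 1) * hk'
    rw [this, IsCoprime.add_mul_left_left_iff]
    exact isCoprime_one_left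

theorem isCoprime_of_modulus (h : IsLocalSetup φ l Ψ p s r e) {a : 𝓞 K}
    (ha : IsCoprime a ((p ^ s * r : ℕ) : 𝓞 K)) : IsCoprime a (p : 𝓞 K) := by
  rw [Nat.cast_mul, Nat.cast_pow] at ha
  exact (IsCoprime.pow_right_iff h.pos).1 ha.of_mul_right_left

theorem primeTo_of_isCoprime (h : IsLocalSetup φ l Ψ p s r e) {a : 𝓞 K}
    (ha : IsCoprime a ((p ^ s * r : ℕ) : 𝓞 K)) :
    PrimeToIdeal (Ideal.span {((p ^ s * r : ℕ) : 𝓞 K)}) a :=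
  ⟨ne_zero_of_isCoprime h.prime (h.isCoprime_of_modulus ha),
    (Ideal.isCoprime_span_singleton_iff _ _).2 ha⟩

theorem primeTo_crtLift (h : IsLocalSetup φ l Ψ p s r e) {x : 𝓞 K}
    (hx : IsCoprime x (p : 𝓞 K)) :
    PrimeToIdeal (Ideal.span {((p ^ s * r : ℕ) : 𝓞 K)}) (crtLift e x) :=
  h.primeTo_of_isCoprime (h.isCoprime_crtLift hx)

theorem etaHom_congr (h : IsLocalSetup φ l Ψ p s r e) {a b : 𝓞 K}
    (ha : IsCoprime a ((p ^ s * r : ℕ) : 𝓞 K)) (hab : ((p ^ s * r : ℕ) : 𝓞 K) ∣ a - b) :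
    etaHom φ l Ψ a = etaHom φ l Ψ b := by
  refine h.good.isHecke a b (h.primeTo_of_isCoprime ha) (h.primeTo_of_isCoprime ?_)
    (Ideal.mem_span_singleton.2 hab)
  obtain ⟨c, hc⟩ := hab
  have : a = b + ((p ^ s * r : ℕ) : 𝓞 K) * c := by rw [← hc]; ring
  rwa [this, IsCoprime.add_mul_left_left_iff] at ha

theorem isCoprime_congr {x y : 𝓞 K}
    (hx : IsCoprime x (p : 𝓞 K)) (hxy : (p : 𝓞 K) ∣ x - y) : IsCoprime y (p : 𝓞 K) := by
  obtain ⟨c, hc⟩ := hxy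
  have : x = y + (p : 𝓞 K) * c := by rw [← hc]; ring
  rwa [this, IsCoprime.add_mul_left_left_iff] at hx

/-- A global element which is `1` away from `p` can be used to compute the local component. -/
theorem locHom_eq (h : IsLocalSetup φ l Ψ p s r e) {a x : 𝓞 K}
    (hx : IsCoprime x (p : 𝓞 K)) (h1 : ((p ^ s : ℕ) : 𝓞 K) ∣ a - x) (h2 : (r : 𝓞 K) ∣ a - 1) :
    locHom φ l Ψ e x = etaHom φ l Ψ a := by
  refine h.etaHom_congr (h.isCoprime_crtLift hx) ?_
  have hcop : IsCoprime ((p ^ s : ℕ) : 𝓞 K) (r : 𝓞 K) := by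
    have : IsCoprime ((p ^ s : ℕ) : ℤ) (r : ℤ) :=
      Nat.isCoprime_iff_coprime.2 ((h.prime.coprime_iff_not_dvd.2 h.not_dvd).pow_left _)
    simpa using this.map (Int.castRingHom (𝓞 K))
  rw [Nat.cast_mul]
  apply hcop.mul_dvd
  · have : crtLift e x - a = (x - 1) * ((e : 𝓞 K) - 1) - (a - x) := by rw [crtLift]; ring
    rw [this]
    exact (h.sub_one_dvd.mul_left _).sub h1
  · have : crtLift e x - a = (x - 1) * (e : 𝓞 K) - (a - 1) := by rw [crtLift]; ring
    rw [this]
    exact (h.dvd_e.mul_left _).sub h2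

/-- The defect of multiplicativity of the lift is a multiple of `e (1 - e)`, which the modulus
divides. -/
theorem locHom_mul (h : IsLocalSetup φ l Ψ p s r e) {x y : 𝓞 K}
    (hx : IsCoprime x (p : 𝓞 K)) (hy : IsCoprime y (p : 𝓞 K)) :
    locHom φ l Ψ e (x * y) = locHom φ l Ψ e x * locHom φ l Ψ e y := by
  rw [locHom, locHom, locHom, ← map_mul]
  refine h.etaHom_congr (h.isCoprime_crtLift (hx.mul_left hy)) ?_
  have : crtLift e (x * y) - crtLift e x * crtLift e y =
      ((e * (1 - e) : ℤ) : 𝓞 K) * (x * y - x - y + 1) := by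
    simp only [crtLift]; push_cast; ring
  rw [this]
  exact h.modulus_dvd.mul_right _

theorem locHom_one : locHom φ l Ψ e 1 = 1 := by
  rw [locHom, crtLift, one_mul, add_sub_cancel, map_one]

theorem locHom_pow (h : IsLocalSetup φ l Ψ p s r e) {x : 𝓞 K}
    (hx : IsCoprime x (p : 𝓞 K)) (n : ℕ) :
    locHom φ l Ψ e (x ^ n) = locHom φ l Ψ e x ^ n := by
  induction n with
  | zero => rw [pow_zero, pow_zero, locHom_one]
  | succ n ih => rw [pow_succ, pow_succ, h.locHom_mul hx.pow_left hx, ih]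

theorem locHom_conj (h : IsLocalSetup φ l Ψ p s r e) {x : 𝓞 K}
    (hx : IsCoprime x (p : 𝓞 K)) :
    locHom φ l Ψ e (conjInt K x) = conj (locHom φ l Ψ e x) := by
  rw [locHom, ← conjInt_crtLift, h.good.etaHom_conj (h.primeTo_crtLift hx), locHom]

theorem locHom_ne_zero (h : IsLocalSetup φ l Ψ p s r e) {x : 𝓞 K}
    (hx : IsCoprime x (p : 𝓞 K)) : locHom φ l Ψ e x ≠ 0 :=
  etaHom_ne_zero φ l Ψ (h.primeTo_crtLift hx).1

theorem norm_locHom (h : IsLocalSetup φ l Ψ p s r e) {x : 𝓞 K}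
    (hx : IsCoprime x (p : 𝓞 K)) : locHom φ l Ψ e x * conj (locHom φ l Ψ e x) = 1 := by
  obtain ⟨k, hk, hk'⟩ := h.good.isHecke.etaHom_pow_eq_one h.good.ne_zero (h.primeTo_crtLift hx)
  have : ‖locHom φ l Ψ e x‖ = 1 := Complex.norm_eq_one_of_pow_eq_one hk' hk.ne'
  rw [Complex.mul_conj, Complex.normSq_eq_norm_sq, this]
  simp

/-- The value at the conjugate of `x` is the complex conjugate of a root of unity, hence its
inverse. Triviality on norms is the main source of explicit values of the local component. -/
theorem locHom_norm (h : IsLocalSetup φ l Ψ p s r e) {x : 𝓞 K}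
    (hx : IsCoprime x (p : 𝓞 K)) : locHom φ l Ψ e (x * conjInt K x) = 1 := by
  rw [h.locHom_mul hx (isCoprime_conjInt hx), h.locHom_conj hx, h.norm_locHom hx]

theorem locHom_intCast_sq (h : IsLocalSetup φ l Ψ p s r e) {m : ℤ}
    (hm : IsCoprime (m : 𝓞 K) (p : 𝓞 K)) : locHom φ l Ψ e (m : 𝓞 K) ^ 2 = 1 := by
  have := h.locHom_norm hm
  rwa [map_intCast, ← pow_two, h.locHom_pow hm] at this

variable {𝔮 : Ideal (𝓞 K)} {c : ℕ}

theorem isCoprime_of_sub_mem (h𝔮 : IsLocalIdeal p 𝔮 c) {x y : 𝓞 K}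
    (hx : IsCoprime x (p : 𝓞 K)) {j : ℕ} (hj : j ≠ 0) (hxy : x - y ∈ 𝔮 ^ j) :
    IsCoprime y (p : 𝓞 K) := by
  have hq : IsCoprime (Ideal.span {x}) 𝔮 := by
    have h1 := (Ideal.isCoprime_span_singleton_iff _ _).2 hx
    rw [← h𝔮.pow_eq] at h1
    exact (IsCoprime.pow_right_iff h𝔮.pos).1 h1
  have h2 := isCoprime_span_congr (Ideal.pow_le_self hj hxy) hq
  have h3 : IsCoprime (Ideal.span {y}) (𝔮 ^ c) := h2.pow_right
  rw [h𝔮.pow_eq] at h3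
  exact (Ideal.isCoprime_span_singleton_iff _ _).1 h3

theorem LocTriv.congr (h : IsLocalSetup φ l Ψ p s r e) (h𝔮 : IsLocalIdeal p 𝔮 c) {j : ℕ}
    (ht : LocTriv φ l Ψ p e 𝔮 j) {x y : 𝓞 K} (hx : IsCoprime x (p : 𝓞 K))
    (hy : IsCoprime y (p : 𝓞 K)) (hxy : x - y ∈ 𝔮 ^ j) :
    locHom φ l Ψ e x = locHom φ l Ψ e y := by
  -- An inverse of `y` modulo `p ^ (j + 1)`, which lies in `𝔮 ^ j`. The exponent `j + 1` keeps `u`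
  -- prime to `p` also when `j = 0`.
  obtain ⟨u, w, huw⟩ := (hy.pow_right : IsCoprime y ((p : 𝓞 K) ^ (j + 1)))
  have hp : (p : 𝓞 K) ^ (j + 1) ∈ 𝔮 ^ j :=
    Ideal.pow_le_pow_right (Nat.le_succ j) (Ideal.pow_mem_pow h𝔮.natCast_mem _)
  have hu : IsCoprime u (p : 𝓞 K) :=
    ⟨y, w * p ^ j, by rw [← huw]; ring⟩
  have h1 : locHom φ l Ψ e (u * y) = 1 := by
    refine ht _ (hu.mul_left hy) ?_
    have : u * y - 1 = -(w * (p : 𝓞 K) ^ (j + 1)) := by rw [← huw]; ring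
    rw [this]
    exact neg_mem (Ideal.mul_mem_left _ _ hp)
  have h2 : locHom φ l Ψ e (u * x) = 1 := by
    refine ht _ (hu.mul_left hx) ?_
    have : u * x - 1 = u * (x - y) - (w * (p : 𝓞 K) ^ (j + 1)) := by rw [← huw]; ring
    rw [this]
    exact Ideal.sub_mem _ (Ideal.mul_mem_left _ _ hxy) (Ideal.mul_mem_left _ _ hp)
  rw [h.locHom_mul hu hx] at h2
  rw [h.locHom_mul hu hy] at h1
  exact mul_left_cancel₀ (h.locHom_ne_zero hu) (h2.trans h1.symm)

theorem LocTriv.mono {i j : ℕ} (hij : i ≤ j) (ht : LocTriv φ l Ψ p e 𝔮 i) :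
    LocTriv φ l Ψ p e 𝔮 j :=
  fun x hx h => ht x hx (Ideal.pow_le_pow_right hij h)

theorem locTriv_top (h : IsLocalSetup φ l Ψ p s r e) (h𝔮 : IsLocalIdeal p 𝔮 c) :
    LocTriv φ l Ψ p e 𝔮 (c * s) := by
  intro x hx hx1
  rw [pow_mul, h𝔮.pow_eq, Ideal.span_singleton_pow, Ideal.mem_span_singleton] at hx1
  rw [← locHom_one (φ := φ) (l := l) (Ψ := Ψ) (e := e), h.locHom_eq hx (a := 1), locHom, crtLift,
    one_mul, add_sub_cancel]
  · rw [Nat.cast_pow, ← dvd_neg]; simpa using hx1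
  · simp

theorem modulus_eq (h𝔮 : IsLocalIdeal p 𝔮 c) : 𝔮 ^ (c * s) * Ideal.span {(r : 𝓞 K)} =
    Ideal.span {((p ^ s * r : ℕ) : 𝓞 K)} := by
  rw [pow_mul, h𝔮.pow_eq, Ideal.span_singleton_pow, Ideal.span_singleton_mul_span_singleton]
  push_cast; rfl

/-- An element congruent to `1` modulo `r` is, modulo `p ^ s * r`, its own lift. So on it `η`
coincides with the local component. -/
theorem factorsMod_iff_locTriv (h : IsLocalSetup φ l Ψ p s r e) (h𝔮 : IsLocalIdeal p 𝔮 c) {j : ℕ}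
    (hj : j ≤ c * s) : FactorsMod φ l Ψ (Ideal.span {((p ^ s * r : ℕ) : 𝓞 K)})
      (𝔮 ^ j * Ideal.span {(r : 𝓞 K)}) ↔ LocTriv φ l Ψ p e 𝔮 j := by
  rw [factorsMod_iff h.good.ne_zero]
  · constructor
    · intro H x hx hx1
      refine H _ (h.primeTo_crtLift hx) ?_
      have : crtLift e x - 1 = (x - 1) * e := by rw [crtLift]; ring
      rw [this]
      exact Ideal.mul_mem_mul hx1 (Ideal.mem_span_singleton.2 h.dvd_e)
    · intro H a ha ha1
      have hac := (Ideal.isCoprime_span_singleton_iff _ _).1 ha.2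
      have hap := h.isCoprime_of_modulus hac
      have h1 : ((p ^ s : ℕ) : 𝓞 K) ∣ a - a := by rw [sub_self]; exact dvd_zero _
      have hle : 𝔮 ^ j * Ideal.span {(r : 𝓞 K)} ≤ 𝔮 ^ j ⊓ Ideal.span {(r : 𝓞 K)} :=
        Ideal.mul_le_inf
      have h3 := (Submodule.mem_inf.1 (hle ha1)).1
      have h2 := Ideal.mem_span_singleton.1 (Submodule.mem_inf.1 (hle ha1)).2
      rw [← h.locHom_eq hap h1 h2]
      exact H a hap h3
  · rw [← modulus_eq h𝔮]
    exact mul_dvd_mul_right (pow_dvd_pow _ hj) _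

theorem exponentAt_le_iff (h : IsLocalSetup φ l Ψ p s r e) (h𝔮 : IsLocalIdeal p 𝔮 c)
    {v : HeightOneSpectrum (𝓞 K)} (hv : (p : 𝓞 K) ∈ v.asIdeal) {𝔣 : Ideal (𝓞 K)}
    (hf : IsCond φ l Ψ (Ideal.span {((p ^ s * r : ℕ) : 𝓞 K)}) 𝔣) {j : ℕ} (hj : j ≤ c * s) :
    exponentAt v 𝔣 ≤ j ↔ LocTriv φ l Ψ p e 𝔮 j := by
  have hfc := h.good.conjIdeal_cond (conjIdeal_span_natCast _) hf
  have hd := hf.1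
  rw [← modulus_eq h𝔮] at hd
  rw [h𝔮.exponentAt_le_iff hv (span_ne_zero (Nat.cast_ne_zero.2 h.ne_zero)) ?_ hd hfc,
    hf.2, h.factorsMod_iff_locTriv h𝔮 hj]
  · rw [← modulus_eq h𝔮]
    exact mul_dvd_mul_right (pow_dvd_pow _ hj) _
  · intro w hw hwr
    rw [Ideal.dvd_span_singleton] at hwr
    have := int_dvd_of_mem h.prime hw (m := r) (by simpa using hwr)
    exact h.not_dvd (by exact_mod_cast this)

end IsLocalSetup

/-- The exponent of `v` in the conductor of `Ψ` is `n`. -/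
def HasExponent (φ : K →+* ℂ) (l : ℕ) (Ψ : (FractionalIdeal (𝓞 K)⁰ K)ˣ →* ℂˣ)
    (𝔐 : Ideal (𝓞 K)) (v : HeightOneSpectrum (𝓞 K)) (n : ℕ) : Prop :=
  ∀ 𝔣, IsCond φ l Ψ 𝔐 𝔣 → exponentAt v 𝔣 = n

theorem IsLocalSetup.hasExponent_iff {p s r c : ℕ} {e : ℤ} {𝔮 : Ideal (𝓞 K)}
    (h : IsLocalSetup φ l Ψ p s r e) (h𝔮 : IsLocalIdeal p 𝔮 c)
    {v : HeightOneSpectrum (𝓞 K)} (hv : (p : 𝓞 K) ∈ v.asIdeal) {n : ℕ} (hn : n ≤ c * s) :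
    HasExponent φ l Ψ (Ideal.span {((p ^ s * r : ℕ) : 𝓞 K)}) v n ↔
      LocTriv φ l Ψ p e 𝔮 n ∧ ∀ m < n, ¬ LocTriv φ l Ψ p e 𝔮 m := by
  constructor
  · intro H
    obtain ⟨𝔣, hf⟩ := exists_isCond h.good.ne_zero h.good.isHecke
    have := H 𝔣 hf
    refine ⟨(h.exponentAt_le_iff h𝔮 hv hf hn).1 this.le, fun m hm ht => ?_⟩
    have := (h.exponentAt_le_iff h𝔮 hv hf (hm.le.trans hn)).2 ht
    omega
  · rintro ⟨h1, h2⟩ 𝔣 hf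
    have h3 := (h.exponentAt_le_iff h𝔮 hv hf hn).2 h1
    by_contra hne
    refine h2 (exponentAt v 𝔣) (by omega) ?_
    exact (h.exponentAt_le_iff h𝔮 hv hf (by omega)).1 le_rfl

/-- Descent to the conductor keeps the coefficients rational, since the conductor is stable under
conjugation. -/
theorem IsGood.exists_heckeCharacter {𝔐 : Ideal (𝓞 K)} (h : IsGood φ l Ψ 𝔐)
    (hc : conjIdeal 𝔐 = 𝔐) {v : HeightOneSpectrum (𝓞 K)} {n : ℕ}
    (hn : HasExponent φ l Ψ 𝔐 v n) :
    ∃ (𝔣' : Ideal (𝓞 K)) (ψ' : HeckeCharacter φ 𝔣' l),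
      ψ'.HasRationalCoefficients ∧ ψ'.IsConductor 𝔣' ∧ exponentAt v 𝔣' = n := by
  obtain ⟨𝔣, hf⟩ := exists_isCond h.ne_zero h.isHecke
  have hff := (hf.2 𝔣 hf.1).1 dvd_rfl
  obtain ⟨Ψ', hΨ', hag⟩ := exists_descent h.ne_zero hf.1 hff
  have hg := h.descent hf.1 (h.conjIdeal_cond hc hf) hΨ' hag
  exact ⟨𝔣, hg.isHecke.toHeckeCharacter hg.ne_zero, hg.hasRationalCoefficients,
    hf.isConductor h.ne_zero hg.isHecke hg.ne_zero hag, hn 𝔣 hf⟩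

end LocalCharacter

/-! ### The values of `η` are roots of unity of `K`. -/

section RootsOfUnity

variable {K : Type*} [Field K] [NumberField K] [Algebra.IsQuadraticExtension ℚ K]
    [IsTotallyComplex K] {φ : K →+* ℂ} {l : ℕ} {Ψ : (FractionalIdeal (𝓞 K)⁰ K)ˣ →* ℂˣ}

theorem exists_int_of_pow_eq_one {z : K} {k : ℕ} (hk : 0 < k) (h : z ^ k = 1) :
    ∃ u : 𝓞 K, z = u ∧ Algebra.norm ℤ u = 1 := by
  have hz : IsIntegral ℤ z := (IsIntegral.of_pow hk (by rw [h]; exact isIntegral_one))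
  refine ⟨⟨z, hz⟩, rfl, ?_⟩
  set u : 𝓞 K := ⟨z, hz⟩
  have hu : u ^ k = 1 := RingOfIntegers.ext (by
    simp only [map_pow, map_one]; exact h)
  have h1 : Algebra.norm ℤ u ^ k = 1 := by rw [← map_pow, hu, map_one]
  exact (pow_eq_one_iff_of_nonneg (norm_nonneg_int u) hk.ne').1 h1

/-- The number `η(a)` lies in `K` and has finite order, so it is an integral unit; its norm is a
nonnegative root of unity in `ℤ`. -/
theorem IsGood.exists_unit {𝔐 : Ideal (𝓞 K)} (h : IsGood φ l Ψ 𝔐) {a : 𝓞 K}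
    (ha : PrimeToIdeal 𝔐 a) : ∃ u : 𝓞 K, etaHom φ l Ψ a = φ u ∧ Algebra.norm ℤ u = 1 := by
  obtain ⟨x, hx⟩ := h.idealVal_mem_range (span_ne_zero ha.1) ha.2
  obtain ⟨k, hk, hk'⟩ := h.isHecke.etaHom_pow_eq_one h.ne_zero ha
  have e : etaHom φ l Ψ a = φ (x / (a : K) ^ l) := by
    rw [etaHom_apply, hx, map_div₀, map_pow]
  obtain ⟨u, hu, hn⟩ := exists_int_of_pow_eq_one (z := x / (a : K) ^ l) hk
    (φ.injective (by rw [map_pow, ← e, hk', map_one]))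
  exact ⟨u, by rw [e, hu], hn⟩

/-- For `u = a + b θ` of norm one, `(2 a + t b) ^ 2 + |discr K| b ^ 2 = 4`. Hence `b = 0` unless
`|discr K| ≤ 4`. -/
theorem unit_cases {u : 𝓞 K} (hu : Algebra.norm ℤ u = 1) :
    u ^ 2 = 1 ∨ (discr K = -4 ∧ u ^ 4 = 1) ∨ (discr K = -3 ∧ u ^ 6 = 1) := by
  obtain ⟨θ, t, n, h, ht⟩ := exists_isQuadGen (K := K)
  obtain ⟨a, b, rfl⟩ := h.exists_eq u
  rw [h.norm_eq] at hu
  have hD := h.discr_eq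
  have hneg := discr_neg (K := K)
  have hθ := h.sq
  have h4 : (2 * a + t * b) ^ 2 + (4 * n - t ^ 2) * b ^ 2 = 4 := by linear_combination 4 * hu
  have hb : b = 0 ∨ (b ^ 2 = 1 ∧ n = 1) := by
    by_cases hb : b = 0
    · exact Or.inl hb
    right
    have hb1 : 1 ≤ b ^ 2 := Int.one_le_abs hb |> fun h => by nlinarith [sq_abs b, abs_nonneg b]
    have hn : 1 ≤ n := by rcases ht with rfl | rfl <;> omega
    have hn2 : n < 2 := by
      by_contra hn2
      rcases ht with rfl | rfl <;> nlinarith [sq_nonneg (2 * a + 0 * b), sq_nonneg (2 * a + 1 * b)]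
    obtain rfl : n = 1 := by omega
    refine ⟨?_, rfl⟩
    rcases ht with rfl | rfl <;>
      nlinarith [sq_nonneg (2 * a + 0 * b), sq_nonneg (2 * a + 1 * b)]
  rcases hb with rfl | ⟨hb, rfl⟩
  · left
    have ha : a ^ 2 = 1 := by linear_combination hu
    have ha' : (a : 𝓞 K) ^ 2 = 1 := by exact_mod_cast congrArg (Int.cast (R := 𝓞 K)) ha
    rw [← ha']; push_cast; ring
  · right
    have hb' : (b : 𝓞 K) ^ 2 = 1 := by exact_mod_cast congrArg (Int.cast (R := 𝓞 K)) hb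
    rcases ht with rfl | rfl
    · left
      refine ⟨by rw [hD]; norm_num, ?_⟩
      have ha : a ^ 2 = 0 := by linear_combination hu - hb
      have ha' : a = 0 := by simpa using ha
      subst ha'
      push_cast at hθ ⊢
      linear_combination (b : 𝓞 K) ^ 4 * (θ ^ 2 - 1) * hθ + ((b : 𝓞 K) ^ 2 + 1) * hb'
    · right
      refine ⟨by rw [hD]; norm_num, ?_⟩
      have ha : a * (a + b) = 0 := by linear_combination hu - hb
      push_cast at hθ
      have h3 : θ ^ 3 = -1 := by linear_combination (θ + 1) * hθ
      have h6 : θ ^ 6 = 1 := by linear_combination (θ ^ 3 - 1) * h3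
      have hb6 : (b : 𝓞 K) ^ 6 = 1 := by
        linear_combination ((b : 𝓞 K) ^ 4 + (b : 𝓞 K) ^ 2 + 1) * hb'
      rcases mul_eq_zero.1 ha with rfl | ha
      · rw [Int.cast_zero, zero_add, mul_pow, hb6, h6, one_mul]
      · obtain rfl : a = -b := by omega
        have e : ((-b : ℤ) : 𝓞 K) + b * θ = b * θ ^ 2 := by
          push_cast; linear_combination -(b : 𝓞 K) * hθ
        rw [e, mul_pow, hb6, ← pow_mul, pow_mul', h6]; ring

namespace IsLocalSetup

variable {p s r : ℕ} {e : ℤ}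

theorem exists_unit (h : IsLocalSetup φ l Ψ p s r e) {x : 𝓞 K} (hx : IsCoprime x (p : 𝓞 K)) :
    ∃ u : 𝓞 K, locHom φ l Ψ e x = φ u ∧ Algebra.norm ℤ u = 1 :=
  h.good.exists_unit (h.primeTo_crtLift hx)

theorem locHom_cases (h : IsLocalSetup φ l Ψ p s r e) {x : 𝓞 K} (hx : IsCoprime x (p : 𝓞 K)) :
    locHom φ l Ψ e x ^ 2 = 1 ∨ (discr K = -4 ∧ locHom φ l Ψ e x ^ 4 = 1) ∨
      (discr K = -3 ∧ locHom φ l Ψ e x ^ 6 = 1) := by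
  obtain ⟨u, hu, hn⟩ := h.exists_unit hx
  rw [hu]
  have key : ∀ k, u ^ k = 1 → φ u ^ k = 1 := by
    intro k hk
    rw [← map_pow]
    have := congrArg (fun y : 𝓞 K => φ y) hk
    simpa using this
  rcases unit_cases hn with h | ⟨hd, h⟩ | ⟨hd, h⟩
  · exact Or.inl (key _ h)
  · exact Or.inr (Or.inl ⟨hd, key _ h⟩)
  · exact Or.inr (Or.inr ⟨hd, key _ h⟩)

theorem locHom_sq (h : IsLocalSetup φ l Ψ p s r e) (h3 : discr K ≠ -3) (h4 : discr K ≠ -4)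
    {x : 𝓞 K} (hx : IsCoprime x (p : 𝓞 K)) : locHom φ l Ψ e x ^ 2 = 1 := by
  rcases h.locHom_cases hx with h | ⟨hd, -⟩ | ⟨hd, -⟩
  · exact h
  · exact absurd hd h4
  · exact absurd hd h3

theorem locHom_pow_four (h : IsLocalSetup φ l Ψ p s r e) (h3 : discr K ≠ -3)
    {x : 𝓞 K} (hx : IsCoprime x (p : 𝓞 K)) : locHom φ l Ψ e x ^ 4 = 1 := by
  rcases h.locHom_cases hx with h | ⟨hd, h⟩ | ⟨hd, -⟩
  · rw [show 4 = 2 * 2 from rfl, pow_mul, h, one_pow]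
  · exact h
  · exact absurd hd h3

theorem locHom_pow_six (h : IsLocalSetup φ l Ψ p s r e) (h4 : discr K ≠ -4)
    {x : 𝓞 K} (hx : IsCoprime x (p : 𝓞 K)) : locHom φ l Ψ e x ^ 6 = 1 := by
  rcases h.locHom_cases hx with h | ⟨hd, -⟩ | ⟨hd, h⟩
  · rw [show 6 = 2 * 3 from rfl, pow_mul, h, one_pow]
  · exact absurd hd h4
  · exact h

end IsLocalSetup

end RootsOfUnity

/-! ### Twists by quadratic Dirichlet characters composed with the norm. -/

section NormTwist

variable {K : Type*} [Field K] [NumberField K] [Algebra.IsQuadraticExtension ℚ K]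
    [IsTotallyComplex K] {φ : K →+* ℂ} {l : ℕ} {Ψ : (FractionalIdeal (𝓞 K)⁰ K)ˣ →* ℂˣ}

open Classical in
/-- The twist of `Ψ` by the composition of a quadratic character and the norm. -/
noncomputable def normTwist {m : ℕ} (χ : MulChar (ZMod m) ℤ)
    (Ψ : (FractionalIdeal (𝓞 K)⁰ K)ˣ →* ℂˣ) : (FractionalIdeal (𝓞 K)⁰ K)ˣ →* ℂˣ :=
  Ψ * extHom fun v => if χ (Ideal.absNorm v.asIdeal : ℕ) = -1 then -1 else 1

theorem isUnit_absNorm {m : ℕ} {𝔞 : Ideal (𝓞 K)} (hc : IsCoprime 𝔞 (Ideal.span {(m : 𝓞 K)})) :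
    IsUnit ((Ideal.absNorm 𝔞 : ℕ) : ZMod m) := by
  rw [ZMod.isUnit_iff_coprime]
  by_contra h
  obtain ⟨q, hq, hq1, hq2⟩ := Nat.Prime.not_coprime_iff_dvd.1 h
  obtain ⟨P, hP, hPq, hPd⟩ := Ideal.exists_isMaximal_dvd_of_dvd_absNorm' hq 𝔞 hq1
  have h2 : IsCoprime P P := by
    refine (hc.of_isCoprime_of_dvd_left hPd).of_isCoprime_of_dvd_right ?_
    rw [Ideal.dvd_span_singleton]
    have hqP : (q : ℤ) ∈ P.under ℤ := by rw [hPq]; exact Ideal.mem_span_singleton_self _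
    rw [Ideal.mem_comap] at hqP
    exact Ideal.mem_of_dvd _ (Nat.cast_dvd_cast hq2) (by simpa using hqP)
  rw [isCoprime_self] at h2
  exact hP.ne_top (by simpa using h2)

theorem primeUnit_normTwist {m : ℕ} {χ : MulChar (ZMod m) ℤ} (hχ : χ.IsQuadratic)
    {v : HeightOneSpectrum (𝓞 K)} (hv : IsCoprime v.asIdeal (Ideal.span {(m : 𝓞 K)})) :
    (normTwist χ Ψ (primeUnit v) : ℂ) =
      Ψ (primeUnit v) * (χ (Ideal.absNorm v.asIdeal : ℕ) : ℤ) := by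
  rw [normTwist, MonoidHom.mul_apply, Units.val_mul, extHom_primeUnit]
  congr 1
  have hu : χ (Ideal.absNorm v.asIdeal : ℕ) ≠ 0 := (isUnit_absNorm hv).map χ |>.ne_zero
  rcases hχ (Ideal.absNorm v.asIdeal : ℕ) with h | h | h
  · exact absurd h hu
  · rw [h]; norm_num
  · rw [h]; norm_num

theorem idealVal_normTwist {m : ℕ} (hm : m ≠ 0) {χ : MulChar (ZMod m) ℤ} (hχ : χ.IsQuadratic)
    {𝔞 : Ideal (𝓞 K)} (ha : 𝔞 ≠ 0) (hc : IsCoprime 𝔞 (Ideal.span {(m : 𝓞 K)})) :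
    idealVal (normTwist χ Ψ) 𝔞 = idealVal Ψ 𝔞 * (χ (Ideal.absNorm 𝔞 : ℕ) : ℤ) := by
  refine ideal_induction_primeTo (span_ne_zero (Nat.cast_ne_zero.2 hm))
    (P := fun 𝔞 => idealVal (normTwist χ Ψ) 𝔞 = idealVal Ψ 𝔞 * (χ (Ideal.absNorm 𝔞 : ℕ) : ℤ))
    ?_ ?_ ha hc
  · rw [idealVal_top, idealVal_top, Ideal.absNorm_top]; simp
  · intro v 𝔟 hv hb hbc ih
    rw [map_mul, map_mul, map_mul, idealVal_prime, idealVal_prime, primeUnit_normTwist hχ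
      ((isCoprime_prime_iff (span_ne_zero (Nat.cast_ne_zero.2 hm)) v).2 hv), ih, Nat.cast_mul,
      map_mul, Int.cast_mul]
    ring

theorem etaHom_normTwist {m : ℕ} (hm : m ≠ 0) {χ : MulChar (ZMod m) ℤ} (hχ : χ.IsQuadratic)
    {a : 𝓞 K} (ha : PrimeToIdeal (Ideal.span {(m : 𝓞 K)}) a) :
    etaHom φ l (normTwist χ Ψ) a = etaHom φ l Ψ a * (χ (Algebra.norm ℤ a : ℤ) : ℤ) := by
  rw [etaHom_apply, etaHom_apply, idealVal_normTwist hm hχ (span_ne_zero ha.1) ha.2,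
    ← absNorm_span_eq]
  push_cast
  ring

theorem dvd_norm_sub_norm {m : ℤ} {a b : 𝓞 K} (h : (m : 𝓞 K) ∣ a - b) :
    m ∣ Algebra.norm ℤ a - Algebra.norm ℤ b := by
  rw [← intCast_dvd_intCast (K := K)]
  push_cast
  rw [← mul_conjInt_eq_norm, ← mul_conjInt_eq_norm]
  obtain ⟨c, hc⟩ := h
  have h1 : conjInt K a - conjInt K b = m * conjInt K c := by
    rw [← map_sub, hc, map_mul, map_intCast]
  exact ⟨c * conjInt K a + b * conjInt K c, by linear_combination conjInt K a * hc + b * h1⟩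

theorem norm_congr {m : ℕ} {a b : 𝓞 K} (h : (m : 𝓞 K) ∣ a - b) :
    ((Algebra.norm ℤ a : ℤ) : ZMod m) = ((Algebra.norm ℤ b : ℤ) : ZMod m) := by
  rw [← sub_eq_zero, ← Int.cast_sub, ZMod.intCast_zmod_eq_zero_iff_dvd]
  exact dvd_norm_sub_norm (by simpa using h)

theorem IsGood.normTwist {m M : ℕ} (hmM : m ∣ M) (h : IsGood φ l Ψ (Ideal.span {(M : 𝓞 K)}))
    {χ : MulChar (ZMod m) ℤ} (hχ : χ.IsQuadratic) :
    IsGood φ l (normTwist χ Ψ) (Ideal.span {(M : 𝓞 K)}) := by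
  have hM : M ≠ 0 := by
    rintro rfl
    exact h.ne_zero (by simp)
  have hm : m ≠ 0 := by rintro rfl; exact hM (Nat.eq_zero_of_zero_dvd hmM)
  have hd : (Ideal.span {(m : 𝓞 K)}) ∣ Ideal.span {(M : 𝓞 K)} :=
    Ideal.dvd_span_singleton.2 (Ideal.mem_span_singleton.2 (Nat.cast_dvd_cast hmM))
  have hv' : ∀ v : HeightOneSpectrum (𝓞 K), ¬ v.asIdeal ∣ Ideal.span {(M : 𝓞 K)} →
      IsCoprime v.asIdeal (Ideal.span {(m : 𝓞 K)}) := fun v hv =>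
    (isCoprime_prime_iff (span_ne_zero (Nat.cast_ne_zero.2 hm)) v).2 fun h' => hv (h'.trans hd)
  refine ⟨h.ne_zero, ?_, fun v hv => ?_, h.conj_not_dvd, fun v hv => ?_⟩
  · intro a b ha hb hab
    rw [etaHom_normTwist hm hχ (ha.mono hd), etaHom_normTwist hm hχ (hb.mono hd),
      h.isHecke a b ha hb hab, norm_congr (m := m)]
    exact (Nat.cast_dvd_cast hmM).trans (Ideal.mem_span_singleton.1 hab)
  · obtain ⟨x, hx⟩ := h.mem_range v hv
    refine ⟨x * (χ (Ideal.absNorm v.asIdeal : ℕ) : ℤ), ?_⟩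
    rw [primeUnit_normTwist hχ (hv' v hv), hx, map_mul, map_intCast]
  · rw [primeUnit_normTwist hχ (hv' v hv), primeUnit_normTwist hχ (hv' _ (h.conj_not_dvd v hv)),
      absNorm_conjPrime, h.map_conj v hv, map_mul, map_intCast]

theorem IsLocalSetup.normTwist {p s r m : ℕ} {e : ℤ} (h : IsLocalSetup φ l Ψ p s r e)
    (hm : m ∣ p ^ s) {χ : MulChar (ZMod m) ℤ} (hχ : χ.IsQuadratic) :
    IsLocalSetup φ l (normTwist χ Ψ) p s r e where
  prime := h.prime
  pos := h.pos
  good := h.good.normTwist (hm.mul_right r) hχ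
  not_dvd := h.not_dvd
  sub_one := h.sub_one
  dvd := h.dvd

theorem IsLocalSetup.locHom_normTwist {p s r m : ℕ} {e : ℤ} (h : IsLocalSetup φ l Ψ p s r e)
    (hm : m ∣ p ^ s) {χ : MulChar (ZMod m) ℤ} (hχ : χ.IsQuadratic) {x : 𝓞 K}
    (hx : IsCoprime x (p : 𝓞 K)) : locHom φ l (_root_.normTwist χ Ψ) e x =
      locHom φ l Ψ e x * (χ (Algebra.norm ℤ x : ℤ) : ℤ) := by
  have hm0 : m ≠ 0 := by
    rintro rfl
    exact pow_ne_zero s h.prime.ne_zero (Nat.eq_zero_of_zero_dvd hm)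
  rw [locHom, etaHom_normTwist hm0 hχ, locHom, norm_congr (m := m) (a := crtLift e x) (b := x)]
  · have : crtLift e x - x = (x - 1) * ((e : 𝓞 K) - 1) := by rw [crtLift]; ring
    rw [this]
    exact (Nat.cast_dvd_cast hm).trans (h.sub_one_dvd.mul_left _)
  · refine (h.primeTo_crtLift hx).mono (Ideal.dvd_span_singleton.2 (Ideal.mem_span_singleton.2 ?_))
    exact Nat.cast_dvd_cast (hm.mul_right r)

end NormTwist

/-! ### Split primes, Dirichlet's theorem and values of `η` at rational integers. -/

section SplitPrimes

variable {K : Type*} [Field K] [NumberField K] [Algebra.IsQuadraticExtension ℚ K]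
    [IsTotallyComplex K] {φ : K →+* ℂ} {l : ℕ} {Ψ : (FractionalIdeal (𝓞 K)⁰ K)ˣ →* ℂˣ}

theorem exists_prime_above {p : ℕ} (hp : p.Prime) :
    ∃ v : HeightOneSpectrum (𝓞 K), (p : 𝓞 K) ∈ v.asIdeal := by
  obtain ⟨P, hP, hle⟩ := Ideal.exists_le_maximal (Ideal.span {(p : 𝓞 K)}) (by
    rw [Ne, Ideal.span_singleton_eq_top]; exact not_isUnit_prime hp)
  have hpP : (p : 𝓞 K) ∈ P := hle (Ideal.mem_span_singleton_self _)
  refine ⟨⟨P, hP.isPrime, ?_⟩, hpP⟩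
  rintro rfl
  exact natCast_ne_zero_of_prime (K := K) hp (by simpa using hpP)

/-- A square root of the discriminant modulo `q` gives a root `x` of the polynomial of `θ`. Then `q`
divides `(θ - x) (t - θ - x)` but neither factor, so `(q)` is not prime. As it is not divisible by
the square of a prime, it is a prime times its conjugate. -/
theorem span_prime_eq_mul_conj {q : ℕ} (hq : q.Prime) (hd : ¬ (q : ℤ) ∣ discr K) (hq2 : q ≠ 2)
    (hsq : IsSquare ((discr K : ℤ) : ZMod q)) : ∃ v : HeightOneSpectrum (𝓞 K),
      Ideal.span {(q : 𝓞 K)} = v.asIdeal * (conjPrime v).asIdeal := by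
  obtain ⟨θ, t, n, h, ht⟩ := exists_isQuadGen (K := K)
  obtain ⟨v, hv⟩ := exists_prime_above (K := K) hq
  obtain ⟨y, hy⟩ := hsq
  have : Fact q.Prime := ⟨hq⟩
  have hcop : IsCoprime (q : ℤ) 4 := by
    have : Nat.Coprime q 4 := by
      rw [show 4 = 2 ^ 2 from rfl]
      exact Nat.Coprime.pow_right _ ((Nat.coprime_primes hq Nat.prime_two).2 hq2)
    exact_mod_cast Nat.isCoprime_iff_coprime.2 this
  obtain ⟨x, hx⟩ : ∃ x : ℤ, (q : ℤ) ∣ x ^ 2 - t * x + n := by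
    have h2 : (2 : ZMod q) ≠ 0 := by
      have : ((2 : ℕ) : ZMod q) ≠ 0 := by
        rw [Ne, ZMod.natCast_eq_zero_iff]
        exact fun h' => hq2 ((Nat.prime_dvd_prime_iff_eq hq Nat.prime_two).1 h')
      exact_mod_cast this
    refine ⟨((t + y) / 2 : ZMod q).val, ?_⟩
    rw [← ZMod.intCast_zmod_eq_zero_iff_dvd]
    push_cast
    rw [ZMod.natCast_zmod_val]
    rw [h.discr_eq] at hy
    push_cast at hy
    field_simp
    linear_combination -hy
  have hN : Ideal.absNorm v.asIdeal = q := by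
    rcases absNorm_prime_eq hq hv with h' | h'
    · exact h'
    · exfalso
      have e : v.asIdeal = Ideal.span {(q : 𝓞 K)} :=
        eq_of_dvd_of_absNorm_eq (span_ne_zero (natCast_ne_zero_of_prime hq))
          (Ideal.dvd_span_singleton.2 hv) (by rw [h', absNorm_span_prime])
      have hm : (θ - x) * (t - θ - x) ∈ v.asIdeal := by
        have e2 : (θ - x) * (t - θ - x) = ((x ^ 2 - t * x + n : ℤ) : 𝓞 K) := by
          push_cast; linear_combination -h.sq
        rw [e2, mem_iff_dvd hq hv]; exact hx
      have hq1 : ¬ (q : ℤ) ∣ 1 := fun h' => by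
        have := Int.isUnit_iff.1 (isUnit_of_dvd_one h')
        have := hq.two_le
        omega
      rcases v.isPrime.mem_or_mem hm with h1 | h1
      · rw [e, Ideal.mem_span_singleton] at h1
        refine hq1 ((h.dvd_iff (m := q) (a := -x) (b := 1)).1 ?_).2
        convert h1 using 1
        · simp
        · push_cast; ring
      · rw [e, Ideal.mem_span_singleton] at h1
        have := ((h.dvd_iff (m := q) (a := t - x) (b := -1)).1 (by
          convert h1 using 1
          · simp
          · push_cast; ring)).2
        exact hq1 (by simpa using this)
  obtain ⟨i, j, hij, he⟩ := eq_pow_mul_pow_of_absNorm_eq v 2 (𝔞 := Ideal.span {(q : 𝓞 K)})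
    (by rw [absNorm_span_prime, hN])
  have hi : i ≠ 2 := by
    rintro rfl
    exact not_sq_dvd_of_not_dvd_discr hq hd (v := v) (by rw [he]; exact dvd_mul_right _ _)
  have hj : j ≠ 2 := by
    rintro rfl
    exact not_sq_dvd_of_not_dvd_discr hq hd (v := conjPrime v) (by rw [he]; exact dvd_mul_left _ _)
  obtain ⟨rfl, rfl⟩ : i = 1 ∧ j = 1 := by omega
  exact ⟨v, by simpa using he⟩

variable {M : ℕ}

theorem IsGood.modulus_ne_zero (h : IsGood φ l Ψ (Ideal.span {(M : 𝓞 K)})) : M ≠ 0 := by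
  rintro rfl
  exact h.ne_zero (by simp)

theorem primeTo_intCast {m : ℤ} (hm : m ≠ 0) (hc : IsCoprime m M) :
    PrimeToIdeal (Ideal.span {(M : 𝓞 K)}) (m : 𝓞 K) :=
  ⟨by exact_mod_cast hm, (Ideal.isCoprime_span_singleton_iff _ _).2
    (by simpa using hc.map (Int.castRingHom (𝓞 K)))⟩

theorem IsGood.etaHom_int_congr (h : IsGood φ l Ψ (Ideal.span {(M : 𝓞 K)})) {m n : ℤ}
    (hm : m ≠ 0) (hn : n ≠ 0) (hc : IsCoprime m M) (hd : (M : ℤ) ∣ m - n) :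
    etaHom φ l Ψ (m : 𝓞 K) = etaHom φ l Ψ (n : 𝓞 K) := by
  refine h.isHecke _ _ (primeTo_intCast hm hc) (primeTo_intCast hn ?_) ?_
  · obtain ⟨c, hc'⟩ := hd
    have : m = n + M * c := by rw [← hc']; ring
    rwa [this, IsCoprime.add_mul_left_left_iff] at hc
  · rw [Ideal.mem_span_singleton]
    have := intCast_dvd_intCast (K := K).2 hd
    simpa using this

theorem IsGood.norm_etaHom {𝔐 : Ideal (𝓞 K)} (h : IsGood φ l Ψ 𝔐) {a : 𝓞 K}
    (ha : PrimeToIdeal 𝔐 a) : ‖etaHom φ l Ψ a‖ = 1 := by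
  obtain ⟨k, hk, hk'⟩ := h.isHecke.etaHom_pow_eq_one h.ne_zero ha
  exact Complex.norm_eq_one_of_pow_eq_one hk' hk.ne'

theorem embedding_natCast (q : ℕ) : φ ((q : 𝓞 K) : K) = q := by simp

/-- For `(q) = v v̄` the value of `Ψ` at `(q)` is `|Ψ(v)| ^ 2`, a positive real. Since `|η(q)| = 1`,
it equals `q ^ l`. -/
theorem IsGood.etaHom_split (h : IsGood φ l Ψ (Ideal.span {(M : 𝓞 K)})) {q : ℕ} (hq : q.Prime)
    (hqM : ¬ q ∣ M) (hd : ¬ (q : ℤ) ∣ discr K) (hq2 : q ≠ 2)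
    (hsq : IsSquare ((discr K : ℤ) : ZMod q)) : etaHom φ l Ψ (q : 𝓞 K) = 1 := by
  obtain ⟨v, hv⟩ := span_prime_eq_mul_conj hq hd hq2 hsq
  have hqM' : IsCoprime (q : ℤ) M := Nat.isCoprime_iff_coprime.2 (hq.coprime_iff_not_dvd.2 hqM)
  have hp := primeTo_intCast (K := K) (m := q) (by exact_mod_cast hq.ne_zero) hqM'
  rw [Int.cast_natCast] at hp
  have hvc : IsCoprime v.asIdeal (Ideal.span {(M : 𝓞 K)}) := by
    have := hp.2; rw [hv] at this; exact this.of_mul_left_left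
  have h1 := idealVal_span φ l Ψ hp.1
  rw [hv, map_mul, asIdeal_conjPrime, h.idealVal_conjIdeal v.ne_bot hvc, Complex.mul_conj,
    embedding_natCast] at h1
  have hn := h.norm_etaHom hp
  have h2 := congrArg (fun z : ℂ => ‖z‖) h1
  simp only [norm_mul, hn, one_mul, norm_pow, Complex.norm_natCast, Complex.norm_real,
    Real.norm_eq_abs, abs_of_nonneg (Complex.normSq_nonneg _)] at h2
  rw [h2] at h1
  have hq0 : ((q : ℂ)) ^ l ≠ 0 := pow_ne_zero _ (Nat.cast_ne_zero.2 hq.ne_zero)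
  apply mul_right_cancel₀ hq0
  rw [← h1]; push_cast; ring

theorem etaHom_neg_one : etaHom φ l Ψ (-1 : 𝓞 K) = (-1) ^ l := by
  rw [etaHom_apply, Ideal.span_singleton_neg, Ideal.span_singleton_one, idealVal_top]
  simp [← inv_pow]

theorem etaHom_neg (a : 𝓞 K) : etaHom φ l Ψ (-a) = (-1) ^ l * etaHom φ l Ψ a := by
  rw [← etaHom_neg_one (K := K) (φ := φ) (Ψ := Ψ), ← map_mul, neg_one_mul]

/-- The quadratic character of an imaginary field is odd. By reciprocity the symbol of `D` depends
only on the lower argument modulo `4 D`, and at `4 D - 1` it equals the symbol of `4 D ≡ 1`. The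
sign comes from `N ≡ 3` modulo `4`. -/
theorem jacobiSym_neg_of_dvd {D N : ℕ} (hD : D ≠ 0) (h : 4 * D ∣ N + 1) :
    jacobiSym (-(D : ℤ)) N = -1 := by
  obtain ⟨k, hk⟩ := h
  have hN4 : N % 4 = 3 := by
    have : N + 1 = 4 * (D * k) := by rw [hk]; ring
    omega
  have hodd : Odd N := Nat.odd_iff.2 (by omega)
  have hmod : N % (4 * D) = 4 * D - 1 := by
    have hk0 : k ≠ 0 := by rintro rfl; simp at hk
    obtain ⟨k, rfl⟩ := Nat.exists_eq_succ_of_ne_zero hk0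
    have h1 : N = (4 * D - 1) + 4 * D * k := by
      have : 4 * D * (k + 1) = 4 * D * k + 4 * D := by ring
      rw [this] at hk
      omega
    rw [h1, Nat.add_mul_mod_self_left, Nat.mod_eq_of_lt (by omega)]
  have hodd' : Odd (4 * D - 1) := Nat.odd_iff.2 (by omega)
  have h1 : jacobiSym (D : ℤ) (4 * D - 1) = 1 := by
    rw [← one_mul (jacobiSym (D : ℤ) _), ← jacobiSym.at_four hodd', ← jacobiSym.mul_left,
      jacobiSym.at_four hodd', jacobiSym.mod_left' (a₂ := 1), jacobiSym.one_left]
    rw [Int.emod_eq_emod_iff_emod_sub_eq_zero, ← Int.dvd_iff_emod_eq_zero]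
    exact ⟨1, by push_cast [Nat.cast_sub (show 1 ≤ 4 * D by omega)]; ring⟩
  rw [jacobiSym.neg _ hodd, jacobiSym.mod_right' _ hodd, hmod, h1, mul_one,
    ZMod.χ₄_nat_three_mod_four hN4]

/-- If `l` is even then `Ψ((n)) = n ^ l` for rational integers `n` prime to the modulus. -/
theorem IsGood.etaHom_intCast_of_even (h : IsGood φ l Ψ (Ideal.span {(M : 𝓞 K)})) (hl : Even l)
    {n : ℤ} (hn : IsCoprime n M) (hn0 : n ≠ 0) : etaHom φ l Ψ (n : 𝓞 K) = 1 := by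
  obtain ⟨D, hD⟩ : ∃ D : ℕ, discr K = -(D : ℤ) :=
    ⟨(discr K).natAbs, by have := discr_neg (K := K); omega⟩
  have hD0 : D ≠ 0 := by
    rintro rfl
    have := discr_neg (K := K); omega
  have hM0 := h.modulus_ne_zero
  -- A prime congruent to `n` modulo `M`, so large that it divides neither `M` nor the discriminant.
  obtain ⟨q, hqb, hq, hqn⟩ := Nat.forall_exists_prime_gt_and_zmodEq (4 * D * M) hM0 hn
  have hDM : 1 ≤ D * M := Nat.one_le_iff_ne_zero.2 (Nat.mul_ne_zero hD0 hM0)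
  have hMle : M ≤ D * M := Nat.le_mul_of_pos_left _ (Nat.pos_of_ne_zero hD0)
  have hDle : D ≤ D * M := Nat.le_mul_of_pos_right _ (Nat.pos_of_ne_zero hM0)
  have key : ∀ q : ℕ, q.Prime → 4 * D * M < q → jacobiSym (-(D : ℤ)) q = 1 →
      etaHom φ l Ψ (q : 𝓞 K) = 1 := by
    intro q hq hqb hJ
    have : Fact q.Prime := ⟨hq⟩
    have hb : 4 * (D * M) < q := by rw [← mul_assoc]; exact hqb
    refine h.etaHom_split hq (fun hd => ?_) (fun hd => ?_) (by omega) ?_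
    · have := Nat.le_of_dvd (Nat.pos_of_ne_zero hM0) hd
      omega
    · rw [hD, dvd_neg, Int.natCast_dvd_natCast] at hd
      have := Nat.le_of_dvd (Nat.pos_of_ne_zero hD0) hd
      omega
    · rw [hD]; exact ZMod.isSquare_of_jacobiSym_eq_one hJ
  have hb : 4 * (D * M) < q := by rw [← mul_assoc]; exact hqb
  have hqη : etaHom φ l Ψ (q : 𝓞 K) = etaHom φ l Ψ (n : 𝓞 K) := by
    have := h.etaHom_int_congr hn0 (n := q) (by exact_mod_cast hq.ne_zero) hn hqn.dvd
    simpa using this.symm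
  have hcop : ∀ m : ℕ, m ≠ 0 → m < q → IsCoprime (q : ℤ) m := fun m hm0 hm =>
    Nat.isCoprime_iff_coprime.2
      (hq.coprime_iff_not_dvd.2 fun hd => by have := Nat.le_of_dvd (Nat.pos_of_ne_zero hm0) hd; omega)
  rw [← hqη]
  have hqD : IsCoprime (q : ℤ) D := hcop D hD0 (by omega)
  rcases jacobiSym.eq_one_or_neg_one (a := -(D : ℤ)) (b := q)
    (Int.isCoprime_iff_gcd_eq_one.1 hqD.symm.neg_left) with hJ | hJ
  · exact key q hq hqb hJ
  -- If `q` is inert, choose a prime `q'` with `q q' ≡ -1` modulo `4 D M`. The symbol at `q q'` is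
  -- `-1`, so `q'` splits. Then `η(q) = η(q q') = η(-1) = (-1) ^ l = 1`.
  · have hc4 : IsCoprime (q : ℤ) ((4 * D * M : ℕ) : ℤ) := hcop _ (by rw [mul_assoc]; omega) hqb
    obtain ⟨u, w, huw⟩ := hc4
    obtain ⟨q', hqb', hq', hqn'⟩ := Nat.forall_exists_prime_gt_and_zmodEq (4 * D * M)
      (q := 4 * D * M) (a := -u) (by rw [mul_assoc]; omega)
      ⟨-q, w, by linear_combination huw⟩
    have hmul : ((4 * D * M : ℕ) : ℤ) ∣ ((q * q' : ℕ) : ℤ) + 1 := by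
      obtain ⟨c, hc⟩ := hqn'.dvd
      exact ⟨w - q * c, by push_cast at hc huw ⊢; linear_combination -(q : ℤ) * hc - huw⟩
    have hJ2 : jacobiSym (-(D : ℤ)) (q * q') = -1 := by
      apply jacobiSym_neg_of_dvd hD0
      have : ((4 * D * M : ℕ) : ℤ) ∣ ((q * q' + 1 : ℕ) : ℤ) := by exact_mod_cast hmul
      exact (Dvd.intro _ rfl).trans (Int.natCast_dvd_natCast.1 this)
    rw [jacobiSym.mul_right' _ hq.ne_zero hq'.ne_zero, hJ] at hJ2
    have h1 := key q' hq' hqb' (by linarith)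
    have h2 : etaHom φ l Ψ ((q * q' : ℕ) : 𝓞 K) = 1 := by
      have hd : (M : ℤ) ∣ (-1) - ((q * q' : ℕ) : ℤ) := by
        have : (M : ℤ) ∣ ((4 * D * M : ℕ) : ℤ) := by push_cast; exact dvd_mul_left _ _
        rw [← dvd_neg]
        convert this.trans hmul using 1; ring
      have := h.etaHom_int_congr (m := -1) (n := ((q * q' : ℕ) : ℤ)) (by norm_num)
        (by exact_mod_cast Nat.mul_ne_zero hq.ne_zero hq'.ne_zero) isCoprime_one_left.neg_left hd
      rw [Int.cast_natCast] at this
      rw [← this, Int.cast_neg, Int.cast_one, etaHom_neg_one, hl.neg_one_pow]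
    rw [Nat.cast_mul, map_mul, h1, mul_one] at h2
    exact h2

end SplitPrimes

/-! ### Local values at rational integers. -/

section LocalIntegers

variable {K : Type*} [Field K] [NumberField K] [Algebra.IsQuadraticExtension ℚ K]
    [IsTotallyComplex K] {φ : K →+* ℂ} {l : ℕ} {Ψ : (FractionalIdeal (𝓞 K)⁰ K)ˣ →* ℂˣ}
    {p s r : ℕ} {e : ℤ}

theorem isCoprime_intCast_iff {m n : ℤ} : IsCoprime (m : 𝓞 K) (n : 𝓞 K) ↔ IsCoprime m n := by
  constructor
  · rintro ⟨x, y, hxy⟩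
    rw [Int.isCoprime_iff_gcd_eq_one]
    obtain ⟨a, ha⟩ := Int.gcd_dvd_left m n
    obtain ⟨b, hb⟩ := Int.gcd_dvd_right m n
    have ha' := congrArg (Int.cast (R := 𝓞 K)) ha
    have hb' := congrArg (Int.cast (R := 𝓞 K)) hb
    rw [Int.cast_mul] at ha' hb'
    have h1 := int_unit_of_mul_eq_one (K := K) (d := (m.gcd n : ℤ)) (x := x * a + y * b) (by
      rw [← hxy]
      linear_combination -x * ha' - y * hb')
    rcases Int.isUnit_iff.1 h1 with h | h <;> omega
  · intro h
    simpa using h.map (Int.castRingHom (𝓞 K))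

theorem isCoprime_natCast_iff_not_dvd (hp : p.Prime) {x : 𝓞 K} :
    IsCoprime x (p : 𝓞 K) ↔ ¬ (p : ℤ) ∣ Algebra.norm ℤ x := by
  have hiff : IsCoprime (Algebra.norm ℤ x) (p : ℤ) ↔ ¬ (p : ℤ) ∣ Algebra.norm ℤ x := by
    rw [isCoprime_comm]
    exact (Nat.prime_iff_prime_int.1 hp).coprime_iff_not_dvd
  rw [← hiff, ← isCoprime_intCast_iff (K := K), ← mul_conjInt_eq_norm, Int.cast_natCast]
  exact ⟨fun h => h.mul_left (isCoprime_conjInt h), fun h => h.of_mul_left_left⟩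

theorem isCoprime_intCast_natCast_iff (hp : p.Prime) {m : ℤ} :
    IsCoprime (m : 𝓞 K) (p : 𝓞 K) ↔ ¬ (p : ℤ) ∣ m := by
  rw [← Int.cast_natCast, isCoprime_intCast_iff, isCoprime_comm]
  exact (Nat.prime_iff_prime_int.1 hp).coprime_iff_not_dvd

namespace IsLocalSetup

theorem locHom_intCast_of_even (h : IsLocalSetup φ l Ψ p s r e) (hl : Even l) {m : ℤ}
    (hm : IsCoprime (m : 𝓞 K) (p : 𝓞 K)) : locHom φ l Ψ e (m : 𝓞 K) = 1 := by
  have hp := h.primeTo_crtLift hm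
  have hc := (Ideal.isCoprime_span_singleton_iff _ _).1 hp.2
  rw [locHom]
  rw [crtLift_intCast] at hp hc ⊢
  refine h.good.etaHom_intCast_of_even hl ?_ (by exact_mod_cast hp.1)
  exact isCoprime_intCast_iff.1 (by simpa using hc)

end IsLocalSetup

end LocalIntegers

/-! ### Upper bounds for the exponent: the filtration by powers of `𝔮`. -/

section UpperBounds

/-- In `x ^ p - 1 = (1 + x + ⋯ + x ^ (p - 1)) (x - 1)` the first factor is congruent to `p`, hence
to `0`, modulo `I`. -/
theorem Ideal.pow_prime_sub_one_mem {R : Type*} [CommRing R] {I : Ideal R} {p : ℕ}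
    (hp : (p : R) ∈ I) {x : R} {n : ℕ} (hn : n ≠ 0) (hx : x - 1 ∈ I ^ n) :
    x ^ p - 1 ∈ I ^ (n + 1) := by
  have h1 : ∑ i ∈ Finset.range p, x ^ i ∈ I := by
    have h2 : ∑ i ∈ Finset.range p, (x ^ i - 1) ∈ I := by
      refine Ideal.sum_mem _ fun i _ => ?_
      exact Ideal.mem_of_dvd _ (sub_one_dvd_pow_sub_one x i) (Ideal.pow_le_self hn hx)
    rw [Finset.sum_sub_distrib] at h2
    simpa using Ideal.add_mem _ h2 (by simpa using hp :
      (∑ _i ∈ Finset.range p, (1 : R)) ∈ I)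
  rw [← geom_sum_mul x p, pow_succ']
  exact Ideal.mul_mem_mul h1 hx

theorem Ideal.pow_prime_pow_sub_one_mem {R : Type*} [CommRing R] {I : Ideal R} {p : ℕ}
    (hp : (p : R) ∈ I) {x : R} (hx : x - 1 ∈ I) (n : ℕ) :
    x ^ p ^ n - 1 ∈ I ^ (n + 1) := by
  induction n with
  | zero => simpa using hx
  | succ n ih =>
    rw [pow_succ p, pow_mul]
    exact Ideal.pow_prime_sub_one_mem hp n.succ_ne_zero ih

theorem eq_one_of_pow_eq_one_of_coprime {z : ℂ} {m n : ℕ} (hm : z ^ m = 1) (hn : z ^ n = 1)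
    (h : m.Coprime n) : z = 1 := by
  have := pow_gcd_eq_one.2 ⟨hm, hn⟩
  rwa [h.gcd_eq_one, pow_one] at this

variable {K : Type*} [Field K] [NumberField K] [Algebra.IsQuadraticExtension ℚ K]
    [IsTotallyComplex K] {φ : K →+* ℂ} {l : ℕ} {Ψ : (FractionalIdeal (𝓞 K)⁰ K)ˣ →* ℂˣ}
    {p s r c : ℕ} {e : ℤ} {𝔮 : Ideal (𝓞 K)}

theorem IsLocalIdeal.mem_pow_iff (h : IsLocalIdeal p 𝔮 c) (a m : ℕ) {x : 𝓞 K} :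
    x ∈ 𝔮 ^ (c * a + m) ↔ ∃ y ∈ 𝔮 ^ m, x = p ^ a * y := by
  rw [pow_add, pow_mul, h.pow_eq, Ideal.span_singleton_pow, Ideal.mem_span_singleton_mul]
  exact ⟨fun ⟨y, hy, h⟩ => ⟨y, hy, h.symm⟩, fun ⟨y, hy, h⟩ => ⟨y, hy, h.symm⟩⟩

theorem IsLocalIdeal.mem_pow_mul_iff (h : IsLocalIdeal p 𝔮 c) (a : ℕ) {x : 𝓞 K} :
    x ∈ 𝔮 ^ (c * a) ↔ (p : 𝓞 K) ^ a ∣ x := by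
  rw [pow_mul, h.pow_eq, Ideal.span_singleton_pow, Ideal.mem_span_singleton]

theorem IsLocalIdeal.isCoprime_of_sub_one_mem (h : IsLocalIdeal p 𝔮 c) {x : 𝓞 K} {j : ℕ}
    (hj : j ≠ 0) (hx : x - 1 ∈ 𝔮 ^ j) : IsCoprime x (p : 𝓞 K) :=
  IsLocalSetup.isCoprime_of_sub_mem h isCoprime_one_left hj
    (by rw [← neg_mem_iff]; simpa using hx)

theorem isCoprime_one_add_mul (p : ℕ) (y : 𝓞 K) : IsCoprime (1 + p * y) (p : 𝓞 K) := by
  rw [IsCoprime.add_mul_left_left_iff]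
  exact isCoprime_one_left

namespace IsLocalSetup

theorem locHom_pow_prime_pow (h : IsLocalSetup φ l Ψ p s r e) (h𝔮 : IsLocalIdeal p 𝔮 c)
    {x : 𝓞 K} (hx : x - 1 ∈ 𝔮) : locHom φ l Ψ e x ^ p ^ (c * s) = 1 := by
  have hxc := h𝔮.isCoprime_of_sub_one_mem one_ne_zero (by rwa [pow_one] : x - 1 ∈ 𝔮 ^ 1)
  rw [← h.locHom_pow hxc]
  exact h.locTriv_top h𝔮 _ hxc.pow_left
    (Ideal.pow_le_pow_right (Nat.le_succ _) (Ideal.pow_prime_pow_sub_one_mem h𝔮.natCast_mem hx _))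

/-- On the pro-`p` part only the `p`-part of the order of the group of roots of unity matters. -/
theorem locHom_pow_eq_one (h : IsLocalSetup φ l Ψ p s r e) (h𝔮 : IsLocalIdeal p 𝔮 c)
    {x : 𝓞 K} (hx : x - 1 ∈ 𝔮) {m k : ℕ} (hk : ¬ p ∣ k) (hw : locHom φ l Ψ e x ^ (m * k) = 1) :
    locHom φ l Ψ e x ^ m = 1 := by
  refine eq_one_of_pow_eq_one_of_coprime (m := p ^ (c * s)) (n := k) ?_ ?_
    ((h.prime.coprime_iff_not_dvd.2 hk).pow_left _)
  · rw [← pow_mul, pow_mul', h.locHom_pow_prime_pow h𝔮 hx, one_pow]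
  · rw [← pow_mul]; exact hw

theorem locTriv_one (h : IsLocalSetup φ l Ψ p s r e) (h𝔮 : IsLocalIdeal p 𝔮 c) {k : ℕ}
    (hk : ¬ p ∣ k) (hw : ∀ x : 𝓞 K, IsCoprime x (p : 𝓞 K) → locHom φ l Ψ e x ^ k = 1) :
    LocTriv φ l Ψ p e 𝔮 1 := by
  intro x hx hx1
  rw [pow_one] at hx1
  have := h.locHom_pow_eq_one h𝔮 hx1 (m := 1) hk (by rw [one_mul]; exact hw x hx)
  rwa [pow_one] at this

theorem locTriv_of_steps (h : IsLocalSetup φ l Ψ p s r e) (h𝔮 : IsLocalIdeal p 𝔮 c) {n : ℕ}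
    (H : ∀ j, n ≤ j → LocTriv φ l Ψ p e 𝔮 (j + 1) → LocTriv φ l Ψ p e 𝔮 j) :
    LocTriv φ l Ψ p e 𝔮 n := by
  by_cases hn : n ≤ c * s
  · refine Nat.decreasingInduction' (P := LocTriv φ l Ψ p e 𝔮) ?_ hn (h.locTriv_top h𝔮)
    exact fun j _ hj => H j hj
  · exact LocTriv.mono (by omega) (h.locTriv_top h𝔮)

/-- Here `(4) = 𝔮 ^ (2 c)`. An element `1 + 4 y` with `y ∈ 𝔮 ^ (m + 1)` agrees with `(1 + 2 y) ^ 2`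
up to `4 y ^ 2`, which lies one step deeper at least, and squares are killed. -/
theorem locTriv_of_sq (h : IsLocalSetup φ l Ψ 2 s r e) (h𝔮 : IsLocalIdeal 2 𝔮 c)
    (hw : ∀ x : 𝓞 K, x - 1 ∈ 𝔮 → locHom φ l Ψ e x ^ 2 = 1) :
    LocTriv φ l Ψ 2 e 𝔮 (2 * c + 1) := by
  refine h.locTriv_of_steps h𝔮 fun j hj ht x hx hx1 => ?_
  obtain ⟨m, rfl⟩ := Nat.exists_eq_add_of_le hj
  rw [show 2 * c + 1 + m = c * 2 + (m + 1) by ring, h𝔮.mem_pow_iff] at hx1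
  obtain ⟨y, hy, hxy⟩ := hx1
  push_cast at hxy
  have h1 : (1 + 2 * y) - 1 ∈ 𝔮 := by
    rw [add_sub_cancel_left]
    exact Ideal.mul_mem_right _ _ (by simpa using h𝔮.natCast_mem)
  have hc1 : IsCoprime (1 + 2 * y) ((2 : ℕ) : 𝓞 K) := by simpa using isCoprime_one_add_mul 2 y
  rw [LocTriv.congr h h𝔮 ht hx (y := (1 + 2 * y) ^ 2) hc1.pow_left, h.locHom_pow hc1, hw _ h1]
  have : x - (1 + 2 * y) ^ 2 = ((2 : ℕ) : 𝓞 K) ^ 2 * (-y ^ 2) := by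
    push_cast; linear_combination hxy
  rw [this, show 2 * c + 1 + m + 1 = c * 2 + (m + 2) by ring, h𝔮.mem_pow_iff]
  refine ⟨_, neg_mem ?_, rfl⟩
  have h2 := Ideal.pow_mem_pow hy 2
  rw [← pow_mul] at h2
  exact Ideal.pow_le_pow_right (by omega) h2

variable {v : HeightOneSpectrum (𝓞 K)}

/-- With residue field `𝔽_p`, the quotient of `1 + v ^ n` by `1 + v ^ (n + 1)` is cyclic of order
`p`, generated by any element at exact level `n`. So one value decides a step of the descent. -/
theorem locTriv_of_succ (h : IsLocalSetup φ l Ψ p s r e) (hv : IsLocalIdeal p v.asIdeal c)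
    (hN : Ideal.absNorm v.asIdeal = p) {n : ℕ} (hn : n ≠ 0) {g : 𝓞 K}
    (hg : g - 1 ∈ v.asIdeal ^ n) (hg' : g - 1 ∉ v.asIdeal ^ (n + 1))
    (hL : locHom φ l Ψ e g = 1) (ht : LocTriv φ l Ψ p e v.asIdeal (n + 1)) :
    LocTriv φ l Ψ p e v.asIdeal n := by
  intro x hx hx1
  obtain ⟨d, y, hy, hd⟩ := Ideal.exists_mul_add_mem_pow_succ v.ne_bot _ _ hg hg' hx1
  obtain ⟨m, hm⟩ := exists_int_sub_mem h.prime hN d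
  have hgc := hv.isCoprime_of_sub_one_mem hn hg
  rw [LocTriv.congr h hv ht hx (y := g ^ m) hgc.pow_left, h.locHom_pow hgc, hL, one_pow]
  have h1 : ∑ i ∈ Finset.range m, g ^ i - m ∈ v.asIdeal := by
    have h2 : ∑ i ∈ Finset.range m, (g ^ i - 1) ∈ v.asIdeal := by
      refine Ideal.sum_mem _ fun i _ => ?_
      exact Ideal.mem_of_dvd _ (sub_one_dvd_pow_sub_one g i) (Ideal.pow_le_self hn hg)
    rw [Finset.sum_sub_distrib] at h2
    simpa using h2
  have h3 : (d - ∑ i ∈ Finset.range m, g ^ i) * (g - 1) ∈ v.asIdeal ^ (n + 1) := by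
    rw [pow_succ']
    refine Ideal.mul_mem_mul ?_ hg
    have := Ideal.sub_mem _ hm h1
    simpa using this
  have h4 := Ideal.add_mem _ h3 hy
  rw [sub_mul, geom_sum_mul] at h4
  convert h4 using 1
  linear_combination -hd

/-- With residue field `𝔽_p`, every `x` is congruent to a rational integer, so the values at
rational integers suffice. -/
theorem locTriv_zero (h : IsLocalSetup φ l Ψ p s r e) (hv : IsLocalIdeal p v.asIdeal c)
    (hN : Ideal.absNorm v.asIdeal = p)
    (hL : ∀ m : ℕ, IsCoprime (m : 𝓞 K) (p : 𝓞 K) → locHom φ l Ψ e (m : 𝓞 K) = 1)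
    (ht : LocTriv φ l Ψ p e v.asIdeal 1) : LocTriv φ l Ψ p e v.asIdeal 0 := by
  intro x hx _
  obtain ⟨m, hm⟩ := exists_int_sub_mem h.prime hN x
  rw [← pow_one v.asIdeal] at hm
  have hmc := isCoprime_of_sub_mem hv hx one_ne_zero hm
  rw [LocTriv.congr h hv ht hx hmc hm, hL m hmc]

/-- At a ramified prime above `2` the conductor exponent is never `1`. -/
theorem locTriv_zero_of_two (h : IsLocalSetup φ l Ψ 2 s r e) (hv : IsLocalIdeal 2 v.asIdeal c)
    (hN : Ideal.absNorm v.asIdeal = 2) (ht : LocTriv φ l Ψ 2 e v.asIdeal 1) :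
    LocTriv φ l Ψ 2 e v.asIdeal 0 := by
  refine h.locTriv_zero hv hN (fun m hm => ht _ hm ?_) ht
  have hm2 := (isCoprime_intCast_natCast_iff (K := K) Nat.prime_two (m := m)).1 (by simpa using hm)
  have h2 : (2 : ℤ) ∣ m - 1 := by push_cast at hm2; omega
  obtain ⟨k, hk⟩ := h2
  have hk' := congrArg (Int.cast (R := 𝓞 K)) hk
  push_cast at hk'
  rw [pow_one, hk']
  exact Ideal.mul_mem_right _ _ (by simpa using hv.natCast_mem)

end IsLocalSetup

end UpperBounds

/-! ### Odd primes. -/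

section OddPrimes

variable {K : Type*} [Field K] [NumberField K] [Algebra.IsQuadraticExtension ℚ K]
    [IsTotallyComplex K] {φ : K →+* ℂ} {l : ℕ} {Ψ : (FractionalIdeal (𝓞 K)⁰ K)ˣ →* ℂˣ}
    {p s r c : ℕ} {e : ℤ} {𝔮 : Ideal (𝓞 K)} {v : HeightOneSpectrum (𝓞 K)}

namespace IsLocalSetup

/-- On `1 + 𝔮` the component has `p`-power order, while its values have order dividing `4`, or `6`
for discriminant `-3`. These are incompatible unless trivial or `p = 3`. -/
theorem locTriv_one_of_odd (h : IsLocalSetup φ l Ψ p s r e) (h𝔮 : IsLocalIdeal p 𝔮 c)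
    (hp2 : p ≠ 2) (hp3 : ¬ (p = 3 ∧ discr K = -3)) : LocTriv φ l Ψ p e 𝔮 1 := by
  have hp := h.prime
  have h2 : ¬ p ∣ 2 := fun h' => hp2 ((Nat.prime_dvd_prime_iff_eq hp Nat.prime_two).1 h')
  by_cases h3 : discr K = -3
  · refine h.locTriv_one h𝔮 (k := 6) (fun h' => ?_)
      fun x hx => h.locHom_pow_six (by rw [h3]; norm_num) hx
    rcases (Nat.Prime.dvd_mul hp).1 (show p ∣ 2 * 3 from h') with h' | h'
    · exact h2 h'
    · exact hp3 ⟨(Nat.prime_dvd_prime_iff_eq hp Nat.prime_three).1 h', h3⟩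
  · exact h.locTriv_one h𝔮 (k := 4) (fun h' => h2 (hp.dvd_of_dvd_pow (show p ∣ 2 ^ 2 from h')))
      fun x hx => h.locHom_pow_four h3 hx

theorem locTriv_zero_of_even (h : IsLocalSetup φ l Ψ p s r e) (hv : IsLocalIdeal p v.asIdeal c)
    (hN : Ideal.absNorm v.asIdeal = p) (hl : Even l) (ht : LocTriv φ l Ψ p e v.asIdeal 1) :
    LocTriv φ l Ψ p e v.asIdeal 0 :=
  h.locTriv_zero hv hN (fun m hm => by
    have := h.locHom_intCast_of_even hl (m := m) (by simpa using hm)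
    simpa using this) ht

/-- A character of odd weight is ramified at each ramified prime. -/
theorem not_locTriv_zero (h : IsLocalSetup φ l Ψ p s r e) (hv : IsLocalIdeal p v.asIdeal 2)
    (hvc : conjPrime v = v) (hpv : (p : 𝓞 K) ∈ v.asIdeal) (hl : Odd l) :
    ¬ LocTriv φ l Ψ p e v.asIdeal 0 := by
  intro ht
  have hF := (h.factorsMod_iff_locTriv hv (Nat.zero_le _)).2 ht
  rw [pow_zero, one_mul] at hF
  have hd : Ideal.span {(r : 𝓞 K)} ∣ Ideal.span {((p ^ s * r : ℕ) : 𝓞 K)} := by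
    rw [Ideal.dvd_span_singleton, Ideal.mem_span_singleton]
    exact Nat.cast_dvd_cast (dvd_mul_left _ _)
  -- A trivial component at `p` would let the character extend to `v`. Its value there lies in `K`
  -- and is real because `v` is self-conjugate, so it is a rational number `q`. As `v ^ 2 = (p)`,
  -- this gives `q ^ 2 = p ^ l`, against the parity of the `p`-adic valuation.
  obtain ⟨Ψ', hΨ', hag⟩ := exists_descent h.good.ne_zero hd hF
  have hg := h.good.descent hd (conjIdeal_span_natCast r) hΨ' hag
  have hvr : ¬ v.asIdeal ∣ Ideal.span {(r : 𝓞 K)} := by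
    rw [Ideal.dvd_span_singleton]
    intro hr
    have := int_dvd_of_mem h.prime hpv (m := r) (by simpa using hr)
    exact h.not_dvd (by exact_mod_cast this)
  obtain ⟨x, hx⟩ := hg.mem_range v hvr
  obtain ⟨q, hq⟩ := exists_rat_of_conj_eq φ (x := x) (by
    rw [← hx, ← hg.map_conj v hvr, hvc])
  have hpp := primeTo_intCast (K := K) (M := r) (m := p) (by exact_mod_cast h.prime.ne_zero)
    (Nat.isCoprime_iff_coprime.2 (h.prime.coprime_iff_not_dvd.2 h.not_dvd))
  rw [Int.cast_natCast] at hpp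
  have h1 := idealVal_span φ l Ψ' hpp.1
  rw [← hv.pow_eq, map_pow, idealVal_prime, hx, hq, embedding_natCast] at h1
  have h2 := congrArg (fun z : ℂ => ‖z‖) h1
  simp only [norm_mul, norm_pow, hg.norm_etaHom hpp, one_mul, Complex.norm_natCast,
    Complex.norm_ratCast] at h2
  have h3 : q ^ 2 = (p : ℚ) ^ l := by
    rw [sq_abs] at h2
    exact_mod_cast h2
  have : Fact p.Prime := ⟨h.prime⟩
  have hq0 : q ≠ 0 := by
    rintro rfl
    rw [zero_pow two_ne_zero] at h3
    exact pow_ne_zero l (Nat.cast_ne_zero.2 h.prime.ne_zero) h3.symm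
  have h4 := congrArg (padicValRat p) h3
  rw [padicValRat.pow, padicValRat.pow, padicValRat.self h.prime.one_lt] at h4
  obtain ⟨k, rfl⟩ := hl
  push_cast at h4
  omega

end IsLocalSetup

/-- Four times the norm of `a + b θ` is `(2 a + t b) ^ 2 - discr K * b ^ 2`. Over `𝔽_p` a sum of two
such quadratic polynomials takes every value, by counting. -/
theorem exists_norm_congr (hp : p.Prime) (hp2 : p ≠ 2) (hd : ¬ (p : ℤ) ∣ discr K) (m : ZMod p) :
    ∃ x : 𝓞 K, ((Algebra.norm ℤ x : ℤ) : ZMod p) = m := by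
  obtain ⟨θ, t, n, h, ht⟩ := exists_isQuadGen (K := K)
  have : Fact p.Prime := ⟨hp⟩
  have h2 : (2 : ZMod p) ≠ 0 := by
    have : ((2 : ℕ) : ZMod p) ≠ 0 := by
      rw [Ne, ZMod.natCast_eq_zero_iff]
      exact fun h' => hp2 ((Nat.prime_dvd_prime_iff_eq hp Nat.prime_two).1 h')
    exact_mod_cast this
  have hd' : ((discr K : ℤ) : ZMod p) ≠ 0 := by rwa [Ne, ZMod.intCast_zmod_eq_zero_iff_dvd]
  open Polynomial in
  obtain ⟨a, b, hab⟩ := FiniteField.exists_root_sum_quadratic (R := ZMod p)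
    (f := C 1 * X ^ 2 + C 0 * X + C (-4 * m)) (g := C (-((discr K : ℤ) : ZMod p)) * X ^ 2 + C 0 * X + C 0)
    (degree_quadratic one_ne_zero) (degree_quadratic (neg_ne_zero.2 hd'))
    (by rw [ZMod.card]; rcases hp.eq_two_or_odd with h | h; exacts [absurd h hp2, h])
  simp only [Polynomial.eval_add, Polynomial.eval_mul, Polynomial.eval_C, Polynomial.eval_pow,
    Polynomial.eval_X] at hab
  refine ⟨((((a - t * b) / 2 : ZMod p).val : ℤ) : 𝓞 K) + ((b.val : ℤ) : 𝓞 K) * θ, ?_⟩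
  rw [h.norm_eq]
  rw [h.discr_eq] at hab
  push_cast at hab ⊢
  rw [ZMod.natCast_zmod_val, ZMod.natCast_zmod_val]
  field_simp
  linear_combination hab

theorem norm_ne_zero_mod (hp : p.Prime) {x : 𝓞 K} (hx : IsCoprime x (p : 𝓞 K)) :
    ((Algebra.norm ℤ x : ℤ) : ZMod p) ≠ 0 := by
  rw [Ne, ZMod.intCast_zmod_eq_zero_iff_dvd]
  exact (isCoprime_natCast_iff_not_dvd hp).1 hx

namespace IsLocalSetup

variable [Fact p.Prime]

theorem exists_of_locTriv_zero (h : IsLocalSetup φ l Ψ p s r e) (hp2 : p ≠ 2)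
    (hd : ¬ (p : ℤ) ∣ discr K) (ht : LocTriv φ l Ψ p e 𝔮 0) :
    ¬ LocTriv φ l (_root_.normTwist (quadraticChar (ZMod p)) Ψ) p e 𝔮 0 := by
  intro ht'
  obtain ⟨m, hm⟩ := quadraticChar_exists_neg_one (F := ZMod p) (by
    rwa [ZMod.ringChar_zmod_n])
  obtain ⟨x, hx⟩ := exists_norm_congr (K := K) h.prime hp2 hd m
  have hxc : IsCoprime x (p : 𝓞 K) := by
    rw [isCoprime_natCast_iff_not_dvd h.prime, ← ZMod.intCast_zmod_eq_zero_iff_dvd, hx]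
    rintro rfl
    simp at hm
  have h1 := ht' x hxc (by simp)
  rw [h.locHom_normTwist (dvd_pow_self p h.pos.ne') (quadraticChar_isQuadratic _) hxc,
    ht x hxc (by simp), hx, hm] at h1
  norm_num at h1

/-- The claim is that a nontrivial component is the quadratic character of the norm. It is trivial
on rational integers, since these are norms modulo `p`. If `N(u) ≡ k ^ 2` and `z = k + u`, then `z̄
u ≡ k z`; as the values are `±1`, this forces the value at `u` to be `1`. One of `k + u` and `-k +
u` is prime to `p`, because their norms add up to `4 k ^ 2` modulo `p`. So the component is trivial
where the norm is a square, and nontriviality makes it `-1` elsewhere. -/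
theorem locTriv_zero_normTwist (h : IsLocalSetup φ l Ψ p s r e) (h𝔮 : IsLocalIdeal p 𝔮 c)
    (hp2 : p ≠ 2) (hd : ¬ (p : ℤ) ∣ discr K)
    (hw : ∀ x : 𝓞 K, IsCoprime x (p : 𝓞 K) → locHom φ l Ψ e x ^ 2 = 1)
    (ht1 : LocTriv φ l Ψ p e 𝔮 1) (ht : ¬ LocTriv φ l Ψ p e 𝔮 0) :
    LocTriv φ l (_root_.normTwist (quadraticChar (ZMod p)) Ψ) p e 𝔮 0 := by
  have hcongr : ∀ x y : 𝓞 K, IsCoprime x (p : 𝓞 K) → (p : 𝓞 K) ∣ x - y →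
      locHom φ l Ψ e x = locHom φ l Ψ e y := by
    intro x y hx hxy
    refine LocTriv.congr h h𝔮 ht1 hx (isCoprime_congr hx hxy) ?_
    rw [pow_one]
    exact Ideal.mem_of_dvd _ hxy h𝔮.natCast_mem
  have hint : ∀ n : ℤ, IsCoprime (n : 𝓞 K) (p : 𝓞 K) → locHom φ l Ψ e (n : 𝓞 K) = 1 := by
    intro n hn
    obtain ⟨x, hx⟩ := exists_norm_congr (K := K) h.prime hp2 hd n
    have hdvd : (p : 𝓞 K) ∣ (n : 𝓞 K) - (Algebra.norm ℤ x : ℤ) := by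
      have : (p : ℤ) ∣ n - Algebra.norm ℤ x := by
        rw [← ZMod.intCast_zmod_eq_zero_iff_dvd]; push_cast; rw [hx, sub_self]
      simpa using intCast_dvd_intCast (K := K).2 this
    rw [hcongr _ _ hn hdvd, ← mul_conjInt_eq_norm]
    have hc := isCoprime_congr hn hdvd
    rw [← mul_conjInt_eq_norm] at hc
    exact h.locHom_norm hc.of_mul_left_left
  have hreal : ∀ x : 𝓞 K, IsCoprime x (p : 𝓞 K) →
      conj (locHom φ l Ψ e x) = locHom φ l Ψ e x := by
    intro x hx
    rcases sq_eq_one_iff.1 (hw x hx) with h' | h' <;> rw [h'] <;> simp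
  have hsub : ∀ (u : 𝓞 K) (k : ℤ), IsCoprime u (p : 𝓞 K) → IsCoprime (k : 𝓞 K) (p : 𝓞 K) →
      (p : 𝓞 K) ∣ (Algebra.norm ℤ u : ℤ) - k ^ 2 → IsCoprime (k + u) (p : 𝓞 K) →
      locHom φ l Ψ e u = 1 := by
    intro u k hu hk hN hz
    have hzc : conjInt K (k + u) = k + conjInt K u := by rw [map_add, map_intCast]
    have hzc' := isCoprime_conjInt hz
    have h1 : locHom φ l Ψ e (conjInt K (k + u) * u) = locHom φ l Ψ e (k * (k + u)) := by
      refine hcongr _ _ (hzc'.mul_left hu) ?_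
      rw [hzc]
      have e1 : (k + conjInt K u) * u - k * (k + u) = (Algebra.norm ℤ u : ℤ) - (k : 𝓞 K) ^ 2 := by
        rw [← mul_conjInt_eq_norm]; ring
      rwa [e1]
    rw [h.locHom_mul hzc' hu, h.locHom_mul hk hz, h.locHom_conj hz, hreal _ hz, hint k hk,
      one_mul] at h1
    exact mul_left_cancel₀ (h.locHom_ne_zero hz) (by rw [h1, mul_one])
  have hsq : ∀ u : 𝓞 K, IsCoprime u (p : 𝓞 K) →
      quadraticChar (ZMod p) (Algebra.norm ℤ u : ℤ) = 1 → locHom φ l Ψ e u = 1 := by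
    intro u hu hχ
    obtain ⟨k₀, hk₀⟩ := (quadraticChar_one_iff_isSquare (norm_ne_zero_mod h.prime hu)).1 hχ
    obtain ⟨k, hkdef⟩ : ∃ k : ℤ, k = (k₀.val : ℕ) := ⟨_, rfl⟩
    have hk' : (k : ZMod p) = k₀ := by rw [hkdef]; push_cast; exact ZMod.natCast_zmod_val _
    have hN : (p : ℤ) ∣ Algebra.norm ℤ u - k ^ 2 := by
      rw [← ZMod.intCast_zmod_eq_zero_iff_dvd]; push_cast; rw [hk', hk₀]; ring
    have hN' : (p : 𝓞 K) ∣ (Algebra.norm ℤ u : ℤ) - (k : 𝓞 K) ^ 2 := by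
      simpa using intCast_dvd_intCast (K := K).2 hN
    have hkp : ¬ (p : ℤ) ∣ k := by
      intro h'
      rw [← ZMod.intCast_zmod_eq_zero_iff_dvd, hk'] at h'
      rw [h', mul_zero] at hk₀
      exact norm_ne_zero_mod h.prime hu hk₀
    have hk : IsCoprime (k : 𝓞 K) (p : 𝓞 K) := (isCoprime_intCast_natCast_iff h.prime).2 hkp
    by_cases hz : IsCoprime (k + u) (p : 𝓞 K)
    · exact hsub u k hu hk hN' hz
    by_cases hz' : IsCoprime (((-k : ℤ) : 𝓞 K) + u) (p : 𝓞 K)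
    · exact hsub u (-k) hu (by rw [Int.cast_neg]; exact hk.neg_left)
        (by rw [Int.cast_neg, neg_sq]; exact hN') hz'
    exfalso
    rw [isCoprime_natCast_iff_not_dvd h.prime, not_not] at hz hz'
    have e1 : Algebra.norm ℤ ((k : 𝓞 K) + u) + Algebra.norm ℤ (((-k : ℤ) : 𝓞 K) + u) =
        2 * (Algebra.norm ℤ u - k ^ 2) + (2 * 2) * (k * k) := by
      apply Int.cast_injective (α := 𝓞 K)
      push_cast
      rw [← mul_conjInt_eq_norm, ← mul_conjInt_eq_norm, ← mul_conjInt_eq_norm]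
      simp only [map_add, map_neg, map_intCast]
      ring
    have h1 := (dvd_add hz hz')
    rw [e1, dvd_add_right (hN.mul_left 2)] at h1
    have hpi := Nat.prime_iff_prime_int.1 h.prime
    have h2 : ¬ (p : ℤ) ∣ 2 := fun h' =>
      hp2 ((Nat.prime_dvd_prime_iff_eq h.prime Nat.prime_two).1 (by exact_mod_cast h'))
    rcases hpi.dvd_or_dvd h1 with h' | h'
    · rcases hpi.dvd_or_dvd h' with h' | h' <;> exact h2 h'
    · rcases hpi.dvd_or_dvd h' with h' | h' <;> exact hkp h'
  have ht' : ∃ x₀ : 𝓞 K, IsCoprime x₀ (p : 𝓞 K) ∧ locHom φ l Ψ e x₀ ≠ 1 := by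
    by_contra! hcon
    exact ht fun x hx _ => hcon x hx
  obtain ⟨x₀, hx₀, hL₀⟩ := ht'
  have hL₀' : locHom φ l Ψ e x₀ = -1 := (sq_eq_one_iff.1 (hw x₀ hx₀)).resolve_left hL₀
  have hχ₀ := (quadraticChar_dichotomy (norm_ne_zero_mod h.prime hx₀)).resolve_left
    fun h' => hL₀ (hsq x₀ hx₀ h')
  intro x hx _
  rw [h.locHom_normTwist (dvd_pow_self p h.pos.ne') (quadraticChar_isQuadratic _) hx]
  rcases quadraticChar_dichotomy (norm_ne_zero_mod h.prime hx) with hχ | hχ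
  · rw [hsq x hx hχ, hχ]; norm_num
  · have h1 := hsq (x * x₀) (hx.mul_left hx₀) (by
      rw [map_mul, Int.cast_mul, map_mul, hχ, hχ₀]; norm_num)
    rw [h.locHom_mul hx hx₀, hL₀'] at h1
    have h2 : locHom φ l Ψ e x = -1 := by linear_combination -h1
    rw [h2, hχ]; norm_num

end IsLocalSetup

end OddPrimes

/-! ### The prime `2` when it is unramified. -/

section UnramifiedTwo

variable {K : Type*} [Field K] [NumberField K] [Algebra.IsQuadraticExtension ℚ K]
    [IsTotallyComplex K] {φ : K →+* ℂ} {l : ℕ} {Ψ : (FractionalIdeal (𝓞 K)⁰ K)ˣ →* ℂˣ}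
    {p s r c : ℕ} {e : ℤ} {𝔮 : Ideal (𝓞 K)}

theorem exists_isQuadGen_of_not_dvd (hd : ¬ (2 : ℤ) ∣ discr K) :
    ∃ (θ : 𝓞 K) (n : ℤ), IsQuadGen θ 1 n := by
  obtain ⟨θ, t, n, h, rfl | rfl⟩ := exists_isQuadGen (K := K)
  · rw [h.discr_eq] at hd
    exact absurd ⟨-2 * n, by ring⟩ hd
  · exact ⟨θ, n, h⟩

theorem isCoprime_one_add_two (y : 𝓞 K) : IsCoprime (1 + 2 * y) ((2 : ℕ) : 𝓞 K) := by
  simpa using isCoprime_one_add_mul 2 y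

theorem isCoprime_odd {m : ℤ} (hm : Odd m) : IsCoprime (m : 𝓞 K) ((2 : ℕ) : 𝓞 K) := by
  obtain ⟨k, rfl⟩ := hm
  have := isCoprime_one_add_two (K := K) k
  rw [add_comm] at this
  exact_mod_cast this

namespace IsLocalSetup

theorem locHom_sq_of_two (h : IsLocalSetup φ l Ψ 2 s r e) (h𝔮 : IsLocalIdeal 2 𝔮 c)
    (h4 : discr K ≠ -4) {x : 𝓞 K} (hx : x - 1 ∈ 𝔮) : locHom φ l Ψ e x ^ 2 = 1 := by
  have hxc := h𝔮.isCoprime_of_sub_one_mem one_ne_zero (by rwa [pow_one] : x - 1 ∈ 𝔮 ^ 1)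
  exact h.locHom_pow_eq_one h𝔮 hx (m := 2) (k := 3) (by norm_num) (h.locHom_pow_six h4 hxc)

variable {θ : 𝓞 K} {n : ℤ}

/-- For `j ≥ 1` the step from `1 + 2 ^ j 𝓞 K` to `1 + 2 ^ (j + 1) 𝓞 K` is the additive group of `𝓞 K
/ 2`, generated by the classes of `1` and `θ`. -/
theorem locTriv_step_unramified (h : IsLocalSetup φ l Ψ 2 s r e) (h𝔮 : IsLocalIdeal 2 𝔮 1)
    (hθ : IsQuadGen θ 1 n) {j : ℕ} (hj : j ≠ 0) (ht : LocTriv φ l Ψ 2 e 𝔮 (j + 1))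
    (h1 : locHom φ l Ψ e (1 + 2 ^ j) = 1) (h2 : locHom φ l Ψ e (1 + 2 ^ j * θ) = 1) :
    LocTriv φ l Ψ 2 e 𝔮 j := by
  obtain ⟨j, rfl⟩ : ∃ k, j = k + 1 := ⟨j - 1, by omega⟩
  have hmem : ∀ (m : ℕ) (x : 𝓞 K), x ∈ 𝔮 ^ m ↔ (2 : 𝓞 K) ^ m ∣ x := by
    intro m x
    rw [← one_mul m, h𝔮.mem_pow_mul_iff, one_mul]
    push_cast; rfl
  have hc : ∀ y : 𝓞 K, IsCoprime (1 + 2 ^ (j + 1) * y) ((2 : ℕ) : 𝓞 K) := by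
    intro y
    have := isCoprime_one_add_two (2 ^ j * y)
    rwa [← mul_assoc, ← pow_succ'] at this
  have hc1 : IsCoprime (1 + 2 ^ (j + 1) : 𝓞 K) ((2 : ℕ) : 𝓞 K) := by simpa using hc 1
  intro x hx hx1
  rw [hmem] at hx1
  obtain ⟨y, hy⟩ := hx1
  obtain ⟨a, b, rfl⟩ := hθ.exists_eq y
  obtain ⟨a', ha⟩ := Int.even_or_odd' a
  obtain ⟨b', hb⟩ := Int.even_or_odd' b
  have key : ∀ g : 𝓞 K, IsCoprime g ((2 : ℕ) : 𝓞 K) → locHom φ l Ψ e g = 1 →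
      (∃ z, x - g = 2 ^ (j + 2) * z) → locHom φ l Ψ e x = 1 := by
    rintro g hg hgL ⟨z, hz⟩
    rw [LocTriv.congr h h𝔮 ht hx hg, hgL]
    rw [hmem]
    exact ⟨z, hz⟩
  rcases ha with rfl | rfl <;> rcases hb with rfl | rfl
  · refine key 1 isCoprime_one_left locHom_one ⟨a' + b' * θ, ?_⟩
    rw [hy]; push_cast; ring
  · refine key _ (hc θ) h2 ⟨a' + b' * θ, ?_⟩
    push_cast at hy
    linear_combination hy
  · refine key _ hc1 h1 ⟨a' + b' * θ, ?_⟩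
    push_cast at hy
    linear_combination hy
  · refine key _ (hc1.mul_left (hc θ)) (by rw [h.locHom_mul hc1 (hc θ), h1, h2, one_mul])
      ⟨a' + b' * θ - 2 ^ j * θ, ?_⟩
    push_cast at hy
    linear_combination hy

/-- Modulo `8`, the integer `5` is the norm of `1 + 4 θ`. -/
theorem locHom_five (h : IsLocalSetup φ l Ψ 2 s r e) (h𝔮 : IsLocalIdeal 2 𝔮 1)
    (hθ : IsQuadGen θ 1 n) (ht : LocTriv φ l Ψ 2 e 𝔮 3) : locHom φ l Ψ e (1 + 2 ^ 2) = 1 := by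
  have hc := isCoprime_one_add_two (2 * θ)
  have h5 : IsCoprime (1 + 2 ^ 2 : 𝓞 K) ((2 : ℕ) : 𝓞 K) := by
    have := isCoprime_one_add_two (K := K) 2
    convert this using 1; ring
  have hN := h.locHom_norm hc
  rw [mul_conjInt_eq_norm] at hN
  rw [← hN]
  refine LocTriv.congr h h𝔮 ht h5 ?_ ?_
  · rw [← mul_conjInt_eq_norm]; exact hc.mul_left (isCoprime_conjInt hc)
  · rw [← one_mul 3, h𝔮.mem_pow_mul_iff, ← mul_conjInt_eq_norm]
    refine ⟨-2 * n, ?_⟩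
    simp only [map_add, map_mul, map_one, map_ofNat, hθ.conj_eq]
    have := hθ.sq
    push_cast at this ⊢
    linear_combination 4 ^ 2 * this

/-- Modulo `4`, the integer `3` is the norm of `1 + 2 θ`. -/
theorem locHom_three (h : IsLocalSetup φ l Ψ 2 s r e) (h𝔮 : IsLocalIdeal 2 𝔮 1)
    (hθ : IsQuadGen θ 1 n) (ht : LocTriv φ l Ψ 2 e 𝔮 2) : locHom φ l Ψ e (1 + 2 ^ 1) = 1 := by
  have hc := isCoprime_one_add_two θ
  have h3 : IsCoprime (1 + 2 ^ 1 : 𝓞 K) ((2 : ℕ) : 𝓞 K) := by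
    have := isCoprime_one_add_two (K := K) 1
    convert this using 1; ring
  have hN := h.locHom_norm hc
  rw [mul_conjInt_eq_norm] at hN
  rw [← hN]
  refine LocTriv.congr h h𝔮 ht h3 ?_ ?_
  · rw [← mul_conjInt_eq_norm]; exact hc.mul_left (isCoprime_conjInt hc)
  · rw [← one_mul 2, h𝔮.mem_pow_mul_iff, ← mul_conjInt_eq_norm]
    refine ⟨-n, ?_⟩
    simp only [map_add, map_mul, map_one, map_ofNat, hθ.conj_eq]
    have := hθ.sq
    push_cast at this ⊢
    linear_combination 4 * this

theorem locTriv_three (h : IsLocalSetup φ l Ψ 2 s r e) (h𝔮 : IsLocalIdeal 2 𝔮 1)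
    (h4 : discr K ≠ -4) : LocTriv φ l Ψ 2 e 𝔮 3 := by
  have := h.locTriv_of_sq h𝔮 fun _ hx => h.locHom_sq_of_two h𝔮 h4 hx
  rwa [show 2 * 1 + 1 = 3 from rfl] at this

theorem locTriv_two (h : IsLocalSetup φ l Ψ 2 s r e) (h𝔮 : IsLocalIdeal 2 𝔮 1)
    (hθ : IsQuadGen θ 1 n) (h4 : discr K ≠ -4) (h1 : locHom φ l Ψ e (1 + 2 ^ 2 * θ) = 1) :
    LocTriv φ l Ψ 2 e 𝔮 2 :=
  h.locTriv_step_unramified h𝔮 hθ two_ne_zero (h.locTriv_three h𝔮 h4)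
    (h.locHom_five h𝔮 hθ (h.locTriv_three h𝔮 h4)) h1

theorem locTriv_one_unramified (h : IsLocalSetup φ l Ψ 2 s r e) (h𝔮 : IsLocalIdeal 2 𝔮 1)
    (hθ : IsQuadGen θ 1 n) (ht : LocTriv φ l Ψ 2 e 𝔮 2)
    (h1 : locHom φ l Ψ e (1 + 2 ^ 1 * θ) = 1) : LocTriv φ l Ψ 2 e 𝔮 1 :=
  h.locTriv_step_unramified h𝔮 hθ one_ne_zero ht (h.locHom_three h𝔮 hθ ht) h1

/-- The units modulo `2` are killed by cubing, and a component with values `±1` trivial on cubes is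
trivial. So the exponent `1` does not occur. -/
theorem locTriv_zero_unramified (h : IsLocalSetup φ l Ψ 2 s r e) (h𝔮 : IsLocalIdeal 2 𝔮 1)
    (hθ : IsQuadGen θ 1 n)
    (hw : ∀ x : 𝓞 K, IsCoprime x ((2 : ℕ) : 𝓞 K) → locHom φ l Ψ e x ^ 2 = 1)
    (ht : LocTriv φ l Ψ 2 e 𝔮 1) : LocTriv φ l Ψ 2 e 𝔮 0 := by
  intro x hx _
  have hN := (isCoprime_natCast_iff_not_dvd Nat.prime_two).1 hx
  have hmem : ∀ y : 𝓞 K, (2 : 𝓞 K) ∣ y → y ∈ 𝔮 ^ 1 := by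
    intro y hy
    rw [pow_one]
    exact Ideal.mem_of_dvd _ hy (by simpa using h𝔮.natCast_mem)
  obtain ⟨a, b, rfl⟩ := hθ.exists_eq x
  rw [hθ.norm_eq] at hN
  have hsq := hθ.sq
  obtain ⟨b', hb⟩ := Int.even_or_odd' b
  rcases hb with rfl | rfl
  · have ha : Odd a := by
      rw [← Int.not_even_iff_odd]
      rintro ⟨k, rfl⟩
      exact hN ⟨2 * k ^ 2 + 2 * k * b' + 2 * n * b' ^ 2, by push_cast; ring⟩
    obtain ⟨k, rfl⟩ := ha
    refine ht _ hx (hmem _ ⟨k + b' * θ, ?_⟩)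
    push_cast; ring
  · have h3 : locHom φ l Ψ e ((a + (2 * b' + 1 : ℤ) * θ) ^ 3) = 1 := by
      refine ht _ hx.pow_left (hmem _ ?_)
      have hodd : Odd (a ^ 2 + 1 * a * (2 * b' + 1) + n * (2 * b' + 1) ^ 2) := by
        rw [← Int.not_even_iff_odd, even_iff_two_dvd]; exact_mod_cast hN
      obtain ⟨k, hk⟩ := hodd
      -- `T` is the trace of the element and `2 * k + 1` its norm. Both are odd, so the element
      -- satisfies `x ^ 2 ≡ x + 1` and hence `x ^ 3 ≡ 1` modulo `2`.
      set T : ℤ := 2 * (a + b') + 1 with hT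
      have hk' := congrArg (Int.cast (R := 𝓞 K)) hk
      have hT' := congrArg (Int.cast (R := 𝓞 K)) hT
      have hx2 : ((a : 𝓞 K) + (2 * b' + 1 : ℤ) * θ) ^ 2 =
          T * (a + (2 * b' + 1 : ℤ) * θ) - (2 * k + 1 : ℤ) := by
        push_cast at hk' hT' hsq ⊢
        rw [hT', ← hk']
        linear_combination (2 * (b' : 𝓞 K) + 1) ^ 2 * hsq
      refine ⟨(2 * (a + b') ^ 2 + 2 * (a + b') - k : ℤ) * (a + (2 * b' + 1 : ℤ) * θ) -
        (2 * (a + b') * k + (a + b') + k + 1 : ℤ), ?_⟩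
      rw [pow_succ, hx2, sub_mul, mul_assoc, ← pow_two, hx2, hT]
      push_cast; ring
    rw [h.locHom_pow hx, pow_succ, hw _ hx, one_mul] at h3
    exact h3

end IsLocalSetup

theorem χ₄_neg_one_of_norm {x : 𝓞 K} {m : ℤ} (hN : Algebra.norm ℤ x = m)
    (hm : m % 4 = 3) : ZMod.χ₄ (Algebra.norm ℤ x : ℤ) = -1 := by
  rw [hN]; exact ZMod.χ₄_int_three_mod_four hm

theorem χ₈_intCast_five {m : ℤ} (hm : m % 8 = 5) : ZMod.χ₈ (m : ℤ) = -1 := by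
  rw [ZMod.χ₈_int_eq_if_mod_eight]
  split_ifs <;> omega

namespace IsLocalSetup

variable {θ : 𝓞 K} {n : ℤ}

theorem locHom_normTwist_four (h : IsLocalSetup φ l Ψ 2 s r e) (hs : 3 ≤ s) {x : 𝓞 K}
    (hx : IsCoprime x ((2 : ℕ) : 𝓞 K)) : locHom φ l (_root_.normTwist ZMod.χ₄ Ψ) e x =
      locHom φ l Ψ e x * (ZMod.χ₄ (Algebra.norm ℤ x : ℤ) : ℤ) :=
  h.locHom_normTwist (pow_dvd_pow 2 (show 2 ≤ s by omega)) ZMod.isQuadratic_χ₄ hx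

theorem locHom_normTwist_eight (h : IsLocalSetup φ l Ψ 2 s r e) (hs : 3 ≤ s) {x : 𝓞 K}
    (hx : IsCoprime x ((2 : ℕ) : 𝓞 K)) : locHom φ l (_root_.normTwist ZMod.χ₈ Ψ) e x =
      locHom φ l Ψ e x * (ZMod.χ₈ (Algebra.norm ℤ x : ℤ) : ℤ) :=
  h.locHom_normTwist (pow_dvd_pow 2 hs) ZMod.isQuadratic_χ₈ hx

theorem normTwist_four (h : IsLocalSetup φ l Ψ 2 s r e) (hs : 3 ≤ s) :
    IsLocalSetup φ l (_root_.normTwist ZMod.χ₄ Ψ) 2 s r e :=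
  h.normTwist (pow_dvd_pow 2 (show 2 ≤ s by omega)) ZMod.isQuadratic_χ₄

theorem normTwist_eight (h : IsLocalSetup φ l Ψ 2 s r e) (hs : 3 ≤ s) :
    IsLocalSetup φ l (_root_.normTwist ZMod.χ₈ Ψ) 2 s r e :=
  h.normTwist (pow_dvd_pow 2 hs) ZMod.isQuadratic_χ₈

end IsLocalSetup

end UnramifiedTwo

/-! ### Global evaluations at the prime `2` when it is ramified. -/

section RamifiedTwo

variable {K : Type*} [Field K] [NumberField K] [Algebra.IsQuadraticExtension ℚ K]
    [IsTotallyComplex K] {φ : K →+* ℂ} {l : ℕ} {Ψ : (FractionalIdeal (𝓞 K)⁰ K)ˣ →* ℂˣ}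
    {s r : ℕ} {e : ℤ}

theorem exists_of_sq_eq {z : K} {a b : ℤ} (h : z ^ 2 = a * z + b) :
    ∃ u : 𝓞 K, (u : K) = z := by
  have hz : IsIntegral ℤ z := by
    refine ⟨Polynomial.X ^ 2 - Polynomial.C a * Polynomial.X - Polynomial.C b, ?_, ?_⟩
    · monicity!
    · simp only [Polynomial.eval₂_sub, Polynomial.eval₂_mul, Polynomial.eval₂_pow,
        Polynomial.eval₂_X, Polynomial.eval₂_C, h]
      simp
  exact ⟨⟨z, hz⟩, rfl⟩

/-- If `n ≡ 0` or `n ≡ 3` modulo `4`, then `θ / 2` or `(1 + θ) / 2` would be integral, yet neither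
lies in `ℤ + ℤ θ`. -/
theorem IsQuadGen.emod_four {θ : 𝓞 K} {n : ℤ} (h : IsQuadGen θ 0 n) : n % 4 = 1 ∨ n % 4 = 2 := by
  have hsq : ((θ : 𝓞 K) : K) ^ 2 = -n := by
    have := congrArg (fun x : 𝓞 K => (x : K)) h.sq
    simp only [RingOfIntegers.coe_eq_algebraMap, map_pow, map_sub, map_mul, map_intCast] at this ⊢
    rw [this]; simp
  by_contra hcon
  have hcase : n % 4 = 0 ∨ n % 4 = 3 := by omega
  have hdiv : ∀ (u : 𝓞 K) (a b : ℤ), (2 : K) * u = a + b * θ → (2 : ℤ) ∣ b := by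
    intro u a b hu
    refine ((h.dvd_iff (m := 2) (a := a) (b := b)).1 ⟨u, ?_⟩).2
    apply RingOfIntegers.ext
    simp only [RingOfIntegers.coe_eq_algebraMap, map_add, map_mul, map_intCast] at hu ⊢
    rw [← hu]; norm_num
  rcases hcase with h0 | h3
  · obtain ⟨k, hk⟩ : ∃ k, n = 4 * k := ⟨n / 4, by omega⟩
    obtain ⟨u, hu⟩ := exists_of_sq_eq (z := (θ : K) / 2) (a := 0) (b := -k) (by
      rw [div_pow, hsq, hk]; push_cast; ring)
    have := hdiv u 0 1 (by rw [hu]; push_cast; ring)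
    omega
  · obtain ⟨k, hk⟩ : ∃ k, n = 4 * k + 3 := ⟨n / 4, by omega⟩
    obtain ⟨u, hu⟩ := exists_of_sq_eq (z := (1 + (θ : K)) / 2) (a := 1) (b := -(k + 1)) (by
      have : (1 + (θ : K)) ^ 2 = 1 + 2 * θ - n := by rw [add_sq, hsq]; ring
      rw [div_pow, this, hk]; push_cast; ring)
    have := hdiv u 1 1 (by rw [hu]; push_cast; ring)
    omega

theorem exists_isQuadGen_of_two_dvd (hd : (2 : ℤ) ∣ discr K) :
    ∃ (θ : 𝓞 K) (n : ℤ), IsQuadGen θ 0 n := by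
  obtain ⟨θ, t, n, h, rfl | rfl⟩ := exists_isQuadGen (K := K)
  · exact ⟨θ, n, h⟩
  · rw [h.discr_eq] at hd
    omega

theorem IsLocalIdeal.mul_mem_pow_iff {p c : ℕ} {𝔮 : Ideal (𝓞 K)} (h : IsLocalIdeal p 𝔮 c)
    (a m : ℕ) {y : 𝓞 K} : (p : 𝓞 K) ^ a * y ∈ 𝔮 ^ (c * a + m) ↔ y ∈ 𝔮 ^ m := by
  rw [h.mem_pow_iff]
  constructor
  · rintro ⟨z, hz, hyz⟩
    rwa [mul_left_cancel₀ (pow_ne_zero _ (natCast_ne_zero_of_prime h.prime)) hyz]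
  · exact fun hy => ⟨y, hy, rfl⟩

theorem intCast_mem_iff {p : ℕ} {v : HeightOneSpectrum (𝓞 K)} {c : ℕ}
    (hv : IsLocalIdeal p v.asIdeal c) {m : ℤ} : (m : 𝓞 K) ∈ v.asIdeal ↔ (p : ℤ) ∣ m :=
  mem_iff_dvd hv.prime hv.natCast_mem

/-- Evaluating a character at an odd rational integer by means of a suitable split prime. -/
theorem IsLocalSetup.exists_prime_locHom_neg (h : IsLocalSetup φ l Ψ 2 s r e) {m : ℤ}
    (hm : Odd m) : ∃ q : ℕ, q.Prime ∧ q ≠ 2 ∧ (2 : ℤ) ^ s ∣ q - m ∧ ¬ (q : ℤ) ∣ discr K ∧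
      (IsSquare ((discr K : ℤ) : ZMod q) → locHom φ l Ψ e ((-m : ℤ) : 𝓞 K) = (-1) ^ l) := by
  have hM := h.good.modulus_ne_zero
  obtain ⟨k, hk⟩ := h.sub_one
  obtain ⟨k', hk'⟩ := h.dvd
  -- The integer `m e - (1 - e)` is `m` modulo `2 ^ s` and `-1` modulo `r`. For a prime `q` in its
  -- class, `-q` is `-m` at `2` and `1` modulo `r`, so `η(-q)` computes the local value at `-m`.
  have hcop : IsCoprime (m * e - (1 - e)) ((2 ^ s * r : ℕ) : ℤ) := by
    push_cast
    apply IsCoprime.mul_right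
    · have e1 : m * e - (1 - e) = m + 2 ^ s * (k * (m + 1)) := by
        push_cast at hk; linear_combination (m + 1) * hk
      rw [e1, IsCoprime.add_mul_left_left_iff]
      apply IsCoprime.pow_right
      obtain ⟨j, rfl⟩ := hm
      exact ⟨1, -j, by ring⟩
    · have e1 : m * e - (1 - e) = -1 + r * (k' * (m + 1)) := by linear_combination (m + 1) * hk'
      rw [e1, IsCoprime.add_mul_left_left_iff]
      exact isCoprime_one_left.neg_left
  obtain ⟨q, hqb, hq, hqm⟩ := Nat.forall_exists_prime_gt_and_zmodEq
    (2 ^ s * r + (discr K).natAbs + 2) hM hcop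
  obtain ⟨w, hw⟩ := hqm.symm.dvd
  push_cast at hw hk
  have hqd : ¬ (q : ℤ) ∣ discr K := fun hd => by
    have := Nat.le_of_dvd (Int.natAbs_pos.2 (discr_neg (K := K)).ne) (Int.natCast_dvd.1 hd)
    omega
  refine ⟨q, hq, by omega, ⟨r * w + k * (m + 1), by linear_combination hw + (m + 1) * hk⟩, hqd, ?_⟩
  intro hsq
  have hqM : ¬ q ∣ 2 ^ s * r := fun hd => by
    have := Nat.le_of_dvd (Nat.pos_of_ne_zero hM) hd
    omega
  rw [h.locHom_eq (a := -(q : 𝓞 K)), etaHom_neg, h.good.etaHom_split hq hqM hqd (by omega) hsq,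
    mul_one]
  · exact isCoprime_odd hm.neg
  · have : ((2 ^ s : ℕ) : ℤ) ∣ -(q : ℤ) - (-m) :=
      ⟨-(r * w + k * (m + 1)), by push_cast; linear_combination -hw - (m + 1) * hk⟩
    simpa using intCast_dvd_intCast (K := K).2 this
  · have : (r : ℤ) ∣ -(q : ℤ) - 1 :=
      ⟨-(2 ^ s * w + k' * (m + 1)), by linear_combination -hw - (m + 1) * hk'⟩
    simpa using intCast_dvd_intCast (K := K).2 this

/-- A global square root of the part of `2` away from the prime above it. -/
theorem IsLocalSetup.exists_sq_eq (h : IsLocalSetup φ l Ψ 2 s r e) {v : HeightOneSpectrum (𝓞 K)}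
    (hv : IsLocalIdeal 2 v.asIdeal 2) {π w : 𝓞 K} (hπ : π ∈ v.asIdeal) (hw : π ^ 2 = 2 * w)
    (hwc : IsCoprime w ((2 : ℕ) : 𝓞 K)) : ∃ (a γ : 𝓞 K) (x : K),
      PrimeToIdeal (Ideal.span {((2 ^ s * r : ℕ) : 𝓞 K)}) a ∧ ((2 ^ s : ℕ) : 𝓞 K) ∣ a - w ∧
      (r : 𝓞 K) ∣ 2 * a - 1 ∧ γ ^ 2 = 2 * a ∧ φ x ^ 2 = etaHom φ l Ψ a * φ a ^ l := by
  have hcop : IsCoprime ((2 : ℤ) ^ (s + 1)) (r : ℤ) :=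
    IsCoprime.pow_left (Nat.isCoprime_iff_coprime.2 (Nat.prime_two.coprime_iff_not_dvd.2 h.not_dvd))
  obtain ⟨u, w', huw⟩ := hcop
  have huw' := congrArg (Int.cast (R := 𝓞 K)) huw
  push_cast at huw'
  -- `γ` is `π` modulo `2 ^ (s + 1)` and `1` modulo `r`. Halving its square gives `a`, close to `w`
  -- at `2` and inverse to `2` modulo `r`.
  set γ : 𝓞 K := π + (1 - π) * u * 2 ^ (s + 1) with hγ
  obtain ⟨a, ha⟩ : ∃ a, γ ^ 2 = 2 * a :=
    ⟨w + 2 ^ s * (2 * π * (1 - π) * u + ((1 - π) * u) ^ 2 * 2 ^ (s + 1)), by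
      rw [hγ]; linear_combination hw⟩
  have haw : a - w = 2 ^ s * (2 * π * (1 - π) * u + ((1 - π) * u) ^ 2 * 2 ^ (s + 1)) := by
    have h2 : (2 : 𝓞 K) ≠ 0 := two_ne_zero
    apply mul_left_cancel₀ h2
    rw [mul_sub, ← ha, ← hw, hγ]; ring
  have hγr : γ - 1 = r * (w' * (π - 1)) := by rw [hγ]; linear_combination (1 - π) * huw'
  have har : 2 * a - 1 = r * (w' * (π - 1) * (γ + 1)) := by
    rw [← ha]; linear_combination (γ + 1) * hγr
  have hac2 : IsCoprime a ((2 : ℕ) : 𝓞 K) := by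
    refine isCoprime_congr (x := w) hwc ?_
    rw [← dvd_neg, neg_sub, haw, Nat.cast_ofNat]
    exact (dvd_pow_self _ h.pos.ne').mul_right _
  have hacr : IsCoprime a (r : 𝓞 K) := ⟨2, -(w' * (π - 1) * (γ + 1)), by linear_combination har⟩
  have hac : IsCoprime a ((2 ^ s * r : ℕ) : 𝓞 K) := by
    rw [Nat.cast_mul, Nat.cast_pow]
    exact hac2.pow_right.mul_right hacr
  have hap := h.primeTo_of_isCoprime hac
  have hγv : γ ∈ v.asIdeal := by
    refine Ideal.add_mem _ hπ (Ideal.mul_mem_left _ _ ?_)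
    exact Ideal.pow_mem_of_mem _ (by simpa using hv.natCast_mem) _ (Nat.succ_pos s)
  -- Since `v ^ 2 = (2)` and `γ ^ 2 = 2 a`, the cofactor of `v` in `(γ)` satisfies `𝔠 ^ 2 = (a)`. So
  -- `Ψ((a))` is the square of a value lying in `K`.
  obtain ⟨𝔠, hc⟩ := Ideal.dvd_span_singleton.2 hγv
  have h2ne : Ideal.span {((2 : ℕ) : 𝓞 K)} ≠ 0 := span_ne_zero (natCast_ne_zero_of_prime Nat.prime_two)
  have hc2 : 𝔠 ^ 2 = Ideal.span {a} := by
    apply mul_left_cancel₀ h2ne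
    rw [← hv.pow_eq, ← mul_pow, ← hc, hv.pow_eq, Ideal.span_singleton_pow, ha,
      Ideal.span_singleton_mul_span_singleton, Nat.cast_ofNat]
  have hc0 : 𝔠 ≠ 0 := by
    rintro rfl
    rw [zero_pow two_ne_zero] at hc2
    exact span_ne_zero hap.1 hc2.symm
  have hcc : IsCoprime 𝔠 (Ideal.span {((2 ^ s * r : ℕ) : 𝓞 K)}) := by
    have := hap.2
    rw [← hc2] at this
    exact (IsCoprime.pow_left_iff two_pos).1 this
  obtain ⟨x, hx⟩ := h.good.idealVal_mem_range hc0 hcc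
  refine ⟨a, γ, x, hap, ?_, ⟨_, har⟩, ha, ?_⟩
  · rw [haw]; exact ⟨_, by push_cast; rfl⟩
  · rw [← hx, ← map_pow, hc2, idealVal_span φ l Ψ hap.1]

theorem sq_eq_one_of_discr (h3 : discr K ≠ -3) (h4 : discr K ≠ -4) {u : 𝓞 K}
    (hu : Algebra.norm ℤ u = 1) : u ^ 2 = 1 := by
  rcases unit_cases hu with h | ⟨h, -⟩ | ⟨h, -⟩
  exacts [h, absurd h h4, absurd h h3]

theorem IsGood.etaHom_sq {𝔐 : Ideal (𝓞 K)} (h : IsGood φ l Ψ 𝔐) (h3 : discr K ≠ -3)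
    (h4 : discr K ≠ -4) {a : 𝓞 K} (ha : PrimeToIdeal 𝔐 a) : etaHom φ l Ψ a ^ 2 = 1 := by
  obtain ⟨u, hu, hn⟩ := h.exists_unit ha
  rw [hu, ← map_pow]
  have := congrArg (fun y : 𝓞 K => φ y) (sq_eq_one_of_discr h3 h4 hn)
  simpa using this

/-- For `l = 2 m` the number `η(a)` is the square of a root of unity of `K`, hence `1`, as the only
roots of unity are `±1`. The integer `2 - e` is `1` at `2` and `2` modulo `r`; multiplying `a` by it
gives an element that is `w` at `2` and `1` modulo `r`, and `η(2 - e) = 1` because `l` is even. -/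
theorem IsLocalSetup.locHom_sq_div_two (h : IsLocalSetup φ l Ψ 2 s r e) (hl : Even l)
    (h3 : discr K ≠ -3) (h4 : discr K ≠ -4) {v : HeightOneSpectrum (𝓞 K)}
    (hv : IsLocalIdeal 2 v.asIdeal 2) {π w : 𝓞 K} (hπ : π ∈ v.asIdeal) (hw : π ^ 2 = 2 * w)
    (hwc : IsCoprime w ((2 : ℕ) : 𝓞 K)) : locHom φ l Ψ e w = 1 := by
  obtain ⟨a, γ, x, ha, haw, har, hγ, hx⟩ := h.exists_sq_eq hv hπ hw hwc
  obtain ⟨m, rfl⟩ := hl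
  have ha0 := embedding_ne_zero φ ha.1
  have hη : etaHom φ (m + m) Ψ a = φ (x / (a : K) ^ m) ^ 2 := by
    rw [map_div₀, map_pow, div_pow, hx, ← pow_mul, mul_two, mul_div_cancel_right₀ _ (pow_ne_zero _ ha0)]
  have hη1 : etaHom φ (m + m) Ψ a = 1 := by
    obtain ⟨u, hu, hn⟩ := exists_int_of_pow_eq_one (z := x / (a : K) ^ m) (k := 4) (by norm_num)
      (φ.injective (by
        rw [map_pow, map_one, show 4 = 2 * 2 from rfl, pow_mul, ← hη, h.good.etaHom_sq h3 h4 ha]))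
    rw [hη, hu, ← map_pow]
    have := congrArg (fun y : 𝓞 K => φ y) (sq_eq_one_of_discr h3 h4 hn)
    simpa using this
  have h2r : IsCoprime (2 : ℤ) (r : ℤ) :=
    Nat.isCoprime_iff_coprime.2 (Nat.prime_two.coprime_iff_not_dvd.2 h.not_dvd)
  obtain ⟨k, hk⟩ := h.sub_one
  obtain ⟨k', hk'⟩ := h.dvd
  push_cast at hk
  have hm0 : IsCoprime (2 - e) ((2 ^ s * r : ℕ) : ℤ) := by
    push_cast
    apply IsCoprime.mul_right
    · have e1 : 2 - e = 1 + 2 ^ s * (-k) := by linear_combination -hk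
      rw [e1, IsCoprime.add_mul_left_left_iff]
      exact isCoprime_one_left
    · have e1 : 2 - e = 2 + r * (-k') := by linear_combination -hk'
      rw [e1, IsCoprime.add_mul_left_left_iff]
      exact h2r
  have hm00 : 2 - e ≠ 0 := by
    intro h0
    obtain rfl : e = 2 := by omega
    have h1 : (2 : ℤ) ∣ 2 ^ s := dvd_pow_self _ h.pos.ne'
    have h2 := h1.trans (Dvd.intro _ hk.symm)
    norm_num at h2
  rw [h.locHom_eq (a := a * ((2 - e : ℤ) : 𝓞 K)) hwc, map_mul, hη1,
    h.good.etaHom_intCast_of_even ⟨m, rfl⟩ hm0 hm00, one_mul]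
  · have : a * ((2 - e : ℤ) : 𝓞 K) - w = (a - w) * ((2 - e : ℤ) : 𝓞 K) - w * (e - 1) := by
      push_cast; ring
    rw [this]
    exact (haw.mul_right _).sub (h.sub_one_dvd.mul_left _)
  · have : a * ((2 - e : ℤ) : 𝓞 K) - 1 = (2 * a - 1) - a * e := by push_cast; ring
    rw [this]
    exact har.sub (h.dvd_e.mul_left _)

theorem IsLocalSetup.discr_eq_of_odd (h : IsLocalSetup φ l Ψ 2 s r e) (hl : Odd l)
    (h3 : discr K ≠ -3) (h4 : discr K ≠ -4) {v : HeightOneSpectrum (𝓞 K)}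
    (hv : IsLocalIdeal 2 v.asIdeal 2) {π w : 𝓞 K} (hπ : π ∈ v.asIdeal) (hw : π ^ 2 = 2 * w)
    (hwc : IsCoprime w ((2 : ℕ) : 𝓞 K)) (hd : (2 : ℤ) ∣ discr K) : discr K = -8 := by
  obtain ⟨a, γ, x, ha, haw, har, hγ, hx⟩ := h.exists_sq_eq hv hπ hw hwc
  obtain ⟨m, rfl⟩ := hl
  have ha0 := embedding_ne_zero φ ha.1
  have hγ0 : γ ≠ 0 := by
    rintro rfl
    rw [zero_pow two_ne_zero, zero_eq_mul] at hγ
    exact hγ.elim two_ne_zero ha.1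
  have hγ0' := embedding_ne_zero φ hγ0
  have hγφ : φ γ ^ 2 = 2 * φ a := by
    have h2 : φ ((2 : 𝓞 K) : K) = 2 := by exact_mod_cast embedding_natCast (K := K) (φ := φ) 2
    have := congrArg (fun y : 𝓞 K => φ y) hγ
    simp only [RingOfIntegers.coe_eq_algebraMap, map_mul, map_pow] at this h2 ⊢
    rw [this, h2]
  -- For odd `l` the factor `γ`, a square root of `2 a`, absorbs the unpaired power of `a`: the
  -- square of `z` is `2 η(a)`, that is `±2`. Among imaginary quadratic fields only `ℚ(√-2)` has a
  -- square root of `±2`.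
  set z : K := 2 * x / ((a : K) ^ m * γ) with hz
  have hz2 : φ z ^ 2 = 2 * etaHom φ (2 * m + 1) Ψ a := by
    rw [hz, map_div₀, map_mul, map_mul, map_pow, div_pow, mul_pow, hx, mul_pow, hγφ, map_ofNat]
    field_simp
    ring
  obtain ⟨k, hk, hkz⟩ : ∃ k : ℤ, (k = 2 ∨ k = -2) ∧ z ^ 2 = k := by
    rcases sq_eq_one_iff.1 (h.good.etaHom_sq h3 h4 ha) with h1 | h1
    · exact ⟨2, Or.inl rfl, φ.injective (by rw [map_pow, hz2, h1, map_intCast]; norm_num)⟩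
    · exact ⟨-2, Or.inr rfl, φ.injective (by rw [map_pow, hz2, h1, map_intCast]; norm_num)⟩
  obtain ⟨u, hu⟩ := exists_of_sq_eq (z := z) (a := 0) (b := k) (by rw [hkz]; simp)
  obtain ⟨θ, n, hθ⟩ := exists_isQuadGen_of_two_dvd hd
  have hu2 : u ^ 2 = k := by
    apply RingOfIntegers.ext
    simp only [RingOfIntegers.coe_eq_algebraMap, map_pow, map_intCast] at hu ⊢
    rw [hu, hkz]
  obtain ⟨b, c, rfl⟩ := hθ.exists_eq u
  have e1 : ((b ^ 2 - n * c ^ 2 : ℤ) : 𝓞 K) + ((2 * b * c : ℤ) : 𝓞 K) * θ =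
      (k : ℤ) + ((0 : ℤ) : 𝓞 K) * θ := by
    have := hθ.sq
    push_cast at this ⊢
    rw [← hu2]
    linear_combination -(c : 𝓞 K) ^ 2 * this
  obtain ⟨e2, e3⟩ := hθ.ext_iff.1 e1
  have hneg := discr_neg (K := K)
  have hdis := hθ.discr_eq
  have hn : 0 < n := by rw [hdis] at hneg; linarith
  rcases mul_eq_zero.1 e3 with hb | rfl
  · obtain rfl : b = 0 := by simpa using hb
    have hc0 : c ≠ 0 := by rintro rfl; rcases hk with rfl | rfl <;> norm_num at e2
    have hc1 : 1 ≤ c ^ 2 := by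
      have := sq_pos_of_ne_zero hc0
      linarith
    have hnc : n * c ^ 2 = 2 := by
      have := mul_pos hn (show 0 < c ^ 2 by linarith)
      rcases hk with rfl | rfl <;> nlinarith
    have hn2 : n ≤ 2 := by nlinarith
    have : n ≠ 1 := by
      rintro rfl
      exact h4 (by rw [hdis]; norm_num)
    obtain rfl : n = 2 := by omega
    rw [hdis]; norm_num
  · exfalso
    have hb2 : b ^ 2 = 2 := by
      rcases hk with rfl | rfl
      · linarith
      · nlinarith
    have : b < 2 := by nlinarith
    have : -2 < b := by nlinarith
    interval_cases b <;> omega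

end RamifiedTwo

/-! ### Descent along the filtration at a ramified prime above `2`. -/

section RamifiedTwoTable

variable {K : Type*} [Field K] [NumberField K] [Algebra.IsQuadraticExtension ℚ K]
    [IsTotallyComplex K] {φ : K →+* ℂ} {l : ℕ} {Ψ : (FractionalIdeal (𝓞 K)⁰ K)ˣ →* ℂˣ}
    {s r : ℕ} {e : ℤ} {v : HeightOneSpectrum (𝓞 K)} {θ : 𝓞 K} {n : ℤ}

theorem IsLocalIdeal.mem_of_sq (hv : IsLocalIdeal 2 v.asIdeal 2) {π w : 𝓞 K}
    (hw : π ^ 2 = 2 * w) : π ∈ v.asIdeal := by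
  apply v.isPrime.mem_of_pow_mem 2
  rw [hw]
  exact Ideal.mul_mem_right _ _ (by simpa using hv.natCast_mem)

theorem IsLocalIdeal.notMem_sq (hv : IsLocalIdeal 2 v.asIdeal 2) {t : ℤ} (hθ : IsQuadGen θ t n)
    {a b : ℤ} (hb : Odd b) : (a + b * θ : 𝓞 K) ∉ v.asIdeal ^ 2 := by
  rw [hv.pow_eq, Ideal.mem_span_singleton]
  intro h
  have := ((hθ.dvd_iff (m := 2)).1 (by simpa using h)).2
  obtain ⟨k, rfl⟩ := hb
  omega

theorem IsLocalIdeal.two_pow_mul_mem (hv : IsLocalIdeal 2 v.asIdeal 2) (a m : ℕ) {y : 𝓞 K} :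
    (2 : 𝓞 K) ^ a * y ∈ v.asIdeal ^ (2 * a + m) ↔ y ∈ v.asIdeal ^ m := by
  simpa using hv.mul_mem_pow_iff a m (y := y)

theorem IsLocalIdeal.odd_notMem (hv : IsLocalIdeal 2 v.asIdeal 2) {m : ℤ} (hm : Odd m) :
    (m : 𝓞 K) ∉ v.asIdeal := by
  rw [intCast_mem_iff hv]
  obtain ⟨k, rfl⟩ := hm
  push_cast; omega

namespace IsLocalSetup

theorem locTriv_five (h : IsLocalSetup φ l Ψ 2 s r e) (hv : IsLocalIdeal 2 v.asIdeal 2)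
    (h4 : discr K ≠ -4) : LocTriv φ l Ψ 2 e v.asIdeal 5 := by
  have := h.locTriv_of_sq hv fun _ hx => h.locHom_sq_of_two hv h4 hx
  rwa [show 2 * 2 + 1 = 5 from rfl] at this

/-- Descent at even exponents by means of the rational integer `1 + 2 ^ j`. -/
theorem locTriv_two_mul (h : IsLocalSetup φ l Ψ 2 s r e) (hv : IsLocalIdeal 2 v.asIdeal 2)
    (hN : Ideal.absNorm v.asIdeal = 2) {j : ℕ} (hj : j ≠ 0)
    (hL : locHom φ l Ψ e (1 + 2 ^ j) = 1) (ht : LocTriv φ l Ψ 2 e v.asIdeal (2 * j + 1)) :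
    LocTriv φ l Ψ 2 e v.asIdeal (2 * j) := by
  refine h.locTriv_of_succ hv hN (by omega) (g := 1 + 2 ^ j) ?_ ?_ hL ht
  · rw [add_sub_cancel_left]
    simpa using (hv.two_pow_mul_mem j 0 (y := 1)).2 (by simp)
  · rw [add_sub_cancel_left]
    have := (hv.two_pow_mul_mem j 1 (y := 1)).not.2 (by
      simpa using hv.odd_notMem (K := K) odd_one)
    simpa using this

theorem locHom_one_add_two_pow (h : IsLocalSetup φ l Ψ 2 s r e) (hl : Even l) {j : ℕ}
    (hj : j ≠ 0) : locHom φ l Ψ e (1 + 2 ^ j) = 1 := by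
  have := h.locHom_intCast_of_even hl (m := 1 + 2 ^ j) (isCoprime_odd
    (Odd.add_even odd_one ((even_two).pow_of_ne_zero hj)))
  simpa using this

theorem locTriv_four (h : IsLocalSetup φ l Ψ 2 s r e) (hv : IsLocalIdeal 2 v.asIdeal 2)
    (hN : Ideal.absNorm v.asIdeal = 2) (hl : Even l) (h4 : discr K ≠ -4) :
    LocTriv φ l Ψ 2 e v.asIdeal 4 :=
  h.locTriv_two_mul hv hN two_ne_zero (h.locHom_one_add_two_pow hl two_ne_zero)
    (h.locTriv_five hv h4)

theorem locTriv_two_of_three (h : IsLocalSetup φ l Ψ 2 s r e) (hv : IsLocalIdeal 2 v.asIdeal 2)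
    (hN : Ideal.absNorm v.asIdeal = 2) (hl : Even l) (ht : LocTriv φ l Ψ 2 e v.asIdeal 3) :
    LocTriv φ l Ψ 2 e v.asIdeal 2 :=
  h.locTriv_two_mul hv hN one_ne_zero (h.locHom_one_add_two_pow hl one_ne_zero) ht

end IsLocalSetup

/-! ### Discriminant exactly divisible by `4`. -/

section FourExactly

theorem IsQuadGen.one_add_sq (hθ : IsQuadGen θ 0 n) {k : ℤ} (hk : n = 4 * k + 1) :
    (1 + θ) ^ 2 = 2 * (θ - (2 * k : ℤ)) := by
  have := hθ.sq
  rw [hk] at this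
  push_cast at this ⊢
  linear_combination this

theorem IsQuadGen.isCoprime_sub (hθ : IsQuadGen θ 0 n) {k : ℤ} (hk : n = 4 * k + 1) :
    IsCoprime (θ - (2 * k : ℤ)) ((2 : ℕ) : 𝓞 K) := by
  rw [isCoprime_natCast_iff_not_dvd Nat.prime_two]
  have e1 : θ - ((2 * k : ℤ) : 𝓞 K) = ((-(2 * k) : ℤ) : 𝓞 K) + ((1 : ℤ) : 𝓞 K) * θ := by
    push_cast; ring
  rw [e1, hθ.norm_eq, hk]
  push_cast
  have e2 : (-(2 * k)) ^ 2 + 0 * -(2 * k) * 1 + (4 * k + 1) * 1 = 2 * (2 * k ^ 2 + 2 * k) + 1 := by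
    ring
  rw [e2]; omega

/-- The uniformizer is `1 + θ`. The steps from `4` to `3`, `3` to `2` and `2` to `1` are decided by
`1 + 2 (1 + θ)`, by the integer `3` and by the local unit `(1 + θ) ^ 2 / 2`; the last step is
automatic. So only the first value matters. -/
theorem IsLocalSetup.locTriv_zero_of_locHom_three (h : IsLocalSetup φ l Ψ 2 s r e)
    (hv : IsLocalIdeal 2 v.asIdeal 2) (hN : Ideal.absNorm v.asIdeal = 2) (hl : Even l)
    (h3 : discr K ≠ -3) (h4 : discr K ≠ -4) (hθ : IsQuadGen θ 0 n) {k : ℤ} (hk : n = 4 * k + 1)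
    (hL : locHom φ l Ψ e (1 + 2 * (1 + θ)) = 1) : LocTriv φ l Ψ 2 e v.asIdeal 0 := by
  have hπ : (1 + θ) ∈ v.asIdeal := hv.mem_of_sq (hθ.one_add_sq hk)
  have hπ2 : (1 + θ) ∉ v.asIdeal ^ 2 := by
    simpa using hv.notMem_sq hθ (a := 1) (b := 1) odd_one
  have t3 : LocTriv φ l Ψ 2 e v.asIdeal 3 := by
    refine h.locTriv_of_succ hv hN (by norm_num) (g := 1 + 2 * (1 + θ)) ?_ ?_ hL
      (h.locTriv_four hv hN hl h4)
    · rw [add_sub_cancel_left]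
      simpa using (hv.two_pow_mul_mem 1 1 (y := 1 + θ)).2 (by simpa using hπ)
    · rw [add_sub_cancel_left]
      simpa using (hv.two_pow_mul_mem 1 2 (y := 1 + θ)).not.2 hπ2
  have t2 := h.locTriv_two_of_three hv hN hl t3
  refine h.locTriv_zero_of_two hv hN ?_
  refine h.locTriv_of_succ hv hN one_ne_zero (g := θ - (2 * k : ℤ)) ?_ ?_
    (h.locHom_sq_div_two hl h3 h4 hv hπ (hθ.one_add_sq hk) (hθ.isCoprime_sub hk)) t2
  · have e1 : θ - (2 * k : ℤ) - 1 = (1 + θ) - 2 * (k + 1) := by push_cast; ring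
    rw [pow_one, e1]
    exact Ideal.sub_mem _ hπ (Ideal.mul_mem_right _ _ (by simpa using hv.natCast_mem))
  · have := hv.notMem_sq hθ (a := -(2 * k) - 1) (b := 1) odd_one
    convert this using 2
    push_cast; ring

end FourExactly

/-! ### Discriminant divisible by `8`. -/

section EightDvd

/-- The product of the rational integer `1 - n` and the square `(1 + θ) ^ 2` has value `1` and is
congruent to `1` exactly modulo `v ^ 3`. It decides the step from `4` to `3`, and the integer `3`
decides the next. -/
theorem IsLocalSetup.locTriv_two_of_eight (h : IsLocalSetup φ l Ψ 2 s r e)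
    (hv : IsLocalIdeal 2 v.asIdeal 2) (hN : Ideal.absNorm v.asIdeal = 2) (hl : Even l)
    (h3 : discr K ≠ -3) (h4 : discr K ≠ -4) (hθ : IsQuadGen θ 0 n) {k : ℤ} (hk : n = 2 * k) :
    LocTriv φ l Ψ 2 e v.asIdeal 2 := by
  have hsq := hθ.sq
  have hsq' : θ ^ 2 = 2 * (-k : ℤ) := by rw [hsq, hk]; push_cast; ring
  have hθv : θ ∈ v.asIdeal := hv.mem_of_sq hsq'
  have hodd : Odd (1 - n) := ⟨-k, by rw [hk]; ring⟩
  have hc1 : IsCoprime ((1 - n : ℤ) : 𝓞 K) ((2 : ℕ) : 𝓞 K) := isCoprime_odd hodd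
  have hc2 : IsCoprime (1 + θ) ((2 : ℕ) : 𝓞 K) := by
    refine hv.isCoprime_of_sub_one_mem one_ne_zero (j := 1) ?_
    rw [add_sub_cancel_left, pow_one]; exact hθv
  refine h.locTriv_two_of_three hv hN hl ?_
  have e1 : ((1 - n : ℤ) : 𝓞 K) * (1 + θ) ^ 2 - 1 =
      2 * ((2 * (k * (k - 1)) : ℤ) + ((1 - n : ℤ) : 𝓞 K) * θ) := by
    push_cast at hsq' ⊢
    rw [hk]; push_cast
    linear_combination (1 - 2 * (k : 𝓞 K)) * hsq'
  have hmem : ((2 * (k * (k - 1)) : ℤ) + ((1 - n : ℤ) : 𝓞 K) * θ) ∈ v.asIdeal := by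
    refine Ideal.add_mem _ ?_ (Ideal.mul_mem_left _ _ hθv)
    rw [intCast_mem_iff hv]; exact Dvd.intro _ rfl
  refine h.locTriv_of_succ hv hN (by norm_num) (g := ((1 - n : ℤ) : 𝓞 K) * (1 + θ) ^ 2) ?_ ?_ ?_
    (h.locTriv_four hv hN hl h4)
  · rw [e1]
    simpa using (hv.two_pow_mul_mem 1 1).2 (by simpa using hmem)
  · rw [e1]
    have := (hv.two_pow_mul_mem 1 2).not.2 (hv.notMem_sq hθ (a := 2 * (k * (k - 1))) hodd)
    rwa [pow_one] at this
  · rw [h.locHom_mul hc1 hc2.pow_left, h.locHom_intCast_of_even hl hc1, h.locHom_pow hc2,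
      h.locHom_sq h3 h4 hc2, one_mul]

theorem IsLocalSetup.locTriv_zero_of_locHom_one (h : IsLocalSetup φ l Ψ 2 s r e)
    (hv : IsLocalIdeal 2 v.asIdeal 2) (hN : Ideal.absNorm v.asIdeal = 2)
    (hθ : IsQuadGen θ 0 n) {k : ℤ} (hk : n = 2 * k) (ht : LocTriv φ l Ψ 2 e v.asIdeal 2)
    (hL : locHom φ l Ψ e (1 + θ) = 1) : LocTriv φ l Ψ 2 e v.asIdeal 0 := by
  have hsq' : θ ^ 2 = 2 * (-k : ℤ) := by rw [hθ.sq, hk]; push_cast; ring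
  have hθv : θ ∈ v.asIdeal := hv.mem_of_sq hsq'
  refine h.locTriv_zero_of_two hv hN (h.locTriv_of_succ hv hN one_ne_zero (g := 1 + θ) ?_ ?_ hL ht)
  · rw [add_sub_cancel_left, pow_one]; exact hθv
  · rw [add_sub_cancel_left]
    simpa using hv.notMem_sq hθ (a := 0) (b := 1) odd_one

theorem IsLocalSetup.discr_eq_neg_eight (h : IsLocalSetup φ l Ψ 2 s r e)
    (hv : IsLocalIdeal 2 v.asIdeal 2) (hl : Odd l) (h3 : discr K ≠ -3) (h4 : discr K ≠ -4)
    (hd : (2 : ℤ) ∣ discr K) : discr K = -8 := by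
  obtain ⟨θ, n, hθ⟩ := exists_isQuadGen_of_two_dvd hd
  rcases hθ.emod_four with hn | hn
  · obtain ⟨k, hk⟩ : ∃ k, n = 4 * k + 1 := ⟨n / 4, by omega⟩
    exact h.discr_eq_of_odd hl h3 h4 hv (hv.mem_of_sq (hθ.one_add_sq hk)) (hθ.one_add_sq hk)
      (hθ.isCoprime_sub hk) hd
  · obtain ⟨k, hk⟩ : ∃ k, n = 2 * k := ⟨n / 2, by omega⟩
    have hsq' : θ ^ 2 = 2 * (-k : ℤ) := by rw [hθ.sq, hk]; push_cast; ring
    refine h.discr_eq_of_odd hl h3 h4 hv (hv.mem_of_sq hsq') hsq' ?_ hd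
    have : IsCoprime ((-k : ℤ) : 𝓞 K) ((2 : ℕ) : 𝓞 K) := isCoprime_odd (by
      rw [Int.odd_iff]; omega)
    simpa using this

/-- A prime `q ≡ 3` modulo `8` splits in `ℚ(√-2)`, so for odd `l` the local value at `-3` is `-1`.
But `-3` is `1` modulo `4`, that is, modulo `v ^ 4`. -/
theorem IsLocalSetup.not_locTriv_four (h : IsLocalSetup φ l Ψ 2 s r e) (hs : 3 ≤ s)
    (hv : IsLocalIdeal 2 v.asIdeal 2) (hl : Odd l) (hd : discr K = -8) :
    ¬ LocTriv φ l Ψ 2 e v.asIdeal 4 := by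
  intro ht
  obtain ⟨q, hq, hq2, hqm, hqd, hqL⟩ := h.exists_prime_locHom_neg (m := 3) ⟨1, by norm_num⟩
  have hq8 : q % 8 = 3 := by
    have : (8 : ℤ) ∣ q - 3 := by
      refine Dvd.dvd.trans ?_ hqm
      exact pow_dvd_pow 2 hs
    omega
  have : Fact q.Prime := ⟨hq⟩
  have h1 := hqL (by
    have h2 : IsSquare (-2 : ZMod q) := (ZMod.exists_sq_eq_neg_two_iff hq2).2 (Or.inr hq8)
    obtain ⟨y, hy⟩ := h2
    refine ⟨2 * y, ?_⟩
    rw [hd]; push_cast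
    linear_combination 4 * hy)
  have hc : IsCoprime ((-3 : ℤ) : 𝓞 K) ((2 : ℕ) : 𝓞 K) := isCoprime_odd ⟨-2, by norm_num⟩
  rw [hl.neg_one_pow, ht _ hc] at h1
  · norm_num at h1
  · have := (hv.two_pow_mul_mem 2 0 (y := -1)).2 (by simp)
    convert this using 1
    push_cast; norm_num

end EightDvd

end RamifiedTwoTable

/-! ### Upper and lower bounds in the fields with extra units. -/

section ExtraUnits

variable {K : Type*} [Field K] [NumberField K] [Algebra.IsQuadraticExtension ℚ K]
    [IsTotallyComplex K] {φ : K →+* ℂ} {l : ℕ} {Ψ : (FractionalIdeal (𝓞 K)⁰ K)ˣ →* ℂˣ}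
    {s r : ℕ} {e : ℤ} {v : HeightOneSpectrum (𝓞 K)} {θ : 𝓞 K}

theorem exists_isQuadGen_of_discr_eq_neg_four (hd : discr K = -4) :
    ∃ θ : 𝓞 K, IsQuadGen θ 0 1 := by
  obtain ⟨θ, n, hθ⟩ := exists_isQuadGen_of_two_dvd (K := K) (by rw [hd]; norm_num)
  have := hθ.discr_eq
  obtain rfl : n = 1 := by rw [hd] at this; linarith
  exact ⟨θ, hθ⟩

theorem exists_isQuadGen_of_discr_eq_neg_three (hd : discr K = -3) :
    ∃ θ : 𝓞 K, IsQuadGen θ 1 1 := by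
  obtain ⟨θ, n, hθ⟩ := exists_isQuadGen_of_not_dvd (K := K) (by rw [hd]; norm_num)
  have := hθ.discr_eq
  obtain rfl : n = 1 := by rw [hd] at this; linarith
  exact ⟨θ, hθ⟩

namespace IsLocalSetup

/-- For `y ∈ v ^ (m + 3)`, the element `1 + 4 y` is `(1 + y) ^ 4` up to terms in `v ^ (m + 8)`, and
fourth powers are killed. -/
theorem locTriv_seven (h : IsLocalSetup φ l Ψ 2 s r e) (hv : IsLocalIdeal 2 v.asIdeal 2)
    (hd : discr K = -4) : LocTriv φ l Ψ 2 e v.asIdeal 7 := by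
  refine h.locTriv_of_steps hv fun j hj ht x hx hx1 => ?_
  obtain ⟨m, rfl⟩ := Nat.exists_eq_add_of_le hj
  rw [show 7 + m = 2 * 2 + (m + 3) by ring, hv.mem_pow_iff] at hx1
  obtain ⟨y, hy, hxy⟩ := hx1
  push_cast at hxy
  have h1 : (1 + y) - 1 ∈ v.asIdeal ^ (m + 3) := by rwa [add_sub_cancel_left]
  have hc := hv.isCoprime_of_sub_one_mem (by omega) h1
  rw [LocTriv.congr h hv ht hx (y := (1 + y) ^ 4) hc.pow_left, h.locHom_pow hc,
    h.locHom_pow_four (by rw [hd]; norm_num) hc]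
  have h2 := Ideal.pow_mem_pow hy 2
  rw [← pow_mul] at h2
  have h3 : 2 ^ 1 * y ^ 2 ∈ v.asIdeal ^ (2 * 1 + (m + 3) * 2) := (hv.two_pow_mul_mem 1 _).2 h2
  have h4 := Ideal.pow_mem_pow hy 4
  rw [← pow_mul] at h4
  have e1 : x - (1 + y) ^ 4 = -((3 + 2 * y) * (2 ^ 1 * y ^ 2) + y ^ 4) := by
    linear_combination hxy
  rw [e1, neg_mem_iff]
  exact Ideal.add_mem _ (Ideal.mul_mem_left _ _ (Ideal.pow_le_pow_right (by omega) h3))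
    (Ideal.pow_le_pow_right (by omega) h4)

/-- The step is decided by `1 + 2 ^ 3 = 3 ^ 2`, on which the component is trivial because its values
at rational integers are `±1`. -/
theorem locTriv_six (h : IsLocalSetup φ l Ψ 2 s r e) (hv : IsLocalIdeal 2 v.asIdeal 2)
    (hN : Ideal.absNorm v.asIdeal = 2) (hd : discr K = -4) : LocTriv φ l Ψ 2 e v.asIdeal 6 := by
  refine h.locTriv_two_mul hv hN (j := 3) (by norm_num) ?_ (h.locTriv_seven hv hd)
  have hc : IsCoprime ((3 : ℤ) : 𝓞 K) ((2 : ℕ) : 𝓞 K) := isCoprime_odd ⟨1, rfl⟩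
  have := h.locHom_intCast_sq hc
  rw [← h.locHom_pow hc] at this
  rw [← this]
  congr 1
  norm_num

/-- The step is decided by `5`, the norm of `1 + 2 θ`. -/
theorem locTriv_four_of_five (h : IsLocalSetup φ l Ψ 2 s r e) (hv : IsLocalIdeal 2 v.asIdeal 2)
    (hN : Ideal.absNorm v.asIdeal = 2) (hθ : IsQuadGen θ 0 1)
    (ht : LocTriv φ l Ψ 2 e v.asIdeal 5) : LocTriv φ l Ψ 2 e v.asIdeal 4 := by
  refine h.locTriv_two_mul hv hN two_ne_zero ?_ ht
  rw [← h.locHom_norm (isCoprime_one_add_two θ)]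
  congr 1
  have h1 : conjInt K (1 + 2 * θ) = 1 - 2 * θ := by
    rw [map_add, map_mul, hθ.conj_eq, map_one, map_ofNat]; push_cast; ring
  rw [h1]
  have := hθ.sq
  push_cast at this
  linear_combination 4 * this

/-- A prime `q ≡ 1` modulo `4` splits in `ℚ(i)`, so for odd `l` the local value at `-1` is `-1`,
although `-1` is `1` modulo `v ^ 2 = (2)`. -/
theorem not_locTriv_two (h : IsLocalSetup φ l Ψ 2 s r e) (hs : 2 ≤ s)
    (hv : IsLocalIdeal 2 v.asIdeal 2) (hl : Odd l) (hd : discr K = -4) :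
    ¬ LocTriv φ l Ψ 2 e v.asIdeal 2 := by
  intro ht
  obtain ⟨q, hq, hq2, hqm, hqd, hqL⟩ := h.exists_prime_locHom_neg (m := 1) odd_one
  have hq4 : q % 4 ≠ 3 := by
    have : (4 : ℤ) ∣ q - 1 := by
      refine Dvd.dvd.trans ?_ hqm
      exact pow_dvd_pow 2 hs
    omega
  have : Fact q.Prime := ⟨hq⟩
  have h1 := hqL (by
    obtain ⟨y, hy⟩ := ZMod.exists_sq_eq_neg_one_iff.2 hq4
    refine ⟨2 * y, ?_⟩
    rw [hd]; push_cast
    linear_combination 4 * hy)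
  have hc : IsCoprime ((-1 : ℤ) : 𝓞 K) ((2 : ℕ) : 𝓞 K) := isCoprime_odd ⟨-1, by norm_num⟩
  rw [hl.neg_one_pow, ht _ hc] at h1
  · norm_num at h1
  · have := (hv.two_pow_mul_mem 1 0 (y := -1)).2 (by simp)
    convert this using 1
    push_cast; norm_num

/-- On `1 + v` the values have order dividing `3`. For `y ∈ v ^ (m + 2)`, the element `1 + 3 y` is
`(1 + y) ^ 3` up to terms in `v ^ (m + 5)`. -/
theorem locTriv_four_of_discr (h : IsLocalSetup φ l Ψ 3 s r e) (hv : IsLocalIdeal 3 v.asIdeal 2)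
    (hd : discr K = -3) : LocTriv φ l Ψ 3 e v.asIdeal 4 := by
  refine h.locTriv_of_steps hv fun j hj ht x hx hx1 => ?_
  obtain ⟨m, rfl⟩ := Nat.exists_eq_add_of_le hj
  rw [show 4 + m = 2 * 1 + (m + 2) by ring, hv.mem_pow_iff] at hx1
  obtain ⟨y, hy, hxy⟩ := hx1
  push_cast at hxy
  have h1 : (1 + y) - 1 ∈ v.asIdeal ^ (m + 2) := by rwa [add_sub_cancel_left]
  have hc := hv.isCoprime_of_sub_one_mem (by omega) h1
  have hL := h.locHom_pow_eq_one hv (Ideal.pow_le_self (by omega) h1) (m := 3) (k := 2)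
    (by norm_num) (h.locHom_pow_six (by rw [hd]; norm_num) hc)
  rw [LocTriv.congr h hv ht hx (y := (1 + y) ^ 3) hc.pow_left, h.locHom_pow hc, hL]
  have h2 := Ideal.pow_mem_pow hy 2
  rw [← pow_mul] at h2
  have h3 : ((3 : ℕ) : 𝓞 K) ^ 1 * y ^ 2 ∈ v.asIdeal ^ (2 * 1 + (m + 2) * 2) :=
    (hv.mul_mem_pow_iff 1 _).2 h2
  have h4 := Ideal.pow_mem_pow hy 3
  rw [← pow_mul] at h4
  have e1 : x - (1 + y) ^ 3 = -(((3 : ℕ) : 𝓞 K) ^ 1 * y ^ 2 + y ^ 3) := by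
    push_cast
    linear_combination hxy
  rw [e1, neg_mem_iff]
  exact Ideal.add_mem _ (Ideal.pow_le_pow_right (by omega) h3)
    (Ideal.pow_le_pow_right (by omega) h4)

/-- The step is decided by `4 = 1 + 3`, the square of a rational integer, at which the component is
`±1`. -/
theorem locTriv_two_of_discr (h : IsLocalSetup φ l Ψ 3 s r e) (hv : IsLocalIdeal 3 v.asIdeal 2)
    (hN : Ideal.absNorm v.asIdeal = 3) (ht : LocTriv φ l Ψ 3 e v.asIdeal 3) :
    LocTriv φ l Ψ 3 e v.asIdeal 2 := by
  have e1 : (((2 : ℤ) : 𝓞 K) ^ 2 - 1) = ((3 : ℕ) : 𝓞 K) ^ 1 * 1 := by norm_num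
  have hc : IsCoprime ((2 : ℤ) : 𝓞 K) ((3 : ℕ) : 𝓞 K) :=
    (isCoprime_intCast_natCast_iff Nat.prime_three).2 (by norm_num)
  refine h.locTriv_of_succ hv hN two_ne_zero (g := ((2 : ℤ) : 𝓞 K) ^ 2) ?_ ?_
    (by rw [h.locHom_pow hc, h.locHom_intCast_sq hc]) ht
  · rw [e1]
    exact (hv.mul_mem_pow_iff 1 0).2 (by simp)
  · rw [e1]
    refine (hv.mul_mem_pow_iff 1 1).not.2 ?_
    rw [pow_one, ← Ideal.ne_top_iff_one]
    exact v.isPrime.ne_top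

end IsLocalSetup

end ExtraUnits

/-! ### The cells of the table, case by case. -/

section Cells

variable {K : Type*} [Field K] [NumberField K] [Algebra.IsQuadraticExtension ℚ K]
    [IsTotallyComplex K] {v : HeightOneSpectrum (𝓞 K)} {p : ℕ} (l : ℕ)

theorem two_mem_iff (hp : p.Prime) (hv : (p : 𝓞 K) ∈ v.asIdeal) :
    (2 : 𝓞 K) ∈ v.asIdeal ↔ p = 2 := by
  have := mem_iff_dvd hp hv (m := 2)
  rw [Int.cast_ofNat] at this
  rw [this, ← Nat.cast_ofNat, Int.natCast_dvd_natCast, Nat.prime_dvd_prime_iff_eq hp Nat.prime_two]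

theorem discr_ne_neg_four_of_dvd (hp : p.Prime) (hp2 : p ≠ 2) (hd : (p : ℤ) ∣ discr K) :
    discr K ≠ -4 := by
  intro h
  rw [h, dvd_neg, show (4 : ℤ) = 2 ^ 2 from rfl] at hd
  have := Int.Prime.dvd_pow' hp hd
  exact hp2 ((Nat.prime_dvd_prime_iff_eq hp Nat.prime_two).1 (by exact_mod_cast this))

theorem eq_three_of_dvd_discr (hp : p.Prime) (hd : (p : ℤ) ∣ discr K) (h3 : discr K = -3) :
    p = 3 := by
  rw [h3, dvd_neg] at hd
  exact (Nat.prime_dvd_prime_iff_eq hp Nat.prime_three).1 (by exact_mod_cast hd)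

theorem possibleExponents_odd_unramified (hp : p.Prime) (hv : (p : 𝓞 K) ∈ v.asIdeal)
    (hp2 : p ≠ 2) (hd : ¬ (p : ℤ) ∣ discr K) : possibleExponents v l = {0, 1} := by
  have h2 := (two_mem_iff hp hv).not.2 hp2
  have hu := (isUnramifiedAt_iff hp hv).2 hd
  simp [possibleExponents, tableRow, h2, hu]

theorem possibleExponents_odd_ramified (hp : p.Prime) (hv : (p : 𝓞 K) ∈ v.asIdeal)
    (hp2 : p ≠ 2) (hd : (p : ℤ) ∣ discr K) (h3 : discr K ≠ -3) :
    possibleExponents v l = if Odd l then {1} else {0} := by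
  have h2 := (two_mem_iff hp hv).not.2 hp2
  have hu := (isUnramifiedAt_iff hp hv).not.2 (not_not.2 hd)
  simp [possibleExponents, tableRow, h2, hu, h3, discr_ne_neg_four_of_dvd hp hp2 hd]

theorem possibleExponents_three (hv : ((3 : ℕ) : 𝓞 K) ∈ v.asIdeal) (h3 : discr K = -3) :
    possibleExponents v l = if Odd l then {1, 2, 4} else {0, 2, 4} := by
  have h2 := (two_mem_iff Nat.prime_three hv).not.2 (by norm_num)
  have hu := (isUnramifiedAt_iff Nat.prime_three hv).not.2 (not_not.2 (by rw [h3]; norm_num))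
  simp [possibleExponents, tableRow, h2, hu, h3]

theorem possibleExponents_two_of_neg_four (hv : ((2 : ℕ) : 𝓞 K) ∈ v.asIdeal)
    (h4 : discr K = -4) :
    possibleExponents v l = if Odd l then {3, 4, 6} else {0, 2, 4, 6} := by
  have h2 := (two_mem_iff Nat.prime_two hv).2 rfl
  simp [possibleExponents, tableRow, h2, h4]

theorem possibleExponents_two_of_neg_three (hv : ((2 : ℕ) : 𝓞 K) ∈ v.asIdeal)
    (h3 : discr K = -3) : possibleExponents v l = {0, 1, 2, 3} := by
  have h2 := (two_mem_iff Nat.prime_two hv).2 rfl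
  simp [possibleExponents, tableRow, h2, h3]

theorem possibleExponents_two_unramified (hv : ((2 : ℕ) : 𝓞 K) ∈ v.asIdeal)
    (h3 : discr K ≠ -3) (hd : ¬ (2 : ℤ) ∣ discr K) : possibleExponents v l = {0, 2, 3} := by
  have h2 := (two_mem_iff Nat.prime_two hv).2 rfl
  have h4 : discr K ≠ -4 := by intro h; rw [h] at hd; norm_num at hd
  have h4' : ¬ (4 : ℤ) ∣ discr K := fun h => hd (Dvd.dvd.trans (by norm_num) h)
  have h8' : ¬ (8 : ℤ) ∣ discr K := fun h => hd (Dvd.dvd.trans (by norm_num) h)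
  simp [possibleExponents, tableRow, h2, h3, h4, h4', h8']

theorem possibleExponents_two_of_eight_dvd (hv : ((2 : ℕ) : 𝓞 K) ∈ v.asIdeal)
    (hd : (8 : ℤ) ∣ discr K) : possibleExponents v l = if Odd l then {5} else {0, 2} := by
  have h2 := (two_mem_iff Nat.prime_two hv).2 rfl
  have h3 : discr K ≠ -3 := by intro h; rw [h] at hd; norm_num at hd
  have h4 : discr K ≠ -4 := by intro h; rw [h] at hd; norm_num at hd
  simp [possibleExponents, tableRow, h2, h3, h4, hd]

theorem possibleExponents_two_of_four_dvd (hv : ((2 : ℕ) : 𝓞 K) ∈ v.asIdeal)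
    (h4 : discr K ≠ -4) (hd : (4 : ℤ) ∣ discr K) (hd8 : ¬ (8 : ℤ) ∣ discr K) :
    possibleExponents v l = if Odd l then ∅ else {0, 4} := by
  have h2 := (two_mem_iff Nat.prime_two hv).2 rfl
  have h3 : discr K ≠ -3 := by intro h; rw [h] at hd; norm_num at hd
  simp [possibleExponents, tableRow, h2, h3, h4, hd, hd8]

end Cells

/-! ### Realizing prescribed exponents. -/

section Realizable

variable {K : Type*} [Field K] [NumberField K] [Algebra.IsQuadraticExtension ℚ K]
    [IsTotallyComplex K] {φ : K →+* ℂ} {l : ℕ} {Ψ : (FractionalIdeal (𝓞 K)⁰ K)ˣ →* ℂˣ}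
    {p s r c : ℕ} {e : ℤ} {𝔮 : Ideal (𝓞 K)} {v : HeightOneSpectrum (𝓞 K)}

/-- `n` is the exponent at `v` of the conductor of some character with rational coefficients. -/
def Realizable (φ : K →+* ℂ) (l : ℕ) (v : HeightOneSpectrum (𝓞 K)) (n : ℕ) : Prop :=
  ∃ (𝔣' : Ideal (𝓞 K)) (ψ' : HeckeCharacter φ 𝔣' l),
    ψ'.HasRationalCoefficients ∧ ψ'.IsConductor 𝔣' ∧ exponentAt v 𝔣' = n

namespace IsLocalSetup

theorem realizable_zero (h : IsLocalSetup φ l Ψ p s r e) (h𝔮 : IsLocalIdeal p 𝔮 c)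
    (hv : (p : 𝓞 K) ∈ v.asIdeal) (ht : LocTriv φ l Ψ p e 𝔮 0) : Realizable φ l v 0 :=
  h.good.exists_heckeCharacter (conjIdeal_span_natCast _)
    ((h.hasExponent_iff h𝔮 hv (Nat.zero_le _)).2 ⟨ht, fun _ hm => absurd hm (Nat.not_lt_zero _)⟩)

theorem realizable_succ (h : IsLocalSetup φ l Ψ p s r e) (h𝔮 : IsLocalIdeal p 𝔮 c)
    (hv : (p : 𝓞 K) ∈ v.asIdeal) {n : ℕ} (hs : n + 1 ≤ s) (ht : LocTriv φ l Ψ p e 𝔮 (n + 1))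
    (ht' : ¬ LocTriv φ l Ψ p e 𝔮 n) : Realizable φ l v (n + 1) :=
  h.good.exists_heckeCharacter (conjIdeal_span_natCast _)
    ((h.hasExponent_iff h𝔮 hv (hs.trans (Nat.le_mul_of_pos_left _ h𝔮.pos))).2
      ⟨ht, fun _ hm h' => ht' (LocTriv.mono (Nat.lt_succ_iff.1 hm) h')⟩)

theorem le_iff (h : IsLocalSetup φ l Ψ p s r e) (h𝔮 : IsLocalIdeal p 𝔮 c)
    (hv : (p : 𝓞 K) ∈ v.asIdeal) {𝔣 : Ideal (𝓞 K)}
    (hf : IsCond φ l Ψ (Ideal.span {((p ^ s * r : ℕ) : 𝓞 K)}) 𝔣) {j : ℕ} (hj : j ≤ s) :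
    exponentAt v 𝔣 ≤ j ↔ LocTriv φ l Ψ p e 𝔮 j :=
  h.exponentAt_le_iff h𝔮 hv hf (hj.trans (Nat.le_mul_of_pos_left _ h𝔮.pos))

/-- The value at `x` is `±1`, and the twist by `χ ∘ N` changes its sign. So any sign can be
prescribed at `x` without disturbing the values where `χ ∘ N` is `1`. -/
theorem exists_toggle (h : IsLocalSetup φ l Ψ p s r e) {m : ℕ} (hm : m ∣ p ^ s)
    {χ : MulChar (ZMod m) ℤ} (hχ : χ.IsQuadratic) {x : 𝓞 K} (hx : IsCoprime x (p : 𝓞 K))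
    (hχx : χ (Algebra.norm ℤ x : ℤ) = -1) (hL : locHom φ l Ψ e x ^ 2 = 1) {a : ℂ}
    (ha : a ^ 2 = 1) : ∃ Ψ', IsLocalSetup φ l Ψ' p s r e ∧ locHom φ l Ψ' e x = a ∧
      ∀ y : 𝓞 K, IsCoprime y (p : 𝓞 K) → χ (Algebra.norm ℤ y : ℤ) = 1 →
        locHom φ l Ψ' e y = locHom φ l Ψ e y := by
  by_cases hxa : locHom φ l Ψ e x = a
  · exact ⟨Ψ, h, hxa, fun _ _ _ => rfl⟩
  · refine ⟨_, h.normTwist hm hχ, ?_, fun y hy hy1 => ?_⟩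
    · rw [h.locHom_normTwist hm hχ hx, hχx]
      rcases sq_eq_one_iff.1 hL with h1 | h1 <;> rcases sq_eq_one_iff.1 ha with h2 | h2 <;>
        simp_all
    · rw [h.locHom_normTwist hm hχ hy, hy1, Int.cast_one, mul_one]

theorem realizable_one_of_locTriv_zero (h : IsLocalSetup φ l Ψ p s r e)
    (h𝔮 : IsLocalIdeal p 𝔮 c) (hv : (p : 𝓞 K) ∈ v.asIdeal) (hp2 : p ≠ 2)
    (hd : ¬ (p : ℤ) ∣ discr K) (ht : LocTriv φ l Ψ p e 𝔮 0) : Realizable φ l v 1 := by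
  have : Fact p.Prime := ⟨h.prime⟩
  have h' := h.normTwist (dvd_pow_self p h.pos.ne') (quadraticChar_isQuadratic (ZMod p))
  refine h'.realizable_succ h𝔮 hv h.pos (h'.locTriv_one_of_odd h𝔮 hp2 ?_)
    (h.exists_of_locTriv_zero hp2 hd ht)
  rintro ⟨rfl, h3⟩
  exact hd (by rw [h3]; norm_num)

end IsLocalSetup

/-- The two halves of the theorem at one prime. -/
def TableHolds (φ : K →+* ℂ) (l : ℕ) (Ψ : (FractionalIdeal (𝓞 K)⁰ K)ˣ →* ℂˣ) (M : ℕ)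
    (v : HeightOneSpectrum (𝓞 K)) : Prop :=
  (∀ 𝔣, IsCond φ l Ψ (Ideal.span {(M : 𝓞 K)}) 𝔣 → exponentAt v 𝔣 ∈ possibleExponents v l) ∧
    ∀ n ∈ possibleExponents v l, Realizable φ l v n

end Realizable

/-! ### The table when the only units are `±1`, and the odd primes with uniform arguments. -/

section GenericTable

variable {K : Type*} [Field K] [NumberField K] [Algebra.IsQuadraticExtension ℚ K]
    [IsTotallyComplex K] {φ : K →+* ℂ} {l : ℕ} {Ψ : (FractionalIdeal (𝓞 K)⁰ K)ˣ →* ℂˣ}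
    {p s r c : ℕ} {e : ℤ} {v : HeightOneSpectrum (𝓞 K)}

namespace IsLocalSetup

theorem exponentAt_odd_unramified (h : IsLocalSetup φ l Ψ p s r e)
    (hv : (p : 𝓞 K) ∈ v.asIdeal) (hp2 : p ≠ 2) (hd : ¬ (p : ℤ) ∣ discr K) {𝔣 : Ideal (𝓞 K)}
    (hf : IsCond φ l Ψ (Ideal.span {((p ^ s * r : ℕ) : 𝓞 K)}) 𝔣) :
    exponentAt v 𝔣 ∈ possibleExponents v l := by
  have h𝔮 := isLocalIdeal_of_not_dvd_discr (K := K) h.prime hd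
  rw [possibleExponents_odd_unramified l h.prime hv hp2 hd]
  have := (h.le_iff h𝔮 hv hf h.pos).2 (h.locTriv_one_of_odd h𝔮 hp2 (by
    rintro ⟨rfl, h3⟩
    exact hd (by rw [h3]; norm_num)))
  simp only [Set.mem_insert_iff, Set.mem_singleton_iff]
  omega

/-- One of the exponents `0` and `1` is that of the given character, and the other is that of its
twist by the quadratic character modulo `p`. -/
theorem tableHolds_odd_unramified (h : IsLocalSetup φ l Ψ p s r e)
    (hv : (p : 𝓞 K) ∈ v.asIdeal) (hp2 : p ≠ 2) (hd : ¬ (p : ℤ) ∣ discr K)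
    (h3 : discr K ≠ -3) (h4 : discr K ≠ -4) : TableHolds φ l Ψ (p ^ s * r) v := by
  refine ⟨fun 𝔣 hf => h.exponentAt_odd_unramified hv hp2 hd hf, ?_⟩
  have h𝔮 := isLocalIdeal_of_not_dvd_discr (K := K) h.prime hd
  have ht1 := h.locTriv_one_of_odd h𝔮 hp2 (fun h' => h3 h'.2)
  rw [possibleExponents_odd_unramified l h.prime hv hp2 hd]
  have : Fact p.Prime := ⟨h.prime⟩
  by_cases ht : LocTriv φ l Ψ p e (Ideal.span {(p : 𝓞 K)}) 0
  · rintro n (rfl | rfl)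
    · exact h.realizable_zero h𝔮 hv ht
    · exact h.realizable_one_of_locTriv_zero h𝔮 hv hp2 hd ht
  · rintro n (rfl | rfl)
    · exact (h.normTwist (dvd_pow_self p h.pos.ne')
        (quadraticChar_isQuadratic (ZMod p))).realizable_zero h𝔮 hv
          (h.locTriv_zero_normTwist h𝔮 hp2 hd (fun x hx => h.locHom_sq h3 h4 hx) ht1 ht)
    · exact h.realizable_succ h𝔮 hv h.pos ht1 ht

theorem tableHolds_odd_ramified (h : IsLocalSetup φ l Ψ p s r e)
    (hv : (p : 𝓞 K) ∈ v.asIdeal) (hp2 : p ≠ 2) (hd : (p : ℤ) ∣ discr K)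
    (h3 : discr K ≠ -3) : TableHolds φ l Ψ (p ^ s * r) v := by
  have h𝔮 := isLocalIdeal_of_dvd_discr h.prime hd hv
  have hN := absNorm_of_dvd_discr h.prime hd hv
  have ht1 := h.locTriv_one_of_odd h𝔮 hp2 (fun h' => h3 h'.2)
  rw [TableHolds, possibleExponents_odd_ramified l h.prime hv hp2 hd h3]
  by_cases hl : Odd l
  · have ht0 := h.not_locTriv_zero h𝔮 (conjPrime_of_dvd_discr h.prime hd hv) hv hl
    rw [if_pos hl]
    refine ⟨fun 𝔣 hf => ?_, ?_⟩
    · have e1 := (h.le_iff h𝔮 hv hf h.pos).2 ht1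
      have e0 := (h.le_iff h𝔮 hv hf (Nat.zero_le _)).not.2 ht0
      simp only [Set.mem_singleton_iff]; omega
    · rintro n rfl
      exact h.realizable_succ h𝔮 hv h.pos ht1 ht0
  · have ht0 := h.locTriv_zero_of_even h𝔮 hN (Nat.not_odd_iff_even.1 hl) ht1
    rw [if_neg hl]
    refine ⟨fun 𝔣 hf => ?_, ?_⟩
    · have e0 := (h.le_iff h𝔮 hv hf (Nat.zero_le _)).2 ht0
      simp only [Set.mem_singleton_iff]; omega
    · rintro n rfl
      exact h.realizable_zero h𝔮 hv ht0

/-- The exponent is read off from the signs at `1 + 4 θ` and `1 + 2 θ`. Their norms are `5` modulo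
`8` and `3` modulo `4`, so `χ₈` adjusts the first sign. Then `χ₄` adjusts the second without
touching the first, whose norm is `1` modulo `4`. -/
theorem tableHolds_two_unramified (h : IsLocalSetup φ l Ψ 2 s r e) (hs : 3 ≤ s)
    (hv : ((2 : ℕ) : 𝓞 K) ∈ v.asIdeal) (h3 : discr K ≠ -3)
    (hd : ¬ (2 : ℤ) ∣ discr K) : TableHolds φ l Ψ (2 ^ s * r) v := by
  have h4 : discr K ≠ -4 := by intro h; rw [h] at hd; norm_num at hd
  have h𝔮 := isLocalIdeal_of_not_dvd_discr (K := K) Nat.prime_two hd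
  obtain ⟨θ, n, hθ⟩ := exists_isQuadGen_of_not_dvd hd
  have hsq : ∀ {Ψ'}, IsLocalSetup φ l Ψ' 2 s r e → ∀ x : 𝓞 K, IsCoprime x ((2 : ℕ) : 𝓞 K) →
    locHom φ l Ψ' e x ^ 2 = 1 := fun h' x hx => h'.locHom_sq h3 h4 hx
  have hc2 : IsCoprime (1 + 2 ^ 2 * θ) ((2 : ℕ) : 𝓞 K) := by
    have := isCoprime_one_add_two (2 * θ)
    rwa [← mul_assoc, ← pow_two] at this
  have hc1 : IsCoprime (1 + 2 ^ 1 * θ) ((2 : ℕ) : 𝓞 K) := by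
    have := isCoprime_one_add_two θ
    rwa [← pow_one (2 : 𝓞 K)] at this
  have hm : ∀ j : ℕ, (1 + 2 ^ j * θ) - 1 ∈ Ideal.span {((2 : ℕ) : 𝓞 K)} ^ j := by
    intro j
    rw [add_sub_cancel_left, Ideal.span_singleton_pow, Ideal.mem_span_singleton]
    exact Dvd.intro _ (by push_cast; rfl)
  have hN : ∀ j : ℕ, Algebra.norm ℤ (1 + 2 ^ j * θ) = 1 + 2 ^ j + n * 2 ^ (2 * j) := by
    intro j
    have := hθ.norm_eq 1 (2 ^ j)
    push_cast at this
    rw [this]; ring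
  rw [TableHolds, possibleExponents_two_unramified l hv h3 hd]
  refine ⟨fun 𝔣 hf => ?_, ?_⟩
  · have e3 := (h.le_iff h𝔮 hv hf hs).2 (h.locTriv_three h𝔮 h4)
    have e1 := h.le_iff h𝔮 hv hf h.pos
    have e0 := h.le_iff h𝔮 hv hf (Nat.zero_le _)
    have e01 := h.locTriv_zero_unramified h𝔮 hθ (hsq h)
    rw [← e1, ← e0] at e01
    simp only [Set.mem_insert_iff, Set.mem_singleton_iff]; omega
  · have t8 := fun a ha => h.exists_toggle (m := 8) (pow_dvd_pow 2 hs) ZMod.isQuadratic_χ₈ hc2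
      (χ₈_intCast_five (by rw [hN]; omega)) (hsq h _ hc2) (a := a) ha
    have t4 := fun Ψ' (h' : IsLocalSetup φ l Ψ' 2 s r e) a ha =>
      h'.exists_toggle (m := 4) (pow_dvd_pow 2 (show 2 ≤ s by omega)) ZMod.isQuadratic_χ₄ hc1
      (χ₄_neg_one_of_norm (hN 1) (by omega)) (hsq h' _ hc1) (a := a) ha
    have hχ : ZMod.χ₄ (Algebra.norm ℤ (1 + 2 ^ 2 * θ) : ℤ) = 1 := by
      rw [hN]; exact ZMod.χ₄_int_one_mod_four (by omega)
    have key : ∀ b : ℂ, b ^ 2 = 1 → ∃ Ψ', IsLocalSetup φ l Ψ' 2 s r e ∧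
        LocTriv φ l Ψ' 2 e (Ideal.span {((2 : ℕ) : 𝓞 K)}) 2 ∧
        locHom φ l Ψ' e (1 + 2 ^ 1 * θ) = b := by
      intro b hb
      obtain ⟨Ψ₁, h₁, hL₁, -⟩ := t8 1 (one_pow 2)
      obtain ⟨Ψ₂, h₂, hL₂, hag⟩ := t4 Ψ₁ h₁ b hb
      exact ⟨Ψ₂, h₂, h₂.locTriv_two h𝔮 hθ h4 (by rw [hag _ hc2 hχ, hL₁]), hL₂⟩
    rintro m (rfl | rfl | rfl)
    · obtain ⟨Ψ', h', ht, hL⟩ := key 1 (one_pow 2)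
      exact h'.realizable_zero h𝔮 hv (h'.locTriv_zero_unramified h𝔮 hθ (hsq h')
        (h'.locTriv_one_unramified h𝔮 hθ ht hL))
    · obtain ⟨Ψ', h', ht, hL⟩ := key (-1) (by norm_num)
      refine h'.realizable_succ h𝔮 hv (by omega) ht fun ht1 => ?_
      rw [ht1 _ hc1 (hm 1)] at hL
      norm_num at hL
    · obtain ⟨Ψ', h', hL, -⟩ := t8 (-1) (by norm_num)
      refine h'.realizable_succ h𝔮 hv hs (h'.locTriv_three h𝔮 h4) fun ht1 => ?_
      rw [ht1 _ hc2 (hm 2)] at hL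
      norm_num at hL

/-- For odd `l` the exponent is forced. For even `l` it depends only on the sign at `1 + θ`, whose
norm is `3` modulo `4`, so `χ₄` switches it. -/
theorem tableHolds_two_of_eight_dvd (h : IsLocalSetup φ l Ψ 2 s r e) (hs : 5 ≤ s)
    (hv : ((2 : ℕ) : 𝓞 K) ∈ v.asIdeal) (hd : (8 : ℤ) ∣ discr K) :
    TableHolds φ l Ψ (2 ^ s * r) v := by
  have h3 : discr K ≠ -3 := by intro h; rw [h] at hd; norm_num at hd
  have h4 : discr K ≠ -4 := by intro h; rw [h] at hd; norm_num at hd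
  have hd2 : (2 : ℤ) ∣ discr K := Dvd.dvd.trans (by norm_num) hd
  have h𝔮 := isLocalIdeal_of_dvd_discr Nat.prime_two hd2 hv
  have hN := absNorm_of_dvd_discr Nat.prime_two hd2 hv
  rw [TableHolds, possibleExponents_two_of_eight_dvd l hv hd]
  by_cases hl : Odd l
  · have ht5 := h.locTriv_five h𝔮 h4
    have ht4 := h.not_locTriv_four (by omega) h𝔮 hl (h.discr_eq_neg_eight h𝔮 hl h3 h4 hd2)
    rw [if_pos hl]
    refine ⟨fun 𝔣 hf => ?_, ?_⟩
    · have e1 := (h.le_iff h𝔮 hv hf hs).2 ht5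
      have e0 := (h.le_iff h𝔮 hv hf (by omega)).not.2 ht4
      simp only [Set.mem_singleton_iff]; omega
    · rintro n rfl
      exact h.realizable_succ h𝔮 hv hs ht5 ht4
  rw [Nat.not_odd_iff_even] at hl
  rw [if_neg (Nat.not_odd_iff_even.2 hl)]
  obtain ⟨θ, n, hθ⟩ := exists_isQuadGen_of_two_dvd hd2
  have hdis := hθ.discr_eq
  have hn := hθ.emod_four
  obtain ⟨k, hk⟩ : ∃ k, n = 2 * k := ⟨n / 2, by omega⟩
  have hn2 : n % 4 = 2 := by omega
  have hsq' : θ ^ 2 = 2 * (-k : ℤ) := by rw [hθ.sq, hk]; push_cast; ring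
  have hθv : (1 + θ) - 1 ∈ v.asIdeal ^ 1 := by
    rw [pow_one, add_sub_cancel_left]; exact h𝔮.mem_of_sq hsq'
  have hc := h𝔮.isCoprime_of_sub_one_mem one_ne_zero hθv
  have hNx : Algebra.norm ℤ (1 + θ) = 1 + n := by
    have := hθ.norm_eq 1 1
    push_cast at this
    rw [one_mul] at this
    rw [this]; ring
  refine ⟨fun 𝔣 hf => ?_, ?_⟩
  · have e2 := (h.le_iff h𝔮 hv hf (by omega)).2 (h.locTriv_two_of_eight h𝔮 hN hl h3 h4 hθ hk)
    have e1 := h.le_iff h𝔮 hv hf h.pos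
    have e0 := h.le_iff h𝔮 hv hf (Nat.zero_le _)
    have e01 := h.locTriv_zero_of_two h𝔮 hN
    rw [← e1, ← e0] at e01
    simp only [Set.mem_insert_iff, Set.mem_singleton_iff]; omega
  · have t4 := fun a ha =>
      h.exists_toggle (m := 4) (pow_dvd_pow 2 (show 2 ≤ s by omega)) ZMod.isQuadratic_χ₄ hc
      (χ₄_neg_one_of_norm hNx (by omega)) (h.locHom_sq h3 h4 hc) (a := a) ha
    rintro m (rfl | rfl)
    · obtain ⟨Ψ', h', hL, -⟩ := t4 1 (one_pow 2)
      exact h'.realizable_zero h𝔮 hv (h'.locTriv_zero_of_locHom_one h𝔮 hN hθ hk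
        (h'.locTriv_two_of_eight h𝔮 hN hl h3 h4 hθ hk) hL)
    · obtain ⟨Ψ', h', hL, -⟩ := t4 (-1) (by norm_num)
      refine h'.realizable_succ h𝔮 hv (by omega)
        (h'.locTriv_two_of_eight h𝔮 hN hl h3 h4 hθ hk) fun ht1 => ?_
      rw [ht1 _ hc hθv] at hL
      norm_num at hL

/-- In the case not divisible by `8`, the exponent depends only on the sign at `3 + 2 θ`, whose norm
`9 + 4 n` is `5` modulo `8`, so `χ₈` switches it. Odd `l` is impossible, as it would force
discriminant `-8`. -/
theorem tableHolds_two_of_two_dvd (h : IsLocalSetup φ l Ψ 2 s r e) (hs : 5 ≤ s)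
    (hv : ((2 : ℕ) : 𝓞 K) ∈ v.asIdeal) (h4 : discr K ≠ -4) (hd2 : (2 : ℤ) ∣ discr K) :
    TableHolds φ l Ψ (2 ^ s * r) v := by
  by_cases hd8 : (8 : ℤ) ∣ discr K
  · exact h.tableHolds_two_of_eight_dvd hs hv hd8
  have h3 : discr K ≠ -3 := by intro h; rw [h] at hd2; norm_num at hd2
  have h𝔮 := isLocalIdeal_of_dvd_discr Nat.prime_two hd2 hv
  have hN := absNorm_of_dvd_discr Nat.prime_two hd2 hv
  obtain ⟨θ, n, hθ⟩ := exists_isQuadGen_of_two_dvd hd2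
  have hdis := hθ.discr_eq
  have hn := hθ.emod_four
  rw [TableHolds, possibleExponents_two_of_four_dvd l hv h4 (by omega) hd8]
  by_cases hl : Odd l
  · have := h.discr_eq_neg_eight h𝔮 hl h3 h4 hd2
    omega
  rw [Nat.not_odd_iff_even] at hl
  rw [if_neg (Nat.not_odd_iff_even.2 hl)]
  obtain ⟨k, hk⟩ : ∃ k, n = 4 * k + 1 := ⟨n / 4, by omega⟩
  have hπ : (1 + θ) ∈ v.asIdeal := h𝔮.mem_of_sq (hθ.one_add_sq hk)
  have hx : (1 + 2 * (1 + θ)) - 1 ∈ v.asIdeal ^ 3 := by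
    rw [add_sub_cancel_left]
    simpa using (h𝔮.two_pow_mul_mem 1 1 (y := 1 + θ)).2 (by simpa using hπ)
  have hc := isCoprime_one_add_two (1 + θ)
  have hNx : Algebra.norm ℤ (1 + 2 * (1 + θ)) = 9 + 4 * n := by
    have e1 : (1 + 2 * (1 + θ)) = ((3 : ℤ) : 𝓞 K) + ((2 : ℤ) : 𝓞 K) * θ := by push_cast; ring
    rw [e1, hθ.norm_eq]; ring
  refine ⟨fun 𝔣 hf => ?_, ?_⟩
  · have e4 := (h.le_iff h𝔮 hv hf (by omega)).2 (h.locTriv_four h𝔮 hN hl h4)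
    have e0 := h.le_iff h𝔮 hv hf (Nat.zero_le _)
    have e3 := h.le_iff h𝔮 hv hf (j := 3) (by omega)
    have e30 : LocTriv φ l Ψ 2 e v.asIdeal 3 → LocTriv φ l Ψ 2 e v.asIdeal 0 := fun ht =>
      h.locTriv_zero_of_locHom_three h𝔮 hN hl h3 h4 hθ hk (ht _ hc hx)
    rw [← e3, ← e0] at e30
    simp only [Set.mem_insert_iff, Set.mem_singleton_iff]; omega
  · have t8 := fun a ha => h.exists_toggle (m := 8) (pow_dvd_pow 2 (show 3 ≤ s by omega))
      ZMod.isQuadratic_χ₈ hc (χ₈_intCast_five (by rw [hNx]; omega)) (h.locHom_sq h3 h4 hc)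
      (a := a) ha
    rintro m (rfl | rfl)
    · obtain ⟨Ψ', h', hL, -⟩ := t8 1 (one_pow 2)
      exact h'.realizable_zero h𝔮 hv (h'.locTriv_zero_of_locHom_three h𝔮 hN hl h3 h4 hθ hk hL)
    · obtain ⟨Ψ', h', hL, -⟩ := t8 (-1) (by norm_num)
      refine h'.realizable_succ h𝔮 hv (by omega) (h'.locTriv_four h𝔮 hN hl h4) fun ht1 => ?_
      rw [ht1 _ hc hx] at hL
      norm_num at hL

end IsLocalSetup

end GenericTable

/-! ### Unit-valued characters and the Hecke characters built from them. -/

section UnitChar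

variable {K : Type*} [Field K] [NumberField K] [Algebra.IsQuadraticExtension ℚ K]
    [IsTotallyComplex K] {φ : K →+* ℂ} {l M M' : ℕ} {χ χ' : 𝓞 K → (𝓞 K)ˣ}

/-- A character of the elements prime to `M` modulo `M` with values in the units, anti-invariant
under complex conjugation. -/
structure IsUnitChar (M : ℕ) (χ : 𝓞 K → (𝓞 K)ˣ) : Prop where
  map_mul : ∀ x y : 𝓞 K, IsCoprime x (M : 𝓞 K) → IsCoprime y (M : 𝓞 K) → χ (x * y) = χ x * χ y
  congr : ∀ x y : 𝓞 K, IsCoprime x (M : 𝓞 K) → IsCoprime y (M : 𝓞 K) → (M : 𝓞 K) ∣ x - y →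
    χ x = χ y
  map_conj : ∀ x : 𝓞 K, IsCoprime x (M : 𝓞 K) → χ (conjInt K x) = (χ x)⁻¹

theorem conjInt_unit (u : (𝓞 K)ˣ) : conjInt K (u : 𝓞 K) = ((u⁻¹ : (𝓞 K)ˣ) : 𝓞 K) := by
  have hn : Algebra.norm ℤ (u : 𝓞 K) = 1 := by
    have h1 : IsUnit (Algebra.norm ℤ (u : 𝓞 K)) := u.isUnit.map _
    have h2 := norm_nonneg_int (u : 𝓞 K)
    rcases Int.isUnit_iff.1 h1 with h | h
    · exact h
    · omega
  have h := mul_conjInt_eq_norm (u : 𝓞 K)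
  rw [hn, Int.cast_one] at h
  rw [← mul_right_inj' u.ne_zero, h, Units.mul_inv]

namespace IsUnitChar

theorem one : IsUnitChar (K := K) M 1 where
  map_mul _ _ _ _ := by simp
  congr _ _ _ _ _ := rfl
  map_conj _ _ := by simp

theorem mul (h : IsUnitChar M χ) (h' : IsUnitChar M χ') : IsUnitChar M (χ * χ') where
  map_mul x y hx hy := by
    simp only [Pi.mul_apply, h.map_mul x y hx hy, h'.map_mul x y hx hy, mul_mul_mul_comm]
  congr x y hx hy hd := by
    simp only [Pi.mul_apply, h.congr x y hx hy hd, h'.congr x y hx hy hd]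
  map_conj x hx := by simp only [Pi.mul_apply, h.map_conj x hx, h'.map_conj x hx, mul_inv]

theorem inv (h : IsUnitChar M χ) : IsUnitChar M χ⁻¹ where
  map_mul x y hx hy := by simp only [Pi.inv_apply, h.map_mul x y hx hy, mul_inv]
  congr x y hx hy hd := by simp only [Pi.inv_apply, h.congr x y hx hy hd]
  map_conj x hx := by simp only [Pi.inv_apply, h.map_conj x hx]

theorem pow (h : IsUnitChar M χ) (n : ℕ) : IsUnitChar M (χ ^ n) := by
  induction n with
  | zero => rw [pow_zero]; exact one
  | succ n ih => rw [pow_succ]; exact ih.mul h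

theorem mono (h : IsUnitChar M χ) (hd : M ∣ M') : IsUnitChar M' χ := by
  have hd' : (M : 𝓞 K) ∣ (M' : 𝓞 K) := Nat.cast_dvd_cast hd
  have hc : ∀ {x : 𝓞 K}, IsCoprime x (M' : 𝓞 K) → IsCoprime x (M : 𝓞 K) :=
    fun hx => hx.of_isCoprime_of_dvd_right hd'
  exact ⟨fun x y hx hy => h.map_mul x y (hc hx) (hc hy),
    fun x y hx hy hxy => h.congr x y (hc hx) (hc hy) (hd'.trans hxy), fun x hx => h.map_conj x (hc hx)⟩

theorem map_one (h : IsUnitChar M χ) : χ 1 = 1 := by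
  have := h.map_mul 1 1 isCoprime_one_left isCoprime_one_left
  rwa [mul_one, left_eq_mul] at this

theorem eq_one (h : IsUnitChar M χ) {x : 𝓞 K} (hx : IsCoprime x (M : 𝓞 K))
    (hd : (M : 𝓞 K) ∣ x - 1) : χ x = 1 := by
  rw [h.congr x 1 hx isCoprime_one_left hd, h.map_one]

/-- In a principal ideal ring, `Ψ((x)) = χ(x) x ^ l` does not depend on the generator, by the
condition on units. The homomorphism is defined by chosen generators of the primes, and the formula
spreads to all ideals prime to `M` by induction. Anti-invariance of `χ` is compatibility with
conjugation, since the conjugate of a unit is its inverse. -/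
theorem exists_isGood [IsPrincipalIdealRing (𝓞 K)] (φ : K →+* ℂ) (hM : M ≠ 0)
    (h : IsUnitChar M χ) (hu : ∀ u : (𝓞 K)ˣ, χ u * u ^ l = 1) :
    ∃ Ψ : (FractionalIdeal (𝓞 K)⁰ K)ˣ →* ℂˣ, IsGood φ l Ψ (Ideal.span {(M : 𝓞 K)}) ∧
      ∀ x : 𝓞 K, PrimeToIdeal (Ideal.span {(M : 𝓞 K)}) x →
        etaHom φ l Ψ x = φ ((χ x : 𝓞 K) : K) := by
  have hM0 : Ideal.span {(M : 𝓞 K)} ≠ 0 := span_ne_zero (Nat.cast_ne_zero.2 hM)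
  have hgen : ∀ 𝔞 : Ideal (𝓞 K), ∃ x : 𝓞 K, 𝔞 = Ideal.span {x} := fun 𝔞 =>
    (IsPrincipalIdealRing.principal 𝔞).principal
  have hcop : ∀ x : 𝓞 K, IsCoprime (Ideal.span {x}) (Ideal.span {(M : 𝓞 K)}) →
      IsCoprime x (M : 𝓞 K) := fun x hx => (Ideal.isCoprime_span_singleton_iff _ _).1 hx
  have hφ : ∀ u : (𝓞 K)ˣ, φ ((u : 𝓞 K) : K) ≠ 0 := fun u => embedding_ne_zero φ u.ne_zero
  choose π hπ using fun v : HeightOneSpectrum (𝓞 K) => hgen v.asIdeal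
  have hπ0 : ∀ v, π v ≠ 0 := by
    intro v h0
    have := hπ v
    rw [h0, Ideal.span_singleton_eq_bot.2 rfl] at this
    exact v.ne_bot this
  set Ψ : (FractionalIdeal (𝓞 K)⁰ K)ˣ →* ℂˣ := extHom fun v =>
    Units.mk0 (φ ((χ (π v) : 𝓞 K) : K) * φ (π v) ^ l)
      (mul_ne_zero (hφ _) (pow_ne_zero _ (embedding_ne_zero φ (hπ0 v)))) with hΨ
  have hΨv : ∀ v, (Ψ (primeUnit v) : ℂ) = φ ((χ (π v) : 𝓞 K) : K) * φ (π v) ^ l := by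
    intro v
    rw [hΨ, extHom_primeUnit, Units.val_mk0]
  have hφm : ∀ x y : 𝓞 K, φ ((x * y : 𝓞 K) : K) = φ x * φ y := by
    intro x y
    simp only [RingOfIntegers.coe_eq_algebraMap, _root_.map_mul]
  have hφu : ∀ u : (𝓞 K)ˣ, φ ((χ u : 𝓞 K) : K) * φ ((u : 𝓞 K) : K) ^ l = 1 := by
    intro u
    have := congrArg (fun w : (𝓞 K)ˣ => φ ((w : 𝓞 K) : K)) (hu u)
    simp only [Units.val_mul, Units.val_pow_eq_pow_val, Units.val_one,
      RingOfIntegers.coe_eq_algebraMap, _root_.map_mul, map_pow, _root_.map_one] at this ⊢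
    exact this
  have key : ∀ 𝔞 : Ideal (𝓞 K), 𝔞 ≠ 0 → IsCoprime 𝔞 (Ideal.span {(M : 𝓞 K)}) →
      ∀ x, 𝔞 = Ideal.span {x} → idealVal Ψ 𝔞 = φ ((χ x : 𝓞 K) : K) * φ x ^ l := by
    intro 𝔞 ha hc
    refine ideal_induction_primeTo hM0 (P := fun 𝔞 => ∀ x, 𝔞 = Ideal.span {x} →
      idealVal Ψ 𝔞 = φ ((χ x : 𝓞 K) : K) * φ x ^ l) ?_ ?_ ha hc
    · intro x hx
      obtain ⟨u, rfl⟩ := Ideal.span_singleton_eq_top.1 hx.symm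
      rw [idealVal_top, hφu]
    · intro v 𝔟 hv hb hbc ih x hx
      obtain ⟨y, rfl⟩ := hgen 𝔟
      have hx' := hx
      rw [hπ v, Ideal.span_singleton_mul_span_singleton, Ideal.span_singleton_eq_span_singleton]
        at hx'
      obtain ⟨u, rfl⟩ := hx'
      have hvc := (isCoprime_prime_iff hM0 v).2 hv
      rw [hπ v] at hvc
      have h1 := hcop _ hvc
      have h2 := hcop _ hbc
      have h3 : IsCoprime (u : 𝓞 K) (M : 𝓞 K) := ⟨((u⁻¹ : (𝓞 K)ˣ) : 𝓞 K), 0, by rw [Units.inv_mul]; ring⟩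
      rw [_root_.map_mul, ih y rfl, idealVal_prime, hΨv, h.map_mul _ _ (h1.mul_left h2) h3,
        h.map_mul _ _ h1 h2, Units.val_mul, Units.val_mul, hφm, hφm, hφm, hφm]
      linear_combination -(φ ((χ (π v) : 𝓞 K) : K) * φ (π v) ^ l *
        (φ ((χ y : 𝓞 K) : K) * φ y ^ l)) * hφu u
  have heta : ∀ x : 𝓞 K, PrimeToIdeal (Ideal.span {(M : 𝓞 K)}) x →
      etaHom φ l Ψ x = φ ((χ x : 𝓞 K) : K) := by
    intro x hx
    rw [etaHom_apply, key _ (span_ne_zero hx.1) hx.2 x rfl,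
      mul_div_cancel_right₀ _ (pow_ne_zero _ (embedding_ne_zero φ hx.1))]
  have hdvd : ∀ v : HeightOneSpectrum (𝓞 K), v.asIdeal ∣ Ideal.span {(M : 𝓞 K)} ↔
      (M : 𝓞 K) ∈ v.asIdeal := fun v => Ideal.dvd_span_singleton
  refine ⟨Ψ, ⟨hM0, ?_, ?_, ?_, ?_⟩, heta⟩
  · intro a b ha hb hab
    rw [heta a ha, heta b hb, h.congr a b (hcop a ha.2) (hcop b hb.2)
      (Ideal.mem_span_singleton.1 hab)]
  · intro v _
    exact ⟨((χ (π v) : 𝓞 K) : K) * (π v : K) ^ l, by rw [hΨv, _root_.map_mul, map_pow]⟩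
  · intro v hv
    rw [hdvd] at hv ⊢
    rwa [mem_conjPrime, map_natCast]
  · intro v hv
    have hvc := (isCoprime_prime_iff hM0 v).2 hv
    have hπc := hcop (π v) (by rwa [← hπ v])
    have hcp : (conjPrime v).asIdeal = Ideal.span {conjInt K (π v)} := by
      ext x
      rw [mem_conjPrime]
      conv_lhs => rw [hπ v]
      rw [Ideal.mem_span_singleton, Ideal.mem_span_singleton,
        ← map_dvd_iff (conjInt K), conjInt_conjInt]
    have hcv : ¬ (conjPrime v).asIdeal ∣ Ideal.span {(M : 𝓞 K)} := by
      rw [hdvd] at hv ⊢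
      rwa [mem_conjPrime, map_natCast]
    rw [← idealVal_prime, key _ (conjPrime v).ne_bot ((isCoprime_prime_iff hM0 _).2 hcv) _ hcp,
      h.map_conj _ hπc, ← conjInt_unit, embedding_conjInt, embedding_conjInt, hΨv, _root_.map_mul,
      map_pow]

/-- The factor `χ` is the prescribed component at `p`; the factor `χ'` has modulus prime to `p` and
serves only to satisfy the condition on units. -/
theorem exists_isLocalSetup [IsPrincipalIdealRing (𝓞 K)] (φ : K →+* ℂ) {p a : ℕ} (hp : p.Prime)
    (h : IsUnitChar (p ^ a) χ) (h' : IsUnitChar M χ') (hpM : ¬ p ∣ M)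
    (hu : ∀ u : (𝓞 K)ˣ, χ u * χ' u * u ^ l = 1) (b : ℕ) :
    ∃ (Ψ : (FractionalIdeal (𝓞 K)⁰ K)ˣ →* ℂˣ) (s r : ℕ) (e : ℤ), b ≤ s ∧
      IsLocalSetup φ l Ψ p s r e ∧ ∀ x : 𝓞 K, IsCoprime x (p : 𝓞 K) →
        locHom φ l Ψ e x = φ ((χ x : 𝓞 K) : K) := by
  have hM : M ≠ 0 := by rintro rfl; exact hpM (dvd_zero p)
  obtain ⟨Ψ, hg, heta⟩ := ((h.mono (dvd_mul_right _ M)).mul (h'.mono (dvd_mul_left _ _))).exists_isGood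
    φ (mul_ne_zero (pow_ne_zero a hp.ne_zero) hM) (l := l) hu
  obtain ⟨s, r, e, hb, hd, hs⟩ := _root_.exists_isLocalSetup hg hp (a + b)
  refine ⟨Ψ, s, r, e, by omega, hs, fun x hx => ?_⟩
  have hd' : p ^ a * M ∣ p ^ s * r := by
    rw [Ideal.dvd_span_singleton, Ideal.mem_span_singleton] at hd
    have := intCast_dvd_intCast (K := K) (m := ((p ^ a * M : ℕ) : ℤ)) (a := ((p ^ s * r : ℕ) : ℤ))
    rw [Int.cast_natCast, Int.cast_natCast] at this
    exact_mod_cast this.1 hd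
  have hMr : M ∣ r := by
    refine Nat.Coprime.dvd_of_dvd_mul_left (k := M) (m := p ^ s) ?_ ((dvd_mul_left _ _).trans hd')
    exact ((hp.coprime_iff_not_dvd.2 hpM).pow_left s).symm
  have hc := hs.isCoprime_crtLift hx
  have hc' : IsCoprime (crtLift e x) ((p ^ a * M : ℕ) : 𝓞 K) :=
    hc.of_isCoprime_of_dvd_right (Nat.cast_dvd_cast hd')
  have hca : IsCoprime (crtLift e x) ((p ^ a : ℕ) : 𝓞 K) :=
    hc'.of_isCoprime_of_dvd_right (Nat.cast_dvd_cast (dvd_mul_right _ _))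
  have hcM : IsCoprime (crtLift e x) (M : 𝓞 K) :=
    hc'.of_isCoprime_of_dvd_right (Nat.cast_dvd_cast (dvd_mul_left _ _))
  have hxa : IsCoprime x ((p ^ a : ℕ) : 𝓞 K) := by
    rw [Nat.cast_pow]; exact hx.pow_right
  have h1 : crtLift e x - x = ((e : 𝓞 K) - 1) * (x - 1) := by rw [crtLift]; ring
  have h2 : crtLift e x - 1 = (e : 𝓞 K) * (x - 1) := by rw [crtLift]; ring
  rw [locHom, heta _ ⟨(hs.primeTo_crtLift hx).1, (Ideal.isCoprime_span_singleton_iff _ _).2 hc'⟩,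
    Pi.mul_apply, h'.eq_one hcM, mul_one, h.congr _ _ hca hxa]
  · rw [h1]
    exact ((Nat.cast_dvd_cast (pow_dvd_pow p (by omega))).trans hs.sub_one_dvd).mul_right _
  · rw [h2]
    exact ((Nat.cast_dvd_cast hMr).trans hs.dvd_e).mul_right _

end IsUnitChar

theorem embedding_unit_eq_one_iff (φ : K →+* ℂ) {u : (𝓞 K)ˣ} :
    φ ((u : 𝓞 K) : K) = 1 ↔ u = 1 := by
  rw [← φ.map_one, φ.injective.eq_iff, ← Units.val_inj, Units.val_one]
  exact ⟨fun h => RingOfIntegers.ext (by simpa using h), fun h => by rw [h]; simp⟩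

/-- The character given by the discrete logarithm of `x ^ k` modulo `𝔫` to a unit base. -/
theorem exists_unitChar_of_log (u : (𝓞 K)ˣ) (k : ℕ) {𝔫 : Ideal (𝓞 K)} (hM : (M : 𝓞 K) ∈ 𝔫)
    (hconj : ∀ x ∈ 𝔫, conjInt K x ∈ 𝔫)
    (hex : ∀ x : 𝓞 K, IsCoprime x (M : 𝓞 K) → ∃ z ∈ Subgroup.zpowers u, x ^ k - (z : 𝓞 K) ∈ 𝔫)
    (huniq : ∀ z ∈ Subgroup.zpowers u, (z : 𝓞 K) - 1 ∈ 𝔫 → z = 1) :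
    ∃ χ : 𝓞 K → (𝓞 K)ˣ, IsUnitChar M χ ∧
      (∀ x : 𝓞 K, IsCoprime x (M : 𝓞 K) → χ x ∈ Subgroup.zpowers u ∧ x ^ k - (χ x : 𝓞 K) ∈ 𝔫) ∧
      ∀ x : 𝓞 K, IsCoprime x (M : 𝓞 K) → ∀ z ∈ Subgroup.zpowers u, x ^ k - (z : 𝓞 K) ∈ 𝔫 →
        χ x = z := by
  classical
  set χ : 𝓞 K → (𝓞 K)ˣ := fun x => if hx : IsCoprime x (M : 𝓞 K) then (hex x hx).choose else 1
    with hχ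
  have hspec : ∀ x : 𝓞 K, IsCoprime x (M : 𝓞 K) → χ x ∈ Subgroup.zpowers u ∧
      x ^ k - (χ x : 𝓞 K) ∈ 𝔫 := by
    intro x hx
    rw [hχ]
    simp only [dif_pos hx]
    exact (hex x hx).choose_spec
  have heq : ∀ x : 𝓞 K, IsCoprime x (M : 𝓞 K) → ∀ z ∈ Subgroup.zpowers u,
      x ^ k - (z : 𝓞 K) ∈ 𝔫 → χ x = z := by
    intro x hx z hz hxz
    obtain ⟨h1, h2⟩ := hspec x hx
    rw [← mul_inv_eq_one]
    refine huniq _ (Subgroup.mul_mem _ h1 (Subgroup.inv_mem _ hz)) ?_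
    have h3 := Ideal.mul_mem_right ((z⁻¹ : (𝓞 K)ˣ) : 𝓞 K) _ (Ideal.sub_mem _ hxz h2)
    convert h3 using 1
    rw [sub_sub_sub_cancel_left, sub_mul, Units.mul_inv, Units.val_mul]
  refine ⟨χ, ⟨fun x y hx hy => ?_, fun x y hx hy hxy => ?_, fun x hx => ?_⟩, hspec, heq⟩
  · refine heq _ (hx.mul_left hy) _ (Subgroup.mul_mem _ (hspec x hx).1 (hspec y hy).1) ?_
    have h1 := Ideal.mul_mem_left _ (x ^ k) (hspec y hy).2
    have h2 := Ideal.mul_mem_left _ (χ y : 𝓞 K) (hspec x hx).2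
    convert Ideal.add_mem _ h1 h2 using 1
    rw [Units.val_mul]; ring
  · refine heq _ hx _ (hspec y hy).1 ?_
    have h1 : x ^ k - y ^ k ∈ 𝔫 := Ideal.mem_of_dvd _ (hxy.trans (sub_dvd_pow_sub_pow x y k)) hM
    convert Ideal.add_mem _ h1 (hspec y hy).2 using 1
    ring
  · have hc : IsCoprime (conjInt K x) (M : 𝓞 K) := by
      have := hx.map (conjInt K).toRingHom
      simpa using this
    refine heq _ hc _ (Subgroup.inv_mem _ (hspec x hx).1) ?_
    have := hconj _ (hspec x hx).2
    rwa [map_sub, map_pow, conjInt_unit] at this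

end UnitChar

/-! ### Class number one, and characters given by a coordinate. -/

section PrincipalFields

variable {K : Type*} [Field K] [NumberField K] [Algebra.IsQuadraticExtension ℚ K]
    [IsTotallyComplex K] {φ : K →+* ℂ} {l M M' : ℕ} {ε : 𝓞 K → (𝓞 K)ˣ} {θ : 𝓞 K} {t n : ℤ}

theorem isPrincipalIdealRing_of_discr (hd : -4 ≤ discr K) : IsPrincipalIdealRing (𝓞 K) := by
  apply RingOfIntegers.isPrincipalIdealRing_of_abs_discr_lt
  have h2 : Module.finrank ℚ K = 2 := Algebra.IsQuadraticExtension.finrank_eq_two ℚ K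
  have h1 : InfinitePlace.nrComplexPlaces K = 1 := by
    have := IsTotallyComplex.finrank K
    omega
  rw [h1, h2]
  have h3 := discr_neg (K := K)
  have h4 : |(discr K : ℤ)| ≤ 4 := by rw [abs_le]; constructor <;> omega
  have h5 : |(discr K : ℝ)| ≤ 4 := by exact_mod_cast h4
  have := Real.pi_gt_three
  norm_num
  nlinarith

theorem exists_lt_of_mem_zpowers {G : Type*} [Group G] {u z : G} {n : ℕ} (hn : n ≠ 0)
    (hu : u ^ n = 1) (hz : z ∈ Subgroup.zpowers u) : ∃ j < n, z = u ^ j := by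
  obtain ⟨k, rfl⟩ := Subgroup.mem_zpowers_iff.1 hz
  have h0 : (0 : ℤ) < n := by exact_mod_cast Nat.pos_of_ne_zero hn
  refine ⟨(k % n).toNat, ?_, ?_⟩
  · have := Int.emod_lt_of_pos k h0
    have := Int.emod_nonneg k h0.ne'
    omega
  · rw [← zpow_natCast, Int.toNat_of_nonneg (Int.emod_nonneg k h0.ne')]
    conv_lhs => rw [← Int.emod_add_mul_ediv k n, zpow_add, zpow_mul, zpow_natCast, hu, one_zpow,
      mul_one]

theorem conjInt_mem_span_natCast (x : 𝓞 K) (hx : x ∈ Ideal.span {(M : 𝓞 K)}) :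
    conjInt K x ∈ Ideal.span {(M : 𝓞 K)} := by
  rw [Ideal.mem_span_singleton] at hx ⊢
  have := map_dvd (conjInt K) hx
  rwa [map_natCast] at this

theorem norm_unit (u : (𝓞 K)ˣ) : Algebra.norm ℤ (u : 𝓞 K) = 1 := by
  have h := mul_conjInt_eq_norm (u : 𝓞 K)
  rw [conjInt_unit, Units.mul_inv] at h
  exact_mod_cast h.symm

/-- A character on the elements congruent to one, given by a coordinate, extended by means of a
character `ε` with values congruent to the argument. -/
theorem IsUnitChar.exists_of_coord (hε : IsUnitChar M ε) (hθ : IsQuadGen θ t n) (hd : M ∣ M')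
    {m m' : ℤ} (hm : m ≠ 0) {u : (𝓞 K)ˣ} (hu : u ^ m' = 1) (P : ℤ → ℤ → Prop)
    (hP : ∀ x : 𝓞 K, IsCoprime x (M' : 𝓞 K) → ∀ a b : ℤ, x * ((ε x)⁻¹ : (𝓞 K)ˣ) = a + b * θ → P a b)
    (hPm : ∀ a b, P a b → m ∣ b)
    (hmul : ∀ a b c d, P a b → P c d → m * m' ∣ (a * d + b * c + t * b * d) - (b + d))
    (hM' : m * m' ∣ M') :
    ∃ ρ : 𝓞 K → (𝓞 K)ˣ, IsUnitChar M' ρ ∧ ∀ x : 𝓞 K, ∀ a b : ℤ,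
      x * ((ε x)⁻¹ : (𝓞 K)ˣ) = a + b * θ → ρ x = u ^ (b / m) := by
  choose A B hAB using hθ.exists_eq
  have hB : ∀ (x : 𝓞 K) (a b : ℤ), x = a + b * θ → B x = b := by
    intro x a b hx
    exact (hθ.ext_iff.1 ((hAB x).symm.trans hx)).2
  -- `u ^ (b / m)` depends only on `b` modulo `m * m'`. Under multiplication the coordinates along
  -- `θ` add modulo `m * m'` by `hmul`, and conjugation changes the sign of the coordinate.
  have hpow : ∀ b c : ℤ, m ∣ b → m ∣ c → m * m' ∣ b - c → u ^ (b / m) = u ^ (c / m) := by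
    rintro _ _ ⟨b, rfl⟩ ⟨c, rfl⟩ h
    rw [← mul_sub] at h
    obtain ⟨k, hk⟩ := Int.dvd_of_mul_dvd_mul_left hm h
    rw [Int.mul_ediv_cancel_left _ hm, Int.mul_ediv_cancel_left _ hm,
      show b = c + m' * k by omega, zpow_add, zpow_mul, hu, one_zpow, mul_one]
  have hε' := hε.mono hd
  refine ⟨fun x => u ^ (B (x * ((ε x)⁻¹ : (𝓞 K)ˣ)) / m), ⟨fun x y hx hy => ?_,
    fun x y hx hy hxy => ?_, fun x hx => ?_⟩, fun x a b hx => congrArg (fun b => u ^ (b / m)) (hB _ _ _ hx)⟩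
  · obtain ⟨a, b, hx1⟩ := hθ.exists_eq (x * ((ε x)⁻¹ : (𝓞 K)ˣ))
    obtain ⟨c, d, hy1⟩ := hθ.exists_eq (y * ((ε y)⁻¹ : (𝓞 K)ˣ))
    have hxy : x * y * ((ε (x * y))⁻¹ : (𝓞 K)ˣ) =
        ((a * c - n * b * d : ℤ) : 𝓞 K) + ((a * d + b * c + t * b * d : ℤ) : 𝓞 K) * θ := by
      rw [hε'.map_mul x y hx hy, mul_inv, Units.val_mul, mul_mul_mul_comm, hx1, hy1]
      have := hθ.sq
      push_cast
      linear_combination (b : 𝓞 K) * d * this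
    have p1 := hP x hx a b hx1
    have p2 := hP y hy c d hy1
    have p3 := hP _ (hx.mul_left hy) _ _ hxy
    simp only [hB _ _ _ hxy, hB _ _ _ hx1, hB _ _ _ hy1]
    rw [← zpow_add, ← Int.add_ediv_of_dvd_left (hPm _ _ p1)]
    exact hpow _ _ (hPm _ _ p3) (dvd_add (hPm _ _ p1) (hPm _ _ p2)) (hmul _ _ _ _ p1 p2)
  · obtain ⟨a, b, hx1⟩ := hθ.exists_eq (x * ((ε x)⁻¹ : (𝓞 K)ˣ))
    obtain ⟨c, d, hy1⟩ := hθ.exists_eq (y * ((ε y)⁻¹ : (𝓞 K)ˣ))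
    have p1 := hP x hx a b hx1
    have p2 := hP y hy c d hy1
    simp only [hB _ _ _ hx1, hB _ _ _ hy1]
    refine hpow _ _ (hPm _ _ p1) (hPm _ _ p2) (hM'.trans ?_)
    have h1 : ((M' : ℤ) : 𝓞 K) ∣ ((a - c : ℤ) : 𝓞 K) + ((b - d : ℤ) : 𝓞 K) * θ := by
      have : ((a - c : ℤ) : 𝓞 K) + ((b - d : ℤ) : 𝓞 K) * θ =
          (x - y) * ((ε x)⁻¹ : (𝓞 K)ˣ) := by
        rw [sub_mul, hx1, hε'.congr x y hx hy hxy, hy1]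
        push_cast; ring
      rw [this, Int.cast_natCast]
      exact hxy.mul_right _
    exact ((hθ.dvd_iff).1 h1).2
  · obtain ⟨a, b, hx1⟩ := hθ.exists_eq (x * ((ε x)⁻¹ : (𝓞 K)ˣ))
    have hx2 : conjInt K x * ((ε (conjInt K x))⁻¹ : (𝓞 K)ˣ) =
        ((a + t * b : ℤ) : 𝓞 K) + ((-b : ℤ) : 𝓞 K) * θ := by
      have h1 := congrArg (conjInt K) hx1
      rw [_root_.map_mul, conjInt_unit, map_add, _root_.map_mul, map_intCast, map_intCast, hθ.conj_eq] at h1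
      rw [hε'.map_conj x hx, h1]
      push_cast; ring
    simp only [hB _ _ _ hx1, hB _ _ _ hx2]
    rw [Int.neg_ediv_of_dvd (hPm _ _ (hP x hx a b hx1)), zpow_neg]

end PrincipalFields

/-! ### Units and characters for discriminant `-4`. -/

section Gaussian

variable {K : Type*} [Field K] [NumberField K] [Algebra.IsQuadraticExtension ℚ K]
    [IsTotallyComplex K] {θ : 𝓞 K}

theorem IsQuadGen.gaussian_sq (hθ : IsQuadGen θ 0 1) : θ ^ 2 = -1 := by rw [hθ.sq]; push_cast; ring

theorem IsQuadGen.exists_gaussian_unit (hθ : IsQuadGen θ 0 1) : ∃ u : (𝓞 K)ˣ, (u : 𝓞 K) = θ ∧ u ^ 4 = 1 ∧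
    (∀ z ∈ Subgroup.zpowers u, (z : 𝓞 K) = 1 ∨ (z : 𝓞 K) = θ ∨ (z : 𝓞 K) = -1 ∨ (z : 𝓞 K) = -θ) ∧
    1 ∈ Subgroup.zpowers u ∧ u ∈ Subgroup.zpowers u ∧ -1 ∈ Subgroup.zpowers u ∧
    -u ∈ Subgroup.zpowers u ∧ ∀ w : (𝓞 K)ˣ, w ∈ Subgroup.zpowers u := by
  have h2 := hθ.gaussian_sq
  obtain ⟨u, hu⟩ : ∃ u : (𝓞 K)ˣ, (u : 𝓞 K) = θ :=
    ⟨⟨θ, -θ, by linear_combination -h2, by linear_combination -h2⟩, rfl⟩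
  have hu2 : u ^ 2 = -1 := Units.ext (by rw [Units.val_pow_eq_pow_val, hu, h2]; simp)
  have hu4 : u ^ 4 = 1 := by rw [show 4 = 2 * 2 from rfl, pow_mul, hu2]; simp
  have m1 := Subgroup.one_mem (Subgroup.zpowers u)
  have m2 := Subgroup.mem_zpowers u
  have m3 : -1 ∈ Subgroup.zpowers u := hu2 ▸ Subgroup.npow_mem_zpowers u 2
  have m4 : -u ∈ Subgroup.zpowers u := by
    have := Subgroup.mul_mem _ m3 m2
    rwa [neg_one_mul] at this
  refine ⟨u, hu, hu4, fun z hz => ?_, m1, m2, m3, m4, fun w => ?_⟩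
  · obtain ⟨j, hj, rfl⟩ := exists_lt_of_mem_zpowers (by norm_num) hu4 hz
    interval_cases j
    · simp
    · simp [hu]
    · simp [hu2]
    · simp [pow_succ u 2, hu2, hu]
  · obtain ⟨a, b, hab⟩ := hθ.exists_eq (w : 𝓞 K)
    have hn := norm_unit w
    rw [hab, hθ.norm_eq] at hn
    have ha : a ^ 2 ≤ 1 := by nlinarith [sq_nonneg b]
    have hb : b ^ 2 ≤ 1 := by nlinarith [sq_nonneg a]
    have ha1 : -1 ≤ a := by nlinarith
    have ha2 : a ≤ 1 := by nlinarith
    have hb1 : -1 ≤ b := by nlinarith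
    have hb2 : b ≤ 1 := by nlinarith
    have key : ∀ z : (𝓞 K)ˣ, (w : 𝓞 K) = z → z ∈ Subgroup.zpowers u →
        w ∈ Subgroup.zpowers u := by
      intro z hz hzm
      rwa [Units.ext hz]
    interval_cases a <;> interval_cases b <;> norm_num at hn
    · exact key _ (by rw [hab]; simp) m3
    · exact key _ (by rw [hab]; simp [hu]) m4
    · exact key _ (by rw [hab]; simp [hu]) m2
    · exact key _ (by rw [hab]; simp) m1

/-- With `i` for `θ`, the element `2 + 2 i` equals `(1 + i) ^ 3` up to a unit. -/
theorem IsQuadGen.mem_span_two_add (hθ : IsQuadGen θ 0 1) {a b : ℤ} :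
    (a + b * θ : 𝓞 K) ∈ Ideal.span {2 + 2 * θ} ↔ (2 : ℤ) ∣ a ∧ (4 : ℤ) ∣ a + b := by
  have h2 := hθ.gaussian_sq
  rw [Ideal.mem_span_singleton]
  constructor
  · rintro ⟨y, hy⟩
    obtain ⟨c, d, rfl⟩ := hθ.exists_eq y
    have : (a + b * θ : 𝓞 K) = ((2 * c - 2 * d : ℤ) : 𝓞 K) + ((2 * c + 2 * d : ℤ) : 𝓞 K) * θ := by
      rw [hy]; push_cast; linear_combination 2 * (d : 𝓞 K) * h2
    obtain ⟨rfl, rfl⟩ := hθ.ext_iff.1 this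
    exact ⟨⟨c - d, by ring⟩, ⟨c, by ring⟩⟩
  · rintro ⟨⟨k, rfl⟩, j, hj⟩
    obtain rfl : b = 4 * j - 2 * k := by linarith
    refine ⟨j + (j - k) * θ, ?_⟩
    push_cast
    linear_combination -2 * ((j : 𝓞 K) - k) * h2

theorem IsQuadGen.gaussian_norm (hθ : IsQuadGen θ 0 1) (a b : ℤ) : Algebra.norm ℤ (a + b * θ : 𝓞 K) = a ^ 2 + b ^ 2 := by
  rw [hθ.norm_eq]; ring

/-- The character modulo `(1 + i) ^ 3` given by the units. -/
theorem IsQuadGen.exists_gaussian_two (hθ : IsQuadGen θ 0 1) : ∃ ε : 𝓞 K → (𝓞 K)ˣ, IsUnitChar (2 ^ 2) ε ∧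
    (∀ x : 𝓞 K, IsCoprime x ((2 : ℕ) : 𝓞 K) →
      x - (ε x : 𝓞 K) ∈ Ideal.span {2 + 2 * θ} ∧
      ∀ z : (𝓞 K)ˣ, x - z ∈ Ideal.span {2 + 2 * θ} → ε x = z) := by
  obtain ⟨u, hu, hu4, hz, m1, m2, m3, m4, hall⟩ := hθ.exists_gaussian_unit
  have h2 := hθ.gaussian_sq
  have hcop : ∀ x : 𝓞 K, IsCoprime x ((2 ^ 2 : ℕ) : 𝓞 K) ↔ IsCoprime x ((2 : ℕ) : 𝓞 K) := by
    intro x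
    rw [Nat.cast_pow, IsCoprime.pow_right_iff two_pos]
  refine Exists.elim (exists_unitChar_of_log (K := K) (M := 2 ^ 2) u 1
    (𝔫 := Ideal.span {2 + 2 * θ}) ?_ ?_ ?_ ?_) ?_
  · have := (hθ.mem_span_two_add (a := 4) (b := 0)).2 ⟨by norm_num, by norm_num⟩
    norm_num at this ⊢
    exact this
  · intro x hx
    obtain ⟨a, b, rfl⟩ := hθ.exists_eq x
    have h4 : conjInt K (a + b * θ) = (a : ℤ) + ((-b : ℤ) : 𝓞 K) * θ := by
      rw [map_add, map_mul, map_intCast, map_intCast, hθ.conj_eq]; push_cast; ring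
    rw [h4]
    rw [hθ.mem_span_two_add] at hx ⊢
    omega
  · intro x hx
    rw [hcop, isCoprime_natCast_iff_not_dvd Nat.prime_two] at hx
    obtain ⟨a, b, rfl⟩ := hθ.exists_eq x
    rw [hθ.gaussian_norm] at hx
    have hab : (a + b) % 2 = 1 := by
      rcases Int.even_or_odd' a with ⟨k, rfl | rfl⟩ <;> rcases Int.even_or_odd' b with ⟨j, rfl | rfl⟩
      · exact absurd ⟨2 * k ^ 2 + 2 * j ^ 2, by push_cast; ring⟩ hx
      · omega
      · omega
      · exact absurd ⟨2 * k ^ 2 + 2 * j ^ 2 + 2 * k + 2 * j + 1, by push_cast; ring⟩ hx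
    have key : ∀ (z : (𝓞 K)ˣ) (c d : ℤ), (z : 𝓞 K) = c + d * θ → z ∈ Subgroup.zpowers u →
        (2 : ℤ) ∣ a - c ∧ (4 : ℤ) ∣ (a - c) + (b - d) → ∃ z ∈ Subgroup.zpowers u,
          (a + b * θ : 𝓞 K) ^ 1 - (z : 𝓞 K) ∈ Ideal.span {2 + 2 * θ} := by
      intro z c d hz hzu hdiv
      refine ⟨z, hzu, ?_⟩
      have := hθ.mem_span_two_add.2 hdiv
      convert this using 1
      rw [hz]; push_cast; ring
    -- The four units represent the four invertible classes modulo `(1 + i) ^ 3`; the parity of `a`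
    -- and the class of `a + b` modulo `4` tell them apart.
    rcases Int.emod_two_eq_zero_or_one a with ha | ha
    · by_cases h4 : (a + b) % 4 = 1
      · exact key u 0 1 (by simp [hu]) m2 (by omega)
      · exact key (-u) 0 (-1) (by simp [hu]) m4 (by omega)
    · by_cases h4 : (a + b) % 4 = 1
      · exact key 1 1 0 (by simp) m1 (by omega)
      · exact key (-1) (-1) 0 (by simp) m3 (by omega)
  · intro z hzu hz1
    have key : ∀ c d : ℤ, (z : 𝓞 K) = c + d * θ → (2 : ℤ) ∣ c - 1 ∧ (4 : ℤ) ∣ c - 1 + d := by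
      intro c d hcd
      rw [← hθ.mem_span_two_add]
      convert hz1 using 1
      rw [hcd]; push_cast; ring
    rcases hz z hzu with h | h | h | h
    · exact Units.ext h
    · have := key 0 1 (by rw [h]; simp)
      omega
    · have := key (-1) 0 (by rw [h]; simp)
      omega
    · have := key 0 (-1) (by rw [h]; simp)
      omega
  · rintro ε ⟨h1, h2, h3⟩
    refine ⟨ε, h1, fun x hx => ⟨?_, fun z hz => ?_⟩⟩
    · simpa using (h2 x ((hcop x).2 hx)).2
    · exact h3 x ((hcop x).2 hx) z (hall z) (by simpa using hz)

/-- The square of the character modulo `3` given by the units. -/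
theorem IsQuadGen.exists_gaussian_three (hθ : IsQuadGen θ 0 1) : ∃ η : 𝓞 K → (𝓞 K)ˣ, IsUnitChar 3 η ∧
    ∀ u : (𝓞 K)ˣ, η u = u ^ 2 := by
  obtain ⟨u, hu, hu4, hz, m1, m2, m3, m4, hall⟩ := hθ.exists_gaussian_unit
  have h2 := hθ.gaussian_sq
  have hmem : ∀ a b : ℤ, (a + b * θ : 𝓞 K) ∈ Ideal.span {((3 : ℕ) : 𝓞 K)} ↔
      (3 : ℤ) ∣ a ∧ (3 : ℤ) ∣ b := by
    intro a b
    rw [Ideal.mem_span_singleton, ← hθ.dvd_iff]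
    push_cast; rfl
  refine Exists.elim (exists_unitChar_of_log (K := K) (M := 3) u 2
    (𝔫 := Ideal.span {((3 : ℕ) : 𝓞 K)}) (Ideal.mem_span_singleton_self _)
    conjInt_mem_span_natCast ?_ ?_) ?_
  · intro x hx
    rw [isCoprime_natCast_iff_not_dvd Nat.prime_three] at hx
    obtain ⟨a, b, rfl⟩ := hθ.exists_eq x
    rw [hθ.gaussian_norm] at hx
    have key : ∀ (z : (𝓞 K)ˣ) (c d : ℤ), (z : 𝓞 K) = c + d * θ → z ∈ Subgroup.zpowers u →
        (3 : ℤ) ∣ a ^ 2 - b ^ 2 - c ∧ (3 : ℤ) ∣ 2 * a * b - d → ∃ z ∈ Subgroup.zpowers u,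
          (a + b * θ : 𝓞 K) ^ 2 - (z : 𝓞 K) ∈ Ideal.span {((3 : ℕ) : 𝓞 K)} := by
      intro z c d hz hzu hdiv
      refine ⟨z, hzu, ?_⟩
      have := (hmem _ _).2 hdiv
      convert this using 1
      rw [hz]; push_cast
      linear_combination (b : 𝓞 K) ^ 2 * h2
    -- In the multiplicative group of the field with nine elements, cyclic of order `8`, the squares
    -- are exactly the classes of the four units.
    have hfin : ∀ a b : ZMod 3, a ^ 2 + b ^ 2 ≠ 0 →
        (a ^ 2 - b ^ 2 - (1 : ℤ) = 0 ∧ 2 * a * b - (0 : ℤ) = 0) ∨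
        (a ^ 2 - b ^ 2 - (0 : ℤ) = 0 ∧ 2 * a * b - (1 : ℤ) = 0) ∨
        (a ^ 2 - b ^ 2 - (-1 : ℤ) = 0 ∧ 2 * a * b - (0 : ℤ) = 0) ∨
        (a ^ 2 - b ^ 2 - (0 : ℤ) = 0 ∧ 2 * a * b - (-1 : ℤ) = 0) := by decide
    have hx' : ((a : ZMod 3)) ^ 2 + (b : ZMod 3) ^ 2 ≠ 0 := by
      have := (ZMod.intCast_zmod_eq_zero_iff_dvd (a ^ 2 + b ^ 2) 3).not.2 (by exact_mod_cast hx)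
      exact_mod_cast this
    have conv : ∀ c d : ℤ, ((a : ZMod 3) ^ 2 - (b : ZMod 3) ^ 2 - (c : ZMod 3) = 0 ∧
        2 * (a : ZMod 3) * b - (d : ZMod 3) = 0) →
        (3 : ℤ) ∣ a ^ 2 - b ^ 2 - c ∧ (3 : ℤ) ∣ 2 * a * b - d := by
      rintro c d ⟨e1, e2⟩
      constructor
      · exact (ZMod.intCast_zmod_eq_zero_iff_dvd _ 3).1 (by exact_mod_cast e1)
      · exact (ZMod.intCast_zmod_eq_zero_iff_dvd _ 3).1 (by exact_mod_cast e2)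
    rcases hfin _ _ hx' with h | h | h | h
    · exact key 1 1 0 (by simp) m1 (conv _ _ h)
    · exact key u 0 1 (by simp [hu]) m2 (conv _ _ h)
    · exact key (-1) (-1) 0 (by simp) m3 (conv _ _ h)
    · exact key (-u) 0 (-1) (by simp [hu]) m4 (conv _ _ h)
  · intro z hzu hz1
    have key : ∀ c d : ℤ, (z : 𝓞 K) = c + d * θ → (3 : ℤ) ∣ c - 1 ∧ (3 : ℤ) ∣ d := by
      intro c d hcd
      rw [← hmem]
      convert hz1 using 1
      rw [hcd]; push_cast; ring
    rcases hz z hzu with h | h | h | h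
    · exact Units.ext h
    · have := key 0 1 (by rw [h]; simp)
      omega
    · have := key (-1) 0 (by rw [h]; simp)
      omega
    · have := key 0 (-1) (by rw [h]; simp)
      omega
  · rintro η ⟨h1, -, h3⟩
    exact ⟨η, h1, fun w => h3 _ ⟨((w⁻¹ : (𝓞 K)ˣ) : 𝓞 K), 0, by rw [Units.inv_mul]; ring⟩ _
      (Subgroup.pow_mem _ (hall w) 2) (by rw [Units.val_pow_eq_pow_val, sub_self]; exact zero_mem _)⟩

end Gaussian

/-! ### The table for discriminant `-4`. -/

section GaussianTable

variable {K : Type*} [Field K] [NumberField K] [Algebra.IsQuadraticExtension ℚ K]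
    [IsTotallyComplex K] {φ : K →+* ℂ} {l : ℕ} {Ψ : (FractionalIdeal (𝓞 K)⁰ K)ˣ →* ℂˣ}
    {p s r : ℕ} {e : ℤ} {v : HeightOneSpectrum (𝓞 K)} {θ : 𝓞 K}

theorem neg_one_ne_one_unit : (-1 : (𝓞 K)ˣ) ≠ 1 := by
  intro h
  have := congrArg (fun u : (𝓞 K)ˣ => (u : 𝓞 K)) h
  norm_num at this

theorem locTriv_zero_of_eq_embedding_one
    (hL : ∀ x : 𝓞 K, IsCoprime x (p : 𝓞 K) → locHom φ l Ψ e x = φ (((1 : (𝓞 K)ˣ) : 𝓞 K) : K))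
    {𝔮 : Ideal (𝓞 K)} : LocTriv φ l Ψ p e 𝔮 0 := fun x hx _ => by
  rw [hL x hx, embedding_unit_eq_one_iff]

theorem exponentAt_two_of_neg_four (h : IsLocalSetup φ l Ψ 2 s r e) (hs : 6 ≤ s)
    (hv : ((2 : ℕ) : 𝓞 K) ∈ v.asIdeal) (hd : discr K = -4) {𝔣 : Ideal (𝓞 K)}
    (hf : IsCond φ l Ψ (Ideal.span {((2 ^ s * r : ℕ) : 𝓞 K)}) 𝔣) :
    exponentAt v 𝔣 ∈ possibleExponents v l := by
  have hd2 : ((2 : ℕ) : ℤ) ∣ discr K := by rw [hd]; norm_num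
  have h𝔮 := isLocalIdeal_of_dvd_discr Nat.prime_two hd2 hv
  have hN := absNorm_of_dvd_discr Nat.prime_two hd2 hv
  obtain ⟨θ, hθ⟩ := exists_isQuadGen_of_discr_eq_neg_four hd
  have e6 := (h.le_iff h𝔮 hv hf hs).2 (h.locTriv_six h𝔮 hN hd)
  have e5 := h.locTriv_four_of_five h𝔮 hN hθ
  rw [← h.le_iff h𝔮 hv hf (by omega), ← h.le_iff h𝔮 hv hf (by omega)] at e5
  rw [possibleExponents_two_of_neg_four l hv hd]
  split_ifs with hl
  · have e2 := (h.le_iff h𝔮 hv hf (by omega)).not.2 (h.not_locTriv_two (by omega) h𝔮 hl hd)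
    simp only [Set.mem_insert_iff, Set.mem_singleton_iff]; omega
  · have e3 := h.locTriv_two_of_three h𝔮 hN (Nat.not_odd_iff_even.1 hl)
    have e1 := h.locTriv_zero_of_two h𝔮 hN
    rw [← h.le_iff h𝔮 hv hf (by omega), ← h.le_iff h𝔮 hv hf (by omega)] at e3 e1
    simp only [Set.mem_insert_iff, Set.mem_singleton_iff]; omega

theorem IsQuadGen.gaussian_one_add_mem (hθ : IsQuadGen θ 0 1)
    (h𝔮 : IsLocalIdeal 2 v.asIdeal 2) : 1 + θ ∈ v.asIdeal :=
  h𝔮.mem_of_sq (w := θ) (by linear_combination hθ.gaussian_sq)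

theorem IsQuadGen.mem_span_of_mem_cube (hθ : IsQuadGen θ 0 1)
    (h𝔮 : IsLocalIdeal 2 v.asIdeal 2) {x : 𝓞 K} (hx : x ∈ v.asIdeal ^ 3) :
    x ∈ Ideal.span {2 + 2 * θ} := by
  rw [show 3 = 2 * 1 + 1 from rfl, h𝔮.mem_pow_iff] at hx
  obtain ⟨y, hy, rfl⟩ := hx
  obtain ⟨a, b, rfl⟩ := hθ.exists_eq y
  rw [pow_one] at hy
  have h1 := Ideal.sub_mem _ hy (Ideal.mul_mem_left _ (b : 𝓞 K) (hθ.gaussian_one_add_mem h𝔮))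
  have h2 : (a + b * θ : 𝓞 K) - b * (1 + θ) = ((a - b : ℤ) : 𝓞 K) := by push_cast; ring
  rw [h2, intCast_mem_iff h𝔮] at h1
  have h3 : ((2 : ℕ) : 𝓞 K) ^ 1 * (a + b * θ) = ((2 * a : ℤ) : 𝓞 K) + ((2 * b : ℤ) : 𝓞 K) * θ := by
    push_cast; ring
  rw [h3, hθ.mem_span_two_add]
  push_cast at h1
  omega

/-- The twist by `χ₈` has exponent exactly `4`: norms of elements `1 + 4 y` are `1` modulo `8`,
while `3 + 2 i`, congruent to `1` modulo `v ^ 3`, has norm `13`, which is `5` modulo `8`. -/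
theorem IsLocalSetup.realizable_four (h : IsLocalSetup φ l Ψ 2 s r e) (hs : 4 ≤ s)
    (h𝔮 : IsLocalIdeal 2 v.asIdeal 2) (hv : ((2 : ℕ) : 𝓞 K) ∈ v.asIdeal)
    (hθ : IsQuadGen θ 0 1) (ht : LocTriv φ l Ψ 2 e v.asIdeal 3) : Realizable φ l v 4 := by
  have h' := h.normTwist_eight (by omega)
  refine h'.realizable_succ h𝔮 hv hs (fun x hx hx1 => ?_) fun ht' => ?_
  · rw [h.locHom_normTwist_eight (by omega) hx, ht x hx (Ideal.pow_le_pow_right (by omega) hx1)]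
    rw [show 3 + 1 = 2 * 2 + 0 from rfl, h𝔮.mem_pow_iff] at hx1
    obtain ⟨y, -, hy⟩ := hx1
    obtain ⟨a, b, rfl⟩ := hθ.exists_eq y
    have hx2 : x = ((1 + 4 * a : ℤ) : 𝓞 K) + ((4 * b : ℤ) : 𝓞 K) * θ := by
      push_cast at hy ⊢
      linear_combination hy
    have hN : Algebra.norm ℤ x % 8 = 1 := by
      rw [hx2, hθ.gaussian_norm,
        show (1 + 4 * a) ^ 2 + (4 * b) ^ 2 = 1 + 8 * (a + 2 * a ^ 2 + 2 * b ^ 2) by ring]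
      omega
    have : ZMod.χ₈ (Algebra.norm ℤ x : ℤ) = 1 := by
      rw [ZMod.χ₈_int_eq_if_mod_eight]
      split_ifs <;> omega
    rw [this]; norm_num
  · have hc := isCoprime_one_add_two (1 + θ)
    have hx : (1 + 2 * (1 + θ)) - 1 ∈ v.asIdeal ^ 3 := by
      rw [add_sub_cancel_left]
      simpa using (h𝔮.two_pow_mul_mem 1 1 (y := 1 + θ)).2
        (by simpa using hθ.gaussian_one_add_mem h𝔮)
    have h1 := ht' _ hc hx
    have e1 : (1 + 2 * (1 + θ)) = ((3 : ℤ) : 𝓞 K) + ((2 : ℤ) : 𝓞 K) * θ := by push_cast; ring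
    rw [h.locHom_normTwist_eight (by omega) hc, ht _ hc hx, χ₈_intCast_five] at h1
    · norm_num at h1
    · rw [e1, hθ.gaussian_norm]; norm_num

/-- Write `x / ε(x) = a + b i`, which is `1` modulo `(1 + i) ^ 3`, and put `ρ(x) = i ^ (b / 2)`.
This character is trivial on units, so it can be multiplied into a given one. At `5 + 4 i = 1 + 4 (1
+ i)`, congruent to `1` modulo `v ^ 5`, it equals `-1`, and `χ`, of modulus `4`, does not interfere.
-/
theorem realizable_six (φ : K →+* ℂ) (hθ : IsQuadGen θ 0 1) (hd : discr K = -4)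
    (hv : ((2 : ℕ) : 𝓞 K) ∈ v.asIdeal) {M : ℕ} {χ χ' : 𝓞 K → (𝓞 K)ˣ}
    (hχ : IsUnitChar (2 ^ 2) χ) (hχ' : IsUnitChar M χ') (hM : ¬ 2 ∣ M)
    (hu : ∀ u : (𝓞 K)ˣ, χ u * χ' u * u ^ l = 1) : Realizable φ l v 6 := by
  have := isPrincipalIdealRing_of_discr (K := K) hd.ge
  have hd2 : ((2 : ℕ) : ℤ) ∣ discr K := by rw [hd]; norm_num
  have h𝔮 := isLocalIdeal_of_dvd_discr Nat.prime_two hd2 hv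
  have hN := absNorm_of_dvd_discr Nat.prime_two hd2 hv
  obtain ⟨ε, hε, hεx⟩ := hθ.exists_gaussian_two
  obtain ⟨u, huθ, hu4, -⟩ := hθ.exists_gaussian_unit
  have h2 := hθ.gaussian_sq
  obtain ⟨ρ, hρ, hρx⟩ := hε.exists_of_coord hθ (M' := 2 ^ 3) (pow_dvd_pow 2 (by norm_num))
    (m := 2) (m' := 4) (u := u) two_ne_zero (by exact_mod_cast hu4)
    (fun a b => 2 ∣ b ∧ 4 ∣ a + b - 1) (fun x hx a b hab => by
      have hx2 : IsCoprime x ((2 : ℕ) : 𝓞 K) := by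
        rwa [Nat.cast_pow, IsCoprime.pow_right_iff (by norm_num)] at hx
      have h1 := Ideal.mul_mem_right (((ε x)⁻¹ : (𝓞 K)ˣ) : 𝓞 K) _ (hεx x hx2).1
      have h3 : (x - (ε x : 𝓞 K)) * (((ε x)⁻¹ : (𝓞 K)ˣ) : 𝓞 K) = ((a - 1 : ℤ) : 𝓞 K) + b * θ := by
        rw [sub_mul, Units.mul_inv, hab]; push_cast; ring
      rw [h3, hθ.mem_span_two_add] at h1
      omega)
    (fun a b h => h.1)
    (by
      rintro a b c d ⟨⟨b, rfl⟩, k, hk⟩ ⟨⟨d, rfl⟩, j, hj⟩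
      exact ⟨d * k + b * j - b * d, by linear_combination 2 * d * hk + 2 * b * hj⟩)
    (by norm_num)
  have hρ1 : ∀ w : (𝓞 K)ˣ, ρ w = 1 := by
    intro w
    have h1 : ε w = w := (hεx w ⟨((w⁻¹ : (𝓞 K)ˣ) : 𝓞 K), 0, by rw [Units.inv_mul]; ring⟩).2 w
      (by rw [sub_self]; exact zero_mem _)
    rw [hρx w 1 0 (by rw [h1, Units.mul_inv]; simp)]
    simp
  obtain ⟨Ψ, s, r, e, hs, h, hL⟩ := ((hχ.mono (pow_dvd_pow 2 (show 2 ≤ 3 by norm_num))).mul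
    hρ).exists_isLocalSetup φ Nat.prime_two hχ' hM (l := l)
    (fun w => by rw [Pi.mul_apply, hρ1, mul_one, hu]) 6
  refine h.realizable_succ h𝔮 hv hs (h.locTriv_six h𝔮 hN hd) fun ht => ?_
  have hx : (1 + 2 ^ 2 * (1 + θ)) - 1 ∈ v.asIdeal ^ 5 := by
    rw [add_sub_cancel_left]
    exact (h𝔮.two_pow_mul_mem 2 1 (y := 1 + θ)).2
      (by simpa using hθ.gaussian_one_add_mem h𝔮)
  have hc : IsCoprime (1 + 2 ^ 2 * (1 + θ)) ((2 : ℕ) : 𝓞 K) :=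
    h𝔮.isCoprime_of_sub_one_mem (by norm_num) hx
  have hε1 : ε (1 + 2 ^ 2 * (1 + θ)) = 1 := (hεx _ hc).2 1
    (by
      rw [Units.val_one]
      exact hθ.mem_span_of_mem_cube h𝔮 (Ideal.pow_le_pow_right (by norm_num) hx))
  have hχ1 : χ (1 + 2 ^ 2 * (1 + θ)) = 1 := by
    refine hχ.eq_one (by rw [Nat.cast_pow]; exact hc.pow_right) ?_
    rw [add_sub_cancel_left, Nat.cast_pow, Nat.cast_ofNat]
    exact dvd_mul_right _ _
  have h1 := ht _ hc hx
  rw [hL _ hc, embedding_unit_eq_one_iff, Pi.mul_apply, hχ1, one_mul,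
    hρx _ 5 4 (by rw [hε1]; push_cast; simp; ring)] at h1
  refine neg_one_ne_one_unit (K := K) (h1.symm.trans ?_).symm
  apply Units.ext
  norm_num
  rw [huθ, h2]

/-- The `∞`-type is absorbed at `2` by `ε ^ (-l)`, because `ε` is the identity on units. This gives
exponent `0` at `p`, and a quadratic twist gives `1`. -/
theorem realizable_gaussian_odd (φ : K →+* ℂ) (hd : discr K = -4) (hp : p.Prime) (hp2 : p ≠ 2)
    (hv : (p : 𝓞 K) ∈ v.asIdeal) {n : ℕ} (hn : n ∈ possibleExponents v l) :
    Realizable φ l v n := by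
  have := isPrincipalIdealRing_of_discr (K := K) hd.ge
  have hpd : ¬ (p : ℤ) ∣ discr K := fun h => discr_ne_neg_four_of_dvd hp hp2 h hd
  have h𝔮 := isLocalIdeal_of_not_dvd_discr (K := K) hp hpd
  obtain ⟨θ, hθ⟩ := exists_isQuadGen_of_discr_eq_neg_four hd
  obtain ⟨ε, hε, hεx⟩ := hθ.exists_gaussian_two
  have hεu : ∀ w : (𝓞 K)ˣ, ε w = w := fun w =>
    (hεx w ⟨((w⁻¹ : (𝓞 K)ˣ) : 𝓞 K), 0, by rw [Units.inv_mul]; ring⟩).2 w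
      (by rw [sub_self]; exact zero_mem _)
  obtain ⟨Ψ, s, r, e, hs, h, hL⟩ := (IsUnitChar.one (K := K) (M := p ^ 0)).exists_isLocalSetup φ hp
    (hε.pow l).inv (fun h => hp2 ((Nat.prime_dvd_prime_iff_eq hp Nat.prime_two).1
      (hp.dvd_of_dvd_pow h))) (l := l)
    (fun w => by simp [hεu]) 1
  have ht : LocTriv φ l Ψ p e (Ideal.span {(p : 𝓞 K)}) 0 := locTriv_zero_of_eq_embedding_one hL
  rw [possibleExponents_odd_unramified l hp hv hp2 hpd] at hn
  rcases hn with rfl | rfl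
  · exact h.realizable_zero h𝔮 hv ht
  · exact h.realizable_one_of_locTriv_zero h𝔮 hv hp2 hpd ht

/-- For odd `l`, `ε ^ (-l)` has exponent `3`. For even `l` the `∞`-type can be absorbed at `3` by
powers of `η`, which squares units, giving exponent `0` at `2`. The exponents `4` and `6` come from
the twist by `χ₈` and from `ρ`. -/
theorem realizable_gaussian_two (φ : K →+* ℂ) (hd : discr K = -4)
    (hv : ((2 : ℕ) : 𝓞 K) ∈ v.asIdeal) {n : ℕ} (hn : n ∈ possibleExponents v l) :
    Realizable φ l v n := by
  have := isPrincipalIdealRing_of_discr (K := K) hd.ge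
  have hd2 : ((2 : ℕ) : ℤ) ∣ discr K := by rw [hd]; norm_num
  have h𝔮 := isLocalIdeal_of_dvd_discr Nat.prime_two hd2 hv
  obtain ⟨θ, hθ⟩ := exists_isQuadGen_of_discr_eq_neg_four hd
  obtain ⟨u, huθ, hu4, -, -, -, -, -, hall⟩ := hθ.exists_gaussian_unit
  have hw4 : ∀ w : (𝓞 K)ˣ, w ^ 4 = 1 := by
    intro w
    obtain ⟨k, rfl⟩ := Subgroup.mem_zpowers_iff.1 (hall w)
    rw [← zpow_natCast, zpow_comm, zpow_natCast, hu4, one_zpow]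
  obtain ⟨ε, hε, hεx⟩ := hθ.exists_gaussian_two
  obtain ⟨η, hη, hηu⟩ := hθ.exists_gaussian_three
  have hεu : ∀ w : (𝓞 K)ˣ, ε w = w := fun w =>
    (hεx w ⟨((w⁻¹ : (𝓞 K)ˣ) : 𝓞 K), 0, by rw [Units.inv_mul]; ring⟩).2 w
      (by rw [sub_self]; exact zero_mem _)
  have hε3 : ∀ x : 𝓞 K, IsCoprime x ((2 : ℕ) : 𝓞 K) → x - 1 ∈ v.asIdeal ^ 3 → ε x = 1 := by
    intro x hx hx1
    exact (hεx x hx).2 1 (by rw [Units.val_one]; exact hθ.mem_span_of_mem_cube h𝔮 hx1)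
  rw [possibleExponents_two_of_neg_four l hv hd] at hn
  split_ifs at hn with hl
  · have hu : ∀ w : (𝓞 K)ˣ, (ε ^ l)⁻¹ (w : 𝓞 K) * (1 : 𝓞 K → (𝓞 K)ˣ) w * w ^ l = 1 :=
      fun w => by simp [hεu]
    obtain ⟨Ψ, s, r, e, hs, h, hL⟩ := (hε.pow l).inv.exists_isLocalSetup φ Nat.prime_two
      (IsUnitChar.one (M := 1)) (by norm_num) hu 6
    have ht : LocTriv φ l Ψ 2 e v.asIdeal 3 := fun x hx hx1 => by
      rw [hL x hx, embedding_unit_eq_one_iff, Pi.inv_apply, Pi.pow_apply, hε3 x hx hx1, one_pow,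
        inv_one]
    rcases hn with rfl | rfl | rfl
    · exact h.realizable_succ h𝔮 hv (by omega) ht (h.not_locTriv_two (by omega) h𝔮 hl hd)
    · exact h.realizable_four (by omega) h𝔮 hv hθ ht
    · exact realizable_six φ hθ hd hv (hε.pow l).inv (IsUnitChar.one (M := 1)) (by norm_num) hu
  · obtain ⟨m, rfl⟩ := (Nat.not_odd_iff_even.1 hl).two_dvd
    have hu : ∀ w : (𝓞 K)ˣ, (1 : 𝓞 K → (𝓞 K)ˣ) (w : 𝓞 K) * (η ^ m) w * w ^ (2 * m) = 1 := by
      intro w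
      rw [Pi.one_apply, Pi.pow_apply, hηu, one_mul, ← pow_mul, ← pow_add,
        show 2 * m + 2 * m = 4 * m by ring, pow_mul, hw4, one_pow]
    obtain ⟨Ψ, s, r, e, hs, h, hL⟩ := (IsUnitChar.one (K := K) (M := 2 ^ 0)).exists_isLocalSetup φ
      Nat.prime_two (hη.pow m) (by norm_num) hu 6
    have ht : LocTriv φ (2 * m) Ψ 2 e v.asIdeal 0 := locTriv_zero_of_eq_embedding_one hL
    rcases hn with rfl | rfl | rfl | rfl
    · exact h.realizable_zero h𝔮 hv ht
    -- Exponent `2` is attained by `ε ^ 2`. If `x = 1 + 2 y`, then `x ^ 2 = 1 + 4 y (y + 1)`, so it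
    -- is trivial modulo `v ^ 2`; and it is `-1` at `i`, which is `1` modulo `v`.
    · have hu' : ∀ w : (𝓞 K)ˣ, (ε ^ 2) (w : 𝓞 K) * (η ^ (m + 1)) w * w ^ (2 * m) = 1 := by
        intro w
        rw [Pi.pow_apply, Pi.pow_apply, hηu, hεu, ← pow_mul, ← pow_add, ← pow_add,
          show 2 + 2 * (m + 1) + 2 * m = 4 * (m + 1) by ring, pow_mul, hw4, one_pow]
      obtain ⟨Ψ', s', r', e', hs', h', hL'⟩ := (hε.pow 2).exists_isLocalSetup φ Nat.prime_two
        (hη.pow (m + 1)) (by norm_num) hu' 6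
      refine h'.realizable_succ h𝔮 hv (by omega) (fun x hx hx1 => ?_) fun ht' => ?_
      · rw [show 1 + 1 = 2 * 1 + 0 from rfl, h𝔮.mem_pow_iff] at hx1
        obtain ⟨y, -, hy⟩ := hx1
        have hx4 : IsCoprime x ((2 ^ 2 : ℕ) : 𝓞 K) := by rw [Nat.cast_pow]; exact hx.pow_right
        rw [hL' x hx, embedding_unit_eq_one_iff, Pi.pow_apply, pow_two, ← hε.map_mul x x hx4 hx4]
        refine hε.eq_one (hx4.mul_left hx4) ⟨y * (y + 1), ?_⟩
        push_cast at hy ⊢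
        linear_combination (x + 1 + 2 * y) * hy
      · have hc : IsCoprime (u : 𝓞 K) ((2 : ℕ) : 𝓞 K) :=
          ⟨((u⁻¹ : (𝓞 K)ˣ) : 𝓞 K), 0, by rw [Units.inv_mul]; ring⟩
        have h1 := ht' u hc (by
          rw [pow_one, huθ, show θ - 1 = (1 + θ) - 2 * 1 by ring]
          exact Ideal.sub_mem _ (hθ.gaussian_one_add_mem h𝔮)
            (Ideal.mul_mem_right _ _ (by simpa using hv)))
        rw [hL' _ hc, embedding_unit_eq_one_iff, Pi.pow_apply, hεu] at h1
        refine neg_one_ne_one_unit (K := K) (h1.symm.trans ?_).symm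
        apply Units.ext
        rw [Units.val_pow_eq_pow_val, huθ, hθ.gaussian_sq, Units.val_neg, Units.val_one]
    · exact h.realizable_four (by omega) h𝔮 hv hθ (IsLocalSetup.LocTriv.mono (Nat.zero_le _) ht)
    · exact realizable_six φ hθ hd hv IsUnitChar.one (hη.pow m) (by norm_num) hu

end GaussianTable

/-! ### Units and characters for discriminant `-3`. -/

section Eisenstein

variable {K : Type*} [Field K] [NumberField K] [Algebra.IsQuadraticExtension ℚ K]
    [IsTotallyComplex K] {θ : 𝓞 K}

theorem IsUnitChar.map_pow {M : ℕ} {χ : 𝓞 K → (𝓞 K)ˣ} (h : IsUnitChar M χ) {x : 𝓞 K}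
    (hx : IsCoprime x (M : 𝓞 K)) (k : ℕ) : χ (x ^ k) = χ x ^ k := by
  induction k with
  | zero => rw [pow_zero, pow_zero, h.map_one]
  | succ k ih => rw [pow_succ, pow_succ, h.map_mul _ _ hx.pow_left hx, ih]

theorem isCoprime_unit (u : (𝓞 K)ˣ) (x : 𝓞 K) : IsCoprime (u : 𝓞 K) x :=
  ⟨((u⁻¹ : (𝓞 K)ˣ) : 𝓞 K), 0, by rw [Units.inv_mul]; ring⟩

theorem IsQuadGen.mem_span_natCast {t n : ℤ} (hθ : IsQuadGen θ t n) (m : ℕ) (a b : ℤ) :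
    (a + b * θ : 𝓞 K) ∈ Ideal.span {(m : 𝓞 K)} ↔ (m : ℤ) ∣ a ∧ (m : ℤ) ∣ b := by
  rw [Ideal.mem_span_singleton, ← hθ.dvd_iff]
  push_cast; rfl

theorem IsQuadGen.eisenstein_sq (hθ : IsQuadGen θ 1 1) : θ ^ 2 = θ - 1 := by
  rw [hθ.sq]; push_cast; ring

theorem IsQuadGen.exists_eisenstein_unit (hθ : IsQuadGen θ 1 1) : ∃ u : (𝓞 K)ˣ,
    (u : 𝓞 K) = θ ∧ u ^ 3 = -1 ∧ u ^ 6 = 1 ∧ (∀ w : (𝓞 K)ˣ, w ∈ Subgroup.zpowers u) ∧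
    (∀ w : (𝓞 K)ˣ, w ^ 6 = 1) ∧ u ^ 2 ≠ 1 ∧ u ^ 4 ≠ 1 := by
  have h2 := hθ.eisenstein_sq
  obtain ⟨u, hu⟩ : ∃ u : (𝓞 K)ˣ, (u : 𝓞 K) = θ :=
    ⟨⟨θ, 1 - θ, by linear_combination -h2, by linear_combination -h2⟩, rfl⟩
  have hv2 : ((u ^ 2 : (𝓞 K)ˣ) : 𝓞 K) = θ - 1 := by rw [Units.val_pow_eq_pow_val, hu, h2]
  have hu3 : u ^ 3 = -1 := by
    apply Units.ext
    rw [Units.val_pow_eq_pow_val, hu, Units.val_neg, Units.val_one]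
    linear_combination (θ + 1) * h2
  have hu6 : u ^ 6 = 1 := by rw [show 6 = 3 * 2 from rfl, pow_mul, hu3]; simp
  have hv4 : ((u ^ 4 : (𝓞 K)ˣ) : 𝓞 K) = -θ := by
    rw [show u ^ 4 = u ^ 3 * u by rw [pow_succ u 3], hu3, neg_one_mul, Units.val_neg, hu]
  have hv5 : ((u ^ 5 : (𝓞 K)ˣ) : 𝓞 K) = 1 - θ := by
    rw [show u ^ 5 = u ^ 3 * u ^ 2 by rw [← pow_add], hu3, neg_one_mul, Units.val_neg, hv2]; ring
  have hall : ∀ w : (𝓞 K)ˣ, w ∈ Subgroup.zpowers u := by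
    intro w
    obtain ⟨a, b, hab⟩ := hθ.exists_eq (w : 𝓞 K)
    have hn := norm_unit w
    rw [hab, hθ.norm_eq] at hn
    have ha : 3 * a ^ 2 ≤ 4 := by nlinarith [sq_nonneg (a + 2 * b)]
    have hb : 3 * b ^ 2 ≤ 4 := by nlinarith [sq_nonneg (2 * a + b)]
    have ha1 : -1 ≤ a := by nlinarith
    have ha2 : a ≤ 1 := by nlinarith
    have hb1 : -1 ≤ b := by nlinarith
    have hb2 : b ≤ 1 := by nlinarith
    have key : ∀ k : ℕ, (w : 𝓞 K) = ((u ^ k : (𝓞 K)ˣ) : 𝓞 K) → w ∈ Subgroup.zpowers u := by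
      intro k hk
      rw [Units.ext hk]
      exact Subgroup.npow_mem_zpowers u k
    interval_cases a <;> interval_cases b <;> norm_num at hn
    · exact key 3 (by rw [hab, hu3]; simp)
    · exact key 2 (by rw [hab, hv2]; push_cast; ring)
    · exact key 4 (by rw [hab, hv4]; push_cast; ring)
    · exact key 1 (by rw [hab, pow_one, hu]; push_cast; ring)
    · exact key 5 (by rw [hab, hv5]; push_cast; ring)
    · exact key 0 (by rw [hab]; simp)
  have hne : ∀ (a b : ℤ), (b ≠ 0) → (a + b * θ : 𝓞 K) ≠ 1 := by
    intro a b hb h1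
    have := (hθ.ext_iff (a := a) (b := b) (c := 1) (d := 0)).1 (by rw [h1]; simp)
    exact hb this.2
  refine ⟨u, hu, hu3, hu6, hall, fun w => ?_, fun h => ?_, fun h => ?_⟩
  · obtain ⟨k, rfl⟩ := Subgroup.mem_zpowers_iff.1 (hall w)
    rw [← zpow_natCast, zpow_comm, zpow_natCast, hu6, one_zpow]
  · rw [h, Units.val_one] at hv2
    exact hne (-1) 1 one_ne_zero (by push_cast; linear_combination -hv2)
  · rw [h, Units.val_one] at hv4
    exact hne 0 (-1) (by norm_num) (by push_cast; linear_combination -hv4)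

/-- The character modulo `3` given by the units. -/
theorem IsQuadGen.exists_eisenstein_three (hθ : IsQuadGen θ 1 1) :
    ∃ ε : 𝓞 K → (𝓞 K)ˣ, IsUnitChar 3 ε ∧
      (∀ x : 𝓞 K, IsCoprime x ((3 : ℕ) : 𝓞 K) →
        x - (ε x : 𝓞 K) ∈ Ideal.span {((3 : ℕ) : 𝓞 K)}) ∧ ∀ w : (𝓞 K)ˣ, ε w = w := by
  obtain ⟨u, hu, hu3, hu6, hall, -⟩ := hθ.exists_eisenstein_unit
  have h2 := hθ.eisenstein_sq
  have hv2 : ((u ^ 2 : (𝓞 K)ˣ) : 𝓞 K) = θ - 1 := by rw [Units.val_pow_eq_pow_val, hu, h2]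
  refine Exists.elim (exists_unitChar_of_log (K := K) (M := 3) u 1
    (𝔫 := Ideal.span {((3 : ℕ) : 𝓞 K)}) (Ideal.mem_span_singleton_self _)
    conjInt_mem_span_natCast ?_ ?_) ?_
  · intro x hx
    rw [isCoprime_natCast_iff_not_dvd Nat.prime_three] at hx
    obtain ⟨a, b, rfl⟩ := hθ.exists_eq x
    rw [hθ.norm_eq] at hx
    have hab : (a - b) % 3 ≠ 0 := by
      intro h
      obtain ⟨k, hk⟩ : ∃ k, a = b + 3 * k := ⟨(a - b) / 3, by omega⟩
      exact hx ⟨b ^ 2 + 3 * b * k + 3 * k ^ 2, by rw [hk]; push_cast; ring⟩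
    have key : ∀ (z : (𝓞 K)ˣ) (c d : ℤ), (z : 𝓞 K) = c + d * θ →
        (3 : ℤ) ∣ a - c ∧ (3 : ℤ) ∣ b - d → ∃ z ∈ Subgroup.zpowers u,
          (a + b * θ : 𝓞 K) ^ 1 - (z : 𝓞 K) ∈ Ideal.span {((3 : ℕ) : 𝓞 K)} := by
      intro z c d hz hdiv
      refine ⟨z, hall z, ?_⟩
      have := (hθ.mem_span_natCast 3 (a - c) (b - d)).2 (by exact_mod_cast hdiv)
      convert this using 1
      rw [hz]; push_cast; ring
    -- The six units represent the six invertible classes modulo `3`.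
    have hcase : (3 ∣ a - 1 ∧ 3 ∣ b - 0) ∨ (3 ∣ a - 0 ∧ 3 ∣ b - 1) ∨ (3 ∣ a - (-1) ∧ 3 ∣ b - 1) ∨
        (3 ∣ a - (-1) ∧ 3 ∣ b - 0) ∨ (3 ∣ a - 0 ∧ 3 ∣ b - (-1)) ∨
        (3 ∣ a - 1 ∧ 3 ∣ b - (-1)) := by omega
    rcases hcase with h | h | h | h | h | h
    · exact key 1 1 0 (by simp) h
    · exact key u 0 1 (by simp [hu]) h
    · exact key (u ^ 2) (-1) 1 (by rw [hv2]; push_cast; ring) h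
    · exact key (-1) (-1) 0 (by simp) h
    · exact key (-u) 0 (-1) (by simp [hu]) h
    · exact key (-u ^ 2) 1 (-1) (by rw [Units.val_neg, hv2]; push_cast; ring) h
  · intro z hzu hz1
    have key : ∀ c d : ℤ, (z : 𝓞 K) = c + d * θ → (3 : ℤ) ∣ c - 1 ∧ (3 : ℤ) ∣ d := by
      intro c d hcd
      have := (hθ.mem_span_natCast 3 (c - 1) d).1 (by
        convert hz1 using 1
        rw [hcd]; push_cast; ring)
      exact_mod_cast this
    have hn := norm_unit z
    obtain ⟨a, b, hab⟩ := hθ.exists_eq (z : 𝓞 K)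
    rw [hab, hθ.norm_eq] at hn
    have hb : 3 * b ^ 2 ≤ 4 := by nlinarith [sq_nonneg (2 * a + b)]
    have ha : 3 * a ^ 2 ≤ 4 := by nlinarith [sq_nonneg (a + 2 * b)]
    have ha1 : -1 ≤ a := by nlinarith
    have ha2 : a ≤ 1 := by nlinarith
    have hb1 : -1 ≤ b := by nlinarith
    have hb2 : b ≤ 1 := by nlinarith
    obtain ⟨h3, h4⟩ := key a b hab
    obtain rfl : a = 1 := by omega
    obtain rfl : b = 0 := by omega
    exact Units.ext (by rw [hab]; simp)
  · rintro ε ⟨h1, h2, h3⟩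
    refine ⟨ε, h1, fun x hx => by simpa using (h2 x hx).2, fun w => ?_⟩
    exact h3 _ (isCoprime_unit w _) _ (hall w) (by rw [pow_one, sub_self]; exact zero_mem _)

/-- The cubic character modulo `2`. -/
theorem IsQuadGen.exists_eisenstein_two (hθ : IsQuadGen θ 1 1) :
    ∃ ε : 𝓞 K → (𝓞 K)ˣ, IsUnitChar 2 ε ∧ ∀ w : (𝓞 K)ˣ, ε w = w ^ 4 := by
  obtain ⟨u, hu, hu3, hu6, hall, hw6, hne2, hne4⟩ := hθ.exists_eisenstein_unit
  have h2 := hθ.eisenstein_sq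
  have hv2 : ((u ^ 2 : (𝓞 K)ˣ) : 𝓞 K) = θ - 1 := by rw [Units.val_pow_eq_pow_val, hu, h2]
  have hv4 : (((u ^ 2) ^ 2 : (𝓞 K)ˣ) : 𝓞 K) = -θ := by
    rw [← pow_mul, show u ^ (2 * 2) = u ^ 3 * u by rw [← pow_succ], hu3, neg_one_mul, Units.val_neg,
      hu]
  refine Exists.elim (exists_unitChar_of_log (K := K) (M := 2) (u ^ 2) 1
    (𝔫 := Ideal.span {((2 : ℕ) : 𝓞 K)}) (Ideal.mem_span_singleton_self _)
    conjInt_mem_span_natCast ?_ ?_) ?_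
  · intro x hx
    rw [isCoprime_natCast_iff_not_dvd Nat.prime_two] at hx
    obtain ⟨a, b, rfl⟩ := hθ.exists_eq x
    rw [hθ.norm_eq] at hx
    have hab : a % 2 ≠ 0 ∨ b % 2 ≠ 0 := by
      by_contra! h
      obtain ⟨k, rfl⟩ : ∃ k, a = 2 * k := ⟨a / 2, by omega⟩
      obtain ⟨j, rfl⟩ : ∃ j, b = 2 * j := ⟨b / 2, by omega⟩
      exact hx ⟨2 * k ^ 2 + 2 * k * j + 2 * j ^ 2, by push_cast; ring⟩
    have key : ∀ (k : ℕ) (c d : ℤ), (((u ^ 2) ^ k : (𝓞 K)ˣ) : 𝓞 K) = c + d * θ →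
        (2 : ℤ) ∣ a - c ∧ (2 : ℤ) ∣ b - d → ∃ z ∈ Subgroup.zpowers (u ^ 2),
          (a + b * θ : 𝓞 K) ^ 1 - (z : 𝓞 K) ∈ Ideal.span {((2 : ℕ) : 𝓞 K)} := by
      intro k c d hz hdiv
      refine ⟨_, Subgroup.npow_mem_zpowers _ k, ?_⟩
      have := (hθ.mem_span_natCast 2 (a - c) (b - d)).2 (by exact_mod_cast hdiv)
      convert this using 1
      rw [hz]; push_cast; ring
    -- The three cube roots of unity, powers of `u ^ 2`, represent the nonzero classes of the field
    -- with four elements.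
    have hcase : (2 ∣ a - 1 ∧ 2 ∣ b - 0) ∨ (2 ∣ a - (-1) ∧ 2 ∣ b - 1) ∨
        (2 ∣ a - 0 ∧ 2 ∣ b - (-1)) := by omega
    rcases hcase with h | h | h
    · exact key 0 1 0 (by simp) h
    · exact key 1 (-1) 1 (by rw [pow_one, hv2]; push_cast; ring) h
    · exact key 2 0 (-1) (by rw [hv4]; push_cast; ring) h
  · intro z hzu hz1
    have key : ∀ c d : ℤ, (z : 𝓞 K) = c + d * θ → (2 : ℤ) ∣ c - 1 ∧ (2 : ℤ) ∣ d := by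
      intro c d hcd
      have := (hθ.mem_span_natCast 2 (c - 1) d).1 (by
        convert hz1 using 1
        rw [hcd]; push_cast; ring)
      exact_mod_cast this
    obtain ⟨j, hj, rfl⟩ := exists_lt_of_mem_zpowers (n := 3) (by norm_num)
      (by rw [← pow_mul, hu6]) hzu
    interval_cases j
    · exact pow_zero _
    · have := key (-1) 1 (by rw [pow_one, hv2]; push_cast; ring)
      omega
    · have := key 0 (-1) (by rw [hv4]; push_cast; ring)
      omega
  · rintro ε ⟨h1, -, h3⟩
    refine ⟨ε, h1, fun w => h3 _ (isCoprime_unit w _) _ ?_ ?_⟩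
    · obtain ⟨k, rfl⟩ := Subgroup.mem_zpowers_iff.1 (hall w)
      refine Subgroup.mem_zpowers_iff.2 ⟨2 * k, ?_⟩
      rw [← zpow_natCast, ← zpow_natCast, ← zpow_mul, ← zpow_mul]
      congr 1
      push_cast; ring
    -- The cube root of unity congruent to a unit `w` modulo `2` is `w ^ 4`, since `w ^ 3 = ±1`.
    · have hw3 : (w : 𝓞 K) ^ 3 = 1 ∨ (w : 𝓞 K) ^ 3 = -1 := by
        rw [← sq_eq_one_iff, ← pow_mul]
        have := congrArg (fun w : (𝓞 K)ˣ => (w : 𝓞 K)) (hw6 w)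
        simpa using this
      rw [Ideal.mem_span_singleton, pow_one, Units.val_pow_eq_pow_val, Nat.cast_ofNat]
      rcases hw3 with h | h
      · exact ⟨0, by linear_combination -(w : 𝓞 K) * h⟩
      · exact ⟨w, by linear_combination -(w : 𝓞 K) * h⟩

end Eisenstein

/-! ### The table for discriminant `-3`. -/

section EisensteinTable

variable {K : Type*} [Field K] [NumberField K] [Algebra.IsQuadraticExtension ℚ K]
    [IsTotallyComplex K] {φ : K →+* ℂ} {l : ℕ} {Ψ : (FractionalIdeal (𝓞 K)⁰ K)ˣ →* ℂˣ}
    {p s r : ℕ} {e : ℤ} {v : HeightOneSpectrum (𝓞 K)} {θ : 𝓞 K}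

theorem exponentAt_three_of_neg_three (h : IsLocalSetup φ l Ψ 3 s r e) (hs : 4 ≤ s)
    (hv : ((3 : ℕ) : 𝓞 K) ∈ v.asIdeal) (hd : discr K = -3) {𝔣 : Ideal (𝓞 K)}
    (hf : IsCond φ l Ψ (Ideal.span {((3 ^ s * r : ℕ) : 𝓞 K)}) 𝔣) :
    exponentAt v 𝔣 ∈ possibleExponents v l := by
  have hd3 : ((3 : ℕ) : ℤ) ∣ discr K := by rw [hd]; norm_num
  have h𝔮 := isLocalIdeal_of_dvd_discr Nat.prime_three hd3 hv
  have hN := absNorm_of_dvd_discr Nat.prime_three hd3 hv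
  have e4 := (h.le_iff h𝔮 hv hf hs).2 (h.locTriv_four_of_discr h𝔮 hd)
  have e3 := h.locTriv_two_of_discr h𝔮 hN
  rw [← h.le_iff h𝔮 hv hf (by omega), ← h.le_iff h𝔮 hv hf (by omega)] at e3
  rw [possibleExponents_three l hv hd]
  split_ifs with hl
  · have e0 := (h.le_iff h𝔮 hv hf (Nat.zero_le _)).not.2
      (h.not_locTriv_zero h𝔮 (conjPrime_of_dvd_discr Nat.prime_three hd3 hv) hv hl)
    simp only [Set.mem_insert_iff, Set.mem_singleton_iff]; omega
  · have e1 := h.locTriv_zero_of_even h𝔮 hN (Nat.not_odd_iff_even.1 hl)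
    rw [← h.le_iff h𝔮 hv hf (by omega), ← h.le_iff h𝔮 hv hf (by omega)] at e1
    simp only [Set.mem_insert_iff, Set.mem_singleton_iff]; omega

theorem exponentAt_two_of_neg_three (h : IsLocalSetup φ l Ψ 2 s r e) (hs : 3 ≤ s)
    (hv : ((2 : ℕ) : 𝓞 K) ∈ v.asIdeal) (hd : discr K = -3) {𝔣 : Ideal (𝓞 K)}
    (hf : IsCond φ l Ψ (Ideal.span {((2 ^ s * r : ℕ) : 𝓞 K)}) 𝔣) :
    exponentAt v 𝔣 ∈ possibleExponents v l := by
  have h𝔮 := isLocalIdeal_of_not_dvd_discr (K := K) Nat.prime_two (by rw [hd]; norm_num)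
  have e3 := (h.le_iff h𝔮 hv hf hs).2 (h.locTriv_three h𝔮 (by rw [hd]; norm_num))
  rw [possibleExponents_two_of_neg_three l hv hd]
  simp only [Set.mem_insert_iff, Set.mem_singleton_iff]; omega

/-- The `∞`-type is absorbed at `3` by `ε ^ (-l)`, leaving every other prime unramified. -/
theorem exists_isLocalSetup_unramified (φ : K →+* ℂ) (l : ℕ) (hd : discr K = -3) (hp : p.Prime)
    (hp3 : p ≠ 3) : ∃ (Ψ : (FractionalIdeal (𝓞 K)⁰ K)ˣ →* ℂˣ) (s r : ℕ) (e : ℤ), 3 ≤ s ∧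
      IsLocalSetup φ l Ψ p s r e ∧ LocTriv φ l Ψ p e (Ideal.span {(p : 𝓞 K)}) 0 := by
  have := isPrincipalIdealRing_of_discr (K := K) (by rw [hd]; norm_num)
  obtain ⟨θ, hθ⟩ := exists_isQuadGen_of_discr_eq_neg_three hd
  obtain ⟨ε, hε, -, hεu⟩ := hθ.exists_eisenstein_three
  obtain ⟨Ψ, s, r, e, hs, h, hL⟩ := (IsUnitChar.one (K := K) (M := p ^ 0)).exists_isLocalSetup φ hp
    (hε.pow l).inv (fun h => hp3 ((Nat.prime_dvd_prime_iff_eq hp Nat.prime_three).1 h)) (l := l)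
    (fun w => by simp [hεu]) 3
  exact ⟨Ψ, s, r, e, hs, h, locTriv_zero_of_eq_embedding_one hL⟩

theorem realizable_eisenstein_odd (φ : K →+* ℂ) (hd : discr K = -3) (hp : p.Prime) (hp2 : p ≠ 2)
    (hp3 : p ≠ 3) (hv : (p : 𝓞 K) ∈ v.asIdeal) {n : ℕ} (hn : n ∈ possibleExponents v l) :
    Realizable φ l v n := by
  have hpd : ¬ (p : ℤ) ∣ discr K := fun h => hp3 (eq_three_of_dvd_discr hp h hd)
  have h𝔮 := isLocalIdeal_of_not_dvd_discr (K := K) hp hpd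
  obtain ⟨Ψ, s, r, e, hs, h, ht⟩ := exists_isLocalSetup_unramified φ l hd hp hp3
  rw [possibleExponents_odd_unramified l hp hv hp2 hpd] at hn
  rcases hn with rfl | rfl
  · exact h.realizable_zero h𝔮 hv ht
  · exact h.realizable_one_of_locTriv_zero h𝔮 hv hp2 hpd ht

/-- Starting from a character unramified at `2`, the twists by `χ₄` and `χ₈` have exponents `2` and
`3`, as the norms of `1 + 2 θ` and `1 + 4 θ` are `7` and `21`. Exponent `1` comes from the cubic
character modulo `2`. -/
theorem realizable_eisenstein_two (φ : K →+* ℂ) (hd : discr K = -3)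
    (hv : ((2 : ℕ) : 𝓞 K) ∈ v.asIdeal) {n : ℕ} (hn : n ∈ possibleExponents v l) :
    Realizable φ l v n := by
  have := isPrincipalIdealRing_of_discr (K := K) (by rw [hd]; norm_num)
  have h𝔮 := isLocalIdeal_of_not_dvd_discr (K := K) Nat.prime_two (by rw [hd]; norm_num)
  have hd4 : discr K ≠ -4 := by rw [hd]; norm_num
  obtain ⟨θ, hθ⟩ := exists_isQuadGen_of_discr_eq_neg_three hd
  obtain ⟨Ψ, s, r, e, hs, h, ht⟩ := exists_isLocalSetup_unramified φ l hd Nat.prime_two (by norm_num)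
  have ht' : ∀ x : 𝓞 K, IsCoprime x ((2 : ℕ) : 𝓞 K) → locHom φ l Ψ e x = 1 :=
    fun x hx => ht x hx (by simp)
  rw [possibleExponents_two_of_neg_three l hv hd] at hn
  rcases hn with rfl | rfl | rfl | rfl
  · exact h.realizable_zero h𝔮 hv ht
  · obtain ⟨ε, hε, -, hεu⟩ := hθ.exists_eisenstein_three
    obtain ⟨δ, hδ, hδu⟩ := hθ.exists_eisenstein_two
    obtain ⟨u, hu, hu3, hu6, hall, hw6, hne2, hne4⟩ := hθ.exists_eisenstein_unit
    -- The equation makes `δ ^ m ε ^ a` compatible with the `∞`-type on units, as `4 m + a + l = 6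
    -- m`; the cubic character `δ ^ m` is nontrivial when `3 ∤ m`.
    obtain ⟨a, m, ham, hm⟩ : ∃ a m : ℕ, l + a = 2 * m ∧ m % 3 ≠ 0 := by
      by_cases h3 : (l + 1) % 3 = 0
      · exact ⟨l + 4, l + 2, by omega, by omega⟩
      · exact ⟨l + 2, l + 1, by omega, by omega⟩
    obtain ⟨Ψ', s', r', e', hs', h', hL'⟩ := (show IsUnitChar (2 ^ 1) (δ ^ m) from
      hδ.pow m).exists_isLocalSetup φ Nat.prime_two (hε.pow a) (by norm_num) (l := l) (fun w => by
        rw [Pi.pow_apply, Pi.pow_apply, hεu, hδu, ← pow_mul, ← pow_add, ← pow_add,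
          show 4 * m + a + l = 6 * m by omega, pow_mul, hw6, one_pow]) 3
    refine h'.realizable_succ h𝔮 hv (by omega) (fun x hx hx1 => ?_) fun h0 => ?_
    · rw [zero_add, pow_one, Ideal.mem_span_singleton] at hx1
      rw [hL' x hx, embedding_unit_eq_one_iff, Pi.pow_apply, hδ.eq_one hx hx1, one_pow]
    · have h1 := h0 u (isCoprime_unit u _) (by simp)
      rw [hL' _ (isCoprime_unit u _), embedding_unit_eq_one_iff, Pi.pow_apply, hδu] at h1
      rw [← Nat.div_add_mod m 3, ← pow_mul, mul_add, ← mul_assoc, pow_add, pow_mul,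
        show u ^ (4 * 3) = (u ^ 6) ^ 2 by rw [← pow_mul], hu6, one_pow, one_pow, one_mul] at h1
      have : m % 3 = 1 ∨ m % 3 = 2 := by omega
      rcases this with h3 | h3
      · rw [h3] at h1; exact hne4 h1
      · rw [h3, show 4 * 2 = 6 + 2 from rfl, pow_add, hu6, one_mul] at h1
        exact hne2 h1
  · have h4 := h.normTwist_four hs
    refine h4.realizable_succ h𝔮 hv (by omega) (fun x hx hx1 => ?_) fun h1 => ?_
    · rw [h.locHom_normTwist_four hs hx, ht' x hx]
      rw [Ideal.span_singleton_pow, Ideal.mem_span_singleton] at hx1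
      obtain ⟨y, hy⟩ := hx1
      obtain ⟨a, b, rfl⟩ := hθ.exists_eq y
      have hx2 : x = ((1 + 4 * a : ℤ) : 𝓞 K) + ((4 * b : ℤ) : 𝓞 K) * θ := by
        push_cast at hy ⊢
        linear_combination hy
      have : ZMod.χ₄ (Algebra.norm ℤ x : ℤ) = 1 := by
        apply ZMod.χ₄_int_one_mod_four
        rw [hx2, hθ.norm_eq,
          show (1 + 4 * a) ^ 2 + 1 * (1 + 4 * a) * (4 * b) + 1 * (4 * b) ^ 2 =
            1 + 4 * (2 * a + 4 * a ^ 2 + b + 4 * a * b + 4 * b ^ 2) by ring]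
        omega
      rw [this]; norm_num
    · have hc := isCoprime_one_add_two θ
      have h2 := h1 _ hc (by
        rw [add_sub_cancel_left, pow_one, Ideal.mem_span_singleton, Nat.cast_ofNat]
        exact dvd_mul_right _ _)
      have hN := hθ.norm_eq 1 2
      push_cast at hN
      rw [h.locHom_normTwist_four hs hc, ht' _ hc, χ₄_neg_one_of_norm hN (by norm_num)] at h2
      norm_num at h2
  · have h8 := h.normTwist_eight hs
    refine h8.realizable_succ h𝔮 hv hs (h8.locTriv_three h𝔮 hd4) fun h1 => ?_
    have hc : IsCoprime (1 + 4 * θ) ((2 : ℕ) : 𝓞 K) := by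
      have := isCoprime_one_add_two (2 * θ)
      rwa [← mul_assoc, show (2 : 𝓞 K) * 2 = 4 by norm_num] at this
    have h2 := h1 _ hc (by
      rw [add_sub_cancel_left, Ideal.span_singleton_pow, Ideal.mem_span_singleton]
      exact ⟨θ, by norm_num⟩)
    have hN := hθ.norm_eq 1 4
    push_cast at hN
    rw [h.locHom_normTwist_eight hs hc, ht' _ hc, hN, χ₈_intCast_five (by norm_num)] at h2
    norm_num at h2

theorem IsQuadGen.eisenstein_one_add_mem (hθ : IsQuadGen θ 1 1)
    (hv : ((3 : ℕ) : 𝓞 K) ∈ v.asIdeal) : 1 + θ ∈ v.asIdeal := by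
  apply v.isPrime.mem_of_pow_mem 2
  have : (1 + θ) ^ 2 = ((3 : ℕ) : 𝓞 K) * θ := by
    push_cast
    linear_combination hθ.eisenstein_sq
  rw [this]
  exact Ideal.mul_mem_right _ _ hv

/-- Write `x / ε(x) = a + b θ`, which is `1` modulo `3`, and let `ρ(x)` be the power `b / 3` of a
primitive cube root of unity. It is trivial on units. At `-2 + 6 θ = 1 + 3 (2 θ - 1)`, where `2 θ -
1` is a square root of `-3` and so lies in `v`, it is nontrivial; hence the exponent exceeds `3`. -/
theorem realizable_eisenstein_three_four (φ : K →+* ℂ) (l : ℕ) (hθ : IsQuadGen θ 1 1)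
    (hd : discr K = -3) (hv : ((3 : ℕ) : 𝓞 K) ∈ v.asIdeal) : Realizable φ l v 4 := by
  have := isPrincipalIdealRing_of_discr (K := K) (by rw [hd]; norm_num)
  have h𝔮 := isLocalIdeal_of_dvd_discr Nat.prime_three (by rw [hd]; norm_num) hv
  obtain ⟨ε, hε, hεx, hεu⟩ := hθ.exists_eisenstein_three
  obtain ⟨u, hu, hu3, hu6, hall, hw6, hne2, hne4⟩ := hθ.exists_eisenstein_unit
  obtain ⟨ρ, hρ, hρx⟩ := hε.exists_of_coord hθ (M' := 3 ^ 2) (by norm_num)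
    (m := 3) (m' := 3) (u := u ^ 2) (by norm_num)
    (by rw [← zpow_natCast, ← zpow_mul]; exact_mod_cast hu6)
    (fun a b => 3 ∣ b ∧ 3 ∣ a - 1) (fun x hx a b hab => by
      have hx3 : IsCoprime x ((3 : ℕ) : 𝓞 K) := by
        rwa [Nat.cast_pow, IsCoprime.pow_right_iff (by norm_num)] at hx
      have h1 := Ideal.mul_mem_right (((ε x)⁻¹ : (𝓞 K)ˣ) : 𝓞 K) _ (hεx x hx3)
      have h3 : (x - (ε x : 𝓞 K)) * (((ε x)⁻¹ : (𝓞 K)ˣ) : 𝓞 K) = ((a - 1 : ℤ) : 𝓞 K) + b * θ := by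
        rw [sub_mul, Units.mul_inv, hab]; push_cast; ring
      rw [h3, hθ.mem_span_natCast] at h1
      exact h1.symm)
    (fun a b h => h.1)
    (by
      rintro a b c d ⟨⟨b, rfl⟩, k, hk⟩ ⟨⟨d, rfl⟩, j, hj⟩
      exact ⟨d * k + b * j + b * d, by linear_combination 3 * d * hk + 3 * b * hj⟩)
    (by norm_num)
  have hρ1 : ∀ w : (𝓞 K)ˣ, ρ w = 1 := by
    intro w
    rw [hρx w 1 0 (by rw [hεu, Units.mul_inv]; simp)]
    simp
  obtain ⟨Ψ, s, r, e, hs, h, hL⟩ := (((hε.pow l).inv.mono (show 3 ∣ 3 ^ 2 by norm_num)).mul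
    hρ).exists_isLocalSetup φ Nat.prime_three (IsUnitChar.one (M := 1)) (by norm_num) (l := l)
    (fun w => by simp [hρ1, hεu]) 4
  refine h.realizable_succ h𝔮 hv hs (h.locTriv_four_of_discr h𝔮 hd) fun ht => ?_
  have hy : 2 * θ - 1 ∈ v.asIdeal := by
    have : 2 * θ - 1 = 2 * (1 + θ) - ((3 : ℕ) : 𝓞 K) := by push_cast; ring
    rw [this]
    exact Ideal.sub_mem _ (Ideal.mul_mem_left _ _ (hθ.eisenstein_one_add_mem hv)) hv
  have hx : (1 + ((3 : ℕ) : 𝓞 K) ^ 1 * (2 * θ - 1)) - 1 ∈ v.asIdeal ^ 3 := by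
    rw [add_sub_cancel_left]
    exact (h𝔮.mul_mem_pow_iff 1 1).2 (by rwa [pow_one])
  have hc := h𝔮.isCoprime_of_sub_one_mem (by norm_num) hx
  have hε1 : ε (1 + ((3 : ℕ) : 𝓞 K) ^ 1 * (2 * θ - 1)) = 1 := hε.eq_one hc (by
    rw [add_sub_cancel_left, pow_one]; exact dvd_mul_right _ _)
  have h1 := ht _ hc hx
  rw [hL _ hc, embedding_unit_eq_one_iff, Pi.mul_apply, Pi.inv_apply, Pi.pow_apply, hε1, one_pow,
    inv_one, one_mul, hρx _ (-2) 6 (by rw [hε1]; push_cast; simp; ring)] at h1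
  apply hne4
  rw [← h1, show (6 / 3 : ℤ) = ((2 : ℕ) : ℤ) from rfl, zpow_natCast, ← pow_mul]

/-- The component at `3` is `ε ^ a`, completed at `2` by `δ ^ m` with `l + a = 2 m`, which fixes
only the parity of `a`. Exponents `0` and `1` come from `a = 0` and `a = 3`, exponent `2` from `a =
1` or `a = 2`, and exponent `4` from `ρ`. -/
theorem realizable_eisenstein_three (φ : K →+* ℂ) (hd : discr K = -3)
    (hv : ((3 : ℕ) : 𝓞 K) ∈ v.asIdeal) {n : ℕ} (hn : n ∈ possibleExponents v l) :
    Realizable φ l v n := by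
  have := isPrincipalIdealRing_of_discr (K := K) (by rw [hd]; norm_num)
  have hd3 : ((3 : ℕ) : ℤ) ∣ discr K := by rw [hd]; norm_num
  have h𝔮 := isLocalIdeal_of_dvd_discr Nat.prime_three hd3 hv
  obtain ⟨θ, hθ⟩ := exists_isQuadGen_of_discr_eq_neg_three hd
  obtain ⟨ε, hε, hεx, hεu⟩ := hθ.exists_eisenstein_three
  obtain ⟨δ, hδ, hδu⟩ := hθ.exists_eisenstein_two
  obtain ⟨u, hu, hu3, hu6, hall, hw6, hne2, hne4⟩ := hθ.exists_eisenstein_unit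
  have base : ∀ a m : ℕ, l + a = 2 * m → ∃ (Ψ : (FractionalIdeal (𝓞 K)⁰ K)ˣ →* ℂˣ) (s r : ℕ)
      (e : ℤ), 4 ≤ s ∧ IsLocalSetup φ l Ψ 3 s r e ∧ ∀ x : 𝓞 K, IsCoprime x ((3 : ℕ) : 𝓞 K) →
        locHom φ l Ψ e x = φ (((ε x ^ a : (𝓞 K)ˣ) : 𝓞 K) : K) := fun a m ham =>
    (show IsUnitChar (3 ^ 1) (ε ^ a) from hε.pow a).exists_isLocalSetup φ Nat.prime_three
      (hδ.pow m) (by norm_num) (l := l) (fun w => by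
        rw [Pi.pow_apply, Pi.pow_apply, hεu, hδu, ← pow_mul, ← pow_add, ← pow_add,
          show a + 4 * m + l = 6 * m by omega, pow_mul, hw6, one_pow]) 4
  have two : ∀ a m : ℕ, l + a = 2 * m → u ^ (2 * a) ≠ 1 → Realizable φ l v 2 := by
    intro a m ham hne
    obtain ⟨Ψ, s, r, e, hs, h, hL⟩ := base a m ham
    refine h.realizable_succ h𝔮 hv (by omega) (fun x hx hx1 => ?_) fun ht => ?_
    · rw [show 1 + 1 = 2 * 1 from rfl, h𝔮.mem_pow_mul_iff, pow_one] at hx1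
      rw [hL x hx, hε.eq_one hx hx1, one_pow, embedding_unit_eq_one_iff]
    -- The cube root of unity `u ^ 2` is `1` modulo `v`, and `ε ^ a` takes there the value `u ^ (2 *
    -- a)`.
    · have hc := isCoprime_unit (u ^ 2) ((3 : ℕ) : 𝓞 K)
      have h1 := ht _ hc (by
        rw [pow_one, Units.val_pow_eq_pow_val, hu, hθ.eisenstein_sq,
          show θ - 1 - 1 = (1 + θ) - ((3 : ℕ) : 𝓞 K) by push_cast; ring]
        exact Ideal.sub_mem _ (hθ.eisenstein_one_add_mem hv) hv)
      rw [hL _ hc, embedding_unit_eq_one_iff, hεu, ← pow_mul] at h1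
      exact hne h1
  rw [possibleExponents_three l hv hd] at hn
  split_ifs at hn with hl
  · obtain ⟨k, hk⟩ := hl
    rcases hn with rfl | rfl | rfl
    · obtain ⟨Ψ, s, r, e, hs, h, hL⟩ := base 3 (k + 2) (by omega)
      refine h.realizable_succ h𝔮 hv (by omega) (fun x hx hx1 => ?_)
        (h.not_locTriv_zero h𝔮 (conjPrime_of_dvd_discr Nat.prime_three hd3 hv) hv ⟨k, hk⟩)
      -- Cubing maps `1 + v` into `1 + v ^ 2`, which is `1 + 3 𝓞 K`, where `ε` is trivial. So `ε ^
      -- 3` is trivial on `1 + v`.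
      have hx3 := Ideal.pow_prime_sub_one_mem hv one_ne_zero hx1
      rw [show 1 + 1 = 2 * 1 from rfl, h𝔮.mem_pow_mul_iff, pow_one] at hx3
      rw [hL x hx, embedding_unit_eq_one_iff, ← hε.map_pow hx, hε.eq_one hx.pow_left hx3]
    · exact two 1 (k + 1) (by omega) hne2
    · exact realizable_eisenstein_three_four φ l hθ hd hv
  · obtain ⟨k, hk⟩ := Nat.not_odd_iff_even.1 hl
    rcases hn with rfl | rfl | rfl
    · obtain ⟨Ψ, s, r, e, hs, h, hL⟩ := base 0 k (by omega)
      exact h.realizable_zero h𝔮 hv fun x hx _ => by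
        rw [hL x hx, pow_zero, embedding_unit_eq_one_iff]
    · exact two 2 (k + 1) (by omega) hne4
    · exact realizable_eisenstein_three_four φ l hθ hd hv

end EisensteinTable
-- Assembling the cases.
section Main

variable {K : Type*} [Field K] [NumberField K] [Algebra.IsQuadraticExtension ℚ K]
    [IsTotallyComplex K] {φ : K →+* ℂ} {l : ℕ} {Ψ : (FractionalIdeal (𝓞 K)⁰ K)ˣ →* ℂˣ}
    {p s r : ℕ} {e : ℤ} {v : HeightOneSpectrum (𝓞 K)}

theorem IsLocalSetup.tableHolds (h : IsLocalSetup φ l Ψ p s r e) (hs : 6 ≤ s)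
    (hv : (p : 𝓞 K) ∈ v.asIdeal) : TableHolds φ l Ψ (p ^ s * r) v := by
  by_cases hd4 : discr K = -4
  · by_cases hp2 : p = 2
    · subst hp2
      exact ⟨fun _ hf => exponentAt_two_of_neg_four h hs hv hd4 hf,
        fun _ hn => realizable_gaussian_two φ hd4 hv hn⟩
    · have hpd : ¬ (p : ℤ) ∣ discr K := fun hd => discr_ne_neg_four_of_dvd h.prime hp2 hd hd4
      exact ⟨fun _ hf => h.exponentAt_odd_unramified hv hp2 hpd hf,
        fun _ hn => realizable_gaussian_odd φ hd4 h.prime hp2 hv hn⟩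
  by_cases hd3 : discr K = -3
  · by_cases hp2 : p = 2
    · subst hp2
      exact ⟨fun _ hf => exponentAt_two_of_neg_three h (by omega) hv hd3 hf,
        fun _ hn => realizable_eisenstein_two φ hd3 hv hn⟩
    by_cases hp3 : p = 3
    · subst hp3
      exact ⟨fun _ hf => exponentAt_three_of_neg_three h (by omega) hv hd3 hf,
        fun _ hn => realizable_eisenstein_three φ hd3 hv hn⟩
    · have hpd : ¬ (p : ℤ) ∣ discr K := fun hd => hp3 (eq_three_of_dvd_discr h.prime hd hd3)
      exact ⟨fun _ hf => h.exponentAt_odd_unramified hv hp2 hpd hf,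
        fun _ hn => realizable_eisenstein_odd φ hd3 h.prime hp2 hp3 hv hn⟩
  by_cases hp2 : p = 2
  · subst hp2
    by_cases hd2 : (2 : ℤ) ∣ discr K
    · exact h.tableHolds_two_of_two_dvd (by omega) hv hd4 hd2
    · exact h.tableHolds_two_unramified (by omega) hv hd3 hd2
  · by_cases hpd : (p : ℤ) ∣ discr K
    · exact h.tableHolds_odd_ramified hv hp2 hpd hd3
    · exact h.tableHolds_odd_unramified hv hp2 hpd hd3 hd4

end Main

theorem proposition6p1 {K : Type*} [Field K] [NumberField K] [Algebra.IsQuadraticExtension ℚ K]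
    [IsTotallyComplex K] (φ : K →+* ℂ) (l : ℕ) (hl : 1 ≤ l) (𝔪 : Ideal (𝓞 K))
    (ψ : HeckeCharacter φ 𝔪 l) (hψ : ψ.HasRationalCoefficients)
    (𝔭 : HeightOneSpectrum (𝓞 K)) :
    (∀ 𝔣 : Ideal (𝓞 K), ψ.IsConductor 𝔣 →
      exponentAt 𝔭 𝔣 = exponentAt (conjPrime 𝔭) 𝔣 ∧
      exponentAt 𝔭 𝔣 ∈ possibleExponents 𝔭 l) ∧
    (∀ e ∈ possibleExponents 𝔭 l,
      ∃ (𝔣' : Ideal (𝓞 K)) (ψ' : HeckeCharacter φ 𝔣' l),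
        ψ'.HasRationalCoefficients ∧ ψ'.IsConductor 𝔣' ∧ exponentAt 𝔭 𝔣' = e) := by
  obtain ⟨p, hp, hv⟩ := exists_prime_mem 𝔭
  have hg := HeckeCharacter.isGood_of_hasRationalCoefficients (by omega) hψ
  -- The bound `6` is the largest exponent occurring in the table.
  obtain ⟨s, r, e, hs, hd, h⟩ := exists_isLocalSetup hg hp 6
  have ht := h.tableHolds hs hv
  refine ⟨fun 𝔣 hf => ?_, ht.2⟩
  have hc := hf.isCond h.good.ne_zero hd
  refine ⟨(exponentAt_conjPrime (ne_zero_of_dvd_ne_zero h.good.ne_zero hc.1)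
    (h.good.conjIdeal_cond (conjIdeal_span_natCast _) hc) 𝔭).symm, ht.1 𝔣 hc⟩
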